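/- Let $\Omega\subset\mathbb{R}^2$ be a bounded domain whose boundary $\partial\Omega$ is a single smooth closed curve of length $|\partial\Omega|$, let $s\mapsto\gamma(s)$ be an arclength parametrization of $\partial\Omega$ (extended $|\partial\Omega|$-periodically), $\nu(s)$ the outer unit normal and $\kappa(s)$ the curvature of $\partial\Omega$ at $\gamma(s)$ (positive for a disc). Let $\mu>0$. For $\varepsilon>0$ put $\omega_\varepsilon=\{x\in\Omega:\operatorname{dist}(x,\partial\Omega)<\varepsilon\}$, $\Sigma=(0,|\partial\Omega|)\times(0,1)$ and $\Phi_\varepsilon(s,t)=\gamma(s)-\varepsilon t\,\nu(s)$. Consider on $\omega_\varepsilon$ the biharmonic Steklov problem in weak form: find $u\in H^2(\omega_\varepsilon)$, $u\neq0$, and $\lambda\in\mathbb{R}$ with $$\int_{\omega_\varepsilon}D^2u:D^2\varphi\,dx+\mu\int_{\partial\omega_\varepsilon}\partial_\nu u\,\partial_\nu\varphi\,d\sigma=\lambda\int_{\partial\omega_\varepsilon}u\,\varphi\,d\sigma\qquad\text{for all }\varphi\in H^2(\omega_\varepsilon),$$ where in the boundary integrals $\nu$ denotes the outer unit normal of $\omega_\varepsilon$.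 Consider also the one-dimensional problem $$u''''-2(\kappa^2u')'=2\lambda u\ \text{ in }(0,|\partial\Omega|),\qquad u^{(j)}(0)=u^{(j)}(|\partial\Omega|),\quad j=0,1,2,3.$$ **Theorem 1.1.** The one-dimensional problem has a sequence of eigenvalues $\lambda_0\le\lambda_1\le\lambda_2\le\dots$, repeated according to multiplicity, with eigenfunctions forming an orthonormal basis of $L^2((0,|\partial\Omega|),2\,ds)$. For all sufficiently small $\varepsilon>0$ the eigenvalues of the Steklov problem on $\omega_\varepsilon$, repeated according to multiplicity, form a sequence $\lambda_{\varepsilon,0}\le\lambda_{\varepsilon,1}\le\dots\to+\infty$ with corresponding eigenfunctions $u_{\varepsilon,k}$ that can be chosen orthonormal in $L^2(\partial\omega_\varepsilon)$. For any such choice of the $u_{\varepsilon,k}$ the following holds. 1. For every $k\ge0$, $\ \lambda_{\varepsilon,k}\sim\lambda_k\,\varepsilon$ as $\varepsilon\to0^+$ (for $k\ge1$ the ratio of the two sides tends to $1$; for $k=0$ both sides are $0$). 2. Every sequence $\varepsilon_n\to0^+$ has a subsequence, again denoted by $\varepsilon_n$, for which there is an orthonormal basis $\{u_k\}_{k\ge0}$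 of $L^2((0,|\partial\Omega|),2\,ds)$, where $u_k$ is an eigenfunction of the one-dimensional problem with eigenvalue $\lambda_k$, such that for every $k\ge0$ $$u_{\varepsilon_n,k}\circ\Phi_{\varepsilon_n}\rightharpoonup u_k\quad\text{weakly in }H^2(\Sigma)\text{ as }n\to\infty,$$ where $u_k$ is regarded as the function $(s,t)\mapsto u_k(s)$ on $\Sigma$. -/

import Mathlib

open MeasureTheory Set Filter Topology Asymptotics
open scoped ContDiff ENNReal

noncomputable section

/-- The Euclidean plane. -/
abbrev Plane : Type := EuclideanSpace ℝ (Fin 2)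

/-! ### The Sobolev space `H²` of an open subset of the plane -/

/-- Classical partial derivative in the `i`-th coordinate direction. -/
def partialDeriv (i : Fin 2) (ψ : Plane → ℝ) (x : Plane) : ℝ :=
  fderiv ℝ ψ x (EuclideanSpace.single i 1)

/-- `g` is the weak partial derivative `∂ᵢ f` on the open set `U`. It is used below only for
`f, g ∈ L²(U)`, so that all integrals converge. -/
def IsWeakPartial (U : Set Plane) (i : Fin 2) (f g : Plane → ℝ) : Prop :=
  ∀ ψ : Plane → ℝ, ContDiff ℝ ∞ ψ → HasCompactSupport ψ → tsupport ψ ⊆ U →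
    ∫ x in U, f x * partialDeriv i ψ x = -∫ x in U, g x * ψ x

/-- An element of `H²(U)`: a function in `L²(U)` together with its weak derivatives of first and
second order (which are determined almost everywhere), all of them in `L²(U)`. -/
structure SobolevH2 (U : Set Plane) where
  /-- the function -/
  val : Plane → ℝ
  /-- `grad i = ∂ᵢ val` -/
  grad : Fin 2 → Plane → ℝ
  /-- `hess i j = ∂ⱼ ∂ᵢ val` -/
  hess : Fin 2 → Fin 2 → Plane → ℝ
  memLp_val : MemLp val 2 (volume.restrict U)
  memLp_grad : ∀ i, MemLp (grad i) 2 (volume.restrict U)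
  memLp_hess : ∀ i j, MemLp (hess i j) 2 (volume.restrict U)
  weak_grad : ∀ i, IsWeakPartial U i val (grad i)
  weak_hess : ∀ i j, IsWeakPartial U j (grad i) (hess i j)

namespace SobolevH2

variable {U : Set Plane}

/-- The integral over `U` of `D²f : D²g`. -/
def hessForm (f g : SobolevH2 U) : ℝ :=
  ∫ x in U, ∑ i : Fin 2, ∑ j : Fin 2, f.hess i j x * g.hess i j x

/-- The inner product of `H²(U)`. -/
def innerH2 (f g : SobolevH2 U) : ℝ :=
  (∫ x in U, f.val x * g.val x) + (∫ x in U, ∑ i : Fin 2, f.grad i x * g.grad i x) + hessForm f g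

end SobolevH2

/-- Weak convergence `fₙ ⇀ f` in the Hilbert space `H²(U)`: the `fₙ` (for large `n`) and `f` agree
almost everywhere in `U` with elements `Fₙ`, `F` of `H²(U)`, and `⟨Fₙ, z⟩ → ⟨F, z⟩` for all
`z ∈ H²(U)`. -/
def TendstoWeaklyH2 (U : Set Plane) (f : ℕ → Plane → ℝ) (g : Plane → ℝ) : Prop :=
  ∃ (F : ℕ → SobolevH2 U) (G : SobolevH2 U),
    (∀ᶠ n in atTop, (F n).val =ᵐ[volume.restrict U] f n) ∧
    G.val =ᵐ[volume.restrict U] g ∧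
    ∀ z : SobolevH2 U, Tendsto (fun n => (F n).innerH2 z) atTop (𝓝 (G.innerH2 z))

/-! ### The domain and its thin tubular neighbourhood -/

/-- The vector `v` rotated clockwise by a right angle. -/
def rotCW (v : Plane) : Plane := !₂[v 1, -(v 0)]

/-- A bounded planar domain `Ω` whose boundary is one smooth closed curve, together with an
arclength parametrization of the boundary, extended periodically, with `Ω` on its left. -/
structure SmoothDomain where
  /-- the set `Ω` -/
  carrier : Set Plane
  /-- the length `|∂Ω|` -/
  length : ℝ
  /-- the arclength parametrization of `∂Ω` -/
  curve : ℝ → Plane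
  isOpen : IsOpen carrier
  isConnected : IsConnected carrier
  isBounded : Bornology.IsBounded carrier
  length_pos : 0 < length
  smooth : ContDiff ℝ ∞ curve
  periodic : Function.Periodic curve length
  unitSpeed : ∀ s, ‖deriv curve s‖ = 1
  injOn : InjOn curve (Ico 0 length)
  range_eq : range curve = frontier carrier
  outward : ∀ s, ∀ᶠ t in 𝓝[>] (0 : ℝ),
    curve s - t • rotCW (deriv curve s) ∈ carrier ∧
    curve s + t • rotCW (deriv curve s) ∉ closure carrier

namespace SmoothDomain

variable (Ω : SmoothDomain)

/-- The outer unit normal of `Ω` at the boundary point with arclength parameter `s`. -/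
def normal (s : ℝ) : Plane := rotCW (deriv Ω.curve s)

/-- The curvature of `∂Ω`, with the sign that makes it positive for a disc. -/
def curvature (s : ℝ) : ℝ := -inner ℝ (deriv (deriv Ω.curve) s) (Ω.normal s)

/-- The tubular neighbourhood `ω_ε = {x ∈ Ω : dist(x, ∂Ω) < ε}`. -/
def thin (ε : ℝ) : Set Plane :=
  {x | x ∈ Ω.carrier ∧ Metric.infDist x (frontier Ω.carrier) < ε}

/-- The coordinate map `Φ_ε (s, t) = γ(s) - ε t ν(s)`. -/
def fermi (ε : ℝ) (p : Plane) : Plane := Ω.curve (p 0) - (ε * p 1) • Ω.normal (p 0)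

/-- The reference set `Σ = (0, |∂Ω|) × (0, 1)`. -/
def refSet : Set Plane := {p | p 0 ∈ Ioo 0 Ω.length ∧ p 1 ∈ Ioo (0 : ℝ) 1}

/-! ### The boundary of `ω_ε`

For small `ε > 0` the boundary of `ω_ε` consists of the two disjoint closed curves `∂Ω` (index `0`)
and the inner parallel curve at distance `ε` (index `1`). A function on `∂ω_ε` is represented by its
values along these two curves, as functions of the arclength parameter `s` of `∂Ω`. -/

/-- The two boundary curves of `ω_ε`. -/
def bdryCurve (ε : ℝ) : Fin 2 → ℝ → Plane :=
  ![Ω.curve, fun s => Ω.curve s - ε • Ω.normal s]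

/-- The outer unit normal of `ω_ε` along the two boundary curves. -/
def bdryNormal : Fin 2 → ℝ → Plane :=
  ![Ω.normal, fun s => -Ω.normal s]

/-- The integral over `∂ω_ε` with respect to arclength `dσ`. -/
def bdryIntegral (ε : ℝ) (F : Fin 2 → ℝ → ℝ) : ℝ :=
  ∑ j : Fin 2, ∫ s in (0 : ℝ)..Ω.length, F j s * ‖deriv (Ω.bdryCurve ε j) s‖

/-- `g ∈ L²(∂ω_ε)` is the trace on `∂ω_ε` of a function `f` with weak gradient `df`: the function
`g` (unique almost everywhere) for which Green's formula
`∫ (f ∂ᵢψ + ∂ᵢf ψ) dx = ∫ g ψ nᵢ dσ` holds for all `ψ ∈ C_c^∞(ℝ²)`, `i = 1, 2`. -/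
def IsTrace (ε : ℝ) (f : Plane → ℝ) (df : Fin 2 → Plane → ℝ) (g : Fin 2 → ℝ → ℝ) : Prop :=
  (∀ j, MemLp (g j) 2 (volume.restrict (Ioc 0 Ω.length))) ∧
  ∀ ψ : Plane → ℝ, ContDiff ℝ ∞ ψ → HasCompactSupport ψ → ∀ i : Fin 2,
    ∫ x in Ω.thin ε, (f x * partialDeriv i ψ x + df i x * ψ x) =
      Ω.bdryIntegral ε (fun j s => g j s * ψ (Ω.bdryCurve ε j s) * Ω.bdryNormal j s i)

open Classical in
/-- The trace on `∂ω_ε` of a function `f` with weak gradient `df`. -/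
def trace (ε : ℝ) (f : Plane → ℝ) (df : Fin 2 → Plane → ℝ) : Fin 2 → ℝ → ℝ :=
  if h : ∃ g, Ω.IsTrace ε f df g then h.choose else 0

variable {Ω} in
/-- The trace of `u ∈ H²(ω_ε)` on `∂ω_ε`. -/
def bdryVal {ε : ℝ} (u : SobolevH2 (Ω.thin ε)) : Fin 2 → ℝ → ℝ :=
  Ω.trace ε u.val u.grad

variable {Ω} in
/-- The normal derivative `∂_ν u` on `∂ω_ε` of `u ∈ H²(ω_ε)`, from the traces of the `∂ᵢu`. -/
def normalDeriv {ε : ℝ} (u : SobolevH2 (Ω.thin ε)) (j : Fin 2) (s : ℝ) : ℝ :=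
  ∑ i : Fin 2, Ω.trace ε (u.grad i) (u.hess i) j s * Ω.bdryNormal j s i

/-! ### The biharmonic Steklov problem on `ω_ε` -/

/-- `u ∈ H²(ω_ε)` is a weak solution of the biharmonic Steklov problem with eigenvalue `Λ`. -/
def IsSteklovSolution (μ ε Λ : ℝ) (u : SobolevH2 (Ω.thin ε)) : Prop :=
  ∀ φ : SobolevH2 (Ω.thin ε),
    u.hessForm φ + μ * Ω.bdryIntegral ε (fun j s => normalDeriv u j s * normalDeriv φ j s) =
      Λ * Ω.bdryIntegral ε (fun j s => bdryVal u j s * bdryVal φ j s)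

/-- `lam 0 ≤ lam 1 ≤ … → ∞` are all the eigenvalues of the biharmonic Steklov problem on `ω_ε`,
repeated according to multiplicity, and the `u k` are corresponding eigenfunctions, orthonormal
in `L²(∂ω_ε)`. -/
structure IsSteklovEigensystem (μ ε : ℝ) (lam : ℕ → ℝ) (u : ℕ → SobolevH2 (Ω.thin ε)) : Prop where
  monotone : Monotone lam
  unbounded : Tendsto lam atTop atTop
  solution : ∀ k, Ω.IsSteklovSolution μ ε (lam k) (u k)
  orthonormal : ∀ k l, Ω.bdryIntegral ε (fun j s => bdryVal (u k) j s * bdryVal (u l) j s) =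
    if k = l then 1 else 0
  /-- no eigenfunction is orthogonal to all the `u k` -/
  exhaustive : ∀ (Λ : ℝ) (v : SobolevH2 (Ω.thin ε)), Ω.IsSteklovSolution μ ε Λ v →
    (∀ k, Ω.bdryIntegral ε (fun j s => bdryVal v j s * bdryVal (u k) j s) = 0) →
    v.val =ᵐ[volume.restrict (Ω.thin ε)] 0

/-! ### The limit problem on `(0, |∂Ω|)` -/

/-- `w ∈ C⁴([0, |∂Ω|])` (extended to the real line in any way) solves
`w'''' - 2 (κ² w')' = 2 Λ w` on `(0, |∂Ω|)` with periodic boundary conditions. -/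
structure IsLimitSolution (Λ : ℝ) (w : ℝ → ℝ) : Prop where
  contDiff : ContDiff ℝ 4 w
  ode : ∀ s ∈ Ioo 0 Ω.length,
    iteratedDeriv 4 w s - 2 * deriv (fun r => Ω.curvature r ^ 2 * deriv w r) s = 2 * Λ * w s
  periodic : ∀ k < 4, iteratedDeriv k w 0 = iteratedDeriv k w Ω.length

/-- The measure `2 ds` on `(0, |∂Ω|)`. -/
def limitMeasure : Measure ℝ := (2 : ℝ≥0∞) • volume.restrict (Ioo 0 Ω.length)

/-- `lam 0 ≤ lam 1 ≤ …` are the eigenvalues of the limit problem, repeated according to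
multiplicity, and the corresponding eigenfunctions `w k` are an orthonormal basis of
`L²((0, |∂Ω|), 2 ds)`. -/
structure IsLimitEigenbasis (lam : ℕ → ℝ) (w : ℕ → ℝ → ℝ) : Prop where
  monotone : Monotone lam
  solution : ∀ k, Ω.IsLimitSolution (lam k) (w k)
  basis : ∃ b : HilbertBasis ℕ ℝ (Lp ℝ 2 Ω.limitMeasure),
    ∀ k, (b k : ℝ → ℝ) =ᵐ[Ω.limitMeasure] w k

end SmoothDomain

end

open Function (Periodic)
open intervalIntegral (integral_of_le)
open intervalIntegral renaming integral_sub → iint_sub, integral_const_mul → iint_const_mul,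
  integral_add → iint_add, integral_nonneg → iint_nonneg, integral_congr → iint_congr,
  integral_mono_on → iint_mono_on, integral_const → iint_const, integral_eq_sub_of_hasDerivAt →
  iint_ftc, integral_add_adjacent_intervals → iint_adjacent, integral_zero → iint_zero,
  integral_mul_const → iint_mul_const, integral_neg → iint_neg


/-! The Fermi coordinates carry `ω_ε` to the fixed strip `Σ`, and the energy `∫|D²u|² + μ∫(∂_ν u)²`
becomes an integral with density `ε(1 - εtκ)` plus boundary terms. Let `N(u)` be the energy divided
by `ε` plus the squared boundary norm (`scaledEnergy`). The uniform estimates (`exists_coercive`)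
rest on the boundary term: since `μ > 0`, the trace of the normal derivative is `O(εN)` in squared
norm, and its derivative across the strip carries a factor `ε`, so the whole normal derivative is
`O(εN)`. Hence `u` differs from its boundary values by `O(εN)`, and a Poincaré inequality bounds the
tangential derivative by `N`. The boundary values then lie in a bounded set of `H¹` of a circle, so
in a Hölder ball that is compact for uniform convergence. For fixed `ε` this gives the discrete
spectrum by successive maximization of a Rayleigh quotient (`FormPair.exists_eigensystem`); as `ε →
0` it gives limits of the eigenfunctions.

The limit equation is found by testing with lifts: a smooth periodic `w` is extended constantly
along the normals. A lift has no normal derivative, its tangential second derivative is `w'' +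
O(ε)`, and each of its two mixed components is `-κw' + O(ε)`. Integration by parts along the curve
moves all derivatives to `w`; the terms with the normal derivative of `u` are small, and what is
left is `∫ u (w'''' - 2(κ²w')')` for the energy over `ε` and `2∫ u w` for the boundary form
(`exists_energy_lift`). The 2 in front of `κ²` counts the two mixed components of the Hessian; the 2
in front of `λ` counts the two boundary curves.

From any sequence of eigensystems with `ε → 0`, compactness extracts scaled eigenvalues tending to
`Λ k` and traces tending to `g k` (`SteklovLimit`). The `g k` solve the limit equation weakly, hence
classically by a bootstrap, and are orthonormal for `2 ds`. Completeness comes from the variational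
principle: for smooth periodic `χ` it passes to the limit as `Λ k (‖χ‖² - Σ_{j<k} ⟨g j, χ⟩²) ≤
q(χ)`, where `q(χ) = ∫ χ''² + 2κ²χ'²`, and `Λ k → ∞` leaves no room for a function orthogonal to all
`g j`. So the spectral theorem for the limit problem is a by-product and needs no separate proof.

Two such limits have the same `Λ`: lifts of the limit functions of one are trial functions in the
min-max principle for the other (`SteklovLimit.value_le`). Therefore the scaled eigenvalues converge
without passing to subsequences. The value for `k = 0` is exactly zero because constants have no
energy, and those for `k ≥ 1` are positive because only constants have no energy in the limit. Weak
convergence in `H²(Σ)` follows from strong convergence of the values and boundedness of all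
derivatives. -/

noncomputable section

/-- Lebesgue measure restricted to a set. -/
notation "𝓁" U:max => Measure.restrict volume U

/-- Square integrability on a set. -/
notation "𝓛" f:max U:max => MemLp f 2 (Measure.restrict volume U)

/-- Smoothness. -/
notation "𝒞" => ContDiff ℝ ∞

notation "𝒟" => partialDeriv

/-- The space `H²(ω_ε)`. -/
abbrev SmoothDomain.H2 (Ω : SmoothDomain) (ε : ℝ) : Type := SobolevH2 (Ω.thin ε)

theorem intervalIntegrable_cont {f : ℝ → ℝ} {a b : ℝ} (h : Continuous f := by fun_prop) :
    IntervalIntegrable f volume a b :=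
  h.intervalIntegrable a b

theorem contDiff_infty_deriv {f : ℝ → ℝ} (hf : 𝒞 f) : 𝒞 (deriv f) :=
  (contDiff_infty_iff_deriv.1 hf).2

/-! ### Spectral theory of a pair of quadratic forms -/

section Forms

variable {V : Type*} [AddCommGroup V] [Module ℝ V]

/-- Cauchy–Schwarz inequality for a symmetric form that is nonnegative on a subspace. -/
theorem form_sq_le (q : V →ₗ[ℝ] V →ₗ[ℝ] ℝ) (W : Submodule ℝ V) (hs : ∀ u v, q u v = q v u)
    (hn : ∀ v ∈ W, 0 ≤ q v v) {u v : V} (hu : u ∈ W) (hv : v ∈ W) :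
    q u v ^ 2 ≤ q u u * q v v := by
  have key : ∀ x : ℝ, 0 ≤ q v v * (x * x) + (2 * q u v) * x + q u u := by
    intro x
    have := hn (u + x • v) (W.add_mem hu (W.smul_mem x hv))
    simp only [map_add, LinearMap.add_apply, map_smul, LinearMap.smul_apply, smul_eq_mul] at this
    rw [hs v u] at this
    nlinarith
  have := discrim_le_zero key
  unfold discrim at this
  nlinarith

theorem form_sq_le' (q : V →ₗ[ℝ] V →ₗ[ℝ] ℝ) (hs : ∀ u v, q u v = q v u)
    (hn : ∀ v, 0 ≤ q v v) (u v : V) : q u v ^ 2 ≤ q u u * q v v :=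
  form_sq_le q ⊤ hs (fun v _ => hn v) trivial trivial

theorem form_add_le (q : V →ₗ[ℝ] V →ₗ[ℝ] ℝ) (W : Submodule ℝ V) (hs : ∀ u v, q u v = q v u)
    (hn : ∀ v ∈ W, 0 ≤ q v v) {u v : V} (hu : u ∈ W) (hv : v ∈ W) :
    q (u + v) (u + v) ≤ 2 * q u u + 2 * q v v := by
  have := hn (u - v) (W.sub_mem hu hv)
  simp only [map_add, LinearMap.add_apply, map_sub, LinearMap.sub_apply] at this ⊢
  rw [hs v u] at *
  linarith

theorem form_sub_le (q : V →ₗ[ℝ] V →ₗ[ℝ] ℝ) (W : Submodule ℝ V) (hs : ∀ u v, q u v = q v u)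
    (hn : ∀ v ∈ W, 0 ≤ q v v) {u v : V} (hu : u ∈ W) (hv : v ∈ W) :
    q (u - v) (u - v) ≤ 2 * q u u + 2 * q v v := by
  have := hn (u + v) (W.add_mem hu hv)
  simp only [map_add, LinearMap.add_apply, map_sub, LinearMap.sub_apply] at this ⊢
  rw [hs v u] at *
  linarith

/-- Two symmetric forms `0 ≤ b ≤ a` such that `a` is complete and `b` is compact with respect
to `a`. -/
structure FormPair (a b : V →ₗ[ℝ] V →ₗ[ℝ] ℝ) : Prop where
  symA : ∀ u v, a u v = a v u
  symB : ∀ u v, b u v = b v u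
  nonneg : ∀ v, 0 ≤ b v v
  le : ∀ v, b v v ≤ a v v
  compact : ∀ (v : ℕ → V) (M : ℝ), (∀ n, a (v n) (v n) ≤ M) → ∃ φ : ℕ → ℕ, StrictMono φ ∧
    ∀ δ > 0, ∃ N, ∀ n ≥ N, ∀ m ≥ N, b (v (φ n) - v (φ m)) (v (φ n) - v (φ m)) ≤ δ
  complete : ∀ v : ℕ → V, (∀ δ > 0, ∃ N, ∀ n ≥ N, ∀ m ≥ N, a (v n - v m) (v n - v m) ≤ δ) →
    ∃ w, ∀ δ > 0, ∃ N, ∀ n ≥ N, a (v n - w) (v n - w) ≤ δ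

namespace FormPair

variable {a b : V →ₗ[ℝ] V →ₗ[ℝ] ℝ}

/-- The Rayleigh quotient `b / a` attains its maximum on a closed subspace. -/
theorem exists_maximizer (h : FormPair a b) (W : Submodule ℝ V)
    (hW : ∀ (v : ℕ → V) (w : V), (∀ n, v n ∈ W) →
      (∀ δ > 0, ∃ N, ∀ n ≥ N, a (v n - w) (v n - w) ≤ δ) → w ∈ W)
    (hpos : ∃ v ∈ W, 0 < b v v) :
    ∃ e ∈ W, ∃ θ > 0, b e e = 1 ∧ (∀ v ∈ W, θ * a e v = b e v) ∧ ∀ v ∈ W, b v v ≤ θ * a v v := by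
  have an : ∀ v, 0 ≤ a v v := fun v => (h.nonneg v).trans (h.le v)
  set S : Set ℝ := {r | ∃ v ∈ W, a v v ≤ 1 ∧ b v v = r} with hS
  have Sbdd : BddAbove S := ⟨1, by rintro r ⟨v, -, h1, rfl⟩; exact (h.le v).trans h1⟩
  have scale : ∀ v ∈ W, 0 < a v v → b v v / a v v ∈ S := by
    intro v hv hav
    refine ⟨(√(a v v))⁻¹ • v, W.smul_mem _ hv, ?_, ?_⟩
    · simp only [map_smul, LinearMap.smul_apply, smul_eq_mul]
      rw [← mul_assoc, ← mul_inv, Real.mul_self_sqrt hav.le, inv_mul_cancel₀ hav.ne']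
    · simp only [map_smul, LinearMap.smul_apply, smul_eq_mul]
      rw [← mul_assoc, ← mul_inv, Real.mul_self_sqrt hav.le]; field_simp
  set θ := sSup S with hθ
  have le_θ : ∀ v ∈ W, b v v ≤ θ * a v v := by
    intro v hv
    rcases (an v).eq_or_lt with h0 | h0
    · rw [← h0, mul_zero]; rw [h0]; exact h.le v
    · have := le_csSup Sbdd (scale v hv h0)
      rwa [div_le_iff₀ h0] at this
  obtain ⟨v0, hv0, hv0p⟩ := hpos
  have θpos : 0 < θ := by
    have h1 : 0 < a v0 v0 := hv0p.trans_le (h.le v0)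
    exact (div_pos hv0p h1).trans_le (le_csSup Sbdd (scale v0 hv0 h1))
  have Sne : S.Nonempty := ⟨_, scale v0 hv0 (hv0p.trans_le (h.le v0))⟩
  have hex : ∀ n : ℕ, ∃ v ∈ W, a v v ≤ 1 ∧ θ - 1 / ((n : ℝ) + 1) < b v v := by
    intro n
    have hn : (0 : ℝ) < 1 / ((n : ℝ) + 1) := Nat.one_div_pos_of_nat
    obtain ⟨r, ⟨v, hv, hv1, rfl⟩, hr⟩ := exists_lt_of_lt_csSup Sne (sub_lt_self θ hn)
    exact ⟨v, hv, hv1, hr⟩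
  choose v hvW hva hvb using hex
  obtain ⟨φ, hφ, hC⟩ := h.compact v 1 hva
  -- The defect form `θ a - b` is nonnegative on `W` and tends to zero along the maximizing
  -- sequence. Together with the `b`-Cauchy property from compactness this makes the sequence
  -- `a`-Cauchy, so no weak limits are needed.
  set q : V →ₗ[ℝ] V →ₗ[ℝ] ℝ := θ • a - b with hq
  have qa : ∀ u v, q u v = θ * a u v - b u v := fun u v => by simp [hq]
  have qs : ∀ u v, q u v = q v u := fun u v => by rw [qa, qa, h.symA, h.symB]
  have qn : ∀ v ∈ W, 0 ≤ q v v := fun v hv => by rw [qa]; linarith [le_θ v hv]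
  have qv : ∀ n, q (v n) (v n) ≤ 1 / ((n : ℝ) + 1) := fun n => by
    rw [qa]; nlinarith [hva n, hvb n]
  have hsmall : ∀ δ > 0, ∃ N : ℕ, ∀ n ≥ N, q (v (φ n)) (v (φ n)) ≤ δ := by
    intro δ hδ
    obtain ⟨N, hN⟩ := exists_nat_one_div_lt hδ
    refine ⟨N, fun n hn => (qv _).trans (le_trans ?_ hN.le)⟩
    apply one_div_le_one_div_of_le (by positivity)
    have := hn.trans (hφ.id_le n)
    gcongr
  obtain ⟨w, hw⟩ := h.complete (fun n => v (φ n)) (by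
    intro δ hδ
    obtain ⟨N1, h1⟩ := hC (θ * δ / 2) (by positivity)
    obtain ⟨N2, h2⟩ := hsmall (θ * δ / 8) (by positivity)
    refine ⟨max N1 N2, fun n hn m hm => ?_⟩
    have e1 := h1 n (le_of_max_le_left hn) m (le_of_max_le_left hm)
    have e2 := form_sub_le q W qs qn (hvW (φ n)) (hvW (φ m))
    have e3 := h2 n (le_of_max_le_right hn)
    have e4 := h2 m (le_of_max_le_right hm)
    rw [qa (v (φ n) - v (φ m))] at e2
    have : θ * a (v (φ n) - v (φ m)) (v (φ n) - v (φ m)) ≤ θ * δ := by linarith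
    exact le_of_mul_le_mul_left this θpos)
  have hwW : w ∈ W := hW _ w (fun n => hvW (φ n)) hw
  have qw : q w w = 0 := by
    refine le_antisymm (le_of_forall_pos_le_add fun δ hδ => ?_) (qn w hwW)
    obtain ⟨N1, h1⟩ := hw (δ / (4 * θ)) (by positivity)
    obtain ⟨N2, h2⟩ := hsmall (δ / 4) (by positivity)
    have e1 := h1 _ (le_max_left N1 N2)
    have e2 := h2 _ (le_max_right N1 N2)
    have e3 := form_sub_le q W qs qn (hvW (φ (max N1 N2)))
      (W.sub_mem (hvW (φ (max N1 N2))) hwW)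
    rw [sub_sub_cancel, qa (v (φ (max N1 N2)) - w)] at e3
    have := h.nonneg (v (φ (max N1 N2)) - w)
    have e4 : θ * a (v (φ (max N1 N2)) - w) (v (φ (max N1 N2)) - w) ≤ δ / 4 := by
      calc _ ≤ θ * (δ / (4 * θ)) := by gcongr
        _ = δ / 4 := by field_simp
    linarith
  -- If `b w w` vanished, `b` would be small along the sequence, whereas it tends to `θ`.
  have bw : 0 < b w w := by
    by_contra hb
    have hb0 : b w w = 0 := le_antisymm (not_lt.1 hb) (h.nonneg w)
    obtain ⟨N1, h1⟩ := hw (θ / 8) (by positivity)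
    obtain ⟨N2, h2⟩ := exists_nat_one_div_lt (show 0 < θ / 2 by positivity)
    set m := max N1 N2
    have e1 := h1 m (le_max_left _ _)
    have e2 := form_add_le b W h.symB (fun v _ => h.nonneg v) hwW
      (W.sub_mem (hvW (φ m)) hwW)
    rw [add_sub_cancel] at e2
    have e3 := h.le (v (φ m) - w)
    have e4 := hvb (φ m)
    have e5 : (1 : ℝ) / ((φ m : ℝ) + 1) ≤ 1 / ((N2 : ℝ) + 1) := by
      apply one_div_le_one_div_of_le (by positivity)
      have := (le_max_right N1 N2).trans (hφ.id_le m)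
      gcongr
    linarith
  have hsq : √(b w w) * √(b w w) = b w w := Real.mul_self_sqrt bw.le
  have hsp : 0 < √(b w w) := Real.sqrt_pos.2 bw
  refine ⟨(√(b w w))⁻¹ • w, W.smul_mem _ hwW, θ, θpos, ?_, ?_, le_θ⟩
  · simp only [map_smul, LinearMap.smul_apply, smul_eq_mul]
    rw [← mul_assoc, ← mul_inv, hsq, inv_mul_cancel₀ bw.ne']
  · intro x hx
    -- Cauchy–Schwarz for the defect form, which vanishes at `w`, is the Euler–Lagrange equation.
    have := form_sq_le q W qs qn hwW hx
    rw [qw, zero_mul] at this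
    have h0 : q w x = 0 := by nlinarith [sq_nonneg (q w x)]
    rw [qa] at h0
    simp only [map_smul, LinearMap.smul_apply, smul_eq_mul]
    linear_combination (√(b w w))⁻¹ * h0

open Classical in
/-- A maximizer of the Rayleigh quotient on `W`. -/
def topVector (a b : V →ₗ[ℝ] V →ₗ[ℝ] ℝ) (W : Submodule ℝ V) : V :=
  if h : ∃ e ∈ W, ∃ θ > 0, b e e = 1 ∧ (∀ v ∈ W, θ * a e v = b e v) ∧
    ∀ v ∈ W, b v v ≤ θ * a v v then h.choose else 0

/-- The subspaces obtained by successively splitting off maximizers of the Rayleigh quotient. -/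
def tower (a b : V →ₗ[ℝ] V →ₗ[ℝ] ℝ) : ℕ → Submodule ℝ V
  | 0 => ⊤
  | n + 1 => tower a b n ⊓ LinearMap.ker (b (topVector a b (tower a b n)))

theorem mem_tower {n : ℕ} {v : V} :
    v ∈ tower a b n ↔ ∀ j < n, b (topVector a b (tower a b j)) v = 0 := by
  induction n with
  | zero => simp [tower]
  | succ n ih =>
    rw [tower, Submodule.mem_inf, ih, LinearMap.mem_ker]
    constructor
    · rintro ⟨h1, h2⟩ j hj
      rcases Nat.lt_succ_iff_lt_or_eq.1 hj with h | rfl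
      exacts [h1 j h, h2]
    · exact fun h => ⟨fun j hj => h j (hj.trans n.lt_succ_self), h n n.lt_succ_self⟩

/-- Each vector maximizes `b / a` on the `b`-orthogonal complement of its predecessors, and the
eigenvalue is the reciprocal of the maximum. The complements are `a`-closed because `b ≤ a`, and
`hinf` keeps the process from stopping. Bounded eigenvalues would give a `b`-orthonormal sequence
with a `b`-Cauchy subsequence, which is impossible since `b (e - e') (e - e') = 2`. -/
theorem exists_eigensystem (h : FormPair a b)
    (hinf : ∀ (n : ℕ) (f : ℕ → V), ∃ v, (∀ j < n, b (f j) v = 0) ∧ 0 < b v v) :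
    ∃ (lam : ℕ → ℝ) (e : ℕ → V), Monotone lam ∧ Tendsto lam atTop atTop ∧
      (∀ k v, a (e k) v = lam k * b (e k) v) ∧
      (∀ k l, b (e k) (e l) = if k = l then 1 else 0) ∧
      ∀ n v, (∀ j < n, b (e j) v = 0) → lam n * b v v ≤ a v v := by
  set W := tower a b with hW
  set e : ℕ → V := fun n => topVector a b (W n) with he
  have hmax : ∀ n, ∃ θ > 0, e n ∈ W n ∧ b (e n) (e n) = 1 ∧ (∀ v ∈ W n, θ * a (e n) v = b (e n) v)
      ∧ ∀ v ∈ W n, b v v ≤ θ * a v v := by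
    intro n
    have hex := h.exists_maximizer (W n) (by
      intro v w hv hvw
      rw [hW, mem_tower]
      intro j hj
      have h0 : ∀ m, b (topVector a b (tower a b j)) (v m) = 0 := fun m => (mem_tower.1 (hv m)) j hj
      set x := topVector a b (tower a b j)
      by_contra hne
      have hp : 0 < b x w ^ 2 := by positivity
      obtain ⟨N, hN⟩ := hvw (b x w ^ 2 / (2 * (b x x + 1)))
        (div_pos hp (by linarith [h.nonneg x]))
      have e1 := form_sq_le' b h.symB h.nonneg x (v N - w)
      rw [map_sub, h0, zero_sub, neg_sq] at e1
      have e2 := (h.le (v N - w)).trans (hN N le_rfl)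
      have hx := h.nonneg x
      have e3 : b x x * b (v N - w) (v N - w) ≤ (b x x + 1) * (b x w ^ 2 / (2 * (b x x + 1))) := by
        apply mul_le_mul (by linarith) e2 (h.nonneg _) (by linarith)
      have e4 : (b x x + 1) * (b x w ^ 2 / (2 * (b x x + 1))) = b x w ^ 2 / 2 := by
        field_simp
      linarith)
      (by
        obtain ⟨v, hv, hp⟩ := hinf n e
        exact ⟨v, mem_tower.2 hv, hp⟩)
    have : e n = hex.choose := by
      simp only [he, topVector]; rw [dif_pos hex]
    obtain ⟨h1, θ, h2, h3⟩ := hex.choose_spec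
    rw [← this] at h1 h3
    exact ⟨θ, h2, h1, h3⟩
  choose θ θpos eW e1 EL le_θ using hmax
  have orth : ∀ j n, j < n → b (e j) (e n) = 0 := fun j n hjn => mem_tower.1 (eW n) j hjn
  have Wanti : ∀ n, W (n + 1) ≤ W n := fun n => inf_le_left
  have Wanti' : Antitone W := antitone_nat_of_succ_le Wanti
  have aorth : ∀ j n, j < n → a (e n) (e j) = 0 := fun j n hjn => by
    have := EL j (e n) (Wanti' hjn.le (eW n))
    rw [orth j n hjn] at this
    rw [h.symA]
    exact (mul_eq_zero.1 this).resolve_left (θpos j).ne'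
  -- The Euler–Lagrange equation holds so far only on the `n`-th complement. Each step back through
  -- the tower adds one earlier vector, on which both sides vanish.
  have ELall : ∀ n d, d ≤ n → ∀ v ∈ W (n - d), θ n * a (e n) v = b (e n) v := by
    intro n d
    induction d with
    | zero => intro _ v hv; exact EL n v hv
    | succ d ih =>
      intro hd v hv
      have hlt : n - (d + 1) < n := by omega
      have hs : n - (d + 1) + 1 = n - d := by omega
      set j := n - (d + 1)
      have hv' : v - b (e j) v • e j ∈ W (n - d) := by
        rw [← hs]
        refine ⟨(W j).sub_mem hv ((W j).smul_mem _ (eW j)), ?_⟩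
        change b (e j) (v - b (e j) v • e j) = 0
        rw [map_sub, map_smul, e1, smul_eq_mul, mul_one, sub_self]
      have := ih (by omega) _ hv'
      rw [map_sub, map_smul, map_sub, map_smul, aorth j n hlt, h.symB (e n) (e j), orth j n hlt] at this
      simpa using this
  have ELf : ∀ n v, θ n * a (e n) v = b (e n) v := fun n v =>
    ELall n n le_rfl v (by rw [Nat.sub_self]; exact trivial)
  have aee : ∀ n, a (e n) (e n) = (θ n)⁻¹ := fun n => by
    have := ELf n (e n); rw [e1] at this
    exact eq_inv_of_mul_eq_one_right this
  have mono : Monotone fun n => (θ n)⁻¹ := by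
    refine monotone_nat_of_le_succ fun n => ?_
    have := le_θ n (e (n + 1)) (Wanti n (eW (n + 1)))
    rw [e1, aee] at this
    rw [inv_le_iff_one_le_mul₀ (θpos n)]
    linarith
  refine ⟨fun n => (θ n)⁻¹, e, mono, ?_, ?_, ?_, ?_⟩
  · rcases tendsto_atTop_of_monotone mono with h1 | ⟨l, hl⟩
    · exact h1
    · exfalso
      have hb : ∀ n, a (e n) (e n) ≤ l := fun n => by
        rw [aee]; exact mono.ge_of_tendsto hl n
      obtain ⟨φ, hφ, hC⟩ := h.compact e l hb
      obtain ⟨N, hN⟩ := hC 1 one_pos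
      have := hN N le_rfl (N + 1) (by omega)
      have ho := orth _ _ (hφ (Nat.lt_succ_self N))
      simp only [map_sub, LinearMap.sub_apply, e1] at this
      rw [h.symB (e (φ (N + 1)))] at this
      rw [ho] at this
      norm_num at this
  · intro k v
    rw [← ELf, ← mul_assoc, inv_mul_cancel₀ (θpos k).ne', one_mul]
  · intro k l
    rcases lt_trichotomy k l with hkl | rfl | hkl
    · rw [if_neg hkl.ne, orth _ _ hkl]
    · rw [if_pos rfl, e1]
    · rw [if_neg hkl.ne', h.symB, orth _ _ hkl]
  · intro n v hv
    have := le_θ n v (mem_tower.2 hv)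
    change (θ n)⁻¹ * _ ≤ _
    rw [inv_mul_le_iff₀ (θpos n)]
    exact this

/-- An orthonormal system of eigenvectors with eigenvalues tending to infinity to which no
eigenvector is orthogonal satisfies the variational principle. -/
theorem variational (h : FormPair a b)
    (hinf : ∀ (n : ℕ) (f : ℕ → V), ∃ v, (∀ j < n, b (f j) v = 0) ∧ 0 < b v v)
    {lam : ℕ → ℝ} {u : ℕ → V} (hmono : Monotone lam) (htop : Tendsto lam atTop atTop)
    (hu : ∀ k v, a (u k) v = lam k * b (u k) v)
    (ho : ∀ k l, b (u k) (u l) = if k = l then 1 else 0)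
    (hex : ∀ (t : ℝ) v, (∀ w, a v w = t * b v w) → (∀ k, b v (u k) = 0) → b v v = 0)
    {k : ℕ} {v : V} (hv : ∀ j < k, b v (u j) = 0) : lam k * b v v ≤ a v v := by
  obtain ⟨ν, e, -, νtop, he, heo, hvar⟩ := h.exists_eigensystem hinf
  -- Up to a `b`-null vector, `e m` is a combination of those `u j` whose eigenvalue is `ν m`: the
  -- remainder satisfies the eigenvalue equation and is orthogonal to every `u j`, so `hex` applies.
  -- Only finitely many `j` can occur because `lam` tends to infinity.
  have expand : ∀ m, ∃ N, ∀ n ≥ N, ∀ w, (∀ j < n, b w (u j) = 0) → b (e m) w = 0 := by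
    intro m
    obtain ⟨N, hN⟩ := eventually_atTop.1 (htop.eventually_gt_atTop (ν m))
    refine ⟨N, fun n hn w hw => ?_⟩
    have hne : ∀ j, lam j ≠ ν m → b (e m) (u j) = 0 := by
      intro j hj
      have h1 := he m (u j)
      rw [h.symA, hu, h.symB] at h1
      have : (lam j - ν m) * b (e m) (u j) = 0 := by linarith
      exact (mul_eq_zero.1 this).resolve_left (sub_ne_zero.2 hj)
    set x := e m - ∑ j ∈ Finset.range n, b (e m) (u j) • u j with hx
    have xx : b x x = 0 := by
      refine hex (ν m) x (fun y => ?_) fun j => ?_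
      · simp only [hx, map_sub, LinearMap.sub_apply, map_sum, LinearMap.sum_apply, map_smul,
          LinearMap.smul_apply, smul_eq_mul, he, hu, mul_sub, Finset.mul_sum]
        congr 1
        refine Finset.sum_congr rfl fun j _ => ?_
        by_cases hj : lam j = ν m
        · rw [hj]; ring
        · rw [hne j hj]; ring
      · simp only [hx, map_sub, LinearMap.sub_apply, map_sum, LinearMap.sum_apply, map_smul,
          LinearMap.smul_apply, smul_eq_mul, ho, mul_ite, mul_one, mul_zero,
          Finset.sum_ite_eq', Finset.mem_range]
        split_ifs with hj
        · simp
        · rw [hne j (hN j (by omega)).ne', sub_zero]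
    have xw : b x w = 0 := by
      have := form_sq_le' b h.symB h.nonneg x w
      rw [xx, zero_mul] at this
      nlinarith [sq_nonneg (b x w)]
    have : b x w = b (e m) w := by
      simp only [hx, map_sub, LinearMap.sub_apply, map_sum, LinearMap.sum_apply, map_smul,
          LinearMap.smul_apply, smul_eq_mul]
      rw [Finset.sum_eq_zero, sub_zero]
      intro j hj
      rw [h.symB (u j), hw j (Finset.mem_range.1 hj), mul_zero]
    rw [← this, xw]
  choose N hN using expand
  obtain ⟨n, hn⟩ := (νtop.eventually_ge_atTop (lam k)).exists
  -- With `K` this large, the residual of `v` after `K` terms is `b`-orthogonal to the first `n`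
  -- vectors of the constructed system. Hence `a ≥ ν n b ≥ lam k b` on the residual.
  set K := max k ((Finset.range n).sup N) with hK
  set r := v - ∑ j ∈ Finset.range K, b v (u j) • u j with hr
  have ru : ∀ j < K, b r (u j) = 0 := by
    intro j hj
    simp only [hr, map_sub, LinearMap.sub_apply, map_sum, LinearMap.sum_apply, map_smul,
      LinearMap.smul_apply, smul_eq_mul, ho, mul_ite, mul_one, mul_zero,
      Finset.sum_ite_eq', Finset.mem_range, hj, if_true, sub_self]
  have re : ν n * b r r ≤ a r r := by
    refine hvar n r fun m hm => hN m K ?_ r ru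
    exact (Finset.le_sup (f := N) (Finset.mem_range.2 hm)).trans (le_max_right _ _)
  have vb : b v v = ∑ j ∈ Finset.range K, b v (u j) ^ 2 + b r r := by
    have h1 : b r r = b r v := by
      conv_lhs => rw [hr, map_sub, ← hr]
      simp only [map_sum, map_smul, smul_eq_mul]
      rw [Finset.sum_eq_zero, sub_zero]
      intro j hj
      rw [ru j (Finset.mem_range.1 hj), mul_zero]
    rw [h1]
    simp only [hr, map_sub, LinearMap.sub_apply, map_sum, LinearMap.sum_apply, map_smul,
      LinearMap.smul_apply, smul_eq_mul]
    rw [add_comm, sub_add_eq_add_sub, eq_sub_iff_add_eq]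
    congr 1
    exact Finset.sum_congr rfl fun j _ => by rw [h.symB v (u j)]; ring
  have va : a v v = ∑ j ∈ Finset.range K, lam j * b v (u j) ^ 2 + a r r := by
    have h1 : a r r = a r v := by
      conv_lhs => rw [hr, map_sub, ← hr]
      simp only [map_sum, map_smul, smul_eq_mul]
      rw [Finset.sum_eq_zero, sub_zero]
      intro j hj
      rw [h.symA r, hu, h.symB (u j) r, ru j (Finset.mem_range.1 hj), mul_zero, mul_zero]
    rw [h1]
    simp only [hr, map_sub, LinearMap.sub_apply, map_sum, LinearMap.sum_apply, map_smul,
      LinearMap.smul_apply, smul_eq_mul, hu]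
    rw [add_comm, sub_add_eq_add_sub, eq_sub_iff_add_eq]
    congr 1
    exact Finset.sum_congr rfl fun j _ => by rw [h.symB v (u j)]; ring
  have hsum : lam k * ∑ j ∈ Finset.range K, b v (u j) ^ 2
      ≤ ∑ j ∈ Finset.range K, lam j * b v (u j) ^ 2 := by
    rw [Finset.mul_sum]
    refine Finset.sum_le_sum fun j _ => ?_
    by_cases hj : j < k
    · rw [hv j hj]; simp
    · exact mul_le_mul_of_nonneg_right (hmono (not_lt.1 hj)) (sq_nonneg _)
  rw [vb, va, mul_add]
  have := mul_le_mul_of_nonneg_right hn (h.nonneg r)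
  linarith

end FormPair

end Forms

/-! ### The Frenet frame and the Fermi coordinates -/

theorem Plane.norm_sq (v : Plane) : ‖v‖ ^ 2 = v 0 ^ 2 + v 1 ^ 2 := by
  rw [EuclideanSpace.norm_sq_eq, Fin.sum_univ_two]; simp

theorem Plane.ext {v w : Plane} (h0 : v 0 = w 0) (h1 : v 1 = w 1) : v = w := by
  ext i; fin_cases i <;> assumption

theorem Plane.contDiff_apply {n : WithTop ℕ∞} (i : Fin 2) : ContDiff ℝ n fun p : Plane => p i :=
  (contDiff_euclidean.1 contDiff_id) i

theorem Plane.continuous_apply (i : Fin 2) : Continuous fun p : Plane => p i :=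
  (Plane.contDiff_apply (n := 0) i).continuous

theorem Function.Periodic.exists_abs_le {f : ℝ → ℝ} {T : ℝ} (hf : Periodic f T)
    (hT : T ≠ 0) (hc : Continuous f) : ∃ K > 0, ∀ s, |f s| ≤ K := by
  obtain ⟨K, hK⟩ := (hf.compact_of_continuous hT hc).isBounded.exists_norm_le
  exact ⟨max K 1, by positivity, fun s => (hK _ (mem_range_self s)).trans (le_max_left _ _)⟩

theorem Function.Periodic.deriv_periodic {E : Type*} [NormedAddCommGroup E] [NormedSpace ℝ E]
    {f : ℝ → E} {T : ℝ} (hf : Periodic f T) : Periodic (deriv f) T := by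
  intro s
  rw [← deriv_comp_add_const]
  congr 1
  exact funext hf

namespace SmoothDomain

variable (Ω : SmoothDomain)

/-- The components of the unit tangent. -/
def tan (i : Fin 2) (s : ℝ) : ℝ := deriv Ω.curve s i

/-- The components of the outer unit normal. -/
def nor (i : Fin 2) (s : ℝ) : ℝ := Ω.normal s i

theorem nor_zero (s : ℝ) : Ω.nor 0 s = Ω.tan 1 s := by simp [nor, tan, normal, rotCW]

theorem nor_one (s : ℝ) : Ω.nor 1 s = -Ω.tan 0 s := by simp [nor, tan, normal, rotCW]

theorem contDiff_curve_deriv : 𝒞 (deriv Ω.curve) :=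
  (contDiff_infty_iff_deriv.1 Ω.smooth).2

theorem contDiff_tan (i : Fin 2) : 𝒞 (Ω.tan i) :=
  (contDiff_euclidean.1 Ω.contDiff_curve_deriv) i

theorem contDiff_nor (i : Fin 2) : 𝒞 (Ω.nor i) := by
  fin_cases i
  · exact (funext Ω.nor_zero : Ω.nor 0 = Ω.tan 1) ▸ Ω.contDiff_tan 1
  · exact (funext Ω.nor_one : Ω.nor 1 = fun s => -Ω.tan 0 s) ▸ (Ω.contDiff_tan 0).neg

theorem tan_sq (s : ℝ) : Ω.tan 0 s ^ 2 + Ω.tan 1 s ^ 2 = 1 := by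
  have := Plane.norm_sq (deriv Ω.curve s)
  rw [Ω.unitSpeed] at this
  simpa [tan] using this.symm

theorem hasDerivAt_curve (i : Fin 2) (s : ℝ) :
    HasDerivAt (fun s => Ω.curve s i) (Ω.tan i s) s := by
  have h : HasDerivAt Ω.curve (deriv Ω.curve s) s :=
    (Ω.smooth.differentiable (by simp) s).hasDerivAt
  exact (EuclideanSpace.proj (𝕜 := ℝ) i).hasFDerivAt.comp_hasDerivAt s h

theorem hasDerivAt_tan_aux (i : Fin 2) (s : ℝ) :
    HasDerivAt (Ω.tan i) (deriv (deriv Ω.curve) s i) s := by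
  have h : HasDerivAt (deriv Ω.curve) (deriv (deriv Ω.curve) s) s :=
    (Ω.contDiff_curve_deriv.differentiable (by simp) s).hasDerivAt
  exact (EuclideanSpace.proj (𝕜 := ℝ) i).hasFDerivAt.comp_hasDerivAt s h

theorem curvature_eq (s : ℝ) : Ω.curvature s =
    -(deriv (deriv Ω.curve) s 0 * Ω.nor 0 s + deriv (deriv Ω.curve) s 1 * Ω.nor 1 s) := by
  simp only [curvature, nor, PiLp.inner_apply, Fin.sum_univ_two, RCLike.inner_apply, conj_trivial]
  ring

theorem contDiff_curvature : 𝒞 Ω.curvature := by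
  have h := (contDiff_infty_iff_deriv.1 Ω.contDiff_curve_deriv).2
  have h2 := contDiff_euclidean.1 h
  rw [funext Ω.curvature_eq]
  exact (((h2 0).mul (Ω.contDiff_nor 0)).add ((h2 1).mul (Ω.contDiff_nor 1))).neg

theorem tan_mul_deriv (s : ℝ) : Ω.tan 0 s * deriv (deriv Ω.curve) s 0 +
    Ω.tan 1 s * deriv (deriv Ω.curve) s 1 = 0 := by
  have h := ((Ω.hasDerivAt_tan_aux 0 s).pow 2).add ((Ω.hasDerivAt_tan_aux 1 s).pow 2)
  have h2 : HasDerivAt (Ω.tan 0 ^ 2 + Ω.tan 1 ^ 2) 0 s := by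
    have : Ω.tan 0 ^ 2 + Ω.tan 1 ^ 2 = fun _ => (1 : ℝ) := funext fun s => by
      simpa using Ω.tan_sq s
    rw [this]; exact hasDerivAt_const s 1
  have := h.unique h2
  push_cast at this
  simp only [pow_one] at this
  linarith

theorem hasDerivAt_tan (i : Fin 2) (s : ℝ) :
    HasDerivAt (Ω.tan i) (-(Ω.curvature s * Ω.nor i s)) s := by
  convert! Ω.hasDerivAt_tan_aux i s using 1
  have h1 := Ω.tan_sq s
  have h2 := Ω.tan_mul_deriv s
  rw [Ω.curvature_eq]
  fin_cases i
  · simp only [Fin.zero_eta, nor_zero, nor_one]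
    linear_combination (deriv (deriv Ω.curve) s 0) * h1 - Ω.tan 0 s * h2
  · simp only [Fin.mk_one, nor_zero, nor_one]
    linear_combination (deriv (deriv Ω.curve) s 1) * h1 - Ω.tan 1 s * h2

theorem hasDerivAt_nor (i : Fin 2) (s : ℝ) :
    HasDerivAt (Ω.nor i) (Ω.curvature s * Ω.tan i s) s := by
  fin_cases i
  · have := Ω.hasDerivAt_tan 1 s
    rw [nor_one] at this
    rw [show Ω.nor ⟨0, by norm_num⟩ = Ω.tan 1 from funext Ω.nor_zero]
    simpa using this
  · have := (Ω.hasDerivAt_tan 0 s).neg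
    rw [nor_zero] at this
    rw [show Ω.nor ⟨1, by norm_num⟩ = -Ω.tan 0 from funext Ω.nor_one]
    simpa using this

theorem tan_periodic (i : Fin 2) : Periodic (Ω.tan i) Ω.length := fun s => by
  simp only [tan]; rw [Ω.periodic.deriv_periodic s]

theorem nor_periodic (i : Fin 2) : Periodic (Ω.nor i) Ω.length := fun s => by
  simp only [nor, normal]; rw [Ω.periodic.deriv_periodic s]

theorem curvature_periodic : Periodic Ω.curvature Ω.length := fun s => by
  simp only [curvature, normal]
  rw [Ω.periodic.deriv_periodic s, Ω.periodic.deriv_periodic.deriv_periodic s]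

/-- The density `1 - ε t κ(s)` of the Fermi coordinates. -/
def jac (ε : ℝ) (p : Plane) : ℝ := 1 - ε * p 1 * Ω.curvature (p 0)

theorem contDiff_jac (ε : ℝ) : 𝒞 (Ω.jac ε) := by
  have := Ω.contDiff_curvature.comp (Plane.contDiff_apply 0)
  exact contDiff_const.sub ((contDiff_const.mul (Plane.contDiff_apply 1)).mul this)

theorem fermi_apply (ε : ℝ) (p : Plane) (i : Fin 2) :
    Ω.fermi ε p i = Ω.curve (p 0) i - ε * p 1 * Ω.nor i (p 0) := by
  simp [fermi, nor]

theorem contDiff_fermi (ε : ℝ) : 𝒞 (Ω.fermi ε) := by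
  rw [contDiff_euclidean]
  intro i
  simp only [fermi_apply]
  have h1 := ((contDiff_euclidean.1 Ω.smooth) i).comp (Plane.contDiff_apply (n := ∞) 0)
  have h2 := (Ω.contDiff_nor i).comp (Plane.contDiff_apply (n := ∞) 0)
  exact h1.sub ((contDiff_const.mul (Plane.contDiff_apply 1)).mul h2)

/-- The derivative of the Fermi coordinates. -/
def fermiDeriv (ε : ℝ) (p : Plane) : Plane →L[ℝ] Plane :=
  (EuclideanSpace.proj (𝕜 := ℝ) 0).smulRight (Ω.jac ε p • deriv Ω.curve (p 0)) -
    (EuclideanSpace.proj (𝕜 := ℝ) 1).smulRight (ε • Ω.normal (p 0))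

theorem fermiDeriv_apply (ε : ℝ) (p v : Plane) (i : Fin 2) : Ω.fermiDeriv ε p v i =
    v 0 * Ω.jac ε p * Ω.tan i (p 0) - v 1 * ε * Ω.nor i (p 0) := by
  simp [fermiDeriv, tan, nor]; ring

theorem hasFDerivAt_apply (i : Fin 2) (p : Plane) :
    HasFDerivAt (fun p : Plane => p i) (EuclideanSpace.proj (𝕜 := ℝ) i) p :=
  (EuclideanSpace.proj (𝕜 := ℝ) i).hasFDerivAt

theorem hasFDerivAt_fermi (ε : ℝ) (p : Plane) :
    HasFDerivAt (Ω.fermi ε) (Ω.fermiDeriv ε p) p := by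
  rw [← hasFDerivWithinAt_univ, hasFDerivWithinAt_euclidean]
  intro i
  rw [hasFDerivWithinAt_univ]
  have h0 := hasFDerivAt_apply 0 p
  have h1 := hasFDerivAt_apply 1 p
  have hc := (Ω.hasDerivAt_curve i (p 0)).comp_hasFDerivAt p h0
  have hn := (Ω.hasDerivAt_nor i (p 0)).comp_hasFDerivAt p h0
  have h := hc.sub ((h1.const_mul ε).mul hn)
  refine (h.congr_fderiv ?_).congr_of_eventuallyEq
    (Eventually.of_forall fun q => Ω.fermi_apply ε q i)
  ext v
  have := Ω.fermiDeriv_apply ε p v i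
  simp only [ContinuousLinearMap.comp_apply, PiLp.proj_apply, this]
  simp [jac]
  ring

theorem det_fermiDeriv (ε : ℝ) (p : Plane) : (Ω.fermiDeriv ε p).det = ε * Ω.jac ε p := by
  rw [ContinuousLinearMap.det,
    ← LinearMap.det_toMatrix (EuclideanSpace.basisFun (Fin 2) ℝ).toBasis, Matrix.det_fin_two]
  have : ∀ i j, LinearMap.toMatrix (EuclideanSpace.basisFun (Fin 2) ℝ).toBasis
      (EuclideanSpace.basisFun (Fin 2) ℝ).toBasis (Ω.fermiDeriv ε p).toLinearMap i j =
      Ω.fermiDeriv ε p (EuclideanSpace.single j 1) i := by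
    intro i j
    simp [LinearMap.toMatrix_apply]
  simp only [this, fermiDeriv_apply]
  have h := Ω.tan_sq (p 0)
  simp [nor_zero, nor_one]
  linear_combination (ε * Ω.jac ε p) * h

/-- The derivative of the Fermi coordinates as an equivalence. -/
def fermiEquiv {ε : ℝ} {p : Plane} (h : ε * Ω.jac ε p ≠ 0) : Plane ≃L[ℝ] Plane :=
  (Ω.fermiDeriv ε p).toContinuousLinearEquivOfDetNeZero (by rwa [det_fermiDeriv])

theorem hasFDerivAt_fermi_equiv {ε : ℝ} {p : Plane} (h : ε * Ω.jac ε p ≠ 0) :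
    HasFDerivAt (Ω.fermi ε) (Ω.fermiEquiv h : Plane →L[ℝ] Plane) p :=
  Ω.hasFDerivAt_fermi ε p

theorem fermi_add_zsmul (ε s t : ℝ) (k : ℤ) :
    Ω.fermi ε !₂[s + k * Ω.length, t] = Ω.fermi ε !₂[s, t] := by
  have h1 := Ω.periodic.int_mul k s
  have h2 := (Ω.nor_periodic 0).int_mul k s
  have h3 := (Ω.nor_periodic 1).int_mul k s
  apply Plane.ext <;> simp [fermi_apply, h1, h2, h3]

theorem fermi_scale (ε s t : ℝ) : Ω.fermi ε !₂[s, t] = Ω.fermi 1 !₂[s, ε * t] := by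
  simp [fermi]

theorem fermi_zero_right (ε s : ℝ) : Ω.fermi ε !₂[s, 0] = Ω.curve s := by
  simp [fermi]

theorem curve_eq_iff {s s' : ℝ} (h : Ω.curve s = Ω.curve s') : ∃ k : ℤ, s' = s + k * Ω.length := by
  have key : ∀ r, Ω.curve (toIcoMod Ω.length_pos 0 r) = Ω.curve r := fun r => by
    rw [toIcoMod, Ω.periodic.sub_zsmul_eq]
  have h2 := Ω.injOn (toIcoMod_mem_Ico' Ω.length_pos s) (toIcoMod_mem_Ico' Ω.length_pos s')
    (by rw [key, key, h])
  refine ⟨toIcoDiv Ω.length_pos 0 s' - toIcoDiv Ω.length_pos 0 s, ?_⟩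
  simp only [toIcoMod, zsmul_eq_mul] at h2
  push_cast
  linarith

theorem exists_curvature_bound : ∃ K > 0, ∀ s, |Ω.curvature s| ≤ K :=
  Ω.curvature_periodic.exists_abs_le Ω.length_pos.ne' Ω.contDiff_curvature.continuous

/-- Compactness and the inverse function theorem. Pairs that violate injectivity at smaller and
smaller distance from the curve accumulate at points of the curve with the same image. Once the
parameters are normalized modulo the period, both members of the pair approach one point, near which
the coordinates are locally injective. -/
theorem exists_tubular_radius : ∃ r > 0, ∀ p q : Plane, |p 1| < r → |q 1| < r →
    Ω.fermi 1 p = Ω.fermi 1 q → p 1 = q 1 ∧ ∃ k : ℤ, q 0 = p 0 + k * Ω.length := by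
  by_contra! hcon
  have L := Ω.length_pos
  have hex : ∀ n : ℕ, ∃ a b c d : ℝ, a ∈ Icc 0 Ω.length ∧ b ∈ Icc (-Ω.length) (2 * Ω.length) ∧
      |a - b| ≤ Ω.length / 2 ∧ |c| < 1 / ((n : ℝ) + 1) ∧ |d| < 1 / ((n : ℝ) + 1) ∧
      Ω.fermi 1 !₂[a, c] = Ω.fermi 1 !₂[b, d] ∧ ¬ (a = b ∧ c = d) := by
    intro n
    obtain ⟨p, q, hp, hq, heq, hne⟩ := hcon (1 / ((n : ℝ) + 1)) Nat.one_div_pos_of_nat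
    obtain ⟨m, hm⟩ : ∃ m : ℤ, toIcoMod L 0 (p 0) = p 0 + m * Ω.length :=
      ⟨-toIcoDiv L 0 (p 0), by rw [toIcoMod]; push_cast; rw [zsmul_eq_mul]; ring⟩
    have ha := toIcoMod_mem_Ico' L (p 0)
    set a := toIcoMod L 0 (p 0)
    -- The second parameter is placed within half a period of the first, so that in the limit the
    -- two cannot differ by a nonzero multiple of the period.
    obtain ⟨m', hm'⟩ : ∃ m : ℤ, toIcoMod L (a - Ω.length / 2) (q 0) = q 0 + m * Ω.length :=
      ⟨-toIcoDiv L (a - Ω.length / 2) (q 0), by rw [toIcoMod]; push_cast; rw [zsmul_eq_mul]; ring⟩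
    have hb := toIcoMod_mem_Ico L (a - Ω.length / 2) (q 0)
    set b := toIcoMod L (a - Ω.length / 2) (q 0)
    refine ⟨a, b, p 1, q 1, ⟨ha.1, ha.2.le⟩, ⟨?_, ?_⟩, ?_, hp, hq, ?_, ?_⟩
    · linarith [hb.1, ha.1]
    · linarith [hb.2, ha.2]
    · rw [abs_le]; constructor <;> linarith [hb.1, hb.2]
    · rw [hm, hm', fermi_add_zsmul, fermi_add_zsmul]
      convert! heq using 2 <;> exact Plane.ext (by simp) (by simp)
    · rintro ⟨h1, h2⟩
      refine hne h2 (m - m') ?_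
      push_cast
      rw [hm, hm'] at h1
      linarith
  choose a b c d ha hb hab hc hd heq hne using hex
  obtain ⟨x, -, φ, hφ, hx⟩ := (isCompact_Icc.prod isCompact_Icc).tendsto_subseq
    (fun n => (⟨ha n, hb n⟩ : (a n, b n) ∈ Icc 0 Ω.length ×ˢ Icc (-Ω.length) (2 * Ω.length)))
  have hxa : Tendsto (fun n => a (φ n)) atTop (𝓝 x.1) := (continuous_fst.tendsto _).comp hx
  have hxb : Tendsto (fun n => b (φ n)) atTop (𝓝 x.2) := (continuous_snd.tendsto _).comp hx
  have z : Tendsto (fun n : ℕ => 1 / ((φ n : ℝ) + 1)) atTop (𝓝 0) :=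
    tendsto_one_div_add_atTop_nhds_zero_nat.comp hφ.tendsto_atTop
  have hxc : Tendsto (fun n => c (φ n)) atTop (𝓝 0) :=
    squeeze_zero_norm (fun n => (hc (φ n)).le) z
  have hxd : Tendsto (fun n => d (φ n)) atTop (𝓝 0) :=
    squeeze_zero_norm (fun n => (hd (φ n)).le) z
  have mk : ∀ {f g : ℕ → ℝ} {y w : ℝ}, Tendsto f atTop (𝓝 y) → Tendsto g atTop (𝓝 w) →
      Tendsto (fun n => (!₂[f n, g n] : Plane)) atTop (𝓝 !₂[y, w]) := by
    intro f g y w hf hg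
    have : Continuous fun r : ℝ × ℝ => (!₂[r.1, r.2] : Plane) := by fun_prop
    exact (this.tendsto (y, w)).comp (hf.prodMk_nhds hg)
  have hA := mk hxa hxc
  have hB := mk hxb hxd
  have cf := (Ω.contDiff_fermi 1).continuous
  have hAB : Ω.curve x.1 = Ω.curve x.2 := by
    rw [← Ω.fermi_zero_right 1, ← Ω.fermi_zero_right 1]
    refine tendsto_nhds_unique ((cf.tendsto _).comp hA) ?_
    refine ((cf.tendsto _).comp hB).congr fun n => ?_
    exact (heq (φ n)).symm
  have habs : |x.1 - x.2| ≤ Ω.length / 2 :=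
    le_of_tendsto (hxa.sub hxb).abs (Eventually.of_forall fun n => hab (φ n))
  obtain ⟨k, hk⟩ := Ω.curve_eq_iff hAB
  have hk0 : k = 0 := by
    have h1 : |(k : ℝ)| * Ω.length ≤ Ω.length / 2 := by
      calc |(k : ℝ)| * Ω.length = |x.1 - x.2| := by
            rw [hk, ← abs_of_pos L, ← abs_mul, abs_of_pos L, ← abs_neg]; congr 1; ring
        _ ≤ _ := habs
    have h2 : |(k : ℝ)| < 1 := by
      by_contra hcon; push Not at hcon; nlinarith
    have : |k| < 1 := by exact_mod_cast h2
    exact Int.abs_lt_one_iff.1 this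
  have hx12 : x.2 = x.1 := by rw [hk, hk0]; simp
  rw [hx12] at hB
  have hdet : (1 : ℝ) * Ω.jac 1 !₂[x.1, 0] ≠ 0 := by simp [jac]
  set e := (Ω.contDiff_fermi 1).contDiffAt.toOpenPartialHomeomorph (Ω.fermi 1)
    (Ω.hasFDerivAt_fermi_equiv hdet) (by simp) with he
  have hmem : e.source ∈ 𝓝 (!₂[x.1, 0] : Plane) :=
    e.open_source.mem_nhds (ContDiffAt.mem_toOpenPartialHomeomorph_source _ _ _)
  obtain ⟨n, h1, h2⟩ := ((hA.eventually hmem).and (hB.eventually hmem)).exists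
  have := e.injOn h1 h2 (heq (φ n))
  refine hne (φ n) ⟨?_, ?_⟩
  · simpa using congrArg (fun v : Plane => v 0) this
  · simpa using congrArg (fun v : Plane => v 1) this

/-- The properties of the Fermi coordinates at small thickness `ε`. -/
structure Tubular (ε : ℝ) : Prop where
  pos : 0 < ε
  le_one : ε ≤ 1
  -- The range of `t` is wider than `[0, 1]`, so that functions on the closed strip can be cut off
  -- outside it and still be transported to the plane.
  inj : ∀ p q : Plane, p 1 ∈ Ioo (-1 : ℝ) 2 → q 1 ∈ Ioo (-1 : ℝ) 2 → Ω.fermi ε p = Ω.fermi ε q →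
    p 1 = q 1 ∧ ∃ k : ℤ, q 0 = p 0 + k * Ω.length
  jac_mem : ∀ p : Plane, p 1 ∈ Icc (-1 : ℝ) 2 → Ω.jac ε p ∈ Icc (1 / 2 : ℝ) (3 / 2)
  mem_thin : ∀ x, x ∈ Ω.thin ε ↔ ∃ p : Plane, p 1 ∈ Ioo (0 : ℝ) 1 ∧ Ω.fermi ε p = x

/-- A short normal segment meets the boundary only at its foot, so by connectedness its inner half
stays in `Ω` and its outer half stays outside the closure. Conversely, let a point of `Ω` lie close
to the boundary and take a nearest boundary point: stationarity of the distance makes the connecting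
segment normal, and the behaviour of the outer half fixes its direction. -/
theorem eventually_tubular : ∀ᶠ ε in 𝓝[>] (0 : ℝ), Ω.Tubular ε := by
  obtain ⟨r, hr, hinj⟩ := Ω.exists_tubular_radius
  obtain ⟨K, hK, hκ⟩ := Ω.exists_curvature_bound
  have ray : ∀ s r : ℝ, Ω.curve s - r • Ω.normal s = Ω.fermi 1 !₂[s, r] := fun s r => by
    simp [fermi]
  have hfr : ∀ s t : ℝ, |t| < r → Ω.fermi 1 !₂[s, t] ∈ frontier Ω.carrier → t = 0 := by
    intro s t ht h
    rw [← Ω.range_eq] at h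
    obtain ⟨s', hs'⟩ := h
    rw [← Ω.fermi_zero_right 1] at hs'
    exact (hinj !₂[s', 0] !₂[s, t] (by simpa using hr) (by simpa using ht) hs').1.symm
  have cray : ∀ s, Continuous fun t : ℝ => Ω.fermi 1 !₂[s, t] := fun s =>
    (Ω.contDiff_fermi 1).continuous.comp (by fun_prop)
  have inside : ∀ s t : ℝ, t ∈ Ioo 0 r → Ω.fermi 1 !₂[s, t] ∈ Ω.carrier := by
    intro s
    have hpre : IsPreconnected ((fun t : ℝ => Ω.fermi 1 !₂[s, t]) '' Ioo 0 r) :=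
      isPreconnected_Ioo.image _ (cray s).continuousOn
    have := hpre.subset_of_closure_inter_subset Ω.isOpen (by
      obtain ⟨t, ⟨h1, -⟩, h2⟩ := ((Ω.outward s).and (Ioo_mem_nhdsGT hr)).exists
      refine ⟨_, ⟨t, h2, rfl⟩, ?_⟩
      simp only
      rw [← ray]; exact h1) (by
      rintro x ⟨h1, t, ht, rfl⟩
      by_contra hx
      have : Ω.fermi 1 !₂[s, t] ∈ frontier Ω.carrier := by
        rw [frontier, Ω.isOpen.interior_eq]; exact ⟨h1, hx⟩
      exact ht.1.ne' (hfr s t (by rw [abs_of_pos ht.1]; exact ht.2) this))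
    exact fun t ht => this ⟨t, ht, rfl⟩
  have outside : ∀ s t : ℝ, t ∈ Ioo (-r) 0 → Ω.fermi 1 !₂[s, t] ∉ closure Ω.carrier := by
    intro s
    have hpre : IsPreconnected ((fun t : ℝ => Ω.fermi 1 !₂[s, t]) '' Ioo (-r) 0) :=
      isPreconnected_Ioo.image _ (cray s).continuousOn
    have := hpre.subset_of_closure_inter_subset (u := (closure Ω.carrier)ᶜ)
      isClosed_closure.isOpen_compl (by
      obtain ⟨t, ⟨-, h1⟩, h2⟩ := ((Ω.outward s).and (Ioo_mem_nhdsGT hr)).exists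
      refine ⟨_, ⟨-t, ⟨by linarith [h2.2], by linarith [h2.1]⟩, rfl⟩, ?_⟩
      have := ray s (-t)
      rw [neg_smul, sub_neg_eq_add] at this
      simp only
      rw [← this]; exact h1) (by
      rintro x ⟨h1, t, ht, rfl⟩ hx
      have : Ω.fermi 1 !₂[s, t] ∈ frontier Ω.carrier := by
        apply frontier_closure_subset
        rw [frontier_eq_closure_inter_closure]
        exact ⟨subset_closure hx, h1⟩
      exact ht.2.ne (hfr s t (by rw [abs_of_neg ht.2]; linarith [ht.1]) this))
    exact fun t ht => this ⟨t, ht, rfl⟩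
  have hfcpt : IsCompact (frontier Ω.carrier) :=
    Ω.isBounded.isCompact_closure.of_isClosed_subset isClosed_frontier frontier_subset_closure
  have hfne : (frontier Ω.carrier).Nonempty := by rw [← Ω.range_eq]; exact range_nonempty _
  have nearest : ∀ x ∈ Ω.carrier, Metric.infDist x (frontier Ω.carrier) < r →
      ∃ s t, 0 < t ∧ t = Metric.infDist x (frontier Ω.carrier) ∧ Ω.fermi 1 !₂[s, t] = x := by
    intro x hx hd
    obtain ⟨y, hy, hxy⟩ := hfcpt.exists_infDist_eq_dist hfne x
    rw [← Ω.range_eq] at hy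
    obtain ⟨s, rfl⟩ := hy
    set d := Metric.infDist x (frontier Ω.carrier)
    have hmin : ∀ s', d ≤ dist x (Ω.curve s') := fun s' =>
      Metric.infDist_le_dist_of_mem (by rw [← Ω.range_eq]; exact mem_range_self s')
    have hd2 : ∀ s', dist x (Ω.curve s') ^ 2
        = (x 0 - Ω.curve s' 0) ^ 2 + (x 1 - Ω.curve s' 1) ^ 2 := fun s' => by
      rw [dist_eq_norm, Plane.norm_sq]; simp
    have hloc : IsLocalMin (fun s' => (x 0 - Ω.curve s' 0) ^ 2 + (x 1 - Ω.curve s' 1) ^ 2) s := by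
      refine Eventually.of_forall fun s' => ?_
      simp only
      rw [← hd2, ← hd2, ← hxy]
      exact pow_le_pow_left₀ Metric.infDist_nonneg (hmin s') 2
    have hder := (((Ω.hasDerivAt_curve 0 s).const_sub (x 0)).pow 2).add
      (((Ω.hasDerivAt_curve 1 s).const_sub (x 1)).pow 2)
    have h0 := hloc.hasDerivAt_eq_zero hder
    push_cast at h0
    simp only [pow_one] at h0
    have hT := Ω.tan_sq s
    set t := -((x 0 - Ω.curve s 0) * Ω.nor 0 s + (x 1 - Ω.curve s 1) * Ω.nor 1 s) with ht
    have hxt : Ω.fermi 1 !₂[s, t] = x := by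
      apply Plane.ext
      · simp only [fermi_apply]
        simp [ht, nor_zero, nor_one]
        linear_combination (x 0 - Ω.curve s 0) * hT + Ω.tan 0 s / 2 * h0
      · simp only [fermi_apply]
        simp [ht, nor_zero, nor_one]
        linear_combination (x 1 - Ω.curve s 1) * hT + Ω.tan 1 s / 2 * h0
    have htd : |t| = d := by
      have h1 : t ^ 2 = d ^ 2 := by
        rw [hxy, hd2]
        conv_rhs => rw [← hxt]
        simp only [fermi_apply]
        simp [nor_zero, nor_one]
        linear_combination -t ^ 2 * hT
      rw [(sq_eq_sq_iff_abs_eq_abs _ _).1 h1]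
      exact abs_of_nonneg Metric.infDist_nonneg
    refine ⟨s, t, ?_, ?_, hxt⟩
    · rcases lt_trichotomy t 0 with h | h | h
      · exfalso
        refine outside s t ⟨?_, h⟩ (by rw [hxt]; exact subset_closure hx)
        rw [abs_of_neg h] at htd; linarith
      · exfalso
        rw [h, fermi_zero_right] at hxt
        have : x ∈ frontier Ω.carrier := by rw [← Ω.range_eq]; exact ⟨s, hxt⟩
        rw [frontier, Ω.isOpen.interior_eq] at this
        exact this.2 hx
      · exact h
    · rcases lt_or_ge t 0 with h | h
      · exfalso
        refine outside s t ⟨?_, h⟩ (by rw [hxt]; exact subset_closure hx)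
        rw [abs_of_neg h] at htd; linarith
      · rw [← htd, abs_of_nonneg h]
  -- Since `|t| ≤ 2`, the bound `r / 2` keeps `εt` inside the tubular radius, and `1 / (4K)` keeps
  -- `|εtκ| ≤ 1/2`.
  have hlt : (0 : ℝ) < min 1 (min (r / 2) (1 / (4 * K))) := by positivity
  filter_upwards [Ioo_mem_nhdsGT hlt] with ε hε
  have h1 : ε < 1 := hε.2.trans_le (min_le_left _ _)
  have h2 : ε < r / 2 := hε.2.trans_le ((min_le_right _ _).trans (min_le_left _ _))
  have h3 : ε < 1 / (4 * K) := hε.2.trans_le ((min_le_right _ _).trans (min_le_right _ _))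
  have h0 := hε.1
  have hsc : ∀ p : Plane, Ω.fermi ε p = Ω.fermi 1 !₂[p 0, ε * p 1] := fun p => by
    rw [← fermi_scale]; congr 1; exact Plane.ext (by simp) (by simp)
  refine ⟨h0, h1.le, ?_, ?_, ?_⟩
  · intro p q hp hq h
    rw [hsc, hsc] at h
    have hb : ∀ t ∈ Ioo (-1 : ℝ) 2, |ε * t| < r := by
      intro t ht
      rw [abs_lt]; constructor <;> nlinarith [ht.1, ht.2]
    have := hinj _ _ (by simpa using hb _ hp) (by simpa using hb _ hq) h
    simpa [h0.ne'] using this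
  · intro p hp
    have hb : |ε * p 1 * Ω.curvature (p 0)| ≤ 1 / 2 := by
      rw [abs_mul, abs_mul, abs_of_pos h0]
      have hp1 : |p 1| ≤ 2 := abs_le.2 ⟨by linarith [hp.1], hp.2⟩
      have hk := hκ (p 0)
      rw [lt_div_iff₀ (by positivity)] at h3
      calc ε * |p 1| * |Ω.curvature (p 0)| ≤ ε * 2 * K := by gcongr
        _ ≤ 1 / 2 := by nlinarith
    rw [abs_le] at hb
    simp only [jac, mem_Icc]
    constructor <;> linarith [hb.1, hb.2]
  · intro x
    constructor
    · rintro ⟨hx, hd⟩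
      obtain ⟨s, t, ht, htd, hst⟩ := nearest x hx (by linarith)
      refine ⟨!₂[s, t / ε], ⟨by simpa using div_pos ht h0, ?_⟩, ?_⟩
      · simp only [Matrix.cons_val_one, Matrix.cons_val_fin_one]
        rw [div_lt_one h0, htd]; exact hd
      · rw [fermi_scale, mul_div_cancel₀ _ h0.ne', hst]
    · rintro ⟨p, hp, rfl⟩
      rw [hsc]
      have hlt : ε * p 1 < ε := by nlinarith [hp.2]
      have hpos : 0 < ε * p 1 := mul_pos h0 hp.1
      refine ⟨inside _ _ ⟨hpos, by linarith⟩, ?_⟩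
      refine lt_of_le_of_lt (Metric.infDist_le_dist_of_mem (y := Ω.curve (p 0)) ?_) ?_
      · rw [← Ω.range_eq]; exact mem_range_self _
      · rw [← ray, dist_eq_norm, sub_sub_cancel_left, norm_neg, norm_smul, Real.norm_of_nonneg hpos.le]
        have : ‖Ω.normal (p 0)‖ = 1 := by
          have h := Plane.norm_sq (Ω.normal (p 0))
          have hT := Ω.tan_sq (p 0)
          have e0 := Ω.nor_zero (p 0)
          have e1 := Ω.nor_one (p 0)
          simp only [nor] at e0 e1
          rw [e0, e1] at h
          have : ‖Ω.normal (p 0)‖ ^ 2 = 1 := by rw [h]; linarith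
          exact (pow_eq_one_iff_of_nonneg (norm_nonneg _) two_ne_zero).1 this
        rw [this, mul_one]; exact hlt

end SmoothDomain

/-! ### Square integrable functions -/

section SquareIntegrable

variable {α : Type*} [MeasurableSpace α] {μ : Measure α}

theorem integrable_mul_of_memLp {f g : α → ℝ} (hf : MemLp f 2 μ) (hg : MemLp g 2 μ) :
    Integrable (fun x => f x * g x) μ := hf.integrable_mul hg

/-- Real square integrable functions. -/
def l2Space (μ : Measure α) : Submodule ℝ (α → ℝ) where
  carrier := {f | MemLp f 2 μ}
  add_mem' := fun hf hg => hf.add hg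
  zero_mem' := MemLp.zero'
  smul_mem' := fun c _ hf => hf.const_smul c

/-- The inner product of square integrable functions. -/
def l2Form (μ : Measure α) : l2Space μ →ₗ[ℝ] l2Space μ →ₗ[ℝ] ℝ :=
  LinearMap.mk₂ ℝ (fun f g => ∫ x, f.1 x * g.1 x ∂μ)
    (fun f f' g => by
      simp only [Submodule.coe_add, Pi.add_apply, add_mul]
      exact integral_add (integrable_mul_of_memLp f.2 g.2) (integrable_mul_of_memLp f'.2 g.2))
    (fun c f g => by
      simp only [Submodule.coe_smul, Pi.smul_apply, smul_eq_mul, mul_assoc]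
      exact integral_const_mul _ _)
    (fun f g g' => by
      simp only [Submodule.coe_add, Pi.add_apply, mul_add]
      exact integral_add (integrable_mul_of_memLp f.2 g.2) (integrable_mul_of_memLp f.2 g'.2))
    (fun c f g => by
      simp only [Submodule.coe_smul, Pi.smul_apply, smul_eq_mul, mul_left_comm]
      exact integral_const_mul _ _)

theorem l2Form_apply (f g : l2Space μ) : l2Form μ f g = ∫ x, f.1 x * g.1 x ∂μ := rfl

theorem l2Form_symm (f g : l2Space μ) : l2Form μ f g = l2Form μ g f := by
  simp only [l2Form_apply, mul_comm]

theorem l2Form_nonneg (f : l2Space μ) : 0 ≤ l2Form μ f f :=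
  integral_nonneg fun x => mul_self_nonneg (f.1 x)

theorem integral_mul_sq_le {f g : α → ℝ} (hf : MemLp f 2 μ) (hg : MemLp g 2 μ) :
    (∫ x, f x * g x ∂μ) ^ 2 ≤ (∫ x, f x ^ 2 ∂μ) * ∫ x, g x ^ 2 ∂μ := by
  have := form_sq_le' (l2Form μ) l2Form_symm l2Form_nonneg ⟨f, hf⟩ ⟨g, hg⟩
  simp only [l2Form_apply, ← sq] at this
  exact this

theorem integral_sq_add_le {f g : α → ℝ} (hf : MemLp f 2 μ) (hg : MemLp g 2 μ) :
    ∫ x, (f x + g x) ^ 2 ∂μ ≤ 2 * (∫ x, f x ^ 2 ∂μ) + 2 * ∫ x, g x ^ 2 ∂μ := by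
  rw [← integral_const_mul, ← integral_const_mul,
    ← integral_add (hf.integrable_sq.const_mul 2) (hg.integrable_sq.const_mul 2)]
  refine integral_mono (hf.add hg).integrable_sq
    ((hf.integrable_sq.const_mul 2).add (hg.integrable_sq.const_mul 2)) fun x => ?_
  simp only
  nlinarith [sq_nonneg (f x - g x)]

theorem integral_sq_sub_le {f g : α → ℝ} (hf : MemLp f 2 μ) (hg : MemLp g 2 μ) :
    ∫ x, (f x - g x) ^ 2 ∂μ ≤ 2 * (∫ x, f x ^ 2 ∂μ) + 2 * ∫ x, g x ^ 2 ∂μ := by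
  have := integral_sq_add_le hf hg.neg
  simpa [sub_eq_add_neg] using this

theorem integral_sq_sub_eq {f g : α → ℝ} (hf : MemLp f 2 μ) (hg : MemLp g 2 μ) :
    ∫ x, (f x - g x) ^ 2 ∂μ =
      (∫ x, f x ^ 2 ∂μ) - 2 * (∫ x, f x * g x ∂μ) + ∫ x, g x ^ 2 ∂μ := by
  have h1 := (integrable_mul_of_memLp hf hg).const_mul 2
  have h2 := integral_sub hf.integrable_sq h1
  have h3 := integral_add (hf.integrable_sq.sub h1) hg.integrable_sq
  simp only [Pi.sub_apply] at h3
  rw [← integral_const_mul, ← h2, ← h3]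
  congr 1; ext x; ring

theorem integral_sq_mono {f g : α → ℝ} {C : ℝ} (hg : MemLp g 2 μ)
    (h : ∀ᵐ x ∂μ, |f x| ≤ C * |g x|) : ∫ x, f x ^ 2 ∂μ ≤ C ^ 2 * ∫ x, g x ^ 2 ∂μ := by
  rw [← integral_const_mul]
  refine integral_mono_of_nonneg (Eventually.of_forall fun x => sq_nonneg _)
    (hg.integrable_sq.const_mul _) ?_
  filter_upwards [h] with x hx
  rw [← sq_abs (f x), ← sq_abs (g x), ← mul_pow]
  exact pow_le_pow_left₀ (abs_nonneg _) hx 2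

theorem ae_eq_zero_of_integral_sq_nonpos {f : α → ℝ} (hf : MemLp f 2 μ)
    (h : ∫ x, f x ^ 2 ∂μ ≤ 0) : f =ᵐ[μ] 0 := by
  have h0 : ∫ x, f x ^ 2 ∂μ = 0 := le_antisymm h (integral_nonneg fun x => sq_nonneg _)
  rw [integral_eq_zero_iff_of_nonneg (fun x => sq_nonneg _) hf.integrable_sq] at h0
  filter_upwards [h0] with x hx
  simpa using hx

theorem sq_le_of_sq_le_mul {x K y : ℝ} (hy : 0 ≤ y) (hK : 0 ≤ K) (h : x ^ 2 ≤ K * y) :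
    2 * x ≤ K + y := by
  nlinarith [sq_nonneg (K - y), sq_nonneg (K + y - 2 * x)]

end SquareIntegrable

/-! ### Test functions -/

/-- `ψ` is a smooth function with compact support in `U`. -/
structure IsTest (U : Set Plane) (ψ : Plane → ℝ) : Prop where
  smooth : 𝒞 ψ
  compact : HasCompactSupport ψ
  subset : tsupport ψ ⊆ U

theorem IsTest.memLp {U : Set Plane} {ψ : Plane → ℝ} (h : IsTest U ψ) (ν : Measure Plane)
    [IsFiniteMeasureOnCompacts ν] : MemLp ψ 2 ν :=
  h.smooth.continuous.memLp_of_hasCompactSupport h.compact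

theorem IsTest.add {U : Set Plane} {ψ χ : Plane → ℝ} (h : IsTest U ψ) (h' : IsTest U χ) :
    IsTest U (ψ + χ) :=
  ⟨h.smooth.add h'.smooth, h.compact.add h'.compact,
    (closure_mono (Function.support_add _ _)).trans (by
      rw [closure_union]; exact union_subset h.subset h'.subset)⟩

theorem IsTest.smul {U : Set Plane} {ψ : Plane → ℝ} (h : IsTest U ψ) (c : ℝ) :
    IsTest U (c • ψ) :=
  ⟨h.smooth.const_smul c, h.compact.mono (Function.support_const_smul_subset c ψ),
    (closure_mono (Function.support_const_smul_subset c ψ)).trans h.subset⟩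

theorem partialDeriv_contDiff {ψ : Plane → ℝ} (h : 𝒞 ψ) (i : Fin 2) :
    𝒞 (𝒟 i ψ) :=
  (h.fderiv_right (m := ∞) (by simp)).clm_apply contDiff_const

theorem IsTest.partialDeriv {U : Set Plane} {ψ : Plane → ℝ} (h : IsTest U ψ) (i : Fin 2) :
    IsTest U (𝒟 i ψ) := by
  have hs : Function.support (𝒟 i ψ) ⊆ tsupport ψ := by
    intro x hx
    refine support_fderiv_subset ℝ (f := ψ) (a := x) ?_
    intro h0
    exact hx (by simp [_root_.partialDeriv, h0])
  exact ⟨partialDeriv_contDiff h.smooth i, h.compact.of_isClosed_subset isClosed_closure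
    (closure_minimal hs (isClosed_tsupport ψ)),
    (closure_minimal hs (isClosed_tsupport ψ)).trans h.subset⟩

theorem ae_eq_zero_of_forall_isTest {U : Set Plane} (hU : IsOpen U) {f : Plane → ℝ}
    (hf : 𝓛 f U)
    (h : ∀ ψ, IsTest U ψ → ∫ x in U, f x * ψ x = 0) : f =ᵐ[𝓁 U] 0 := by
  have hl : LocallyIntegrableOn f U volume :=
    locallyIntegrableOn_of_locallyIntegrable_restrict (hf.locallyIntegrable (by norm_num))
  have := hU.ae_eq_zero_of_integral_contDiff_smul_eq_zero hl (fun ψ h1 h2 h3 => by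
    rw [← h ψ ⟨h1, h2, h3⟩, ← integral_indicator hU.measurableSet]
    congr 1
    ext x
    by_cases hx : x ∈ U
    · rw [indicator_of_mem hx, smul_eq_mul, mul_comm]
    · rw [indicator_of_notMem hx, image_eq_zero_of_notMem_tsupport fun hx' => hx (h3 hx'),
        zero_smul])
  rw [EventuallyEq, ae_restrict_iff' hU.measurableSet]
  exact this

/-- Density by orthogonality: only zero is orthogonal to all test functions, so their classes span a
dense subspace of `L²`. -/
theorem exists_isTest_near {U : Set Plane} (hU : IsOpen U) {f : Plane → ℝ}
    (hf : 𝓛 f U) {δ : ℝ} (hδ : 0 < δ) :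
    ∃ ψ, IsTest U ψ ∧ ∫ x in U, (f x - ψ x) ^ 2 ≤ δ := by
  let S : Submodule ℝ (Lp ℝ 2 (𝓁 U)) :=
    { carrier := {g | ∃ ψ, IsTest U ψ ∧ g =ᵐ[𝓁 U] ψ}
      add_mem' := by
        rintro g g' ⟨ψ, h, h1⟩ ⟨ψ', h', h1'⟩
        exact ⟨ψ + ψ', h.add h', (Lp.coeFn_add g g').trans (h1.add h1')⟩
      zero_mem' := ⟨0, ⟨contDiff_const, HasCompactSupport.zero, by simp [tsupport]⟩,
        Lp.coeFn_zero _ _ _⟩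
      smul_mem' := by
        rintro c g ⟨ψ, h, h1⟩
        exact ⟨c • ψ, h.smul c, (Lp.coeFn_smul c g).trans (h1.const_smul c)⟩ }
  have hS : S.topologicalClosure = ⊤ := by
    rw [Submodule.topologicalClosure_eq_top_iff, Submodule.eq_bot_iff]
    intro g hg
    have h0 := ae_eq_zero_of_forall_isTest hU (Lp.memLp g) fun ψ hψ => by
      have hm := hψ.memLp (𝓁 U)
      have := (Submodule.mem_orthogonal' S g).1 hg (hm.toLp ψ) ⟨ψ, hψ, hm.coeFn_toLp⟩
      rw [L2.inner_def] at this
      rw [← this]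
      refine integral_congr_ae ?_
      filter_upwards [hm.coeFn_toLp] with x hx
      simp [hx, mul_comm]
    exact (Lp.eq_zero_iff_ae_eq_zero).2 h0
  have hmem : hf.toLp f ∈ closure (S : Set (Lp ℝ 2 (𝓁 U))) := by
    rw [← Submodule.topologicalClosure_coe, hS]; trivial
  obtain ⟨g, ⟨ψ, hψ, hgψ⟩, hg⟩ := Metric.mem_closure_iff.1 hmem (√δ) (Real.sqrt_pos.2 hδ)
  refine ⟨ψ, hψ, ?_⟩
  have h1 : ‖hf.toLp f - g‖ ^ 2 ≤ δ := by
    rw [← dist_eq_norm]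
    calc _ ≤ √δ ^ 2 := pow_le_pow_left₀ dist_nonneg hg.le 2
      _ = δ := Real.sq_sqrt hδ.le
  rw [← real_inner_self_eq_norm_sq, L2.inner_def] at h1
  refine le_of_eq_of_le (integral_congr_ae ?_) h1
  filter_upwards [Lp.coeFn_sub (hf.toLp f) g, hf.coeFn_toLp, hgψ] with x h1 h2 h3
  rw [h1, Pi.sub_apply, h2, h3]
  simp [sq]

/-- The `L²` norm by duality. A test function close to `f` is inserted, and the quadratic hypothesis
is used in the linear form `2x ≤ K + y`. -/
theorem integral_sq_le_of_forall_isTest {U : Set Plane} (hU : IsOpen U) {f : Plane → ℝ} {K : ℝ}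
    (hK : 0 ≤ K) (hf : 𝓛 f U)
    (h : ∀ ψ, IsTest U ψ → (∫ x in U, f x * ψ x) ^ 2 ≤ K * ∫ x in U, ψ x ^ 2) :
    ∫ x in U, f x ^ 2 ≤ K := by
  refine le_of_forall_pos_le_add fun δ hδ => ?_
  obtain ⟨ψ, hψ, hd⟩ := exists_isTest_near hU hf hδ
  have hm := hψ.memLp (𝓁 U)
  have hy := sq_le_of_sq_le_mul (integral_nonneg fun x => sq_nonneg (ψ x)) hK (h ψ hψ)
  have : ∫ x in U, (f x - ψ x) ^ 2 =
      (∫ x in U, f x ^ 2) - 2 * (∫ x in U, f x * ψ x) + ∫ x in U, ψ x ^ 2 :=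
    integral_sq_sub_eq hf hm
  linarith

/-! ### Smooth primitives -/

/-- A primitive in the last variable of a smooth function is smooth. -/
theorem contDiff_primitive {P : Type*} [NormedAddCommGroup P] [NormedSpace ℝ P] {g : P → ℝ → ℝ}
    (hg : 𝒞 ↿g) {R : ℝ} (h0 : ∀ p r, r ≤ 0 ∨ R ≤ r → g p r = 0) :
    𝒞 fun q : P × ℝ => ∫ r in 0..q.2, g q.1 r := by
  -- The primitive is the convolution of `g` with the indicator of the positive half-line, so
  -- smoothness jointly with the parameter follows from the theorem on convolutions.
  have h := contDiffOn_convolution_right_with_param (n := ⊤) (μ := (volume : Measure ℝ))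
    (ContinuousLinearMap.mul ℝ ℝ) (f := indicator (Ioi (0 : ℝ)) 1) (g := g) (s := univ)
    (k := Icc 0 R) isOpen_univ isCompact_Icc
    (fun p x _ hx => h0 p x (by
      by_contra hcon
      push Not at hcon
      exact hx ⟨hcon.1.le, hcon.2.le⟩))
    ((locallyIntegrable_const (1 : ℝ)).indicator measurableSet_Ioi) hg.contDiffOn
  rw [univ_prod_univ, contDiffOn_univ] at h
  convert! h using 1
  funext q
  obtain ⟨p, t⟩ := q
  simp only [MeasureTheory.convolution, ContinuousLinearMap.mul_apply']
  have e1 : ∀ y, indicator (Ioi (0 : ℝ)) 1 y * g p (t - y) =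
      indicator (Ioi (0 : ℝ)) (fun y => g p (t - y)) y := fun y => by
    by_cases hy : y ∈ Ioi (0 : ℝ)
    · rw [indicator_of_mem hy, indicator_of_mem hy]; simp
    · rw [indicator_of_notMem hy, indicator_of_notMem hy]; simp
  simp only [e1]
  rw [integral_indicator measurableSet_Ioi]
  have e2 : ∫ y in Ioi (0 : ℝ), g p (t - y) = ∫ r in Iic t, g p r := by
    have := integral_comp_neg_Iic (-0 : ℝ) (fun y => g p (t - y))
    rw [neg_neg] at this
    rw [← this]
    have h2 := (measurePreserving_add_right volume t).setIntegral_preimage_emb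
      (measurableEmbedding_addRight t) (fun r => g p r) (Iic t)
    rw [← h2]
    simp [sub_neg_eq_add, add_comm]
  rw [e2]
  have z : ∀ r ≤ 0, g p r = 0 := fun r hr => h0 p r (Or.inl hr)
  rcases le_total 0 t with ht | ht
  · rw [integral_of_le ht]
    refine (setIntegral_eq_of_subset_of_forall_sdiff_eq_zero measurableSet_Iic
      Ioc_subset_Iic_self ?_).symm
    intro r hr
    by_contra hne
    refine hr.2 ⟨?_, hr.1⟩
    by_contra h'
    exact hne (z r (not_lt.1 h'))
  · rw [intervalIntegral.integral_symm, integral_of_le ht,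
      setIntegral_eq_zero_of_forall_eq_zero fun r hr => z r hr.2, neg_zero]
    exact (setIntegral_eq_zero_of_forall_eq_zero fun r hr =>
      z r (le_trans (mem_Iic.1 hr) ht)).symm

/-! ### The reference rectangle -/

/-- A point of the plane from its coordinates. -/
def planeEquiv : ℝ × ℝ ≃ᵐ Plane :=
  (MeasurableEquiv.finTwoArrow).symm.trans (MeasurableEquiv.toLp 2 (Fin 2 → ℝ))

theorem planeEquiv_apply (x : ℝ × ℝ) : planeEquiv x = !₂[x.1, x.2] := rfl

theorem measurePreserving_planeEquiv :
    MeasurePreserving planeEquiv (volume.prod volume) volume :=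
  ((volume_preserving_finTwoArrow ℝ).symm _).trans (PiLp.volume_preserving_toLp (Fin 2))

theorem Plane.eta (p : Plane) : !₂[p 0, p 1] = p := Plane.ext (by simp) (by simp)

theorem partialDeriv_eq_deriv {ψ : Plane → ℝ} (h : 𝒞 ψ) (i : Fin 2) (s t : ℝ) :
    𝒟 i ψ !₂[s, t] =
      if i = 0 then deriv (fun r => ψ !₂[r, t]) s else deriv (fun r => ψ !₂[s, r]) t := by
  have hd : HasFDerivAt ψ (fderiv ℝ ψ !₂[s, t]) !₂[s, t] :=
    (h.differentiable (by simp) _).hasFDerivAt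
  fin_cases i
  · have hl : HasDerivAt (fun r : ℝ => (!₂[r, t] : Plane)) (EuclideanSpace.single 0 1) s := by
      rw [hasDerivAt_iff_hasFDerivAt, ← hasFDerivWithinAt_univ, hasFDerivWithinAt_euclidean]
      intro j
      rw [hasFDerivWithinAt_univ]
      fin_cases j
      · convert! (hasFDerivAt_id (𝕜 := ℝ) s) using 1; ext; simp
      · convert! (hasFDerivAt_const (𝕜 := ℝ) t s) using 1; ext; simp
    have := (hd.comp_hasDerivAt s hl).deriv.symm
    simp only [Function.comp_def] at this
    simpa [partialDeriv] using this
  · have hl : HasDerivAt (fun r : ℝ => (!₂[s, r] : Plane)) (EuclideanSpace.single 1 1) t := by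
      rw [hasDerivAt_iff_hasFDerivAt, ← hasFDerivWithinAt_univ, hasFDerivWithinAt_euclidean]
      intro j
      rw [hasFDerivWithinAt_univ]
      fin_cases j
      · convert! (hasFDerivAt_const (𝕜 := ℝ) s t) using 1; ext; simp
      · convert! (hasFDerivAt_id (𝕜 := ℝ) t) using 1; ext; simp
    have := (hd.comp_hasDerivAt t hl).deriv.symm
    simp only [Function.comp_def] at this
    simpa [partialDeriv] using this

namespace SmoothDomain

variable (Ω : SmoothDomain)

/-- The measure on the parameter rectangle as a product. -/
def rectMeasure : Measure (ℝ × ℝ) :=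
  (𝓁 (Ioo 0 Ω.length)).prod (𝓁 (Ioo (0 : ℝ) 1))

instance : IsFiniteMeasure (𝓁 (Ioo 0 Ω.length)) :=
  ⟨by rw [Measure.restrict_apply_univ]; exact measure_Ioo_lt_top⟩

instance : IsFiniteMeasure Ω.rectMeasure := by unfold rectMeasure; infer_instance

theorem measurePreserving_rect :
    MeasurePreserving planeEquiv Ω.rectMeasure (𝓁 Ω.refSet) := by
  rw [rectMeasure, Measure.prod_restrict]
  convert! measurePreserving_planeEquiv.restrict_preimage_emb planeEquiv.measurableEmbedding
    Ω.refSet using 2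

theorem integral_refSet (f : Plane → ℝ) :
    ∫ p in Ω.refSet, f p = ∫ x, f !₂[x.1, x.2] ∂Ω.rectMeasure :=
  (Ω.measurePreserving_rect.integral_comp planeEquiv.measurableEmbedding f).symm

theorem memLp_refSet {f : Plane → ℝ} (hf : 𝓛 f Ω.refSet) :
    MemLp (fun x : ℝ × ℝ => f !₂[x.1, x.2]) 2 Ω.rectMeasure :=
  hf.comp_measurePreserving Ω.measurePreserving_rect

theorem memLp_refSet_of_rect {f : ℝ × ℝ → ℝ} (hf : MemLp f 2 Ω.rectMeasure) :
    𝓛 (fun p : Plane => f (p 0, p 1)) Ω.refSet :=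
  hf.comp_measurePreserving (Ω.measurePreserving_rect.symm planeEquiv)

theorem isOpen_refSet : IsOpen Ω.refSet :=
  (isOpen_Ioo.preimage (Plane.continuous_apply 0)).inter
    (isOpen_Ioo.preimage (Plane.continuous_apply 1))

theorem integral_congr_refSet {f g : Plane → ℝ} (h : EqOn f g Ω.refSet) :
    ∫ p in Ω.refSet, f p = ∫ p in Ω.refSet, g p :=
  setIntegral_congr_fun Ω.isOpen_refSet.measurableSet h

/-- The closed parameter rectangle. -/
def closedRect : Set Plane := {p | p 0 ∈ Icc 0 Ω.length ∧ p 1 ∈ Icc (0 : ℝ) 1}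

theorem isCompact_closedRect : IsCompact Ω.closedRect := by
  have : Ω.closedRect = (fun x : ℝ × ℝ => (!₂[x.1, x.2] : Plane)) ''
      (Icc 0 Ω.length ×ˢ Icc (0 : ℝ) 1) := by
    ext p
    constructor
    · intro h; exact ⟨(p 0, p 1), h, Plane.eta p⟩
    · rintro ⟨x, h, rfl⟩; exact h
  rw [this]
  exact (isCompact_Icc.prod isCompact_Icc).image (by fun_prop)

theorem refSet_subset : Ω.refSet ⊆ Ω.closedRect := fun _ h =>
  ⟨Ioo_subset_Icc_self h.1, Ioo_subset_Icc_self h.2⟩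

instance : IsFiniteMeasure (𝓁 Ω.refSet) :=
  ⟨by
    rw [Measure.restrict_apply_univ]
    exact (measure_mono Ω.refSet_subset).trans_lt Ω.isCompact_closedRect.measure_lt_top⟩

theorem exists_bound {c : Plane → ℝ} (hc : Continuous c) :
    ∃ C > 0, ∀ p ∈ Ω.closedRect, |c p| ≤ C := by
  obtain ⟨C, hC⟩ := Ω.isCompact_closedRect.exists_bound_of_continuousOn hc.continuousOn
  exact ⟨max C 1, by positivity, fun p hp => (hC p hp).trans (le_max_left _ _)⟩

theorem ae_refSet {P : Plane → Prop} (h : ∀ p ∈ Ω.refSet, P p) :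
    ∀ᵐ p ∂𝓁 Ω.refSet, P p :=
  (ae_restrict_iff' Ω.isOpen_refSet.measurableSet).2 (Eventually.of_forall h)

theorem memLp_mul {c F : Plane → ℝ} (hc : Continuous c)
    (hF : 𝓛 F Ω.refSet) :
    𝓛 (fun p => c p * F p) Ω.refSet := by
  obtain ⟨C, -, hC⟩ := Ω.exists_bound hc
  refine hF.of_le_mul (c := C) (hc.aestronglyMeasurable.mul hF.1) (Ω.ae_refSet fun p hp => ?_)
  rw [norm_mul]
  exact mul_le_mul_of_nonneg_right (hC p (Ω.refSet_subset hp)) (norm_nonneg _)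

theorem memLp_continuous {c : Plane → ℝ} (hc : Continuous c) :
    𝓛 c Ω.refSet := by
  simpa using Ω.memLp_mul hc (memLp_const 1)

theorem memLp_Ioc {g : ℝ → ℝ} :
    𝓛 g (Ioc 0 Ω.length) ↔ 𝓛 g (Ioo 0 Ω.length) := by
  rw [Measure.restrict_congr_set Ioo_ae_eq_Ioc]

theorem integral_Ioo (g : ℝ → ℝ) : ∫ s in Ioo 0 Ω.length, g s = ∫ s in 0..Ω.length, g s := by
  rw [integral_of_le Ω.length_pos.le, integral_Ioc_eq_integral_Ioo]

theorem memLp_fst {g : ℝ → ℝ} (hg : 𝓛 g (Ioc 0 Ω.length)) :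
    𝓛 (fun p : Plane => g (p 0)) Ω.refSet := by
  have : IsProbabilityMeasure (𝓁 (Ioo (0 : ℝ) 1)) := ⟨by simp⟩
  exact Ω.memLp_refSet_of_rect ((Ω.memLp_Ioc.1 hg).comp_measurePreserving
    (measurePreserving_fst (ν := 𝓁 (Ioo (0 : ℝ) 1))))

theorem integral_refSet_fst (g : ℝ → ℝ) :
    ∫ p in Ω.refSet, g (p 0) = ∫ s in 0..Ω.length, g s := by
  have : IsProbabilityMeasure (𝓁 (Ioo (0 : ℝ) 1)) := ⟨by simp⟩
  rw [integral_refSet, ← integral_Ioo]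
  simp only [Matrix.cons_val_zero]
  have := integral_fun_fst (μ := 𝓁 (Ioo 0 Ω.length))
    (ν := 𝓁 (Ioo (0 : ℝ) 1)) g
  rw [rectMeasure, this]
  simp

/-- Fubini's theorem on the parameter rectangle. -/
theorem integral_refSet_prod {f : Plane → ℝ} (hf : Integrable f (𝓁 Ω.refSet)) :
    ∫ p in Ω.refSet, f p = ∫ s in 0..Ω.length, ∫ t in 0..1, f !₂[s, t] := by
  have h2 : Integrable (fun x : ℝ × ℝ => f !₂[x.1, x.2]) Ω.rectMeasure :=
    (Ω.measurePreserving_rect.integrable_comp_emb planeEquiv.measurableEmbedding).2 hf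
  rw [integral_refSet, rectMeasure, integral_prod _ h2, ← integral_Ioo]
  refine integral_congr_ae (Eventually.of_forall fun s => ?_)
  simp only
  rw [integral_of_le zero_le_one, integral_Ioc_eq_integral_Ioo]

/-- The periodic extension of a smooth function that vanishes near the ends of the period. -/
theorem exists_periodization {ψ : Plane → ℝ} (hψ : 𝒞 ψ) {α β : ℝ} (hα : 0 < α)
    (hβ : β < Ω.length) (h0 : ∀ p : Plane, p 0 ∉ Icc α β → ψ p = 0) :
    ∃ χ : Plane → ℝ, 𝒞 χ ∧ (∀ s t, χ !₂[s + Ω.length, t] = χ !₂[s, t]) ∧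
      (∀ p : Plane, p 0 ∈ Icc 0 Ω.length → χ p = ψ p) ∧
      ∀ p : Plane, ∃ q : Plane, χ p = ψ q ∧ q 1 = p 1 := by
  have L := Ω.length_pos
  set χ : Plane → ℝ := fun p => ψ !₂[toIcoMod L 0 (p 0), p 1] with hχ
  have shift : ∀ (p : Plane) (k : ℤ) (y : ℝ), y ∈ Ico 0 Ω.length → p 0 = y + k * Ω.length →
      χ p = ψ !₂[p 0 - k * Ω.length, p 1] := by
    intro p k y hy hp
    have : toIcoMod L 0 (p 0) = y :=
      (toIcoMod_eq_iff L).2 ⟨by simpa using hy, k, by simpa using hp⟩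
    simp only [hχ]
    rw [this, hp, add_sub_cancel_right]
  refine ⟨χ, ?_, ?_, ?_, fun p => ⟨_, rfl, by simp⟩⟩
  · rw [contDiff_iff_contDiffAt]
    intro p
    set y := toIcoMod L 0 (p 0) with hy
    have hyI := toIcoMod_mem_Ico' L (p 0)
    obtain ⟨k, hk⟩ : ∃ k : ℤ, p 0 = y + k * Ω.length :=
      ⟨toIcoDiv L 0 (p 0), by rw [hy, toIcoMod, zsmul_eq_mul]; ring⟩
    have c0 : Tendsto (fun q : Plane => q 0) (𝓝 p) (𝓝 (p 0)) :=
      (Plane.continuous_apply 0).tendsto p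
    rw [← hy] at hyI
    -- Near a multiple of the period the extension vanishes, because `ψ` is zero outside `[α, β]`;
    -- elsewhere it is locally a single translate of `ψ`.
    rcases hyI.1.eq_or_lt with h | h
    · rw [← h, zero_add] at hk
      have hN : Ioo (k * Ω.length - (Ω.length - β)) (k * Ω.length + α) ∈ 𝓝 (p 0) := by
        rw [hk]; exact Ioo_mem_nhds (by linarith) (by linarith)
      have : ContDiffAt ℝ ∞ (fun _ : Plane => (0 : ℝ)) p := contDiffAt_const
      refine this.congr_of_eventuallyEq ?_
      by_cases hαL : α ≤ Ω.length
      · by_cases hβ0 : 0 ≤ β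
        · filter_upwards [c0 hN] with q hq
          rcases le_or_gt (k * Ω.length) (q 0) with hle | hlt
          · rw [shift q k (q 0 - k * Ω.length) ⟨by linarith, by linarith [hq.2]⟩ (by ring)]
            exact h0 _ fun hm => by simp at hm; linarith [hm.1, hq.2]
          · rw [shift q (k - 1) (q 0 - (k - 1 : ℤ) * Ω.length)
              ⟨by push_cast; linarith [hq.1], by push_cast; linarith⟩ (by ring)]
            exact h0 _ fun hm => by push_cast at hm; simp at hm; linarith [hm.2, hq.1]
        · exact Eventually.of_forall fun q => h0 _ fun hm => by linarith [hm.1, hm.2]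
      · refine Eventually.of_forall fun q => h0 _ fun hm => ?_
        linarith [hm.1, hm.2]
    · have hN : Ioo (k * Ω.length) (Ω.length + k * Ω.length) ∈ 𝓝 (p 0) := by
        rw [hk]; exact Ioo_mem_nhds (by linarith) (by linarith [hyI.2])
      have hc : 𝒞 fun q : Plane => ψ !₂[q 0 - k * Ω.length, q 1] := by
        refine hψ.comp ?_
        rw [contDiff_euclidean]
        intro i
        fin_cases i
        · exact (Plane.contDiff_apply 0).sub contDiff_const
        · exact Plane.contDiff_apply 1
      refine hc.contDiffAt.congr_of_eventuallyEq ?_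
      filter_upwards [c0 hN] with q hq
      exact shift q k (q 0 - k * Ω.length) ⟨by linarith [hq.1], by linarith [hq.2]⟩ (by ring)
  · intro s t
    simp only [hχ]
    simp
  · intro p hp
    rcases hp.2.eq_or_lt with h | h
    · have h1 : ψ p = 0 := h0 p fun hm => by rw [h] at hm; linarith [hm.2]
      rw [h1]
      have : toIcoMod L 0 (p 0) = 0 :=
        (toIcoMod_eq_iff L).2 ⟨⟨le_rfl, by simpa using L⟩, 1, by simpa using h⟩
      refine h0 _ fun hm => ?_
      simp [this] at hm
      linarith [hm.1]
    · rw [shift p 0 (p 0) ⟨hp.1, h⟩ (by simp)]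
      simp [Plane.eta]

end SmoothDomain

/-! ### Calculus of partial derivatives -/

theorem partialDeriv_of_hasFDerivAt {ψ : Plane → ℝ} {D : Plane →L[ℝ] ℝ} {p : Plane}
    (h : HasFDerivAt ψ D p) (i : Fin 2) : 𝒟 i ψ p = D (EuclideanSpace.single i 1) := by
  rw [partialDeriv, h.fderiv]

theorem ContDiff.hasFDerivAt_top {ψ : Plane → ℝ} (h : 𝒞 ψ) (p : Plane) :
    HasFDerivAt ψ (fderiv ℝ ψ p) p := (h.differentiable (by simp) p).hasFDerivAt

theorem partialDeriv_mul {ψ χ : Plane → ℝ} {p : Plane} (h : DifferentiableAt ℝ ψ p)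
    (h' : DifferentiableAt ℝ χ p) (i : Fin 2) :
    𝒟 i (fun p => ψ p * χ p) p =
      𝒟 i ψ p * χ p + ψ p * 𝒟 i χ p := by
  rw [partialDeriv_of_hasFDerivAt (h.hasFDerivAt.fun_mul h'.hasFDerivAt)]
  simp [partialDeriv]; ring

theorem partialDeriv_add {ψ χ : Plane → ℝ} {p : Plane} (h : DifferentiableAt ℝ ψ p)
    (h' : DifferentiableAt ℝ χ p) (i : Fin 2) :
    𝒟 i (fun p => ψ p + χ p) p = 𝒟 i ψ p + 𝒟 i χ p := by
  rw [partialDeriv_of_hasFDerivAt (h.hasFDerivAt.fun_add h'.hasFDerivAt)]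
  simp [partialDeriv]

theorem partialDeriv_sub {ψ χ : Plane → ℝ} {p : Plane} (h : DifferentiableAt ℝ ψ p)
    (h' : DifferentiableAt ℝ χ p) (i : Fin 2) :
    𝒟 i (fun p => ψ p - χ p) p = 𝒟 i ψ p - 𝒟 i χ p := by
  rw [partialDeriv_of_hasFDerivAt (h.hasFDerivAt.fun_sub h'.hasFDerivAt)]
  simp [partialDeriv]

theorem hasFDerivAt_coord (i : Fin 2) (p : Plane) :
    HasFDerivAt (fun p : Plane => p i) (EuclideanSpace.proj (𝕜 := ℝ) i) p :=
  (EuclideanSpace.proj (𝕜 := ℝ) i).hasFDerivAt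

theorem partialDeriv_coord {c : ℝ → ℝ} {c' : ℝ} {p : Plane} (i j : Fin 2)
    (h : HasDerivAt c c' (p j)) :
    𝒟 i (fun p => c (p j)) p = if i = j then c' else 0 := by
  rw [partialDeriv_of_hasFDerivAt (ψ := fun p : Plane => c (p j))
    (h.comp_hasFDerivAt p (hasFDerivAt_coord j p))]
  simp [eq_comm]

theorem partialDeriv_congr {ψ χ : Plane → ℝ} {p : Plane} (h : ψ =ᶠ[𝓝 p] χ) (i : Fin 2) :
    𝒟 i ψ p = 𝒟 i χ p := by
  rw [partialDeriv, partialDeriv, h.fderiv_eq]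

theorem ContDiff.diffAt {ψ : Plane → ℝ} (h : 𝒞 ψ) (p : Plane) :
    DifferentiableAt ℝ ψ p := h.differentiable (by simp) p

theorem ContDiff.comp_coord {c : ℝ → ℝ} (h : 𝒞 c) (i : Fin 2) :
    𝒞 fun p : Plane => c (p i) := h.comp (Plane.contDiff_apply i)

theorem Plane.contDiff_mk {E : Type*} [NormedAddCommGroup E] [NormedSpace ℝ E] {f g : E → ℝ}
    (hf : 𝒞 f) (hg : 𝒞 g) :
    𝒞 fun x => (!₂[f x, g x] : Plane) := by
  rw [contDiff_euclidean]
  intro i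
  fin_cases i
  exacts [hf, hg]

theorem IsCompact.subset_Icc_of_subset_Ioo {K : Set ℝ} (hK : IsCompact K) {a b : ℝ} (hab : a < b)
    (h : K ⊆ Ioo a b) : ∃ α β, a < α ∧ β < b ∧ K ⊆ Icc α β := by
  rcases K.eq_empty_or_nonempty with rfl | hne
  · exact ⟨b, a, hab, hab, empty_subset _⟩
  · obtain ⟨x, hx, hxl⟩ := hK.exists_isLeast hne
    obtain ⟨y, hy, hyl⟩ := hK.exists_isGreatest hne
    exact ⟨x, y, (h hx).1, (h hy).2, fun z hz => ⟨hxl hz, hyl hz⟩⟩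

theorem sq_intervalIntegral_le {f : ℝ → ℝ} (hf : Continuous f) {a b : ℝ} (hab : a ≤ b) :
    (∫ r in a..b, f r) ^ 2 ≤ (b - a) * ∫ r in a..b, f r ^ 2 := by
  have hc : ∀ g : ℝ → ℝ, Continuous g → 𝓛 g (Ioc a b) := fun g hg =>
    ((memLp_top_of_bound hg.aestronglyMeasurable _
      ((ae_restrict_iff' measurableSet_Ioc).2 (Eventually.of_forall fun x hx =>
        (isCompact_Icc.exists_bound_of_continuousOn hg.continuousOn).choose_spec x
          (Ioc_subset_Icc_self hx)))).mono_exponent le_top)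
  have := integral_mul_sq_le (hc _ hf) (hc _ (continuous_const (y := (1 : ℝ))))
  simp only [mul_one, one_pow] at this
  rw [integral_of_le hab, integral_of_le hab]
  simpa [hab, mul_comm] using this

namespace SmoothDomain

variable (Ω : SmoothDomain)

/-! ### Weak derivatives on the parameter strip, periodic in the first variable -/

/-- Smooth functions of `(s, t)`, periodic in `s`. -/
structure PerSmooth (χ : Plane → ℝ) : Prop where
  smooth : 𝒞 χ
  per : ∀ s t, χ !₂[s + Ω.length, t] = χ !₂[s, t]

variable {Ω}

theorem PerSmooth.mul {χ ψ : Plane → ℝ} (h : Ω.PerSmooth χ) (h' : Ω.PerSmooth ψ) :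
    Ω.PerSmooth fun p => χ p * ψ p :=
  ⟨h.smooth.mul h'.smooth, fun s t => by rw [h.per, h'.per]⟩

theorem PerSmooth.add {χ ψ : Plane → ℝ} (h : Ω.PerSmooth χ) (h' : Ω.PerSmooth ψ) :
    Ω.PerSmooth fun p => χ p + ψ p :=
  ⟨h.smooth.add h'.smooth, fun s t => by rw [h.per, h'.per]⟩

theorem PerSmooth.sub {χ ψ : Plane → ℝ} (h : Ω.PerSmooth χ) (h' : Ω.PerSmooth ψ) :
    Ω.PerSmooth fun p => χ p - ψ p :=
  ⟨h.smooth.sub h'.smooth, fun s t => by rw [h.per, h'.per]⟩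

theorem PerSmooth.const (c : ℝ) : Ω.PerSmooth fun _ => c := ⟨contDiff_const, fun _ _ => rfl⟩

theorem PerSmooth.fst {c : ℝ → ℝ} (hc : 𝒞 c) (hp : Periodic c Ω.length) :
    Ω.PerSmooth fun p => c (p 0) := ⟨hc.comp_coord 0, fun s t => by simpa using hp s⟩

theorem PerSmooth.snd {c : ℝ → ℝ} (hc : 𝒞 c) : Ω.PerSmooth fun p => c (p 1) :=
  ⟨hc.comp_coord 1, fun s t => by simp⟩

theorem PerSmooth.partialDeriv {χ : Plane → ℝ} (h : Ω.PerSmooth χ) (i : Fin 2) :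
    Ω.PerSmooth (𝒟 i χ) := by
  refine ⟨partialDeriv_contDiff h.smooth i, fun s t => ?_⟩
  rw [partialDeriv_eq_deriv h.smooth, partialDeriv_eq_deriv h.smooth]
  simp only [h.per]
  congr 1
  rw [← deriv_comp_add_const]
  simp only [h.per]

theorem PerSmooth.trace {χ : Plane → ℝ} (h : Ω.PerSmooth χ) (t : ℝ) :
    𝒞 (fun s => χ !₂[s, t]) ∧ Periodic (fun s => χ !₂[s, t]) Ω.length :=
  ⟨h.smooth.comp (Plane.contDiff_mk contDiff_id contDiff_const), fun s => h.per s t⟩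

variable (Ω)

/-- `F` has weak derivatives `Fs`, `Ft` on the strip, periodic in `s`, and boundary values `g 0`
at `t = 0` and `g 1` at `t = 1`. -/
structure StripGrad (F Fs Ft : Plane → ℝ) (g : Fin 2 → ℝ → ℝ) : Prop where
  memF : 𝓛 F Ω.refSet
  memS : 𝓛 Fs Ω.refSet
  memT : 𝓛 Ft Ω.refSet
  memg : ∀ j, 𝓛 (g j) (Ioc 0 Ω.length)
  horiz : ∀ χ, Ω.PerSmooth χ → ∫ p in Ω.refSet, (F p * 𝒟 0 χ p + Fs p * χ p) = 0
  vert : ∀ χ, Ω.PerSmooth χ → ∫ p in Ω.refSet, (F p * 𝒟 1 χ p + Ft p * χ p) =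
    (∫ s in 0..Ω.length, g 1 s * χ !₂[s, 1]) - ∫ s in 0..Ω.length, g 0 s * χ !₂[s, 0]

variable {Ω}

theorem integrable_mul_continuous {F c : Plane → ℝ} (hF : 𝓛 F Ω.refSet)
    (hc : Continuous c) : Integrable (fun p => F p * c p) (𝓁 Ω.refSet) :=
  integrable_mul_of_memLp hF (Ω.memLp_continuous hc)

theorem memLp_mul_one {g c : ℝ → ℝ} (hg : 𝓛 g (Ioc 0 Ω.length))
    (hc : Continuous c) : 𝓛 (fun s => c s * g s) (Ioc 0 Ω.length) := by
  obtain ⟨C, hC⟩ := isCompact_Icc.exists_bound_of_continuousOn (s := Icc 0 Ω.length)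
    hc.continuousOn
  refine hg.of_le_mul (c := C) (hc.aestronglyMeasurable.mul hg.1)
    ((ae_restrict_iff' measurableSet_Ioc).2 (Eventually.of_forall fun s hs => ?_))
  rw [norm_mul]
  exact mul_le_mul_of_nonneg_right (hC s (Ioc_subset_Icc_self hs)) (norm_nonneg _)

theorem memLp_continuous_one {c : ℝ → ℝ} (hc : Continuous c) :
    𝓛 c (Ioc 0 Ω.length) := by
  simpa using memLp_mul_one (Ω := Ω) (memLp_const 1) hc

theorem intervalIntegrable_mul {g h : ℝ → ℝ} (hg : 𝓛 g (Ioc 0 Ω.length))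
    (hh : 𝓛 h (Ioc 0 Ω.length)) :
    IntervalIntegrable (fun s => g s * h s) volume 0 Ω.length := by
  rw [intervalIntegrable_iff, uIoc_of_le Ω.length_pos.le]
  exact integrable_mul_of_memLp hg hh

theorem intervalIntegrable_mul_continuous {g c : ℝ → ℝ}
    (hg : 𝓛 g (Ioc 0 Ω.length)) (hc : Continuous c) :
    IntervalIntegrable (fun s => g s * c s) volume 0 Ω.length :=
  intervalIntegrable_mul hg (memLp_continuous_one hc)

theorem PerSmooth.cont {χ : Plane → ℝ} (h : Ω.PerSmooth χ) : Continuous χ := h.smooth.continuous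

namespace StripGrad

variable {F Fs Ft F' Fs' Ft' : Plane → ℝ} {g g' : Fin 2 → ℝ → ℝ}

theorem mul (h : Ω.StripGrad F Fs Ft g) {c : Plane → ℝ} (hc : Ω.PerSmooth c) :
    Ω.StripGrad (fun p => c p * F p) (fun p => 𝒟 0 c p * F p + c p * Fs p)
      (fun p => 𝒟 1 c p * F p + c p * Ft p)
      (fun j s => c !₂[s, ((j : ℕ) : ℝ)] * g j s) := by
  refine ⟨Ω.memLp_mul hc.cont h.memF,
    (Ω.memLp_mul (hc.partialDeriv 0).cont h.memF).add (Ω.memLp_mul hc.cont h.memS),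
    (Ω.memLp_mul (hc.partialDeriv 1).cont h.memF).add (Ω.memLp_mul hc.cont h.memT),
    fun j => memLp_mul_one (h.memg j) (hc.trace _).1.continuous, fun χ hχ => ?_, fun χ hχ => ?_⟩
  · rw [← h.horiz _ (hc.mul hχ)]
    congr 1; ext p
    rw [partialDeriv_mul (hc.smooth.diffAt p) (hχ.smooth.diffAt p)]
    ring
  · have := h.vert _ (hc.mul hχ)
    simp only [Fin.val_zero, Fin.val_one, Nat.cast_zero, Nat.cast_one]
    simp only [mul_left_comm (g _ _), ← mul_assoc] at this
    rw [← this]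
    congr 1; ext p
    rw [partialDeriv_mul (hc.smooth.diffAt p) (hχ.smooth.diffAt p)]
    ring

theorem add (h : Ω.StripGrad F Fs Ft g) (h' : Ω.StripGrad F' Fs' Ft' g') :
    Ω.StripGrad (fun p => F p + F' p) (fun p => Fs p + Fs' p) (fun p => Ft p + Ft' p)
      (fun j s => g j s + g' j s) := by
  refine ⟨h.memF.add h'.memF, h.memS.add h'.memS, h.memT.add h'.memT,
    fun j => (h.memg j).add (h'.memg j), fun χ hχ => ?_, fun χ hχ => ?_⟩
  · have hi := (hχ.partialDeriv 0).cont
    have := integral_add ((integrable_mul_continuous h.memF hi).add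
      (integrable_mul_continuous h.memS hχ.cont)) ((integrable_mul_continuous h'.memF hi).add
      (integrable_mul_continuous h'.memS hχ.cont))
    simp only [Pi.add_apply] at this
    rw [h.horiz χ hχ, h'.horiz χ hχ, add_zero] at this
    rw [← this]
    congr 1; ext p; ring
  · have hi := (hχ.partialDeriv 1).cont
    have := integral_add ((integrable_mul_continuous h.memF hi).add
      (integrable_mul_continuous h.memT hχ.cont)) ((integrable_mul_continuous h'.memF hi).add
      (integrable_mul_continuous h'.memT hχ.cont))
    simp only [Pi.add_apply] at this
    rw [h.vert χ hχ, h'.vert χ hχ] at this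
    have e : ∀ j (t : ℝ), ∫ s in 0..Ω.length, (g j s + g' j s) * χ !₂[s, t] =
        (∫ s in 0..Ω.length, g j s * χ !₂[s, t]) +
          ∫ s in 0..Ω.length, g' j s * χ !₂[s, t] := fun j t => by
      simp only [add_mul]
      exact iint_add
        (intervalIntegrable_mul_continuous (h.memg j) (hχ.trace t).1.continuous)
        (intervalIntegrable_mul_continuous (h'.memg j) (hχ.trace t).1.continuous)
    rw [e, e]
    trans (∫ p in Ω.refSet, (F p * 𝒟 1 χ p + Ft p * χ p +
      (F' p * 𝒟 1 χ p + Ft' p * χ p)))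
    · congr 1; ext p; ring
    · rw [this]; ring

theorem const_mul (h : Ω.StripGrad F Fs Ft g) (c : ℝ) :
    Ω.StripGrad (fun p => c * F p) (fun p => c * Fs p) (fun p => c * Ft p)
      (fun j s => c * g j s) := by
  have := h.mul (PerSmooth.const c)
  simpa [partialDeriv] using this

theorem sub (h : Ω.StripGrad F Fs Ft g) (h' : Ω.StripGrad F' Fs' Ft' g') :
    Ω.StripGrad (fun p => F p - F' p) (fun p => Fs p - Fs' p) (fun p => Ft p - Ft' p)
      (fun j s => g j s - g' j s) := by
  simpa [sub_eq_add_neg] using h.add (h'.const_mul (-1))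

theorem isTest_support {ψ : Plane → ℝ} (hψ : IsTest Ω.refSet ψ) : ∃ α β a b : ℝ, 0 < α ∧
    β < Ω.length ∧ 0 < a ∧ b < 1 ∧ ∀ p : Plane, p 0 ∉ Icc α β ∨ p 1 ∉ Icc a b → ψ p = 0 := by
  obtain ⟨α, β, hα, hβ, h0⟩ := (hψ.compact.isCompact.image
    (Plane.continuous_apply 0)).subset_Icc_of_subset_Ioo Ω.length_pos (by
      rintro _ ⟨p, hp, rfl⟩; exact (hψ.subset hp).1)
  obtain ⟨a, b, ha, hb, h1⟩ := (hψ.compact.isCompact.image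
    (Plane.continuous_apply 1)).subset_Icc_of_subset_Ioo zero_lt_one (by
      rintro _ ⟨p, hp, rfl⟩; exact (hψ.subset hp).2)
  refine ⟨α, β, a, b, hα, hβ, ha, hb, fun p hp => ?_⟩
  refine image_eq_zero_of_notMem_tsupport fun hm => ?_
  rcases hp with hp | hp
  exacts [hp (h0 (mem_image_of_mem _ hm)), hp (h1 (mem_image_of_mem _ hm))]

theorem partialDeriv_eq_of_eqOn {χ X : Plane → ℝ}
    (h : ∀ p : Plane, p 0 ∈ Icc 0 Ω.length → χ p = X p) (i : Fin 2) {p : Plane}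
    (hp : p ∈ Ω.refSet) : 𝒟 i χ p = 𝒟 i X p := by
  refine partialDeriv_congr ?_ i
  filter_upwards [Ω.isOpen_refSet.mem_nhds hp] with q hq
  exact h q (Ioo_subset_Icc_self hq.1)

/-- On the rectangle a test function agrees with its periodic extension. The extension is admissible
for both identities and vanishes at `t = 0` and `t = 1`, so no boundary terms remain. -/
theorem isWeakPartial (h : Ω.StripGrad F Fs Ft g) :
    IsWeakPartial Ω.refSet 0 F Fs ∧ IsWeakPartial Ω.refSet 1 F Ft := by
  have key : ∀ ψ, IsTest Ω.refSet ψ → ∃ χ, Ω.PerSmooth χ ∧ (∀ p ∈ Ω.refSet, χ p = ψ p) ∧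
      (∀ i, ∀ p ∈ Ω.refSet, 𝒟 i χ p = 𝒟 i ψ p) ∧
      ∀ p : Plane, p 1 ∉ Ioo (0 : ℝ) 1 → χ p = 0 := by
    intro ψ hψ
    obtain ⟨α, β, a, b, hα, hβ, ha, hb, h0⟩ := isTest_support hψ
    obtain ⟨χ, h1, h2, h3, h4⟩ := Ω.exists_periodization hψ.smooth hα hβ
      (fun p hp => h0 p (Or.inl hp))
    refine ⟨χ, ⟨h1, h2⟩, fun p hp => h3 p (Ioo_subset_Icc_self hp.1),
      fun i p hp => partialDeriv_eq_of_eqOn h3 i hp, fun p hp => ?_⟩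
    obtain ⟨q, hq, hq1⟩ := h4 p
    rw [hq]
    refine h0 q (Or.inr fun hm => hp ?_)
    rw [← hq1]
    exact ⟨ha.trans_le hm.1, hm.2.trans_lt hb⟩
  constructor
  · intro ψ h1 h2 h3
    have hψ : IsTest Ω.refSet ψ := ⟨h1, h2, h3⟩
    obtain ⟨χ, hχ, e1, e2, -⟩ := key ψ hψ
    rw [eq_neg_iff_add_eq_zero, ← integral_add
      (integrable_mul_continuous h.memF (hψ.partialDeriv 0).smooth.continuous)
      (integrable_mul_continuous h.memS hψ.smooth.continuous), ← h.horiz χ hχ]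
    refine Ω.integral_congr_refSet fun p hp => ?_
    simp only [e1 p hp, e2 0 p hp]
  · intro ψ h1 h2 h3
    have hψ : IsTest Ω.refSet ψ := ⟨h1, h2, h3⟩
    obtain ⟨χ, hχ, e1, e2, e3⟩ := key ψ hψ
    have hv := h.vert χ hχ
    simp only [e3 !₂[_, (1 : ℝ)] (by simp), e3 !₂[_, (0 : ℝ)] (by simp)] at hv
    simp only [mul_zero, iint_zero, sub_zero] at hv
    rw [eq_neg_iff_add_eq_zero, ← integral_add
      (integrable_mul_continuous h.memF (hψ.partialDeriv 1).smooth.continuous)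
      (integrable_mul_continuous h.memT hψ.smooth.continuous), ← hv]
    refine Ω.integral_congr_refSet fun p hp => ?_
    simp only [e1 p hp, e2 1 p hp]

/-- The boundary values differ from the function by at most the vertical derivative. -/
theorem integral_sub_trace_le (h : Ω.StripGrad F Fs Ft g) (j : Fin 2) :
    ∫ p in Ω.refSet, (F p - g j (p 0)) ^ 2 ≤ ∫ p in Ω.refSet, Ft p ^ 2 := by
  have hgm : 𝓛 (fun p : Plane => g j (p 0)) Ω.refSet :=
    Ω.memLp_fst (h.memg j)
  -- By duality it is enough to pair with a test function `ψ`. Its vertical primitive `Y` that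
  -- vanishes on the side opposite to `j` turns the pairing of `F - g j` into `-∫ Ft Y`, and the
  -- norm of `Y` is at most that of `ψ`.
  refine integral_sq_le_of_forall_isTest Ω.isOpen_refSet (integral_nonneg fun p => sq_nonneg _)
    (h.memF.sub hgm) fun ψ hψ => ?_
  obtain ⟨α, β, a, b, hα, hβ, ha, hb, h0⟩ := isTest_support hψ
  have cψ : Continuous ψ := hψ.smooth.continuous
  have cl : ∀ s : ℝ, Continuous fun r : ℝ => ψ !₂[s, r] := fun s => cψ.comp (by fun_prop)
  set X : Plane → ℝ := fun p => ∫ r in 0..p 1, ψ !₂[p 0, r] with hX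
  have Xs : 𝒞 X := by
    have h1 : 𝒞 (Function.uncurry fun s r : ℝ => ψ !₂[s, r]) :=
      hψ.smooth.comp (Plane.contDiff_mk contDiff_fst contDiff_snd)
    have h2 := contDiff_primitive (g := fun s r : ℝ => ψ !₂[s, r]) (R := 1) h1
      (fun s r hr => h0 _ (Or.inr fun hm => by
      have h1 := hm.1; have h2 := hm.2
      simp only [Matrix.cons_val_one, Matrix.cons_val_fin_one] at h1 h2
      rcases hr with hr | hr <;> linarith))
    exact h2.comp ((Plane.contDiff_apply 0).prodMk (Plane.contDiff_apply 1))
  -- the primitive of `ψ` that vanishes at the end opposite to `j`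
  set Y : Plane → ℝ := fun p => X p - if j = 0 then X !₂[p 0, 1] else 0 with hY
  have Ysm : 𝒞 Y := by
    have : 𝒞 fun p : Plane => X !₂[p 0, 1] :=
      Xs.comp (Plane.contDiff_mk (Plane.contDiff_apply 0) contDiff_const)
    by_cases hj : j = 0
    · simp only [hY, hj, if_true]; exact Xs.sub this
    · simp only [hY, hj, if_false, sub_zero]; exact Xs
  have X0 : ∀ p : Plane, p 0 ∉ Icc α β → X p = 0 := by
    intro p hp
    have : ∀ r : ℝ, ψ !₂[p 0, r] = 0 := fun r => h0 _ (Or.inl (by simpa using hp))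
    simp [hX, this]
  have Y0 : ∀ p : Plane, p 0 ∉ Icc α β → Y p = 0 := by
    intro p hp
    simp only [hY]
    rw [X0 p hp, X0 !₂[p 0, 1] (by simpa using hp)]
    simp
  have Yd : ∀ p, 𝒟 1 Y p = ψ p := by
    intro p
    rw [← Plane.eta p, partialDeriv_eq_deriv Ysm]
    simp only [one_ne_zero, if_false, hY, hX]
    simp only [Matrix.cons_val_zero, Matrix.cons_val_one, Matrix.cons_val_fin_one, deriv_sub_const_fun]
    exact (cl _).deriv_integral _ _ _
  obtain ⟨χ, hχ1, hχ2, hχ3, -⟩ := Ω.exists_periodization Ysm hα hβ Y0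
  have hχ : Ω.PerSmooth χ := ⟨hχ1, hχ2⟩
  have hχY : ∀ s ∈ Icc 0 Ω.length, ∀ t : ℝ, χ !₂[s, t] = Y !₂[s, t] := fun s hs t =>
    hχ3 _ (by simpa using hs)
  have hv := h.vert χ hχ
  -- the boundary terms
  have hbd : (∫ s in 0..Ω.length, g 1 s * χ !₂[s, 1]) -
      (∫ s in 0..Ω.length, g 0 s * χ !₂[s, 0]) =
      ∫ s in 0..Ω.length, g j s * X !₂[s, 1] := by
    have e : ∀ i (t : ℝ), ∫ s in 0..Ω.length, g i s * χ !₂[s, t] =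
        ∫ s in 0..Ω.length, g i s * Y !₂[s, t] := fun i t => by
      refine iint_congr fun s hs => ?_
      rw [uIcc_of_le Ω.length_pos.le] at hs
      simp only [hχY s hs]
    have X00 : ∀ s : ℝ, X !₂[s, 0] = 0 := fun s => by simp [hX]
    rw [e, e]
    fin_cases j
    · simp [hY, X00]
    · simp [hY, X00]
  have hgψ : ∫ p in Ω.refSet, g j (p 0) * ψ p = ∫ s in 0..Ω.length, g j s * X !₂[s, 1] := by
    rw [Ω.integral_refSet_prod (integrable_mul_continuous hgm cψ)]
    refine iint_congr fun s _ => ?_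
    simp [hX]
  have hmain : ∫ p in Ω.refSet, (F p - g j (p 0)) * ψ p = -∫ p in Ω.refSet, Ft p * χ p := by
    simp only [sub_mul]
    rw [integral_sub (integrable_mul_continuous h.memF cψ) (integrable_mul_continuous hgm cψ),
      hgψ, ← hbd, ← hv, integral_add (integrable_mul_continuous h.memF
        (hχ.partialDeriv 1).cont) (integrable_mul_continuous h.memT hχ.cont)]
    have : ∫ p in Ω.refSet, F p * 𝒟 1 χ p = ∫ p in Ω.refSet, F p * ψ p := by
      refine Ω.integral_congr_refSet fun p hp => ?_
      simp only [partialDeriv_eq_of_eqOn hχ3 1 hp, Yd]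
    rw [this]; ring
  rw [hmain, neg_sq]
  refine (integral_mul_sq_le h.memT (Ω.memLp_continuous hχ.cont)).trans ?_
  refine mul_le_mul_of_nonneg_left ?_ (integral_nonneg fun p => sq_nonneg _)
  -- the primitive is bounded by the function
  have hYle : ∀ s : ℝ, ∀ t ∈ Icc (0 : ℝ) 1, Y !₂[s, t] ^ 2 ≤ ∫ r in 0..1, ψ !₂[s, r] ^ 2 := by
    intro s t ht
    have hi : ∀ x y : ℝ, IntervalIntegrable (fun r => ψ !₂[s, r] ^ 2) volume x y := fun x y =>
      ((cl s).pow 2).intervalIntegrable x y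
    have nn : ∀ x y : ℝ, x ≤ y → 0 ≤ ∫ r in x..y, ψ !₂[s, r] ^ 2 := fun x y hxy =>
      iint_nonneg hxy fun r _ => sq_nonneg _
    have split := iint_adjacent (hi 0 t) (hi t 1)
    by_cases hj : j = 0
    · have : Y !₂[s, t] = -∫ r in t..1, ψ !₂[s, r] := by
        have := iint_adjacent
          ((cl s).intervalIntegrable (μ := volume) 0 t) ((cl s).intervalIntegrable t 1)
        simp only [hY, hX, hj, if_true]
        simp
        linarith
      rw [this, neg_sq]
      have := sq_intervalIntegral_le (cl s) ht.2
      nlinarith [nn 0 t ht.1, nn t 1 ht.2, ht.1, ht.2]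
    · have : Y !₂[s, t] = ∫ r in 0..t, ψ !₂[s, r] := by simp [hY, hX, hj]
      rw [this]
      have := sq_intervalIntegral_le (cl s) ht.1
      nlinarith [nn 0 t ht.1, nn t 1 ht.2, ht.1, ht.2]
  set m : ℝ → ℝ := fun s => ∫ r in 0..1, ψ !₂[s, r] ^ 2 with hm
  have cm : Continuous m := by
    refine intervalIntegral.continuous_parametric_intervalIntegral_of_continuous'
      (f := fun s r : ℝ => ψ !₂[s, r] ^ 2) ?_ 0 1
    exact (cψ.comp (by fun_prop : Continuous fun x : ℝ × ℝ => (!₂[x.1, x.2] : Plane))).pow 2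
  calc ∫ p in Ω.refSet, χ p ^ 2 ≤ ∫ p in Ω.refSet, m (p 0) := by
        refine setIntegral_mono_on ?_ ?_ Ω.isOpen_refSet.measurableSet fun p hp => ?_
        · exact (Ω.memLp_continuous hχ.cont).integrable_sq
        · exact (Ω.memLp_continuous (cm.comp (Plane.continuous_apply 0))).integrable (by norm_num)
        · rw [hχ3 p (Ioo_subset_Icc_self hp.1)]
          have := hYle (p 0) (p 1) (Ioo_subset_Icc_self hp.2)
          rwa [Plane.eta] at this
    _ = ∫ p in Ω.refSet, ψ p ^ 2 := by
        rw [Ω.integral_refSet_fst,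
          Ω.integral_refSet_prod (hψ.memLp (𝓁 Ω.refSet)).integrable_sq]

/-- The difference has value zero and vertical derivative zero, so the estimate by the vertical
derivative annihilates its boundary values. -/
theorem trace_unique (h : Ω.StripGrad F Fs Ft g) (h' : Ω.StripGrad F Fs' Ft g') (j : Fin 2) :
    g j =ᵐ[𝓁 (Ioc 0 Ω.length)] g' j := by
  have hd := h.sub h'
  have h1 := hd.integral_sub_trace_le j
  simp only [sub_self, zero_sub, neg_sq] at h1
  rw [Ω.integral_refSet_fst (fun s => (g j s - g' j s) ^ 2)] at h1
  rw [integral_of_le Ω.length_pos.le] at h1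
  simp only [ne_eq, OfNat.ofNat_ne_zero, not_false_eq_true, zero_pow, integral_zero] at h1
  filter_upwards [ae_eq_zero_of_integral_sq_nonpos (hd.memg j) h1] with s hs
  simpa [sub_eq_zero] using hs

end StripGrad

end SmoothDomain

/-! ### Cutoff functions -/

/-- The derivative of a cutoff is of size `n` only in layers of width `1/n` at the two ends, hence
`|η'| min(t, 1 - t)` is bounded uniformly in `n`. This is what dominated convergence needs when `η'`
is multiplied by a function that vanishes at both ends. -/
theorem exists_cutoff : ∃ (η : ℕ → ℝ → ℝ) (C : ℝ), 0 < C ∧ ∀ n, 𝒞 (η n) ∧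
    (∀ t, t ∉ Icc (1 / ((n : ℝ) + 3)) (1 - 1 / ((n : ℝ) + 3)) → η n t = 0) ∧
    (∀ t, |η n t| ≤ 1) ∧ (∀ t ∈ Ioo (0 : ℝ) 1, |deriv (η n) t| * min t (1 - t) ≤ C) ∧
    ∀ t ∈ Ioo (0 : ℝ) 1, 1 < ((n : ℝ) + 3) * t - 1 → 1 < ((n : ℝ) + 3) * (1 - t) - 1 →
      η n t = 1 ∧ deriv (η n) t = 0 := by
  set θ := Real.smoothTransition
  have θs : 𝒞 θ := Real.smoothTransition.contDiff
  have θd : ∀ x, HasDerivAt θ (deriv θ x) x := fun x =>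
    (θs.differentiable (by simp) x).hasDerivAt
  have d1 : ∀ x, 1 < x → deriv θ x = 0 := fun x hx => by
    have : θ =ᶠ[𝓝 x] fun _ => 1 := by
      filter_upwards [Ioi_mem_nhds hx] with y hy
      exact Real.smoothTransition.one_of_one_le (le_of_lt hy)
    rw [this.deriv_eq]; simp
  have d0 : ∀ x, x < 0 → deriv θ x = 0 := fun x hx => by
    have : θ =ᶠ[𝓝 x] fun _ => 0 := by
      filter_upwards [Iio_mem_nhds hx] with y hy
      exact Real.smoothTransition.zero_of_nonpos (le_of_lt hy)
    rw [this.deriv_eq]; simp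
  obtain ⟨K, hK⟩ := (isCompact_Icc (a := (0 : ℝ)) (b := 1)).exists_bound_of_continuousOn
    (θs.continuous_deriv (by simp)).continuousOn
  have hK' : ∀ x, |deriv θ x| ≤ max K 0 := fun x => by
    by_cases h : x ∈ Icc (0 : ℝ) 1
    · exact (hK x h).trans (le_max_left _ _)
    · rw [mem_Icc, not_and_or, not_le, not_le] at h
      rcases h with h | h
      · rw [d0 x h]; simp
      · rw [d1 x h]; simp
  set K' := max K 0 with hKd
  have K0 : 0 ≤ K' := le_max_right _ _
  have θ1 : ∀ x, |θ x| ≤ 1 := fun x => by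
    rw [abs_of_nonneg (Real.smoothTransition.nonneg x)]
    exact Real.smoothTransition.le_one x
  -- Each of the two factors contributes `2K'`; the extra 1 only makes the constant positive.
  refine ⟨fun n t => θ (((n : ℝ) + 3) * t - 1) * θ (((n : ℝ) + 3) * (1 - t) - 1), 4 * K' + 1,
    by positivity, fun n => ?_⟩
  have hn : (0 : ℝ) < (n : ℝ) + 3 := by positivity
  set m := (n : ℝ) + 3 with hm
  have hd : ∀ t, HasDerivAt (fun t => θ (m * t - 1) * θ (m * (1 - t) - 1))
      (deriv θ (m * t - 1) * m * θ (m * (1 - t) - 1) +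
        θ (m * t - 1) * (deriv θ (m * (1 - t) - 1) * (m * -1))) t := by
    intro t
    have h1 : HasDerivAt (fun t => m * t - 1) m t := by
      simpa using ((hasDerivAt_id t).const_mul m).sub_const 1
    have h2 : HasDerivAt (fun t => m * (1 - t) - 1) (m * -1) t :=
      (((hasDerivAt_id t).const_sub 1).const_mul m).sub_const 1
    exact ((θd _).comp t h1).mul ((θd _).comp t h2)
  have small : ∀ t, 0 < t → |deriv θ (m * t - 1)| * m * t ≤ 2 * K' := by
    intro t ht
    by_cases h : 1 < m * t - 1
    · rw [d1 _ h]; simp [K0]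
    · have : m * t ≤ 2 := by linarith
      calc |deriv θ (m * t - 1)| * m * t = |deriv θ (m * t - 1)| * (m * t) := by ring
        _ ≤ K' * 2 := mul_le_mul (hK' _) this (by positivity) K0
        _ = _ := by ring
  refine ⟨?_, fun t ht => ?_, fun t => ?_, fun t ht => ?_, fun t ht h1 h2 => ⟨?_, ?_⟩⟩
  · exact (θs.comp ((contDiff_const.mul contDiff_id).sub contDiff_const)).mul
      (θs.comp ((contDiff_const.mul (contDiff_const.sub contDiff_id)).sub contDiff_const))
  · rw [mem_Icc, not_and_or, not_le, not_le] at ht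
    rcases ht with h | h
    · rw [lt_div_iff₀ hn] at h
      have : θ (m * t - 1) = 0 := Real.smoothTransition.zero_of_nonpos (by linarith)
      show θ (m * t - 1) * θ (m * (1 - t) - 1) = 0
      rw [this, zero_mul]
    · have h' : 1 - t < 1 / m := by linarith
      rw [lt_div_iff₀ hn] at h'
      have : θ (m * (1 - t) - 1) = 0 := Real.smoothTransition.zero_of_nonpos (by linarith)
      show θ (m * t - 1) * θ (m * (1 - t) - 1) = 0
      rw [this, mul_zero]
  · rw [abs_mul]
    exact mul_le_one₀ (θ1 _) (abs_nonneg _) (θ1 _)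
  · rw [(hd t).deriv]
    have ht1 : 0 < 1 - t := by linarith [ht.2]
    have hmin : 0 ≤ min t (1 - t) := le_min ht.1.le ht1.le
    have e1 := small t ht.1
    have e2 := small (1 - t) ht1
    calc _ ≤ (|deriv θ (m * t - 1)| * m + |deriv θ (m * (1 - t) - 1)| * m) * min t (1 - t) := by
          refine mul_le_mul_of_nonneg_right ((abs_add_le _ _).trans (add_le_add ?_ ?_)) hmin
          · rw [abs_mul, abs_mul, abs_of_pos hn]
            exact mul_le_of_le_one_right (by positivity) (θ1 _)
          · rw [abs_mul, abs_mul, abs_mul, abs_neg, abs_one, abs_of_pos hn, mul_one]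
            exact mul_le_of_le_one_left (by positivity) (θ1 _)
      _ ≤ |deriv θ (m * t - 1)| * m * t + |deriv θ (m * (1 - t) - 1)| * m * (1 - t) := by
          rw [add_mul]
          exact add_le_add (mul_le_mul_of_nonneg_left (min_le_left _ _) (by positivity))
            (mul_le_mul_of_nonneg_left (min_le_right _ _) (by positivity))
      _ ≤ 4 * K' + 1 := by linarith
  · have e1 : θ (m * t - 1) = 1 := Real.smoothTransition.one_of_one_le h1.le
    have e2 : θ (m * (1 - t) - 1) = 1 := Real.smoothTransition.one_of_one_le h2.le
    show θ (m * t - 1) * θ (m * (1 - t) - 1) = 1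
    rw [e1, e2, mul_one]
  · rw [(hd t).deriv, d1 _ h1, d1 _ h2]; simp

namespace SmoothDomain

variable (Ω : SmoothDomain)

theorem integral_refSet_prod_symm {f : Plane → ℝ}
    (hf : Integrable f (𝓁 Ω.refSet)) :
    ∫ p in Ω.refSet, f p = ∫ t in 0..1, ∫ s in 0..Ω.length, f !₂[s, t] := by
  have h2 : Integrable (fun x : ℝ × ℝ => f !₂[x.1, x.2]) Ω.rectMeasure :=
    (Ω.measurePreserving_rect.integrable_comp_emb planeEquiv.measurableEmbedding).2 hf
  rw [integral_refSet, rectMeasure, integral_prod_symm _ h2,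
    integral_of_le zero_le_one, integral_Ioc_eq_integral_Ioo]
  refine integral_congr_ae (Eventually.of_forall fun s => ?_)
  simp only
  rw [← integral_Ioo]

/-! ### Existence of boundary values -/

variable {Ω}

theorem memLp_average {K : Plane → ℝ} (hK : 𝓛 K Ω.refSet) :
    𝓛 (fun s => ∫ t in 0..1, K !₂[s, t]) (Ioc 0 Ω.length) := by
  rw [memLp_Ioc]
  have : IsProbabilityMeasure (𝓁 (Ioo (0 : ℝ) 1)) := ⟨by simp⟩
  have h := Ω.memLp_refSet hK
  have e : (fun s => ∫ t in 0..1, K !₂[s, t]) =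
      fun s => ∫ t in Ioo (0 : ℝ) 1, K !₂[s, t] := by
    ext s; rw [integral_of_le zero_le_one, integral_Ioc_eq_integral_Ioo]
  rw [e]
  have hm : AEStronglyMeasurable (fun s => ∫ t in Ioo (0 : ℝ) 1, K !₂[s, t])
      (𝓁 (Ioo 0 Ω.length)) :=
    h.1.integral_prod_right'
  rw [memLp_two_iff_integrable_sq hm]
  have hi : Integrable (fun x : ℝ × ℝ => K !₂[x.1, x.2] ^ 2) Ω.rectMeasure := h.integrable_sq
  refine hi.integral_prod_left.mono' (hm.pow 2) ?_
  have hsec := hi.prod_right_ae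
  have hmeas := h.1.prodMk_left
  filter_upwards [hsec, hmeas] with s h1 h2
  have hms : 𝓛 (fun t => K !₂[s, t]) (Ioo (0 : ℝ) 1) :=
    (memLp_two_iff_integrable_sq h2).2 h1
  have := integral_mul_sq_le hms (memLp_const (1 : ℝ))
  rw [Real.norm_of_nonneg (sq_nonneg _)]
  simpa using this

theorem integral_mul_average {K : Plane → ℝ} (hK : 𝓛 K Ω.refSet)
    {a : ℝ → ℝ} (ha : 𝓛 a (Ioc 0 Ω.length)) :
    ∫ p in Ω.refSet, K p * a (p 0) =
      ∫ s in 0..Ω.length, (∫ t in 0..1, K !₂[s, t]) * a s := by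
  rw [Ω.integral_refSet_prod (integrable_mul_of_memLp hK (Ω.memLp_fst ha))]
  simp

/-- The hypotheses test only away from the two sides of the strip. Cutoffs extend the horizontal
identity to all tests and the vertical one to tests that vanish on both sides. A general `χ` differs
from such a test by `χ(s,0)(1 - t) + χ(s,1)t`, and inserting these two terms dictates the boundary
values `∫(F - (1 - t)Ft) dt` and `∫(F + t Ft) dt`. -/
theorem exists_stripGrad {F Fs Ft : Plane → ℝ} (hF : 𝓛 F Ω.refSet)
    (hFs : 𝓛 Fs Ω.refSet) (hFt : 𝓛 Ft Ω.refSet)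
    (hs : ∀ χ, Ω.PerSmooth χ → (∃ a b : ℝ, 0 < a ∧ b < 1 ∧ ∀ p : Plane, p 1 ∉ Icc a b → χ p = 0) →
      ∫ p in Ω.refSet, (F p * 𝒟 0 χ p + Fs p * χ p) = 0)
    (ht : ∀ χ, Ω.PerSmooth χ → (∃ a b : ℝ, 0 < a ∧ b < 1 ∧ ∀ p : Plane, p 1 ∉ Icc a b → χ p = 0) →
      ∫ p in Ω.refSet, (F p * 𝒟 1 χ p + Ft p * χ p) = 0) :
    ∃ g, Ω.StripGrad F Fs Ft g := by
  obtain ⟨η, C, hC, hη⟩ := exists_cutoff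
  have ηper : ∀ n, Ω.PerSmooth fun p => η n (p 1) := fun n => PerSmooth.snd (hη n).1
  have ηsupp : ∀ n (χ : Plane → ℝ), ∃ a b : ℝ, 0 < a ∧ b < 1 ∧
      ∀ p : Plane, p 1 ∉ Icc a b → η n (p 1) * χ p = 0 := fun n χ =>
    ⟨1 / ((n : ℝ) + 3), 1 - 1 / ((n : ℝ) + 3), by positivity, by
      have : (0 : ℝ) < 1 / ((n : ℝ) + 3) := by positivity
      linarith, fun p hp => by rw [(hη n).2.1 _ hp, zero_mul]⟩
  have ηev : ∀ t ∈ Ioo (0 : ℝ) 1, ∀ᶠ n in atTop, η n t = 1 ∧ deriv (η n) t = 0 := by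
    intro t ht
    have key : ∀ x : ℝ, 0 < x → ∀ᶠ n : ℕ in atTop, 1 < ((n : ℝ) + 3) * x - 1 := by
      intro x hx
      have : Tendsto (fun n : ℕ => ((n : ℝ) + 3) * x - 1) atTop atTop :=
        tendsto_atTop_add_const_right _ _
          ((tendsto_atTop_add_const_right _ _ tendsto_natCast_atTop_atTop).atTop_mul_const hx)
      exact this.eventually_gt_atTop 1
    filter_upwards [key t ht.1, key (1 - t) (by linarith [ht.2])] with n h1 h2
    exact (hη n).2.2.2.2 t ht h1 h2
  have dη : ∀ n i (p : Plane), 𝒟 i (fun p : Plane => η n (p 1)) p =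
      if i = 1 then deriv (η n) (p 1) else 0 := fun n i p =>
    partialDeriv_coord i 1 (((hη n).1.differentiable (by simp) _).hasDerivAt)
  have horiz : ∀ χ, Ω.PerSmooth χ →
      ∫ p in Ω.refSet, (F p * 𝒟 0 χ p + Fs p * χ p) = 0 := by
    intro χ hχ
    have hlim : Tendsto (fun n => ∫ p in Ω.refSet, η n (p 1) *
        (F p * 𝒟 0 χ p + Fs p * χ p)) atTop
        (𝓝 (∫ p in Ω.refSet, (F p * 𝒟 0 χ p + Fs p * χ p))) := by
      have hint := (integrable_mul_continuous hF (hχ.partialDeriv 0).cont).add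
        (integrable_mul_continuous hFs hχ.cont)
      refine tendsto_integral_of_dominated_convergence _ (fun n =>
        (((ηper n).cont.aestronglyMeasurable).mul hint.1)) hint.norm (fun n =>
        Eventually.of_forall fun p => ?_) (Ω.ae_refSet fun p hp => ?_)
      · rw [norm_mul]
        exact mul_le_of_le_one_left (norm_nonneg _) ((hη n).2.2.1 _)
      · refine tendsto_const_nhds.congr' ?_
        filter_upwards [ηev _ hp.2] with n hn
        rw [hn.1, one_mul]
    refine tendsto_nhds_unique hlim (tendsto_const_nhds.congr fun n => ?_)
    rw [← hs _ ((ηper n).mul hχ) (ηsupp n χ)]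
    congr 1; ext p
    rw [partialDeriv_mul ((ηper n).smooth.diffAt p) (hχ.smooth.diffAt p), dη]
    simp; ring
  have vert0 : ∀ χ, Ω.PerSmooth χ → (∀ s, χ !₂[s, 0] = 0) → (∀ s, χ !₂[s, 1] = 0) →
      ∫ p in Ω.refSet, (F p * 𝒟 1 χ p + Ft p * χ p) = 0 := by
    intro χ hχ h0 h1
    obtain ⟨M, hM, hMb⟩ := Ω.exists_bound (hχ.partialDeriv 1).cont
    have cdχ : ∀ s : ℝ, Continuous fun r : ℝ => 𝒟 1 χ !₂[s, r] := fun s =>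
      (hχ.partialDeriv 1).cont.comp (by fun_prop)
    have hder : ∀ s r : ℝ, HasDerivAt (fun r => χ !₂[s, r]) (𝒟 1 χ !₂[s, r]) r := by
      intro s r
      rw [partialDeriv_eq_deriv hχ.smooth]
      have : 𝒞 fun r => χ !₂[s, r] :=
        hχ.smooth.comp (Plane.contDiff_mk contDiff_const contDiff_id)
      simpa using (this.differentiable (by simp) r).hasDerivAt
    have hmin : ∀ p ∈ Ω.refSet, |χ p| ≤ M * min (p 1) (1 - p 1) := by
      intro p hp
      have hb : ∀ r ∈ Icc (0 : ℝ) 1, ‖𝒟 1 χ !₂[p 0, r]‖ ≤ M := fun r hr =>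
        hMb _ ⟨Ioo_subset_Icc_self hp.1, by simpa using hr⟩
      rw [mul_min_of_nonneg _ _ hM.le]
      refine le_min ?_ ?_
      · have := Convex.norm_image_sub_le_of_norm_hasDerivWithin_le
          (fun r hr => (hder (p 0) r).hasDerivWithinAt) hb (convex_Icc 0 1)
          (left_mem_Icc.2 zero_le_one) (Ioo_subset_Icc_self hp.2)
        rw [h0, sub_zero, sub_zero, Plane.eta, Real.norm_eq_abs, Real.norm_eq_abs,
          abs_of_pos hp.2.1] at this
        exact this
      · have := Convex.norm_image_sub_le_of_norm_hasDerivWithin_le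
          (fun r hr => (hder (p 0) r).hasDerivWithinAt) hb (convex_Icc 0 1)
          (Ioo_subset_Icc_self hp.2) (right_mem_Icc.2 zero_le_one)
        rw [h1, zero_sub, norm_neg, Plane.eta, Real.norm_eq_abs, Real.norm_eq_abs,
          abs_of_pos (sub_pos.2 hp.2.2)] at this
        exact this
    have i1 := integrable_mul_continuous hF (hχ.partialDeriv 1).cont
    have i2 := integrable_mul_continuous hFt hχ.cont
    have iF : Integrable F (𝓁 Ω.refSet) := hF.integrable (by norm_num)
    have hint := i1.add i2
    have hlim : Tendsto (fun n => ∫ p in Ω.refSet, (deriv (η n) (p 1) * χ p * F p + η n (p 1) *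
        (F p * 𝒟 1 χ p + Ft p * χ p))) atTop
        (𝓝 (∫ p in Ω.refSet, (F p * 𝒟 1 χ p + Ft p * χ p))) := by
      refine tendsto_integral_of_dominated_convergence
        (fun p => C * M * ‖F p‖ + ‖F p * 𝒟 1 χ p + Ft p * χ p‖) (fun n => ?_)
        ((iF.norm.const_mul _).add hint.norm)
        (fun n => Ω.ae_refSet fun p hp => ?_) (Ω.ae_refSet fun p hp => ?_)
      · have cd : Continuous fun p : Plane => deriv (η n) (p 1) :=
          ((hη n).1.continuous_deriv (by simp)).comp (Plane.continuous_apply 1)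
        exact ((cd.mul hχ.cont).aestronglyMeasurable.mul hF.1).add
          ((ηper n).cont.aestronglyMeasurable.mul hint.1)
      · refine (norm_add_le _ _).trans (add_le_add ?_ ?_)
        · rw [norm_mul]
          refine mul_le_mul_of_nonneg_right ?_ (norm_nonneg _)
          rw [norm_mul, Real.norm_eq_abs, Real.norm_eq_abs]
          calc |deriv (η n) (p 1)| * |χ p| ≤ |deriv (η n) (p 1)| * (M * min (p 1) (1 - p 1)) :=
                mul_le_mul_of_nonneg_left (hmin p hp) (abs_nonneg _)
            _ = (|deriv (η n) (p 1)| * min (p 1) (1 - p 1)) * M := by ring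
            _ ≤ C * M := mul_le_mul_of_nonneg_right ((hη n).2.2.2.1 _ hp.2) hM.le
        · rw [norm_mul]
          exact mul_le_of_le_one_left (norm_nonneg _) ((hη n).2.2.1 _)
      · refine tendsto_const_nhds.congr' ?_
        filter_upwards [ηev _ hp.2] with n hn
        rw [hn.1, hn.2]; ring
    refine tendsto_nhds_unique hlim (tendsto_const_nhds.congr fun n => ?_)
    rw [← ht _ ((ηper n).mul hχ) (ηsupp n χ)]
    congr 1; ext p
    rw [partialDeriv_mul ((ηper n).smooth.diffAt p) (hχ.smooth.diffAt p), dη]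
    simp only [if_true]; ring
  -- the boundary values
  have c1 : Continuous fun p : Plane => 1 - p 1 := continuous_const.sub (Plane.continuous_apply 1)
  have c2 : Continuous fun p : Plane => p 1 := Plane.continuous_apply 1
  have hK0 : 𝓛 (fun p => F p - (1 - p 1) * Ft p) Ω.refSet :=
    hF.sub (Ω.memLp_mul c1 hFt)
  have hK1 : 𝓛 (fun p => F p + p 1 * Ft p) Ω.refSet :=
    hF.add (Ω.memLp_mul c2 hFt)
  have e0 : ∀ a : ℝ → ℝ, 𝒞 a → ∫ p in Ω.refSet, (F p * 𝒟 1
      (fun p : Plane => a (p 0) * (1 - p 1)) p + Ft p * (a (p 0) * (1 - p 1))) =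
      -∫ s in 0..Ω.length, (∫ t in 0..1, (F !₂[s, t] -
        (1 - (!₂[s, t] : Plane) 1) * Ft !₂[s, t])) * a s := by
    intro a ha
    rw [← integral_mul_average hK0 (memLp_continuous_one ha.continuous), ← integral_neg]
    congr 1; ext p
    have h1 : 𝒞 fun t : ℝ => 1 - t := contDiff_const.sub contDiff_id
    rw [partialDeriv_mul (χ := fun p : Plane => 1 - p 1) ((ha.comp_coord 0).diffAt p)
      ((h1.comp_coord 1).diffAt p),
      partialDeriv_coord 1 0 ((ha.differentiable (by simp) _).hasDerivAt),
      partialDeriv_coord (c := fun t : ℝ => 1 - t) 1 1 ((hasDerivAt_id _).const_sub 1)]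
    simp; ring
  have e1 : ∀ a : ℝ → ℝ, 𝒞 a → ∫ p in Ω.refSet, (F p * 𝒟 1
      (fun p : Plane => a (p 0) * p 1) p + Ft p * (a (p 0) * p 1)) =
      ∫ s in 0..Ω.length, (∫ t in 0..1, (F !₂[s, t] +
        (!₂[s, t] : Plane) 1 * Ft !₂[s, t])) * a s := by
    intro a ha
    rw [← integral_mul_average hK1 (memLp_continuous_one ha.continuous)]
    congr 1; ext p
    rw [partialDeriv_mul (χ := fun p : Plane => p 1) ((ha.comp_coord 0).diffAt p)
      ((Plane.contDiff_apply 1).diffAt p),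
      partialDeriv_coord 1 0 ((ha.differentiable (by simp) _).hasDerivAt),
      partialDeriv_coord (c := fun t : ℝ => t) 1 1 (hasDerivAt_id _)]
    simp; ring
  refine ⟨![fun s => ∫ t in 0..1, (F !₂[s, t] - (1 - (!₂[s, t] : Plane) 1) * Ft !₂[s, t]),
    fun s => ∫ t in 0..1, (F !₂[s, t] + (!₂[s, t] : Plane) 1 * Ft !₂[s, t])],
    hF, hFs, hFt, fun j => ?_, horiz, fun χ hχ => ?_⟩
  · fin_cases j
    exacts [memLp_average hK0, memLp_average hK1]
  · have a0 := hχ.trace 0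
    have a1 := hχ.trace 1
    have t0 : Ω.PerSmooth fun p => (fun s => χ !₂[s, 0]) (p 0) * (1 - p 1) :=
      (PerSmooth.fst a0.1 a0.2).mul
        (PerSmooth.snd (c := fun t => 1 - t) (contDiff_const.sub contDiff_id))
    have t1 : Ω.PerSmooth fun p => (fun s => χ !₂[s, 1]) (p 0) * p 1 :=
      (PerSmooth.fst a1.1 a1.2).mul (PerSmooth.snd (c := fun t => t) contDiff_id)
    have hz := vert0 _ ((hχ.sub t0).sub t1) (fun s => by simp) (fun s => by simp)
    have E0 := e0 _ a0.1
    have E1 := e1 _ a1.1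
    have I0 := (integrable_mul_continuous hF (t0.partialDeriv 1).cont).add
      (integrable_mul_continuous hFt t0.cont)
    have I1 := (integrable_mul_continuous hF (t1.partialDeriv 1).cont).add
      (integrable_mul_continuous hFt t1.cont)
    have Iz := (integrable_mul_continuous hF (((hχ.sub t0).sub t1).partialDeriv 1).cont).add
      (integrable_mul_continuous hFt ((hχ.sub t0).sub t1).cont)
    have hsum := integral_add Iz (I0.add I1)
    have hsum2 := integral_add I0 I1
    simp only [Pi.add_apply] at hsum hsum2
    rw [hz, hsum2, E0, E1, zero_add] at hsum
    simp only [Matrix.cons_val_zero, Matrix.cons_val_one, Matrix.cons_val_fin_one] at hsum ⊢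
    rw [sub_eq_neg_add, ← hsum]
    congr 1; ext p
    rw [partialDeriv_sub ((hχ.sub t0).smooth.diffAt p) (t1.smooth.diffAt p),
      partialDeriv_sub (hχ.smooth.diffAt p) (t0.smooth.diffAt p)]
    ring

end SmoothDomain

/-! ### Periodic functions of one variable -/

section PeriodicPrimitive

variable {L : ℝ}

theorem integral_mul_deriv_of_periodic {f g f' g' : ℝ → ℝ} (hf : ∀ s, HasDerivAt f (f' s) s)
    (hg : ∀ s, HasDerivAt g (g' s) s) (hf' : Continuous f') (hg' : Continuous g')
    (pf : Periodic f L) (pg : Periodic g L) :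
    ∫ s in 0..L, f s * g' s = -∫ s in 0..L, f' s * g s := by
  rw [intervalIntegral.integral_mul_deriv_eq_deriv_mul (fun s _ => hf s) (fun s _ => hg s)
    (hf'.intervalIntegrable _ _) (hg'.intervalIntegrable _ _)]
  have h1 := pf 0
  have h2 := pg 0
  rw [zero_add] at h1 h2
  rw [h1, h2]; ring

theorem integral_deriv_of_periodic {g g' : ℝ → ℝ} (hg : ∀ s, HasDerivAt g (g' s) s)
    (hg' : Continuous g') (pg : Periodic g L) : ∫ s in 0..L, g' s = 0 := by
  rw [iint_ftc (fun s _ => hg s)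
    (hg'.intervalIntegrable _ _)]
  have := pg 0
  rw [zero_add] at this
  rw [this, sub_self]

/-- Removing the mean of `f` makes the primitive periodic; a further constant removes the mean of
the primitive. -/
theorem exists_periodic_primitive (hL : 0 < L) {f : ℝ → ℝ} (hf : Continuous f)
    (pf : Periodic f L) :
    ∃ F : ℝ → ℝ, (∀ s, HasDerivAt F (f s - (∫ r in 0..L, f r) / L) s) ∧
      Periodic F L ∧ ∫ s in 0..L, F s = 0 := by
  set m := (∫ r in 0..L, f r) / L with hm
  set f₀ : ℝ → ℝ := fun s => f s - m with hf₀
  have cf : Continuous f₀ := hf.sub continuous_const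
  have pf₀ : Periodic f₀ L := fun s => by simp only [hf₀]; rw [pf s]
  have i0 : ∫ s in 0..L, f₀ s = 0 := by
    simp only [hf₀]
    rw [iint_sub (hf.intervalIntegrable _ _) (by simp)]
    simp only [iint_const, sub_zero, smul_eq_mul, hm]
    field_simp; ring
  set F₀ : ℝ → ℝ := fun s => ∫ r in 0..s, f₀ r with hF₀
  have d0 : ∀ s, HasDerivAt F₀ (f₀ s) s := fun s =>
    intervalIntegral.integral_hasDerivAt_right (cf.intervalIntegrable _ _)
      cf.aestronglyMeasurable.stronglyMeasurableAtFilter cf.continuousAt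
  have cF : Continuous F₀ := continuous_iff_continuousAt.2 fun s => (d0 s).continuousAt
  refine ⟨fun s => F₀ s - (∫ r in 0..L, F₀ r) / L, fun s => (d0 s).sub_const _, fun s => ?_, ?_⟩
  · have : F₀ (s + L) = F₀ s := by
      simp only [hF₀]
      rw [← iint_adjacent (b := s)
        (cf.intervalIntegrable _ _) (cf.intervalIntegrable _ _),
        pf₀.intervalIntegral_add_eq s 0, zero_add, i0, add_zero]
    simp only [this]
  · rw [iint_sub (cF.intervalIntegrable _ _) (by simp)]
    simp only [iint_const, sub_zero, smul_eq_mul]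
    field_simp; ring

theorem contDiff_of_hasDerivAt {F f : ℝ → ℝ} {m : ℕ} (h : ∀ s, HasDerivAt F (f s) s)
    (hf : ContDiff ℝ m f) : ContDiff ℝ ((m + 1 : ℕ) : WithTop ℕ∞) F := by
  have : deriv F = f := funext fun s => (h s).deriv
  push_cast
  rw [contDiff_succ_iff_deriv, this]
  exact ⟨fun s => (h s).differentiableAt, by simp, hf⟩

theorem contDiff_infty_of_hasDerivAt {F f : ℝ → ℝ} (h : ∀ s, HasDerivAt F (f s) s)
    (hf : 𝒞 f) : 𝒞 F := by
  rw [contDiff_infty_iff_deriv, funext fun s => (h s).deriv]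
  exact ⟨fun s => (h s).differentiableAt, hf⟩

end PeriodicPrimitive

namespace SmoothDomain

variable {Ω : SmoothDomain}

theorem exists_periodization_real {ψ : ℝ → ℝ} (hψ : 𝒞 ψ) (hc : HasCompactSupport ψ)
    (hs : tsupport ψ ⊆ Ioo 0 Ω.length) :
    ∃ χ : ℝ → ℝ, 𝒞 χ ∧ Periodic χ Ω.length ∧
      ∀ s ∈ Icc 0 Ω.length, χ s = ψ s := by
  obtain ⟨α, β, hα, hβ, h0⟩ : ∃ α β : ℝ, 0 < α ∧ β < Ω.length ∧ tsupport ψ ⊆ Icc α β := by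
    rcases (tsupport ψ).eq_empty_or_nonempty with he | hne
    · exact ⟨1, Ω.length - 1, one_pos, by linarith, by simp [he]⟩
    · obtain ⟨a, ha, ha'⟩ := hc.isCompact.exists_isLeast hne
      obtain ⟨b, hb, hb'⟩ := hc.isCompact.exists_isGreatest hne
      exact ⟨a, b, (hs ha).1, (hs hb).2, fun s hs => ⟨ha' hs, hb' hs⟩⟩
  obtain ⟨χ, h1, h2, h3, -⟩ := Ω.exists_periodization (ψ := fun p : Plane => ψ (p 0))
    (hψ.comp_coord 0) hα hβ (fun p hp => by
      by_contra hne
      exact hp (h0 (subset_tsupport _ hne)))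
  refine ⟨fun s => χ !₂[s, 0], h1.comp (Plane.contDiff_mk contDiff_id contDiff_const),
    fun s => h2 s 0, fun s hs => ?_⟩
  simpa using h3 !₂[s, 0] (by simpa using hs)

theorem ae_eq_zero_of_periodic {f : ℝ → ℝ} (hf : 𝓛 f (Ioc 0 Ω.length))
    (h : ∀ χ : ℝ → ℝ, 𝒞 χ → Periodic χ Ω.length →
      ∫ s in 0..Ω.length, f s * χ s = 0) :
    f =ᵐ[𝓁 (Ioc 0 Ω.length)] 0 := by
  have L := Ω.length_pos
  rw [← Measure.restrict_congr_set Ioo_ae_eq_Ioc]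
  have i : IntegrableOn f (Ioo 0 Ω.length) := (Ω.memLp_Ioc.1 hf).integrable (by norm_num)
  have := IsOpen.ae_eq_zero_of_integral_contDiff_smul_eq_zero isOpen_Ioo i.locallyIntegrableOn
    (fun ψ hψ hc hs => by
      obtain ⟨χ, h1, h2, h3⟩ := exists_periodization_real (Ω := Ω) hψ hc hs
      rw [← h χ h1 h2, ← Ω.integral_Ioo, ← setIntegral_eq_integral_of_forall_compl_eq_zero
        (s := Ioo 0 Ω.length)]
      · refine setIntegral_congr_fun measurableSet_Ioo fun s hs => ?_
        simp only [smul_eq_mul]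
        rw [h3 s (Ioo_subset_Icc_self hs), mul_comm]
      · intro s hn
        rw [image_eq_zero_of_notMem_tsupport fun hh => hn (hs hh), zero_smul])
  exact (ae_restrict_iff' measurableSet_Ioo).2 this

/-- The lemma of du Bois-Reymond on the circle: every smooth periodic function minus its mean is the
derivative of an admissible test function, so `f` minus its mean is orthogonal to all tests. -/
theorem ae_eq_const_of_periodic {f : ℝ → ℝ} (hf : 𝓛 f (Ioc 0 Ω.length))
    (h : ∀ χ : ℝ → ℝ, 𝒞 χ → Periodic χ Ω.length →
      ∫ s in 0..Ω.length, f s * deriv χ s = 0) :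
    ∃ c, f =ᵐ[𝓁 (Ioc 0 Ω.length)] fun _ => c := by
  have L := Ω.length_pos
  set c := (∫ s in 0..Ω.length, f s) / Ω.length with hc
  refine ⟨c, ?_⟩
  have mc : 𝓛 (fun _ : ℝ => c) (Ioc 0 Ω.length) :=
    memLp_continuous_one continuous_const
  have hm := hf.sub mc
  have key := ae_eq_zero_of_periodic hm fun χ hχ hp => by
    obtain ⟨X, d, pX, -⟩ := exists_periodic_primitive L hχ.continuous hp
    set m := (∫ r in 0..Ω.length, χ r) / Ω.length with hm'
    have := h X (contDiff_infty_of_hasDerivAt d (hχ.sub contDiff_const)) pX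
    rw [funext fun s => (d s).deriv] at this
    have i1 := intervalIntegrable_mul_continuous hf hχ.continuous
    have i2 := intervalIntegrable_mul_continuous hf (continuous_const (y := (1 : ℝ)))
    simp only [mul_one] at i2
    have e1 : ∫ s in 0..Ω.length, f s * (χ s - m) =
        (∫ s in 0..Ω.length, f s * χ s) - (∫ s in 0..Ω.length, f s) * m := by
      rw [← iint_mul_const, ← iint_sub i1
        (i2.mul_const m)]
      congr 1; ext s; ring
    have e2 : ∫ s in 0..Ω.length, (f - fun _ : ℝ => c) s * χ s =
        (∫ s in 0..Ω.length, f s * χ s) - c * ∫ s in 0..Ω.length, χ s := by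
      rw [← iint_const_mul, ← iint_sub i1
        ((hχ.continuous.intervalIntegrable _ _).const_mul c)]
      congr 1; ext s; simp only [Pi.sub_apply]; ring
    have e3 : c * ∫ s in 0..Ω.length, χ s = (∫ s in 0..Ω.length, f s) * m := by
      rw [hc, hm']; ring
    rw [e2, e3, ← e1]
    exact this
  filter_upwards [key] with s hs
  exact sub_eq_zero.1 hs

/-- The primitive of `k` is absolutely continuous, so it may be integrated by parts against `χ`.
Testing with the constant 1 gives `k` zero mean, which removes the boundary terms. The difference of
`g` and the primitive is then orthogonal to all derivatives, hence constant. -/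
theorem ae_eq_primitive {g k : ℝ → ℝ} (hg : 𝓛 g (Ioc 0 Ω.length))
    (hk : 𝓛 k (Ioc 0 Ω.length))
    (h : ∀ χ : ℝ → ℝ, 𝒞 χ → Periodic χ Ω.length →
      ∫ s in 0..Ω.length, (g s * deriv χ s + k s * χ s) = 0) :
    (∫ s in 0..Ω.length, k s = 0) ∧
    ∃ c, g =ᵐ[𝓁 (Ioc 0 Ω.length)] fun s => c + ∫ r in 0..s, k r := by
  have L := Ω.length_pos
  have k0 : ∫ s in 0..Ω.length, k s = 0 := by
    have := h (fun _ => 1) contDiff_const fun _ => rfl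
    simpa using this
  refine ⟨k0, ?_⟩
  have ki : IntervalIntegrable k volume 0 Ω.length := by
    have := intervalIntegrable_mul_continuous hk (continuous_const (y := (1 : ℝ)))
    simpa only [mul_one] using this
  set K : ℝ → ℝ := fun s => ∫ r in 0..s, k r with hK
  have ac : AbsolutelyContinuousOnInterval K 0 Ω.length :=
    ki.absolutelyContinuousOnInterval_intervalIntegral left_mem_uIcc
  have dK : ∀ᵐ s, s ∈ uIoc 0 Ω.length → deriv K s = k s := by
    filter_upwards [ki.ae_hasDerivAt_integral] with s hs hs'
    exact (hs (uIoc_subset_uIcc hs') 0 left_mem_uIcc).deriv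
  have mK : 𝓛 K (Ioc 0 Ω.length) := by
    have := ac.continuousOn
    rw [uIcc_of_le L.le] at this
    obtain ⟨B, hB⟩ := isCompact_Icc.exists_bound_of_continuousOn this
    refine MemLp.of_bound ((this.mono Ioc_subset_Icc_self).aestronglyMeasurable measurableSet_Ioc)
      B ?_
    filter_upwards [ae_restrict_mem measurableSet_Ioc] with s hs
    exact hB s (Ioc_subset_Icc_self hs)
  obtain ⟨c, hc⟩ := ae_eq_const_of_periodic (hg.sub mK) fun χ hχ hp => by
    have acχ : AbsolutelyContinuousOnInterval χ 0 Ω.length :=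
      (hχ.of_le (by simp)).contDiffOn.absolutelyContinuousOnInterval
    have p := ac.integral_mul_deriv_eq_deriv_mul acχ
    have K0 : K 0 = 0 := by simp [hK]
    have KL : K Ω.length = 0 := k0
    have e : ∫ s in 0..Ω.length, deriv K s * χ s = ∫ s in 0..Ω.length, k s * χ s := by
      refine intervalIntegral.integral_congr_ae ?_
      filter_upwards [dK] with s hs hs'
      rw [hs hs']
    rw [K0, KL, e] at p
    have cχ := hχ.continuous_deriv (by simp)
    have h1 := h χ hχ hp
    rw [iint_add (intervalIntegrable_mul_continuous hg cχ)
      (intervalIntegrable_mul_continuous hk hχ.continuous)] at h1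
    have e2 : ∫ s in 0..Ω.length, (g - K) s * deriv χ s =
        (∫ s in 0..Ω.length, g s * deriv χ s) - ∫ s in 0..Ω.length, K s * deriv χ s := by
      rw [← iint_sub (intervalIntegrable_mul_continuous hg cχ)
        (intervalIntegrable_mul_continuous mK cχ)]
      congr 1; ext s; simp only [Pi.sub_apply]; ring
    rw [e2, p]; linarith
  refine ⟨c, ?_⟩
  filter_upwards [hc] with s hs
  simp only [Pi.sub_apply] at hs
  linarith

/-- Cauchy–Schwarz on the interval between the two points: the Hölder bound with exponent `1/2` for
functions with square integrable derivative. -/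
theorem abs_primitive_sub_le {k : ℝ → ℝ} (hk : 𝓛 k (Ioc 0 Ω.length))
    {M : ℝ} (hM : ∫ s in 0..Ω.length, k s ^ 2 ≤ M) {s t : ℝ} (hs : s ∈ Icc 0 Ω.length)
    (ht : t ∈ Icc 0 Ω.length) :
    |(∫ r in 0..s, k r) - ∫ r in 0..t, k r| ≤ √M * √|s - t| := by
  have L := Ω.length_pos
  wlog h : t ≤ s generalizing s t
  · rw [abs_sub_comm, abs_sub_comm s]
    exact this ht hs (le_of_not_ge h)
  have ki : IntegrableOn k (Ioc 0 Ω.length) := hk.integrable (by norm_num)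
  have ii : ∀ {a b : ℝ}, a ∈ Icc 0 Ω.length → b ∈ Icc 0 Ω.length → a ≤ b →
      IntervalIntegrable k volume a b := fun {a b} ha hb hab => by
    rw [intervalIntegrable_iff, uIoc_of_le hab]
    exact ki.mono_set (Ioc_subset_Ioc ha.1 hb.2)
  have z : (0 : ℝ) ∈ Icc 0 Ω.length := left_mem_Icc.2 L.le
  rw [intervalIntegral.integral_interval_sub_left (ii z hs hs.1) (ii z ht ht.1),
    integral_of_le h]
  have sub : Ioc t s ⊆ Ioc 0 Ω.length := Ioc_subset_Ioc ht.1 hs.2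
  have m1 : 𝓛 k (Ioc t s) :=
    hk.mono_measure (Measure.restrict_mono sub le_rfl)
  have m2 : 𝓛 (fun _ : ℝ => (1 : ℝ)) (Ioc t s) := memLp_const 1
  have cs := integral_mul_sq_le m1 m2
  have e : ∫ r in Ioc t s, (1 : ℝ) ^ 2 = s - t := by simp [h]
  have mono : ∫ r in Ioc t s, k r ^ 2 ≤ M := by
    rw [integral_of_le L.le] at hM
    refine le_trans ?_ hM
    exact setIntegral_mono_set hk.integrable_sq (ae_of_all _ fun r => sq_nonneg _) sub.eventuallyLE
  rw [e] at cs
  simp only [mul_one] at cs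
  rw [abs_of_nonneg (sub_nonneg.2 h), ← Real.sqrt_mul' _ (sub_nonneg.2 h)]
  exact Real.abs_le_sqrt (cs.trans (mul_le_mul_of_nonneg_right mono (sub_nonneg.2 h)))

end SmoothDomain

theorem IsWeakPartial.integral_eq {U : Set Plane} {i : Fin 2} {f g ψ : Plane → ℝ}
    (h : IsWeakPartial U i f g) (hf : 𝓛 f U)
    (hg : 𝓛 g U) (hψ : IsTest U ψ) :
    ∫ x in U, (f x * 𝒟 i ψ x + g x * ψ x) = 0 := by
  rw [integral_add (integrable_mul_of_memLp hf ((hψ.partialDeriv i).memLp _))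
    (integrable_mul_of_memLp hg (hψ.memLp _)), h ψ hψ.smooth hψ.compact hψ.subset]
  ring

namespace SmoothDomain

variable {Ω : SmoothDomain} {ε : ℝ}

/-! ### Change of variables -/

theorem Tubular.jac_pos (h : Ω.Tubular ε) {p : Plane} (hp : p 1 ∈ Icc (-1 : ℝ) 2) :
    0 < Ω.jac ε p := by linarith [(h.jac_mem p hp).1]

/-- The half-open rectangle is the set on which the Fermi coordinates are a bijection onto `ω_ε`.
Passing to the open rectangle `Σ` loses only a segment. -/
theorem refSet_ae_eq :
    ({p | p 0 ∈ Ico 0 Ω.length ∧ p 1 ∈ Ioo (0 : ℝ) 1} : Set Plane) =ᵐ[volume] Ω.refSet := by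
  have hnull : volume {p : Plane | p 0 = 0} = 0 := by
    have := Measure.addHaar_submodule (volume : Measure Plane)
      (LinearMap.ker (EuclideanSpace.proj (𝕜 := ℝ) (0 : Fin 2)).toLinearMap) (fun htop => by
        have h1 : (EuclideanSpace.single (0 : Fin 2) (1 : ℝ) : Plane) ∈
            LinearMap.ker (EuclideanSpace.proj (𝕜 := ℝ) (0 : Fin 2)).toLinearMap := by
          rw [htop]; trivial
        simp at h1)
    convert! this using 2
  have h2 : ∀ᵐ p : Plane, p 0 ≠ 0 := by
    rw [ae_iff]; simpa using hnull
  filter_upwards [h2] with p hp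
  refine propext ⟨fun h => ⟨⟨lt_of_le_of_ne h.1.1 hp.symm, h.1.2⟩, h.2⟩,
    fun h => ⟨Ioo_subset_Ico_self h.1, h.2⟩⟩

theorem measurableSet_halfOpen :
    MeasurableSet ({p | p 0 ∈ Ico 0 Ω.length ∧ p 1 ∈ Ioo (0 : ℝ) 1} : Set Plane) :=
  (measurableSet_Ico.preimage (Plane.continuous_apply 0).measurable).inter
    (measurableSet_Ioo.preimage (Plane.continuous_apply 1).measurable)

theorem exists_mem_Ico (s : ℝ) : ∃ k : ℤ, s + k * Ω.length ∈ Ico 0 Ω.length := by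
  have h := toIcoMod_mem_Ico' Ω.length_pos s
  refine ⟨-toIcoDiv Ω.length_pos 0 s, ?_⟩
  simp only [toIcoMod, zsmul_eq_mul] at h
  push_cast
  rwa [neg_mul, ← sub_eq_add_neg]

variable (Ω ε) in
theorem isOpen_thin : IsOpen (Ω.thin ε) :=
  Ω.isOpen.inter (isOpen_lt (Metric.continuous_infDist_pt _) continuous_const)

namespace Tubular

theorem image_fermi (h : Ω.Tubular ε) : Ω.fermi ε '' {p | p 0 ∈ Ico 0 Ω.length ∧ p 1 ∈ Ioo (0 : ℝ) 1} =
    Ω.thin ε := by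
  ext x
  rw [h.mem_thin]
  constructor
  · rintro ⟨p, hp, rfl⟩
    exact ⟨p, hp.2, rfl⟩
  · rintro ⟨p, hp, rfl⟩
    obtain ⟨k, hk⟩ := Ω.exists_mem_Ico (p 0)
    refine ⟨!₂[p 0 + k * Ω.length, p 1], ⟨by simpa using hk, by simpa using hp⟩, ?_⟩
    rw [fermi_add_zsmul, Plane.eta]

theorem injOn_fermi (h : Ω.Tubular ε) :
    InjOn (Ω.fermi ε) {p | p 0 ∈ Ico 0 Ω.length ∧ p 1 ∈ Ioo (0 : ℝ) 1} := by
  intro p hp q hq hpq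
  obtain ⟨h1, k, hk⟩ := h.inj p q ⟨by linarith [hp.2.1], by linarith [hp.2.2]⟩
    ⟨by linarith [hq.2.1], by linarith [hq.2.2]⟩ hpq
  have hk0 : k = 0 := by
    have L := Ω.length_pos
    have a1 : (k : ℝ) * Ω.length < 1 * Ω.length := by linarith [hp.1.1, hq.1.2]
    have a2 : (-1 : ℝ) * Ω.length < k * Ω.length := by linarith [hp.1.2, hq.1.1]
    have b1 := lt_of_mul_lt_mul_right a1 L.le
    have b2 := lt_of_mul_lt_mul_right a2 L.le
    have c1 : k < 1 := by exact_mod_cast b1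
    have c2 : -1 < k := by exact_mod_cast b2
    omega
  subst hk0
  exact Plane.ext (by simpa using hk.symm) h1

theorem abs_det (h : Ω.Tubular ε) {p : Plane} (hp : p 1 ∈ Ioo (0 : ℝ) 1) :
    |(Ω.fermiDeriv ε p).det| = ε * Ω.jac ε p := by
  rw [det_fermiDeriv, abs_of_pos (mul_pos h.pos (h.jac_pos ⟨by linarith [hp.1], by linarith [hp.2]⟩))]

theorem integral_thin (h : Ω.Tubular ε) (f : Plane → ℝ) :
    ∫ x in Ω.thin ε, f x = ∫ p in Ω.refSet, ε * Ω.jac ε p * f (Ω.fermi ε p) := by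
  rw [← h.image_fermi, integral_image_eq_integral_abs_det_fderiv_smul volume
    Ω.measurableSet_halfOpen (fun p _ => (Ω.hasFDerivAt_fermi ε p).hasFDerivWithinAt) h.injOn_fermi,
    setIntegral_congr_set Ω.refSet_ae_eq]
  refine Ω.integral_congr_refSet fun p hp => ?_
  rw [h.abs_det hp.2, smul_eq_mul]

theorem memLp_comp (h : Ω.Tubular ε) {f : Plane → ℝ} (hf : 𝓛 f (Ω.thin ε)) :
    𝓛 (fun p => f (Ω.fermi ε p)) Ω.refSet := by
  set S : Set Plane := {p | p 0 ∈ Ico 0 Ω.length ∧ p 1 ∈ Ioo (0 : ℝ) 1} with hS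
  have hms : MeasurableSet S := Ω.measurableSet_halfOpen
  have hmeas : Measurable (Ω.fermi ε) := (Ω.contDiff_fermi ε).continuous.measurable
  have hmap := map_withDensity_abs_det_fderiv_eq_addHaar volume hms.nullMeasurableSet
    (fun p _ => (Ω.hasFDerivAt_fermi ε p).hasFDerivWithinAt) h.injOn_fermi
  rw [h.image_fermi] at hmap
  rw [← hmap] at hf
  have h1 := hf.comp_of_map hmeas.aemeasurable
  rw [← Measure.restrict_congr_set Ω.refSet_ae_eq]
  -- The density of the change of variables is at least `ε / 2`, which gives the factor `2 / ε`.
  refine h1.of_measure_le_smul (c := ENNReal.ofReal (2 / ε)) (by simp) ?_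
  rw [Measure.le_iff]
  intro T hT
  have e0 := h.pos
  rw [Measure.smul_apply, withDensity_apply _ hT, smul_eq_mul, ← lintegral_const_mul' _ _ (by simp),
    ← setLIntegral_one]
  rw [Measure.restrict_restrict hT]
  refine setLIntegral_mono_ae' (hT.inter hms) (Eventually.of_forall fun p hp => ?_)
  rw [h.abs_det hp.2.2, ← ENNReal.ofReal_mul (by positivity), ← ENNReal.ofReal_one]
  refine ENNReal.ofReal_le_ofReal ?_
  have := (h.jac_mem p ⟨by linarith [hp.2.2.1], by linarith [hp.2.2.2]⟩).1
  have e : 2 / ε * (ε * Ω.jac ε p) = 2 * Ω.jac ε p := by field_simp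
  rw [e]; linarith

theorem ae_eq_zero_of_comp (h : Ω.Tubular ε) {f : Plane → ℝ} (hf : 𝓛 f (Ω.thin ε))
    (h0 : (fun p => f (Ω.fermi ε p)) =ᵐ[𝓁 Ω.refSet] 0) :
    f =ᵐ[𝓁 (Ω.thin ε)] 0 := by
  have : ∫ x in Ω.thin ε, f x ^ 2 = 0 := by
    rw [h.integral_thin]
    refine integral_eq_zero_of_ae ?_
    filter_upwards [h0] with p hp
    have hp : f (Ω.fermi ε p) = 0 := hp
    simp [hp]
  exact ae_eq_zero_of_integral_sq_nonpos hf this.le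

theorem integral_comp_sq_le (h : Ω.Tubular ε) {f : Plane → ℝ} (hf : 𝓛 f (Ω.thin ε)) :
    ∫ p in Ω.refSet, f (Ω.fermi ε p) ^ 2 ≤ 2 / ε * ∫ x in Ω.thin ε, f x ^ 2 := by
  have e0 := h.pos
  rw [h.integral_thin, ← integral_const_mul]
  have hc := (h.memLp_comp hf)
  have hi : Integrable (fun p => Ω.jac ε p * f (Ω.fermi ε p) ^ 2) (𝓁 Ω.refSet) := by
    have := integrable_mul_of_memLp (Ω.memLp_mul (Ω.contDiff_jac ε).continuous hc) hc
    refine this.congr (Eventually.of_forall fun p => ?_)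
    simp only; ring
  refine setIntegral_mono_on hc.integrable_sq ?_ Ω.isOpen_refSet.measurableSet fun p hp => ?_
  · refine (hi.const_mul 2).congr (Eventually.of_forall fun p => ?_)
    simp only; field_simp
  · have := (h.jac_mem p ⟨by linarith [hp.2.1], by linarith [hp.2.2]⟩).1
    have e : 2 / ε * (ε * Ω.jac ε p * f (Ω.fermi ε p) ^ 2) =
      2 * Ω.jac ε p * f (Ω.fermi ε p) ^ 2 := by field_simp
    rw [e]
    nlinarith [sq_nonneg (f (Ω.fermi ε p))]

/-! ### Smooth functions given in Fermi coordinates -/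

/-- Injectivity modulo periods makes the value independent of the chosen preimage. Near the compact
image of `α ≤ t ≤ β` the function is a composition with a smooth local inverse, and off this image
it is zero. -/
theorem exists_push (h : Ω.Tubular ε) {ζ : Plane → ℝ} (hζ : Ω.PerSmooth ζ) {α β : ℝ}
    (hα : -1 < α) (hβ : β < 2)
    (h0 : ∀ p : Plane, p 1 ∉ Icc α β → ζ p = 0) :
    ∃ ψ : Plane → ℝ, 𝒞 ψ ∧ HasCompactSupport ψ ∧
      (∀ p : Plane, p 1 ∈ Ioo (-1 : ℝ) 2 → ψ (Ω.fermi ε p) = ζ p) ∧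
      (0 < α → β < 1 → tsupport ψ ⊆ Ω.thin ε) := by
  classical
  set ψ : Plane → ℝ := fun x =>
    if hx : ∃ p : Plane, p 1 ∈ Ioo (-1 : ℝ) 2 ∧ Ω.fermi ε p = x then ζ hx.choose else 0 with hψ
  have hper : ∀ (s t : ℝ) (k : ℤ), ζ !₂[s + k * Ω.length, t] = ζ !₂[s, t] := fun s t k =>
    Periodic.int_mul (f := fun s => ζ !₂[s, t]) (fun s => hζ.per s t) k s
  have hval : ∀ p : Plane, p 1 ∈ Ioo (-1 : ℝ) 2 → ψ (Ω.fermi ε p) = ζ p := by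
    intro p hp
    have hx : ∃ q : Plane, q 1 ∈ Ioo (-1 : ℝ) 2 ∧ Ω.fermi ε q = Ω.fermi ε p := ⟨p, hp, rfl⟩
    simp only [hψ]
    rw [dif_pos hx]
    obtain ⟨h1, k, hk⟩ := h.inj p hx.choose hp hx.choose_spec.1 hx.choose_spec.2.symm
    rw [← Plane.eta hx.choose, ← h1, hk, hper, Plane.eta]
  set K : Set Plane := Ω.fermi ε '' {p | p 0 ∈ Icc 0 Ω.length ∧ p 1 ∈ Icc α β} with hK
  have hKc : IsCompact K := by
    refine IsCompact.image ?_ (Ω.contDiff_fermi ε).continuous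
    have hc := (isCompact_Icc (a := (0 : ℝ)) (b := Ω.length)).prod (isCompact_Icc (a := α) (b := β))
    have hcont : Continuous fun x : ℝ × ℝ => (!₂[x.1, x.2] : Plane) := by fun_prop
    convert! hc.image hcont using 1
    ext p
    constructor
    · intro hp
      exact ⟨(p 0, p 1), ⟨hp.1, hp.2⟩, Plane.eta p⟩
    · rintro ⟨x, hx, rfl⟩
      exact ⟨by simpa using hx.1, by simpa using hx.2⟩
  have hmemK : ∀ p : Plane, p 1 ∈ Icc α β → Ω.fermi ε p ∈ K := by
    intro p hp
    obtain ⟨k, hk⟩ := Ω.exists_mem_Ico (p 0)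
    refine ⟨!₂[p 0 + k * Ω.length, p 1], ⟨by simpa using Ico_subset_Icc_self hk, by simpa using hp⟩, ?_⟩
    rw [fermi_add_zsmul, Plane.eta]
  have hzero : ∀ x, x ∉ K → ψ x = 0 := by
    intro x hx
    by_cases hex : ∃ p : Plane, p 1 ∈ Ioo (-1 : ℝ) 2 ∧ Ω.fermi ε p = x
    · obtain ⟨p, hp, rfl⟩ := hex
      rw [hval p hp]
      exact h0 p fun hm => hx (hmemK p hm)
    · simp only [hψ]
      rw [dif_neg hex]
  have hts : tsupport ψ ⊆ K := closure_minimal (fun x hx => by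
    by_contra hcon; exact hx (hzero x hcon)) hKc.isClosed
  refine ⟨ψ, contDiff_iff_contDiffAt.2 fun x => ?_, hKc.of_isClosed_subset (isClosed_tsupport ψ) hts,
    hval, fun ha hb => ?_⟩
  · by_cases hx : x ∈ K
    · obtain ⟨p, hp, rfl⟩ := hx
      have hpI : p 1 ∈ Ioo (-1 : ℝ) 2 := ⟨hα.trans_le hp.2.1, hp.2.2.trans_lt hβ⟩
      have hne : ε * Ω.jac ε p ≠ 0 := (mul_pos h.pos (h.jac_pos (Ioo_subset_Icc_self hpI))).ne'
      have hcd : ContDiffAt ℝ ∞ (Ω.fermi ε) p := (Ω.contDiff_fermi ε).contDiffAt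
      have hder := Ω.hasFDerivAt_fermi_equiv hne
      have hloc := hcd.to_localInverse hder (by simp)
      have hst := hcd.hasStrictFDerivAt' hder (by simp)
      have hright := hst.eventually_right_inverse
      have himg : hcd.localInverse hder (by simp) (Ω.fermi ε p) = p :=
        hcd.localInverse_apply_image hder (by simp)
      have hev : ∀ᶠ y in 𝓝 (Ω.fermi ε p), (hcd.localInverse hder (by simp) y) 1 ∈ Ioo (-1 : ℝ) 2 := by
        have hc : ContinuousAt (fun y => (hcd.localInverse hder (by simp) y) 1) (Ω.fermi ε p) :=
          (Plane.continuous_apply 1).continuousAt.comp hloc.continuousAt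
        refine hc.eventually_mem (Ioo_mem_nhds ?_ ?_) <;> rw [himg]
        exacts [hpI.1, hpI.2]
      have hcomp : ContDiffAt ℝ ∞ (fun y => ζ (hcd.localInverse hder (by simp) y)) (Ω.fermi ε p) :=
        hζ.smooth.contDiffAt.comp _ hloc
      refine hcomp.congr_of_eventuallyEq ?_
      filter_upwards [hright, hev] with y hy1 hy2
      have e := hval _ hy2
      rw [← e]
      congr 1
      exact hy1.symm
    · have : ψ =ᶠ[𝓝 x] fun _ => 0 := by
        filter_upwards [hKc.isClosed.isOpen_compl.mem_nhds hx] with y hy using hzero y hy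
      exact contDiffAt_const.congr_of_eventuallyEq this
  · refine hts.trans ?_
    rintro _ ⟨p, hp, rfl⟩
    exact (h.mem_thin _).2 ⟨p, ⟨ha.trans_le hp.2.1, hp.2.2.trans_lt hb⟩, rfl⟩

end Tubular

end SmoothDomain

theorem fderiv_eq_partialDeriv (ψ : Plane → ℝ) (x v : Plane) :
    fderiv ℝ ψ x v = v 0 * 𝒟 0 ψ x + v 1 * 𝒟 1 ψ x := by
  have hv : v = v 0 • EuclideanSpace.single 0 1 + v 1 • EuclideanSpace.single 1 1 := by
    apply Plane.ext <;> simp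
  conv_lhs => rw [hv]
  rw [map_add, map_smul, map_smul, smul_eq_mul, smul_eq_mul]
  rfl

/-- A cutoff function equal to `1` on `[0, 1]`. -/
def stripCutoff (t : ℝ) : ℝ :=
  Real.smoothTransition (2 * t + 1) * Real.smoothTransition (3 - 2 * t)

theorem contDiff_stripCutoff : 𝒞 stripCutoff :=
  (Real.smoothTransition.contDiff.comp ((contDiff_const.mul contDiff_id).add contDiff_const)).mul
    (Real.smoothTransition.contDiff.comp (contDiff_const.sub (contDiff_const.mul contDiff_id)))

theorem stripCutoff_eq_one {t : ℝ} (ht : t ∈ Icc (0 : ℝ) 1) : stripCutoff t = 1 := by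
  rw [stripCutoff, Real.smoothTransition.one_of_one_le (by linarith [ht.1]),
    Real.smoothTransition.one_of_one_le (by linarith [ht.2]), one_mul]

theorem stripCutoff_eq_zero {t : ℝ} (ht : t ∉ Icc (-(1 / 2) : ℝ) (3 / 2)) : stripCutoff t = 0 := by
  rw [mem_Icc, not_and_or, not_le, not_le] at ht
  rcases ht with ht | ht
  · rw [stripCutoff, Real.smoothTransition.zero_of_nonpos (by linarith), zero_mul]
  · rw [stripCutoff, Real.smoothTransition.zero_of_nonpos (x := 3 - 2 * t) (by linarith), mul_zero]

namespace SmoothDomain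

variable (Ω : SmoothDomain) (ε : ℝ)

/-! ### Green's formula in Fermi coordinates and the trace -/

/-- The tangential component of a vector field on the strip. -/
def tanComp (G : Fin 2 → Plane → ℝ) (p : Plane) : ℝ :=
  Ω.tan 0 (p 0) * G 0 p + Ω.tan 1 (p 0) * G 1 p

/-- The normal component of a vector field on the strip. -/
def norComp (G : Fin 2 → Plane → ℝ) (p : Plane) : ℝ :=
  Ω.nor 0 (p 0) * G 0 p + Ω.nor 1 (p 0) * G 1 p

/-- A function on `ω_ε` in Fermi coordinates. -/
def pull (f : Plane → ℝ) (p : Plane) : ℝ := f (Ω.fermi ε p)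

theorem perSmooth_tan (i : Fin 2) : Ω.PerSmooth fun p => Ω.tan i (p 0) :=
  .fst (Ω.contDiff_tan i) (Ω.tan_periodic i)

theorem perSmooth_nor (i : Fin 2) : Ω.PerSmooth fun p => Ω.nor i (p 0) :=
  .fst (Ω.contDiff_nor i) (Ω.nor_periodic i)

theorem perSmooth_curvature : Ω.PerSmooth fun p => Ω.curvature (p 0) :=
  .fst Ω.contDiff_curvature Ω.curvature_periodic

theorem perSmooth_jac : Ω.PerSmooth (Ω.jac ε) :=
  ⟨Ω.contDiff_jac ε, fun s t => by simp [jac, Ω.curvature_periodic s]⟩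

theorem PerSmooth.pull {ψ : Plane → ℝ} (hψ : 𝒞 ψ) : Ω.PerSmooth (Ω.pull ε ψ) :=
  ⟨hψ.comp (Ω.contDiff_fermi ε), fun s t => by
    simpa [SmoothDomain.pull] using congrArg ψ (Ω.fermi_add_zsmul ε s t 1)⟩

theorem memLp_tanComp {G : Fin 2 → Plane → ℝ} (hG : ∀ i, 𝓛 (G i) Ω.refSet) :
    𝓛 (Ω.tanComp G) Ω.refSet :=
  (Ω.memLp_mul (Ω.perSmooth_tan 0).cont (hG 0)).add (Ω.memLp_mul (Ω.perSmooth_tan 1).cont (hG 1))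

theorem memLp_norComp {G : Fin 2 → Plane → ℝ} (hG : ∀ i, 𝓛 (G i) Ω.refSet) :
    𝓛 (Ω.norComp G) Ω.refSet :=
  (Ω.memLp_mul (Ω.perSmooth_nor 0).cont (hG 0)).add (Ω.memLp_mul (Ω.perSmooth_nor 1).cont (hG 1))

theorem partialDeriv_pull {ψ : Plane → ℝ} (hψ : 𝒞 ψ) (p : Plane) :
    𝒟 0 (Ω.pull ε ψ) p =
      Ω.jac ε p * Ω.tanComp (fun i => Ω.pull ε (𝒟 i ψ)) p ∧
    𝒟 1 (Ω.pull ε ψ) p =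
      -(ε * Ω.norComp (fun i => Ω.pull ε (𝒟 i ψ)) p) := by
  have h := (hψ.hasFDerivAt_top (Ω.fermi ε p)).comp p (Ω.hasFDerivAt_fermi ε p)
  constructor <;>
  · rw [partialDeriv_of_hasFDerivAt (ψ := Ω.pull ε ψ) h]
    simp only [ContinuousLinearMap.comp_apply, fderiv_eq_partialDeriv, fermiDeriv_apply, tanComp,
      norComp, pull]
    simp
    ring

theorem partialDeriv_jac (p : Plane) :
    𝒟 0 (Ω.jac ε) p = -(ε * p 1 * deriv Ω.curvature (p 0)) ∧
    𝒟 1 (Ω.jac ε) p = -(ε * Ω.curvature (p 0)) := by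
  have h1 : 𝒞 fun t : ℝ => ε * t := contDiff_const.mul contDiff_id
  have e : Ω.jac ε = fun p => 1 - (fun t => ε * t) (p 1) * Ω.curvature (p 0) := rfl
  have hκ := Ω.perSmooth_curvature
  have hc : ∀ i, 𝒟 i (fun _ : Plane => (1 : ℝ)) p = 0 := fun i => by simp [partialDeriv]
  constructor <;>
  · rw [e, partialDeriv_sub (ψ := fun _ => 1) (by fun_prop)
      (((h1.comp_coord 1).mul hκ.smooth).diffAt p),
      partialDeriv_mul (ψ := fun p : Plane => (fun t => ε * t) (p 1))
        ((h1.comp_coord 1).diffAt p) (hκ.smooth.diffAt p), hc,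
      partialDeriv_coord _ 1 ((h1.differentiable (by simp) _).hasDerivAt),
      partialDeriv_coord _ 0 ((Ω.contDiff_curvature.differentiable (by simp) _).hasDerivAt)]
    simp

theorem partialDeriv_tan (i j : Fin 2) (p : Plane) : 𝒟 i (fun p => Ω.tan j (p 0)) p =
    if i = 0 then -(Ω.curvature (p 0) * Ω.nor j (p 0)) else 0 :=
  partialDeriv_coord i 0 (Ω.hasDerivAt_tan j (p 0))

theorem partialDeriv_nor (i j : Fin 2) (p : Plane) : 𝒟 i (fun p => Ω.nor j (p 0)) p =
    if i = 0 then Ω.curvature (p 0) * Ω.tan j (p 0) else 0 :=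
  partialDeriv_coord i 0 (Ω.hasDerivAt_nor j (p 0))

theorem bdryCurve_eq (j : Fin 2) (s : ℝ) :
    Ω.bdryCurve ε j s = Ω.fermi ε !₂[s, ((j : ℕ) : ℝ)] := by
  fin_cases j <;> simp [bdryCurve, fermi]

theorem bdryNormal_eq (j : Fin 2) (s : ℝ) (i : Fin 2) :
    Ω.bdryNormal j s i = (1 - 2 * ((j : ℕ) : ℝ)) * Ω.nor i s := by
  fin_cases j <;> simp [bdryNormal, nor]; ring

theorem norm_deriv_bdryCurve (j : Fin 2) (s : ℝ) :
    ‖deriv (Ω.bdryCurve ε j) s‖ = |Ω.jac ε !₂[s, ((j : ℕ) : ℝ)]| := by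
  have h1 : HasDerivAt (fun s : ℝ => (!₂[s, ((j : ℕ) : ℝ)] : Plane))
      (EuclideanSpace.single 0 1) s := by
    have e : (fun s : ℝ => (!₂[s, ((j : ℕ) : ℝ)] : Plane)) =
        fun s => s • EuclideanSpace.single 0 1 + !₂[0, ((j : ℕ) : ℝ)] := by
      ext s i; fin_cases i <;> simp
    rw [e]
    simpa using ((hasDerivAt_id s).smul_const (EuclideanSpace.single (0 : Fin 2) (1 : ℝ))).add_const
      (!₂[0, ((j : ℕ) : ℝ)] : Plane)
  have h2 := (Ω.hasFDerivAt_fermi ε !₂[s, ((j : ℕ) : ℝ)]).comp_hasDerivAt s h1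
  have e : Ω.bdryCurve ε j = Ω.fermi ε ∘ fun s : ℝ => (!₂[s, ((j : ℕ) : ℝ)] : Plane) :=
    funext (Ω.bdryCurve_eq ε j)
  rw [e, h2.deriv]
  have e2 : Ω.fermiDeriv ε !₂[s, ((j : ℕ) : ℝ)] (EuclideanSpace.single 0 1) =
      Ω.jac ε !₂[s, ((j : ℕ) : ℝ)] • deriv Ω.curve s := by
    ext i; simp [fermiDeriv_apply, tan]
  rw [e2, norm_smul, Ω.unitSpeed, mul_one, Real.norm_eq_abs]

variable {Ω ε}

theorem Tubular.bdryIntegral_eq (h : Ω.Tubular ε) (F : Fin 2 → ℝ → ℝ) : Ω.bdryIntegral ε F =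
    (∫ s in 0..Ω.length, F 0 s) +
      ∫ s in 0..Ω.length, F 1 s * Ω.jac ε !₂[s, 1] := by
  have hj : ∀ (j : Fin 2) s, ‖deriv (Ω.bdryCurve ε j) s‖ = Ω.jac ε !₂[s, ((j : ℕ) : ℝ)] :=
    fun j s => by
      rw [norm_deriv_bdryCurve, abs_of_pos (h.jac_pos _)]
      fin_cases j <;> simp
  simp only [bdryIntegral, hj, Fin.sum_univ_two]
  simp [jac]

/-- The density is known to be positive only for `-1 ≤ t ≤ 2`; the support of `χ` keeps the quotient
smooth elsewhere. -/
theorem Tubular.perSmooth_div_jac (h : Ω.Tubular ε) {χ : Plane → ℝ} (hχ : Ω.PerSmooth χ) {a b : ℝ}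
    (ha : -1 ≤ a) (hb : b ≤ 2) (h0 : ∀ p : Plane, p 1 ∉ Icc a b → χ p = 0) :
    Ω.PerSmooth fun p => χ p / Ω.jac ε p := by
  refine ⟨contDiff_iff_contDiffAt.2 fun p => ?_, fun s t => by rw [hχ.per, (Ω.perSmooth_jac ε).per]⟩
  by_cases hp : p 1 ∈ Icc a b
  · exact hχ.smooth.contDiffAt.div (Ω.contDiff_jac ε).contDiffAt
      (h.jac_pos ⟨ha.trans hp.1, hp.2.trans hb⟩).ne'
  · have : (fun p => χ p / Ω.jac ε p) =ᶠ[𝓝 p] fun _ => 0 := by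
      filter_upwards [(isClosed_Icc.preimage (Plane.continuous_apply 1)).isOpen_compl.mem_nhds hp]
        with q hq
      rw [h0 q hq, zero_div]
    exact contDiffAt_const.congr_of_eventuallyEq this

/-- The Piola transform of a vector field `ψ`: with `X = ε ψ_τ` and `Y = jac ψ_ν` one has `ε jac div
ψ = ∂_s X - ∂_t Y`, because the curvature terms from the rotation of the frame and from the density
cancel. Similarly, the product of `df` with `ψ` splits into its tangential and normal parts. -/
theorem Tubular.green (h : Ω.Tubular ε) {f : Plane → ℝ} {df : Fin 2 → Plane → ℝ}
    (hf : 𝓛 f (Ω.thin ε))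
    (hdf : ∀ i, 𝓛 (df i) (Ω.thin ε)) {ψ Z : Fin 2 → Plane → ℝ}
    (hψ : ∀ i, 𝒞 (ψ i)) (hZ : ∀ i, Ω.PerSmooth (Z i))
    (hψZ : ∀ i, ∀ p ∈ Ω.refSet, ψ i (Ω.fermi ε p) = Z i p) {X Y : Plane → ℝ}
    (hX : ∀ p, X p = ε * Ω.tanComp Z p) (hY : ∀ p, Y p = Ω.jac ε p * Ω.norComp Z p) :
    (∫ x in Ω.thin ε, (f x * 𝒟 0 (ψ 0) x + df 0 x * ψ 0 x)) +
      ∫ x in Ω.thin ε, (f x * 𝒟 1 (ψ 1) x + df 1 x * ψ 1 x) =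
    (∫ p in Ω.refSet, (Ω.pull ε f p * 𝒟 0 X p +
      Ω.jac ε p * Ω.tanComp (fun i => Ω.pull ε (df i)) p * X p)) -
    ∫ p in Ω.refSet, (Ω.pull ε f p * 𝒟 1 Y p +
      -(ε * Ω.norComp (fun i => Ω.pull ε (df i)) p) * Y p) := by
  have hF : 𝓛 (Ω.pull ε f) Ω.refSet := h.memLp_comp hf
  have hG : ∀ i, 𝓛 (Ω.pull ε (df i)) Ω.refSet := fun i =>
    h.memLp_comp (hdf i)
  have hFs := Ω.memLp_mul (Ω.contDiff_jac ε).continuous (Ω.memLp_tanComp hG)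
  have hFt := (Ω.memLp_norComp hG).const_mul ε |>.neg
  have XS : Ω.PerSmooth X := by
    rw [funext hX]
    exact (PerSmooth.const ε).mul (((Ω.perSmooth_tan 0).mul (hZ 0)).add
      ((Ω.perSmooth_tan 1).mul (hZ 1)))
  have YS : Ω.PerSmooth Y := by
    rw [funext hY]
    exact (Ω.perSmooth_jac ε).mul (((Ω.perSmooth_nor 0).mul (hZ 0)).add
      ((Ω.perSmooth_nor 1).mul (hZ 1)))
  have hi : ∀ i, Integrable (fun p => ε * Ω.jac ε p *
      (f (Ω.fermi ε p) * 𝒟 i (ψ i) (Ω.fermi ε p) +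
        df i (Ω.fermi ε p) * ψ i (Ω.fermi ε p))) (𝓁 Ω.refSet) := fun i => by
    have c0 : Continuous fun p => ε * Ω.jac ε p :=
      continuous_const.mul (Ω.contDiff_jac ε).continuous
    have c1 : Continuous fun p => 𝒟 i (ψ i) (Ω.fermi ε p) :=
      (partialDeriv_contDiff (hψ i) i).continuous.comp (Ω.contDiff_fermi ε).continuous
    have c2 : Continuous fun p => ψ i (Ω.fermi ε p) :=
      (hψ i).continuous.comp (Ω.contDiff_fermi ε).continuous
    refine ((integrable_mul_continuous hF (c0.mul c1)).add
      (integrable_mul_continuous (hG i) (c0.mul c2))).congr (Eventually.of_forall fun p => ?_)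
    simp only [pull, Pi.add_apply, Pi.mul_apply]; ring
  have hsub := integral_sub
    ((integrable_mul_continuous hF (XS.partialDeriv 0).cont).add
      (integrable_mul_continuous hFs XS.cont))
    ((integrable_mul_continuous hF (YS.partialDeriv 1).cont).add
      (integrable_mul_continuous hFt YS.cont))
  simp only [Pi.add_apply, Pi.neg_apply] at hsub
  rw [h.integral_thin, h.integral_thin, ← integral_add (hi 0) (hi 1), ← hsub]
  refine Ω.integral_congr_refSet fun p hp => ?_
  have hd : ∀ i j, 𝒟 j (Z i) p = 𝒟 j (Ω.pull ε (ψ i)) p := fun i j => by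
    refine partialDeriv_congr ?_ j
    filter_upwards [Ω.isOpen_refSet.mem_nhds hp] with q hq
    exact (hψZ i q hq).symm
  have hZd : ∀ i, DifferentiableAt ℝ (Z i) p := fun i => (hZ i).smooth.diffAt p
  have hT : ∀ i, DifferentiableAt ℝ (fun p : Plane => Ω.tan i (p 0)) p := fun i =>
    (Ω.perSmooth_tan i).smooth.diffAt p
  have hN : ∀ i, DifferentiableAt ℝ (fun p : Plane => Ω.nor i (p 0)) p := fun i =>
    (Ω.perSmooth_nor i).smooth.diffAt p
  have hJ : DifferentiableAt ℝ (Ω.jac ε) p := (Ω.contDiff_jac ε).diffAt p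
  have dX : 𝒟 0 X p = ε * ((-(Ω.curvature (p 0) * Ω.nor 0 (p 0)) * Z 0 p +
      Ω.tan 0 (p 0) * 𝒟 0 (Z 0) p) + (-(Ω.curvature (p 0) * Ω.nor 1 (p 0)) * Z 1 p +
      Ω.tan 1 (p 0) * 𝒟 0 (Z 1) p)) := by
    rw [funext hX]
    unfold tanComp
    rw [partialDeriv_mul (ψ := fun _ => ε) (by fun_prop) (((hT 0).fun_mul (hZd 0)).fun_add
      ((hT 1).fun_mul (hZd 1))),
      partialDeriv_add ((hT 0).fun_mul (hZd 0)) ((hT 1).fun_mul (hZd 1)),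
      partialDeriv_mul (hT 0) (hZd 0), partialDeriv_mul (hT 1) (hZd 1), partialDeriv_tan,
      partialDeriv_tan]
    simp [partialDeriv]
  have dY : 𝒟 1 Y p = -(ε * Ω.curvature (p 0)) * Ω.norComp Z p + Ω.jac ε p *
      (Ω.nor 0 (p 0) * 𝒟 1 (Z 0) p + Ω.nor 1 (p 0) * 𝒟 1 (Z 1) p) := by
    rw [funext hY]
    unfold norComp
    rw [partialDeriv_mul hJ (((hN 0).fun_mul (hZd 0)).fun_add ((hN 1).fun_mul (hZd 1))),
      partialDeriv_add ((hN 0).fun_mul (hZd 0)) ((hN 1).fun_mul (hZd 1)),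
      partialDeriv_mul (hN 0) (hZd 0), partialDeriv_mul (hN 1) (hZd 1), partialDeriv_nor,
      partialDeriv_nor, (Ω.partialDeriv_jac ε p).2]
    simp
  simp only [hψZ 0 p hp, hψZ 1 p hp]
  rw [dX, dY, hX, hY]
  simp only [hd, (Ω.partialDeriv_pull ε (hψ 0) p).1, (Ω.partialDeriv_pull ε (hψ 1) p).1,
    (Ω.partialDeriv_pull ε (hψ 0) p).2, (Ω.partialDeriv_pull ε (hψ 1) p).2]
  simp only [tanComp, norComp, pull, nor_zero, nor_one]
  have ht := Ω.tan_sq (p 0)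
  set a := Ω.tan 0 (p 0)
  set b := Ω.tan 1 (p 0)
  have hb : b ^ 2 = 1 - a ^ 2 := by linarith
  linear_combination (-(ε * Ω.jac ε p * (f (Ω.fermi ε p) * (𝒟 0 (ψ 0) (Ω.fermi ε p) +
    𝒟 1 (ψ 1) (Ω.fermi ε p)) + df 0 (Ω.fermi ε p) * Z 0 p +
    df 1 (Ω.fermi ε p) * Z 1 p))) * ht

/-- Green's formula for the field whose `i`-th component is `ψ` and whose other component is zero.
The tangential part integrates to zero by periodicity; the normal part leaves the two boundary
integrals with weights `1` and `jac` and opposite normals. -/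
theorem StripGrad.isTrace (h : Ω.Tubular ε) {f : Plane → ℝ} {df : Fin 2 → Plane → ℝ}
    {g : Fin 2 → ℝ → ℝ} (hf : 𝓛 f (Ω.thin ε))
    (hdf : ∀ i, 𝓛 (df i) (Ω.thin ε))
    (hs : Ω.StripGrad (Ω.pull ε f) (fun p => Ω.jac ε p * Ω.tanComp (fun i => Ω.pull ε (df i)) p)
      (fun p => -(ε * Ω.norComp (fun i => Ω.pull ε (df i)) p)) g) : Ω.IsTrace ε f df g := by
  refine ⟨hs.memg, fun ψ hψ _ i => ?_⟩
  have hP : ∀ j : Fin 2, 𝒞 (fun x => (if j = i then 1 else 0) * ψ x) := fun j =>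
    contDiff_const.mul hψ
  have hg := h.green hf hdf hP (fun j => PerSmooth.pull Ω ε (hP j)) (fun j p _ => rfl)
    (fun p => rfl) (fun p => rfl)
  rw [hs.horiz, hs.vert, zero_sub] at hg
  · have e : (∫ x in Ω.thin ε, (f x * 𝒟 0 (fun x => (if (0 : Fin 2) = i then 1 else 0) *
        ψ x) x + df 0 x * ((if (0 : Fin 2) = i then 1 else 0) * ψ x))) +
        ∫ x in Ω.thin ε, (f x * 𝒟 1 (fun x => (if (1 : Fin 2) = i then 1 else 0) *
        ψ x) x + df 1 x * ((if (1 : Fin 2) = i then 1 else 0) * ψ x)) =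
        ∫ x in Ω.thin ε, (f x * 𝒟 i ψ x + df i x * ψ x) := by
      have hz : ∀ k x, 𝒟 k (fun _ : Plane => (0 : ℝ)) x = 0 := fun k x => by
        simp [partialDeriv]
      fin_cases i <;> simp [hz]
    rw [← e, hg, h.bdryIntegral_eq, neg_sub, sub_eq_add_neg, ← iint_neg]
    congr 1
    · refine iint_congr fun s _ => ?_
      simp only [bdryCurve_eq, bdryNormal_eq, norComp, pull, jac]
      fin_cases i <;> simp <;> ring
    · refine iint_congr fun s _ => ?_
      simp only [bdryCurve_eq, bdryNormal_eq, norComp, pull]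
      fin_cases i <;> simp <;> ring
  · exact (Ω.perSmooth_jac ε).mul (((Ω.perSmooth_nor 0).mul (PerSmooth.pull Ω ε (hP 0))).add
      ((Ω.perSmooth_nor 1).mul (PerSmooth.pull Ω ε (hP 1))))
  · exact (PerSmooth.const ε).mul (((Ω.perSmooth_tan 0).mul (PerSmooth.pull Ω ε (hP 0))).add
      ((Ω.perSmooth_tan 1).mul (PerSmooth.pull Ω ε (hP 1))))

theorem tanComp_tan (Y : Plane → ℝ) (p : Plane) :
    Ω.tanComp (fun i p => Ω.tan i (p 0) * Y p) p = Y p := by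
  simp only [tanComp]; linear_combination Y p * Ω.tan_sq (p 0)

theorem norComp_tan (Y : Plane → ℝ) (p : Plane) :
    Ω.norComp (fun i p => Ω.tan i (p 0) * Y p) p = 0 := by
  simp only [norComp, nor_zero, nor_one]; ring

theorem tanComp_nor (Y : Plane → ℝ) (p : Plane) :
    Ω.tanComp (fun i p => Ω.nor i (p 0) * Y p) p = 0 := by
  simp only [tanComp, nor_zero, nor_one]; ring

theorem norComp_nor (Y : Plane → ℝ) (p : Plane) :
    Ω.norComp (fun i p => Ω.nor i (p 0) * Y p) p = Y p := by
  simp only [norComp, nor_zero, nor_one]; linear_combination Y p * Ω.tan_sq (p 0)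

/-- The tangential field `(χ/ε) τ` isolates the horizontal identity and the normal field `(χ/jac) ν`
the vertical one. Weak derivatives on `ω_ε` are tested with the push-forwards of these fields, which
are supported inside `ω_ε` when `χ` vanishes near the sides. -/
theorem Tubular.exists_stripGrad (h : Ω.Tubular ε) {f : Plane → ℝ} {df : Fin 2 → Plane → ℝ}
    (hf : 𝓛 f (Ω.thin ε))
    (hdf : ∀ i, 𝓛 (df i) (Ω.thin ε))
    (hw : ∀ i, IsWeakPartial (Ω.thin ε) i f (df i)) :
    ∃ g, Ω.StripGrad (Ω.pull ε f) (fun p => Ω.jac ε p * Ω.tanComp (fun i => Ω.pull ε (df i)) p)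
      (fun p => -(ε * Ω.norComp (fun i => Ω.pull ε (df i)) p)) g := by
  have hG : ∀ i, 𝓛 (Ω.pull ε (df i)) Ω.refSet := fun i =>
    h.memLp_comp (hdf i)
  have key : ∀ (Z : Fin 2 → Plane → ℝ) (X Y : Plane → ℝ), (∀ i, Ω.PerSmooth (Z i)) →
      (∃ a b : ℝ, 0 < a ∧ b < 1 ∧ ∀ i, ∀ p : Plane, p 1 ∉ Icc a b → Z i p = 0) →
      (∀ p, X p = ε * Ω.tanComp Z p) → (∀ p, Y p = Ω.jac ε p * Ω.norComp Z p) →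
      (∫ p in Ω.refSet, (Ω.pull ε f p * 𝒟 0 X p +
        Ω.jac ε p * Ω.tanComp (fun i => Ω.pull ε (df i)) p * X p)) -
      ∫ p in Ω.refSet, (Ω.pull ε f p * 𝒟 1 Y p +
        -(ε * Ω.norComp (fun i => Ω.pull ε (df i)) p) * Y p) = 0 := by
    rintro Z X Y hZ ⟨a, b, ha, hb, h0⟩ hX hY
    choose ψ h1 h2 h3 h4 using fun i => h.exists_push (hZ i) (α := a) (β := b) (by linarith)
      (by linarith) (h0 i)
    rw [← h.green hf hdf h1 hZ (fun i p hp => h3 i p ⟨by linarith [hp.2.1], by linarith [hp.2.2]⟩)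
      hX hY, (hw 0).integral_eq hf (hdf 0) ⟨h1 0, h2 0, h4 0 ha hb⟩,
      (hw 1).integral_eq hf (hdf 1) ⟨h1 1, h2 1, h4 1 ha hb⟩, add_zero]
  refine SmoothDomain.exists_stripGrad (h.memLp_comp hf)
    (Ω.memLp_mul (Ω.contDiff_jac ε).continuous (Ω.memLp_tanComp hG))
    (((Ω.memLp_norComp hG).const_mul ε).neg) (fun χ hχ hsup => ?_) (fun χ hχ hsup => ?_)
  · obtain ⟨a, b, ha, hb, h0⟩ := hsup
    have := key (fun i p => Ω.tan i (p 0) * (ε⁻¹ * χ p)) χ (fun _ => 0)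
      (fun i => (Ω.perSmooth_tan i).mul ((PerSmooth.const _).mul hχ))
      ⟨a, b, ha, hb, fun i p hp => by rw [h0 p hp]; simp⟩
      (fun p => by rw [tanComp_tan, mul_inv_cancel_left₀ h.pos.ne'])
      (fun p => by rw [norComp_tan, mul_zero])
    simpa [partialDeriv] using this
  · obtain ⟨a, b, ha, hb, h0⟩ := hsup
    have hd := h.perSmooth_div_jac hχ (a := a) (b := b) (by linarith) (by linarith) h0
    have := key (fun i p => Ω.nor i (p 0) * (χ p / Ω.jac ε p)) (fun _ => 0) χ
      (fun i => (Ω.perSmooth_nor i).mul hd)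
      ⟨a, b, ha, hb, fun i p hp => by rw [h0 p hp]; simp⟩
      (fun p => by rw [tanComp_nor, mul_zero])
      (fun p => by
        rw [norComp_nor]
        by_cases hp : p 1 ∈ Icc a b
        · rw [mul_div_cancel₀ _ (h.jac_pos ⟨by linarith [hp.1], by linarith [hp.2]⟩).ne']
        · rw [h0 p hp]; simp)
    simpa [partialDeriv] using this

/-- Again the fields `(χ/ε) τ` and `(χ/jac) ν`, but now `χ` reaches the boundary curves. A cutoff
equal to 1 on the closed strip makes their push-forwards compactly supported in the plane, as the
definition of the trace requires. -/
theorem IsTrace.stripGrad (h : Ω.Tubular ε) {f : Plane → ℝ} {df : Fin 2 → Plane → ℝ}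
    {g : Fin 2 → ℝ → ℝ} (hf : 𝓛 f (Ω.thin ε))
    (hdf : ∀ i, 𝓛 (df i) (Ω.thin ε)) (ht : Ω.IsTrace ε f df g) :
    Ω.StripGrad (Ω.pull ε f) (fun p => Ω.jac ε p * Ω.tanComp (fun i => Ω.pull ε (df i)) p)
      (fun p => -(ε * Ω.norComp (fun i => Ω.pull ε (df i)) p)) g := by
  have hG : ∀ i, 𝓛 (Ω.pull ε (df i)) Ω.refSet := fun i =>
    h.memLp_comp (hdf i)
  have key : ∀ (Z : Fin 2 → Plane → ℝ) (X Y : Plane → ℝ), (∀ i, Ω.PerSmooth (Z i)) →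
      (∀ i, ∀ p : Plane, p 1 ∉ Icc (-(1 / 2) : ℝ) (3 / 2) → Z i p = 0) →
      (∀ p, X p = ε * Ω.tanComp Z p) → (∀ p, Y p = Ω.jac ε p * Ω.norComp Z p) →
      (∫ p in Ω.refSet, (Ω.pull ε f p * 𝒟 0 X p +
        Ω.jac ε p * Ω.tanComp (fun i => Ω.pull ε (df i)) p * X p)) -
      ∫ p in Ω.refSet, (Ω.pull ε f p * 𝒟 1 Y p +
        -(ε * Ω.norComp (fun i => Ω.pull ε (df i)) p) * Y p) =
      (∫ s in 0..Ω.length, g 0 s * Y !₂[s, 0]) -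
        ∫ s in 0..Ω.length, g 1 s * Y !₂[s, 1] := by
    intro Z X Y hZ h0 hX hY
    choose ψ h1 h2 h3 h4 using fun i => h.exists_push (hZ i) (α := -(1 / 2)) (β := 3 / 2)
      (by norm_num) (by norm_num) (h0 i)
    rw [← h.green hf hdf h1 hZ (fun i p hp => h3 i p ⟨by linarith [hp.2.1], by linarith [hp.2.2]⟩)
      hX hY, ht.2 _ (h1 0) (h2 0) 0, ht.2 _ (h1 1) (h2 1) 1, h.bdryIntegral_eq, h.bdryIntegral_eq]
    simp only [bdryCurve_eq, bdryNormal_eq]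
    have hv : ∀ (i : Fin 2) (s t : ℝ), t ∈ Ioo (-1 : ℝ) 2 →
        ψ i (Ω.fermi ε !₂[s, t]) = Z i !₂[s, t] := fun i s t hst => h3 i _ (by simpa using hst)
    have z0 : (((0 : Fin 2) : ℕ) : ℝ) = 0 := by simp
    have z1 : (((1 : Fin 2) : ℕ) : ℝ) = 1 := by simp
    simp only [z0, z1, hv _ _ 0 ⟨by norm_num, by norm_num⟩, hv _ _ 1 ⟨by norm_num, by norm_num⟩]
    have hZc : ∀ (i : Fin 2) (t : ℝ), Continuous fun s => Z i !₂[s, t] := fun i t =>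
      ((hZ i).trace t).1.continuous
    have hnc : ∀ i : Fin 2, Continuous fun s => Ω.nor i s := fun i => (Ω.contDiff_nor i).continuous
    have hjc : Continuous fun s => Ω.jac ε !₂[s, 1] := ((Ω.perSmooth_jac ε).trace 1).1.continuous
    have i0 : ∀ i : Fin 2, IntervalIntegrable
        (fun s => g 0 s * Z i !₂[s, 0] * ((1 - 2 * 0) * Ω.nor i s)) volume 0 Ω.length := fun i => by
      have := intervalIntegrable_mul_continuous (ht.1 0) ((hZc i 0).mul (hnc i))
      refine this.congr fun s _ => ?_
      simp only [Pi.mul_apply]; ring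
    have i1 : ∀ i : Fin 2, IntervalIntegrable
        (fun s => g 1 s * Z i !₂[s, 1] * ((1 - 2 * 1) * Ω.nor i s) * Ω.jac ε !₂[s, 1])
        volume 0 Ω.length := fun i => by
      have := (intervalIntegrable_mul_continuous (ht.1 1) (((hZc i 1).mul (hnc i)).mul hjc)).neg
      refine this.congr fun s _ => ?_
      simp only [Pi.mul_apply, Pi.neg_apply]; ring
    rw [add_add_add_comm, ← iint_add (i0 0) (i0 1),
      ← iint_add (i1 0) (i1 1),
      sub_eq_add_neg (∫ s in 0..Ω.length, g 0 s * Y !₂[s, 0]), ← iint_neg]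
    congr 1 <;>
    · refine iint_congr fun s _ => ?_
      simp only [hY, norComp]
      simp [jac]
      try ring
  have hcut : ∀ χ : Plane → ℝ, Ω.PerSmooth χ → Ω.PerSmooth fun p => stripCutoff (p 1) * χ p :=
    fun χ hχ => (PerSmooth.snd contDiff_stripCutoff).mul hχ
  have hd : ∀ (χ : Plane → ℝ) (k : Fin 2), ∀ p ∈ Ω.refSet,
      𝒟 k (fun p => stripCutoff (p 1) * χ p) p = 𝒟 k χ p := by
    intro χ k p hp
    refine partialDeriv_congr ?_ k
    filter_upwards [Ω.isOpen_refSet.mem_nhds hp] with q hq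
    rw [stripCutoff_eq_one (Ioo_subset_Icc_self hq.2), one_mul]
  refine ⟨h.memLp_comp hf, Ω.memLp_mul (Ω.contDiff_jac ε).continuous (Ω.memLp_tanComp hG),
    ((Ω.memLp_norComp hG).const_mul ε).neg, ht.1, fun χ hχ => ?_, fun χ hχ => ?_⟩
  · have := key (fun i p => Ω.tan i (p 0) * (ε⁻¹ * (stripCutoff (p 1) * χ p)))
      (fun p => stripCutoff (p 1) * χ p) (fun _ => 0)
      (fun i => (Ω.perSmooth_tan i).mul ((PerSmooth.const _).mul (hcut χ hχ)))
      (fun i p hp => by rw [stripCutoff_eq_zero hp]; simp)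
      (fun p => by rw [tanComp_tan, mul_inv_cancel_left₀ h.pos.ne'])
      (fun p => by rw [norComp_tan, mul_zero])
    simp only [partialDeriv, fderiv_fun_const, mul_zero, Pi.zero_apply,
      zero_apply, add_zero, integral_zero, sub_zero,
      iint_zero] at this
    rw [← this]
    refine Ω.integral_congr_refSet fun p hp => ?_
    have e := hd χ 0 p hp
    rw [partialDeriv] at e
    rw [e, stripCutoff_eq_one (Ioo_subset_Icc_self hp.2), one_mul]
  · have hd' := h.perSmooth_div_jac (hcut χ hχ) (a := -(1 / 2)) (b := 3 / 2) (by norm_num)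
      (by norm_num) (fun p hp => by rw [stripCutoff_eq_zero hp, zero_mul])
    have := key (fun i p => Ω.nor i (p 0) * (stripCutoff (p 1) * χ p / Ω.jac ε p)) (fun _ => 0)
      (fun p => stripCutoff (p 1) * χ p) (fun i => (Ω.perSmooth_nor i).mul hd')
      (fun i p hp => by rw [stripCutoff_eq_zero hp]; simp)
      (fun p => by rw [tanComp_nor, mul_zero])
      (fun p => by
        rw [norComp_nor]
        by_cases hp : p 1 ∈ Icc (-(1 / 2) : ℝ) (3 / 2)
        · rw [mul_div_cancel₀ _ (h.jac_pos ⟨by linarith [hp.1], by linarith [hp.2]⟩).ne']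
        · rw [stripCutoff_eq_zero hp]; simp)
    have z : ∀ p, 𝒟 0 (fun _ : Plane => (0 : ℝ)) p = 0 := fun p => by
      simp [partialDeriv]
    simp only [z, mul_zero, add_zero, integral_zero, zero_sub, Matrix.cons_val_one,
      Matrix.cons_val_fin_one] at this
    rw [stripCutoff_eq_one ⟨le_rfl, zero_le_one⟩, stripCutoff_eq_one ⟨zero_le_one, le_rfl⟩] at this
    simp only [one_mul] at this
    rw [← neg_sub, ← this, neg_neg]
    refine Ω.integral_congr_refSet fun p hp => ?_
    rw [hd χ 1 p hp, stripCutoff_eq_one (Ioo_subset_Icc_self hp.2), one_mul]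

theorem Tubular.isTrace_trace (h : Ω.Tubular ε) {f : Plane → ℝ} {df : Fin 2 → Plane → ℝ}
    (hf : 𝓛 f (Ω.thin ε))
    (hdf : ∀ i, 𝓛 (df i) (Ω.thin ε))
    (hw : ∀ i, IsWeakPartial (Ω.thin ε) i f (df i)) : Ω.IsTrace ε f df (Ω.trace ε f df) := by
  obtain ⟨g, hg⟩ := h.exists_stripGrad hf hdf hw
  have hex : ∃ g, Ω.IsTrace ε f df g := ⟨g, hg.isTrace h hf hdf⟩
  rw [trace, dif_pos hex]
  exact hex.choose_spec

theorem Tubular.stripGrad_trace (h : Ω.Tubular ε) {f : Plane → ℝ} {df : Fin 2 → Plane → ℝ}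
    (hf : 𝓛 f (Ω.thin ε))
    (hdf : ∀ i, 𝓛 (df i) (Ω.thin ε))
    (hw : ∀ i, IsWeakPartial (Ω.thin ε) i f (df i)) :
    Ω.StripGrad (Ω.pull ε f) (fun p => Ω.jac ε p * Ω.tanComp (fun i => Ω.pull ε (df i)) p)
      (fun p => -(ε * Ω.norComp (fun i => Ω.pull ε (df i)) p)) (Ω.trace ε f df) :=
  (h.isTrace_trace hf hdf hw).stripGrad h hf hdf

end SmoothDomain

/-! ### Algebra of weak derivatives and the vector space structure of `H²` -/

theorem partialDeriv_comm {ψ : Plane → ℝ} (h : 𝒞 ψ) (i j : Fin 2) (p : Plane) :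
    𝒟 i (𝒟 j ψ) p = 𝒟 j (𝒟 i ψ) p := by
  have hs : IsSymmSndFDerivAt ℝ ψ p := 
    (h.contDiffAt (x := p)).isSymmSndFDerivAt (by
      simp only [minSmoothness_of_isRCLikeNormedField]
      exact WithTop.coe_le_coe.2 (le_top (a := (2 : ℕ∞))))
  have hd : DifferentiableAt ℝ (fderiv ℝ ψ) p :=
    ((h.fderiv_right (m := ∞) (by simp)).differentiable (by simp)) p
  have e : ∀ k l, 𝒟 k (partialDeriv l ψ) p =
      fderiv ℝ (fderiv ℝ ψ) p (EuclideanSpace.single k 1) (EuclideanSpace.single l 1) := by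
    intro k l
    have : HasFDerivAt (partialDeriv l ψ) _ p :=
      hd.hasFDerivAt.clm_apply (hasFDerivAt_const (EuclideanSpace.single l (1 : ℝ) : Plane) p)
    rw [partialDeriv_of_hasFDerivAt this]
    simp
  rw [e, e, hs.eq]

theorem IsWeakPartial.add {U : Set Plane} {i : Fin 2} {f g f' g' : Plane → ℝ}
    (h : IsWeakPartial U i f g) (h' : IsWeakPartial U i f' g') (hf : 𝓛 f U)
    (hg : 𝓛 g U) (hf' : 𝓛 f' U)
    (hg' : 𝓛 g' U) : IsWeakPartial U i (f + f') (g + g') := by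
  intro ψ h1 h2 h3
  have ht : IsTest U ψ := ⟨h1, h2, h3⟩
  simp only [Pi.add_apply, add_mul]
  rw [integral_add (integrable_mul_of_memLp hf ((ht.partialDeriv i).memLp _))
    (integrable_mul_of_memLp hf' ((ht.partialDeriv i).memLp _)),
    integral_add (integrable_mul_of_memLp hg (ht.memLp _))
      (integrable_mul_of_memLp hg' (ht.memLp _)), h ψ h1 h2 h3, h' ψ h1 h2 h3]
  ring

theorem IsWeakPartial.const_smul {U : Set Plane} {i : Fin 2} {f g : Plane → ℝ}
    (h : IsWeakPartial U i f g) (c : ℝ) : IsWeakPartial U i (c • f) (c • g) := by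
  intro ψ h1 h2 h3
  simp only [Pi.smul_apply, smul_eq_mul, mul_assoc]
  rw [integral_const_mul, integral_const_mul, h ψ h1 h2 h3]
  ring

theorem IsWeakPartial.zero {U : Set Plane} {i : Fin 2} : IsWeakPartial U i 0 0 := by
  intro ψ _ _ _; simp

theorem IsWeakPartial.congr {U : Set Plane} {i : Fin 2} {f g f' g' : Plane → ℝ}
    (h : IsWeakPartial U i f g) (hf : f =ᵐ[𝓁 U] f')
    (hg : g =ᵐ[𝓁 U] g') : IsWeakPartial U i f' g' := by
  intro ψ h1 h2 h3
  have e1 : ∫ x in U, f' x * 𝒟 i ψ x = ∫ x in U, f x * 𝒟 i ψ x := by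
    refine integral_congr_ae ?_
    filter_upwards [hf] with x hx
    rw [hx]
  have e2 : ∫ x in U, g' x * ψ x = ∫ x in U, g x * ψ x := by
    refine integral_congr_ae ?_
    filter_upwards [hg] with x hx
    rw [hx]
  rw [e1, e2, h ψ h1 h2 h3]

/-- Weak derivatives of functions vanishing almost everywhere vanish almost everywhere. -/
theorem IsWeakPartial.ae_eq_zero {U : Set Plane} (hU : IsOpen U) {i : Fin 2} {f g : Plane → ℝ}
    (h : IsWeakPartial U i f g) (hg : 𝓛 g U)
    (hf : f =ᵐ[𝓁 U] 0) : g =ᵐ[𝓁 U] 0 := by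
  refine ae_eq_zero_of_forall_isTest hU hg fun ψ hψ => ?_
  have h1 := (h.congr hf (Filter.EventuallyEq.refl _ g)) ψ hψ.smooth hψ.compact hψ.subset
  simp only [Pi.zero_apply, zero_mul, integral_zero] at h1
  linarith

theorem isWeakPartial_of_contDiff {U : Set Plane} {ψ : Plane → ℝ} (h : 𝒞 ψ)
    (i : Fin 2) : IsWeakPartial U i ψ (𝒟 i ψ) := by
  intro χ h1 h2 h3
  have hχ : IsTest U χ := ⟨h1, h2, h3⟩
  have c1 : Continuous ψ := h.continuous
  have c2 : Continuous (𝒟 i ψ) := (partialDeriv_contDiff h i).continuous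
  have c3 := (hχ.partialDeriv i).smooth.continuous
  have hI := integral_mul_fderiv_eq_neg_fderiv_mul_of_integrable (μ := (volume : Measure Plane))
    (f := ψ) (g := χ) (v := EuclideanSpace.single i 1)
    ((c2.mul h1.continuous).integrable_of_hasCompactSupport h2.mul_left)
    ((c1.mul c3).integrable_of_hasCompactSupport (hχ.partialDeriv i).compact.mul_left)
    ((c1.mul h1.continuous).integrable_of_hasCompactSupport h2.mul_left)
    (fun x _ => h.diffAt x) (fun x _ => h1.diffAt x)
  have z : ∀ x, x ∉ U → χ x = 0 := fun x hx =>
    image_eq_zero_of_notMem_tsupport fun hm => hx (h3 hm)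
  have z' : ∀ x, x ∉ U → 𝒟 i χ x = 0 := fun x hx =>
    image_eq_zero_of_notMem_tsupport fun hm => hx ((hχ.partialDeriv i).subset hm)
  rw [setIntegral_eq_integral_of_forall_compl_eq_zero (fun x hx => by rw [z' x hx, mul_zero]),
    setIntegral_eq_integral_of_forall_compl_eq_zero (fun x hx => by rw [z x hx, mul_zero])]
  exact hI

namespace SobolevH2

variable {U : Set Plane}

/-- The triples underlying `H²(U)`. -/
def data (U : Set Plane) :
    Submodule ℝ ((Plane → ℝ) × (Fin 2 → Plane → ℝ) × (Fin 2 → Fin 2 → Plane → ℝ)) where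
  carrier := {f | MemLp f.1 2 (𝓁 U) ∧ (∀ i, 𝓛 (f.2.1 i) U) ∧
    (∀ i j, 𝓛 (f.2.2 i j) U) ∧ (∀ i, IsWeakPartial U i f.1 (f.2.1 i)) ∧
    ∀ i j, IsWeakPartial U j (f.2.1 i) (f.2.2 i j)}
  add_mem' := fun ha hb => ⟨ha.1.add hb.1, fun i => (ha.2.1 i).add (hb.2.1 i),
    fun i j => (ha.2.2.1 i j).add (hb.2.2.1 i j),
    fun i => (ha.2.2.2.1 i).add (hb.2.2.2.1 i) ha.1 (ha.2.1 i) hb.1 (hb.2.1 i),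
    fun i j => (ha.2.2.2.2 i j).add (hb.2.2.2.2 i j) (ha.2.1 i) (ha.2.2.1 i j) (hb.2.1 i)
      (hb.2.2.1 i j)⟩
  zero_mem' := ⟨MemLp.zero', fun _ => MemLp.zero', fun _ _ => MemLp.zero',
    fun _ => IsWeakPartial.zero, fun _ _ => IsWeakPartial.zero⟩
  smul_mem' := fun c _ ha => ⟨ha.1.const_smul c, fun i => (ha.2.1 i).const_smul c,
    fun i j => (ha.2.2.1 i j).const_smul c, fun i => (ha.2.2.2.1 i).const_smul c,
    fun i j => (ha.2.2.2.2 i j).const_smul c⟩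

/-- `H²(U)` as a space of triples. -/
def equivData (U : Set Plane) : SobolevH2 U ≃ data U where
  toFun f := ⟨(f.val, f.grad, f.hess), f.memLp_val, f.memLp_grad, f.memLp_hess, f.weak_grad,
    f.weak_hess⟩
  invFun f := ⟨f.1.1, f.1.2.1, f.1.2.2, f.2.1, f.2.2.1, f.2.2.2.1, f.2.2.2.2.1, f.2.2.2.2.2⟩
  left_inv _ := rfl
  right_inv _ := rfl

-- Elements are representatives, not classes of functions equal almost everywhere. Forms built on
-- this space are therefore only semidefinite, which is all that `FormPair` asks for.
instance : AddCommGroup (SobolevH2 U) := (equivData U).addCommGroup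

instance : Module ℝ (SobolevH2 U) := (equivData U).module ℝ

theorem add_val (f g : SobolevH2 U) : (f + g).val = f.val + g.val := rfl
theorem add_grad (f g : SobolevH2 U) (i : Fin 2) : (f + g).grad i = f.grad i + g.grad i := rfl
theorem add_hess (f g : SobolevH2 U) (i j : Fin 2) :
    (f + g).hess i j = f.hess i j + g.hess i j := rfl
theorem sub_val (f g : SobolevH2 U) : (f - g).val = f.val - g.val := rfl
theorem sub_grad (f g : SobolevH2 U) (i : Fin 2) : (f - g).grad i = f.grad i - g.grad i := rfl
theorem sub_hess (f g : SobolevH2 U) (i j : Fin 2) :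
    (f - g).hess i j = f.hess i j - g.hess i j := rfl
theorem smul_val (c : ℝ) (f : SobolevH2 U) : (c • f).val = c • f.val := rfl
theorem smul_grad (c : ℝ) (f : SobolevH2 U) (i : Fin 2) : (c • f).grad i = c • f.grad i := rfl
theorem smul_hess (c : ℝ) (f : SobolevH2 U) (i j : Fin 2) :
    (c • f).hess i j = c • f.hess i j := rfl

/-- Partial derivatives of test functions commute, and this passes to distributional derivatives. -/
theorem hess_symm (hU : IsOpen U) (f : SobolevH2 U) :
    f.hess 0 1 =ᵐ[𝓁 U] f.hess 1 0 := by
  have h0 : f.hess 0 1 - f.hess 1 0 =ᵐ[𝓁 U] 0 := by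
    refine ae_eq_zero_of_forall_isTest hU ((f.memLp_hess 0 1).sub (f.memLp_hess 1 0)) fun ψ hψ => ?_
    simp only [Pi.sub_apply, sub_mul]
    rw [integral_sub (integrable_mul_of_memLp (f.memLp_hess 0 1) (hψ.memLp _))
      (integrable_mul_of_memLp (f.memLp_hess 1 0) (hψ.memLp _))]
    have e1 := f.weak_hess 0 1 ψ hψ.smooth hψ.compact hψ.subset
    have e2 := f.weak_hess 1 0 ψ hψ.smooth hψ.compact hψ.subset
    have d1 := hψ.partialDeriv 1
    have d0 := hψ.partialDeriv 0
    have e3 := f.weak_grad 0 _ d1.smooth d1.compact d1.subset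
    have e4 := f.weak_grad 1 _ d0.smooth d0.compact d0.subset
    simp only [partialDeriv_comm hψ.smooth 0 1] at e3
    linarith
  filter_upwards [h0] with x hx
  have : f.hess 0 1 x - f.hess 1 0 x = 0 := hx
  linarith

/-- A smooth function with compact support as an element of `H²(U)`. -/
def ofSmooth (U : Set Plane) (ψ : Plane → ℝ) (h : 𝒞 ψ) (hc : HasCompactSupport ψ) :
    SobolevH2 U where
  val := ψ
  grad i := 𝒟 i ψ
  hess i j := 𝒟 j (𝒟 i ψ)
  memLp_val := h.continuous.memLp_of_hasCompactSupport hc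
  memLp_grad i := ((IsTest.mk h hc (subset_univ _)).partialDeriv i).memLp _
  memLp_hess i j := (((IsTest.mk h hc (subset_univ _)).partialDeriv i).partialDeriv j).memLp _
  weak_grad := isWeakPartial_of_contDiff h
  weak_hess i := isWeakPartial_of_contDiff (partialDeriv_contDiff h i)

end SobolevH2

/-- A bilinear form from a symmetric function that is linear in the first variable. -/
def bilinOfSymm {V : Type*} [AddCommGroup V] [Module ℝ V] (f : V → V → ℝ)
    (hs : ∀ u v, f u v = f v u) (ha : ∀ u u' v, f (u + u') v = f u v + f u' v)
    (hm : ∀ (c : ℝ) u v, f (c • u) v = c * f u v) : V →ₗ[ℝ] V →ₗ[ℝ] ℝ :=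
  LinearMap.mk₂ ℝ f ha hm (fun u v w => by rw [hs, ha, hs v, hs w])
    (fun c u v => by rw [hs, hm, hs v]; rfl)

theorem SobolevH2.hessForm_integrable {U : Set Plane} (f g : SobolevH2 U) (i j : Fin 2) :
    Integrable (fun x => f.hess i j x * g.hess i j x) (𝓁 U) :=
  integrable_mul_of_memLp (f.memLp_hess i j) (g.memLp_hess i j)

/-- The form `∫ D²f : D²g` as a bilinear map. -/
def SobolevH2.hessBilin (U : Set Plane) : SobolevH2 U →ₗ[ℝ] SobolevH2 U →ₗ[ℝ] ℝ :=
  bilinOfSymm hessForm (fun u v => by simp only [hessForm, mul_comm])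
    (fun u u' v => by
      have hi : ∀ w : SobolevH2 U, Integrable (fun x => ∑ i : Fin 2, ∑ j : Fin 2,
          w.hess i j x * v.hess i j x) (𝓁 U) := fun w =>
        integrable_finsetSum _ fun i _ => integrable_finsetSum _ fun j _ =>
          hessForm_integrable w v i j
      simp only [hessForm]
      rw [← integral_add (hi u) (hi u')]
      congr 1; ext x
      simp only [add_hess, Pi.add_apply, Fin.sum_univ_two]; ring)
    (fun c u v => by
      simp only [hessForm]
      rw [← integral_const_mul]
      congr 1; ext x
      simp only [smul_hess, Pi.smul_apply, smul_eq_mul, Fin.sum_univ_two]; ring)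

namespace SmoothDomain

variable {Ω : SmoothDomain} {ε : ℝ}

/-! ### The forms of the Steklov problem -/

theorem Tubular.trace_unique (h : Ω.Tubular ε) {f : Plane → ℝ} {df : Fin 2 → Plane → ℝ}
    {g : Fin 2 → ℝ → ℝ}
    (hf : 𝓛 f (Ω.thin ε))
    (hdf : ∀ i, 𝓛 (df i) (Ω.thin ε))
    (hw : ∀ i, IsWeakPartial (Ω.thin ε) i f (df i))
    (hg : Ω.StripGrad (Ω.pull ε f) (fun p => Ω.jac ε p * Ω.tanComp (fun i => Ω.pull ε (df i)) p)
      (fun p => -(ε * Ω.norComp (fun i => Ω.pull ε (df i)) p)) g) (j : Fin 2) :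
    Ω.trace ε f df j =ᵐ[𝓁 (Ioc 0 Ω.length)] g j :=
  (h.stripGrad_trace hf hdf hw).trace_unique hg j

theorem Tubular.trace_add (h : Ω.Tubular ε) {f f' : Plane → ℝ} {df df' : Fin 2 → Plane → ℝ}
    (hf : 𝓛 f (Ω.thin ε))
    (hdf : ∀ i, 𝓛 (df i) (Ω.thin ε))
    (hw : ∀ i, IsWeakPartial (Ω.thin ε) i f (df i))
    (hf' : 𝓛 f' (Ω.thin ε))
    (hdf' : ∀ i, 𝓛 (df' i) (Ω.thin ε))
    (hw' : ∀ i, IsWeakPartial (Ω.thin ε) i f' (df' i)) (j : Fin 2) :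
    Ω.trace ε (f + f') (fun i => df i + df' i) j =ᵐ[𝓁 (Ioc 0 Ω.length)]
      fun s => Ω.trace ε f df j s + Ω.trace ε f' df' j s := by
  refine h.trace_unique (g := fun j s => Ω.trace ε f df j s + Ω.trace ε f' df' j s) (hf.add hf')
    (fun i => (hdf i).add (hdf' i))
    (fun i => (hw i).add (hw' i) hf (hdf i) hf' (hdf' i)) ?_ j
  convert! (h.stripGrad_trace hf hdf hw).add (h.stripGrad_trace hf' hdf' hw') using 1
  · ext p; simp only [tanComp, pull, Pi.add_apply]; ring
  · ext p; simp only [norComp, pull, Pi.add_apply]; ring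

theorem Tubular.trace_smul (h : Ω.Tubular ε) {f : Plane → ℝ} {df : Fin 2 → Plane → ℝ}
    (hf : 𝓛 f (Ω.thin ε))
    (hdf : ∀ i, 𝓛 (df i) (Ω.thin ε))
    (hw : ∀ i, IsWeakPartial (Ω.thin ε) i f (df i)) (c : ℝ) (j : Fin 2) :
    Ω.trace ε (c • f) (fun i => c • df i) j =ᵐ[𝓁 (Ioc 0 Ω.length)]
      fun s => c * Ω.trace ε f df j s := by
  refine h.trace_unique (g := fun j s => c * Ω.trace ε f df j s) (hf.const_smul c)
    (fun i => (hdf i).const_smul c)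
    (fun i => (hw i).const_smul c) ?_ j
  convert! (h.stripGrad_trace hf hdf hw).const_mul c using 1
  · ext p; simp only [tanComp, pull, Pi.smul_apply, smul_eq_mul]; ring
  · ext p; simp only [norComp, pull, Pi.smul_apply, smul_eq_mul]; ring

/-- The component of the trace of the gradient along the outer normal of `Ω`. -/
def normalTrace (u : Ω.H2 ε) (j : Fin 2) (s : ℝ) : ℝ :=
  Ω.nor 0 s * Ω.trace ε (u.grad 0) (u.hess 0) j s + Ω.nor 1 s * Ω.trace ε (u.grad 1) (u.hess 1) j s

/-- The tangential component of the trace of the gradient. -/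
def tangentTrace (u : Ω.H2 ε) (j : Fin 2) (s : ℝ) : ℝ :=
  Ω.tan 0 s * Ω.trace ε (u.grad 0) (u.hess 0) j s + Ω.tan 1 s * Ω.trace ε (u.grad 1) (u.hess 1) j s

theorem normalDeriv_eq (u : Ω.H2 ε) (j : Fin 2) (s : ℝ) :
    normalDeriv u j s = (1 - 2 * ((j : ℕ) : ℝ)) * normalTrace u j s := by
  simp only [normalDeriv, normalTrace, bdryNormal_eq, Fin.sum_univ_two]; ring

/-- On the inner curve the outer normal of `ω_ε` is opposite to that of `Ω`, but the sign cancels in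
a product. From here on both curves use the normal of `Ω`, for which the strip identities are
uniform. -/
theorem normalDeriv_mul (u v : Ω.H2 ε) (j : Fin 2) (s : ℝ) :
    normalDeriv u j s * normalDeriv v j s = normalTrace u j s * normalTrace v j s := by
  rw [normalDeriv_eq, normalDeriv_eq]
  fin_cases j <;> simp
  ring

theorem Tubular.stripGrad_val (h : Ω.Tubular ε) (u : Ω.H2 ε) :
    Ω.StripGrad (Ω.pull ε u.val)
      (fun p => Ω.jac ε p * Ω.tanComp (fun i => Ω.pull ε (u.grad i)) p)
      (fun p => -(ε * Ω.norComp (fun i => Ω.pull ε (u.grad i)) p)) (bdryVal u) :=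
  h.stripGrad_trace u.memLp_val u.memLp_grad u.weak_grad

theorem Tubular.stripGrad_grad (h : Ω.Tubular ε) (u : Ω.H2 ε) (i : Fin 2) :
    Ω.StripGrad (Ω.pull ε (u.grad i))
      (fun p => Ω.jac ε p * Ω.tanComp (fun j => Ω.pull ε (u.hess i j)) p)
      (fun p => -(ε * Ω.norComp (fun j => Ω.pull ε (u.hess i j)) p))
      (Ω.trace ε (u.grad i) (u.hess i)) :=
  h.stripGrad_trace (u.memLp_grad i) (u.memLp_hess i) (u.weak_hess i)

theorem Tubular.memLp_bdryVal (h : Ω.Tubular ε) (u : Ω.H2 ε) (j : Fin 2) :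
    𝓛 (bdryVal u j) (Ioc 0 Ω.length) := (h.stripGrad_val u).memg j

theorem Tubular.memLp_normalTrace (h : Ω.Tubular ε) (u : Ω.H2 ε) (j : Fin 2) :
    𝓛 (normalTrace u j) (Ioc 0 Ω.length) :=
  (memLp_mul_one ((h.stripGrad_grad u 0).memg j) (Ω.contDiff_nor 0).continuous).add
    (memLp_mul_one ((h.stripGrad_grad u 1).memg j) (Ω.contDiff_nor 1).continuous)

theorem Tubular.bdryVal_add (h : Ω.Tubular ε) (u v : Ω.H2 ε) (j : Fin 2) :
    bdryVal (u + v) j =ᵐ[𝓁 (Ioc 0 Ω.length)] fun s => bdryVal u j s + bdryVal v j s :=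
  h.trace_add u.memLp_val u.memLp_grad u.weak_grad v.memLp_val v.memLp_grad v.weak_grad j

theorem Tubular.bdryVal_smul (h : Ω.Tubular ε) (c : ℝ) (u : Ω.H2 ε) (j : Fin 2) :
    bdryVal (c • u) j =ᵐ[𝓁 (Ioc 0 Ω.length)] fun s => c * bdryVal u j s :=
  h.trace_smul u.memLp_val u.memLp_grad u.weak_grad c j

theorem Tubular.normalTrace_add (h : Ω.Tubular ε) (u v : Ω.H2 ε) (j : Fin 2) :
    normalTrace (u + v) j =ᵐ[𝓁 (Ioc 0 Ω.length)]
      fun s => normalTrace u j s + normalTrace v j s := by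
  have e := fun i => h.trace_add (u.memLp_grad i) (u.memLp_hess i) (u.weak_hess i)
    (v.memLp_grad i) (v.memLp_hess i) (v.weak_hess i) j
  filter_upwards [e 0, e 1] with s h0 h1
  have h0' : Ω.trace ε ((u + v).grad 0) ((u + v).hess 0) j s = _ := h0
  have h1' : Ω.trace ε ((u + v).grad 1) ((u + v).hess 1) j s = _ := h1
  simp only [normalTrace]
  rw [h0', h1']
  ring

theorem Tubular.normalTrace_smul (h : Ω.Tubular ε) (c : ℝ) (u : Ω.H2 ε) (j : Fin 2) :
    normalTrace (c • u) j =ᵐ[𝓁 (Ioc 0 Ω.length)] fun s => c * normalTrace u j s := by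
  have e := fun i => h.trace_smul (u.memLp_grad i) (u.memLp_hess i) (u.weak_hess i) c j
  filter_upwards [e 0, e 1] with s h0 h1
  have h0' : Ω.trace ε ((c • u).grad 0) ((c • u).hess 0) j s = _ := h0
  have h1' : Ω.trace ε ((c • u).grad 1) ((c • u).hess 1) j s = _ := h1
  simp only [normalTrace]
  rw [h0', h1']
  ring

theorem continuous_jac_trace (t : ℝ) : Continuous fun s => Ω.jac ε !₂[s, t] :=
  ((Ω.perSmooth_jac ε).trace t).1.continuous

/-- The bilinear form `∫ x(u) x(v) dσ` for an almost everywhere linear boundary operator `x`. -/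
def Tubular.bdryBilin (h : Ω.Tubular ε) {V : Type*} [AddCommGroup V] [Module ℝ V]
    (x : V → Fin 2 → ℝ → ℝ) (hm : ∀ u j, 𝓛 (x u j) (Ioc 0 Ω.length))
    (ha : ∀ u v j, x (u + v) j =ᵐ[𝓁 (Ioc 0 Ω.length)] fun s => x u j s + x v j s)
    (hc : ∀ (c : ℝ) u j, x (c • u) j =ᵐ[𝓁 (Ioc 0 Ω.length)] fun s => c * x u j s) :
    V →ₗ[ℝ] V →ₗ[ℝ] ℝ :=
  bilinOfSymm (fun u v => Ω.bdryIntegral ε fun j s => x u j s * x v j s)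
    (fun u v => by simp only [mul_comm])
    (fun u u' v => by
      have hI : ∀ j, ∀ a : ℝ → ℝ, Continuous a → ∫ s in 0..Ω.length,
          x (u + u') j s * x v j s * a s = (∫ s in 0..Ω.length, x u j s * x v j s * a s) +
          ∫ s in 0..Ω.length, x u' j s * x v j s * a s := fun j a hac => by
        have hi : ∀ w, IntervalIntegrable (fun s => x w j s * x v j s * a s) volume 0 Ω.length :=
          fun w => (intervalIntegrable_mul (hm w j) (memLp_mul_one (hm v j) hac)).congr
            fun s _ => by ring
        rw [← iint_add (hi u) (hi u'),
          integral_of_le Ω.length_pos.le,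
          integral_of_le Ω.length_pos.le]
        refine integral_congr_ae ?_
        filter_upwards [ha u u' j] with s hs
        rw [hs]; ring
      have h0 := hI 0 (fun _ => 1) continuous_const
      have h1 := hI 1 _ (continuous_jac_trace (Ω := Ω) (ε := ε) 1)
      simp only [mul_one] at h0
      rw [h.bdryIntegral_eq, h.bdryIntegral_eq, h.bdryIntegral_eq, h0, h1]
      ring)
    (fun c u v => by
      have hI : ∀ j, ∀ a : ℝ → ℝ, ∫ s in 0..Ω.length, x (c • u) j s * x v j s * a s =
          c * ∫ s in 0..Ω.length, x u j s * x v j s * a s := fun j a => by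
        rw [← iint_const_mul, integral_of_le Ω.length_pos.le,
          integral_of_le Ω.length_pos.le]
        refine integral_congr_ae ?_
        filter_upwards [hc c u j] with s hs
        rw [hs]; ring
      have h0 := hI 0 (fun _ => 1)
      have h1 := hI 1 fun s => Ω.jac ε !₂[s, 1]
      simp only [mul_one] at h0
      rw [h.bdryIntegral_eq, h.bdryIntegral_eq, h0, h1]
      ring)

/-- The form `∫ u v dσ` on the boundary of `ω_ε`. -/
def Tubular.bdryForm (h : Ω.Tubular ε) :
    Ω.H2 ε →ₗ[ℝ] Ω.H2 ε →ₗ[ℝ] ℝ :=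
  h.bdryBilin bdryVal h.memLp_bdryVal h.bdryVal_add h.bdryVal_smul

/-- The energy form of the Steklov problem. -/
def Tubular.energy (h : Ω.Tubular ε) (μ : ℝ) :
    Ω.H2 ε →ₗ[ℝ] Ω.H2 ε →ₗ[ℝ] ℝ :=
  SobolevH2.hessBilin (Ω.thin ε) +
    μ • h.bdryBilin normalTrace h.memLp_normalTrace h.normalTrace_add h.normalTrace_smul

theorem Tubular.bdryForm_apply (h : Ω.Tubular ε) (u v : Ω.H2 ε) :
    h.bdryForm u v = Ω.bdryIntegral ε fun j s => bdryVal u j s * bdryVal v j s := rfl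

theorem Tubular.energy_apply (h : Ω.Tubular ε) (μ : ℝ) (u v : Ω.H2 ε) :
    h.energy μ u v = u.hessForm v +
      μ * Ω.bdryIntegral ε fun j s => normalTrace u j s * normalTrace v j s := rfl

theorem Tubular.isSteklovSolution_iff (h : Ω.Tubular ε) {μ Λ : ℝ} {u : Ω.H2 ε} :
    Ω.IsSteklovSolution μ ε Λ u ↔ ∀ v, h.energy μ u v = Λ * h.bdryForm u v := by
  simp only [IsSteklovSolution, h.energy_apply, h.bdryForm_apply, normalDeriv_mul]

theorem Tubular.bdryForm_symm (h : Ω.Tubular ε) (u v : Ω.H2 ε) :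
    h.bdryForm u v = h.bdryForm v u := by simp only [h.bdryForm_apply, mul_comm]

theorem Tubular.energy_symm (h : Ω.Tubular ε) (μ : ℝ) (u v : Ω.H2 ε) :
    h.energy μ u v = h.energy μ v u := by
  simp only [h.energy_apply, SobolevH2.hessForm, mul_comm]

end SmoothDomain

namespace SmoothDomain

variable {Ω : SmoothDomain} {ε : ℝ}

/-! ### Frame components of the derivatives -/

/-- The tangential derivative in Fermi coordinates. -/
def gradTan (u : Ω.H2 ε) : Plane → ℝ := Ω.tanComp fun i => Ω.pull ε (u.grad i)

/-- The normal derivative in Fermi coordinates. -/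
def gradNor (u : Ω.H2 ε) : Plane → ℝ := Ω.norComp fun i => Ω.pull ε (u.grad i)

/-- The tangential-tangential component of the Hessian in Fermi coordinates. -/
def hessTT (u : Ω.H2 ε) : Plane → ℝ :=
  Ω.tanComp fun i => Ω.tanComp fun j => Ω.pull ε (u.hess i j)

/-- The tangential-normal component of the Hessian in Fermi coordinates. -/
def hessTN (u : Ω.H2 ε) : Plane → ℝ :=
  Ω.tanComp fun i => Ω.norComp fun j => Ω.pull ε (u.hess i j)

/-- The normal-tangential component of the Hessian in Fermi coordinates. -/
def hessNT (u : Ω.H2 ε) : Plane → ℝ :=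
  Ω.norComp fun i => Ω.tanComp fun j => Ω.pull ε (u.hess i j)

/-- The normal-normal component of the Hessian in Fermi coordinates. -/
def hessNN (u : Ω.H2 ε) : Plane → ℝ :=
  Ω.norComp fun i => Ω.norComp fun j => Ω.pull ε (u.hess i j)

namespace Tubular

theorem memLp_val (h : Ω.Tubular ε) (u : Ω.H2 ε) :
    𝓛 (Ω.pull ε u.val) Ω.refSet := h.memLp_comp u.memLp_val

theorem memLp_gradTan (h : Ω.Tubular ε) (u : Ω.H2 ε) :
    𝓛 (gradTan u) Ω.refSet :=
  Ω.memLp_tanComp fun i => h.memLp_comp (u.memLp_grad i)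

theorem memLp_gradNor (h : Ω.Tubular ε) (u : Ω.H2 ε) :
    𝓛 (gradNor u) Ω.refSet :=
  Ω.memLp_norComp fun i => h.memLp_comp (u.memLp_grad i)

theorem memLp_hessTT (h : Ω.Tubular ε) (u : Ω.H2 ε) :
    𝓛 (hessTT u) Ω.refSet :=
  Ω.memLp_tanComp fun i => Ω.memLp_tanComp fun j => h.memLp_comp (u.memLp_hess i j)

theorem memLp_hessTN (h : Ω.Tubular ε) (u : Ω.H2 ε) :
    𝓛 (hessTN u) Ω.refSet :=
  Ω.memLp_tanComp fun i => Ω.memLp_norComp fun j => h.memLp_comp (u.memLp_hess i j)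

theorem memLp_hessNT (h : Ω.Tubular ε) (u : Ω.H2 ε) :
    𝓛 (hessNT u) Ω.refSet :=
  Ω.memLp_norComp fun i => Ω.memLp_tanComp fun j => h.memLp_comp (u.memLp_hess i j)

theorem memLp_hessNN (h : Ω.Tubular ε) (u : Ω.H2 ε) :
    𝓛 (hessNN u) Ω.refSet :=
  Ω.memLp_norComp fun i => Ω.memLp_norComp fun j => h.memLp_comp (u.memLp_hess i j)

theorem stripGrad_pull (h : Ω.Tubular ε) (u : Ω.H2 ε) :
    Ω.StripGrad (Ω.pull ε u.val) (fun p => Ω.jac ε p * gradTan u p)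
      (fun p => -(ε * gradNor u p)) (bdryVal u) := h.stripGrad_val u

/-- Differentiating `τ · ∇u` along the curve also differentiates `τ`; the Frenet equation produces
the curvature term with the normal derivative. Across the strip the frame is constant. -/
theorem stripGrad_gradTan (h : Ω.Tubular ε) (u : Ω.H2 ε) :
    Ω.StripGrad (gradTan u)
      (fun p => Ω.jac ε p * hessTT u p - Ω.curvature (p 0) * gradNor u p)
      (fun p => -(ε * hessTN u p)) (tangentTrace u) := by
  convert! ((h.stripGrad_grad u 0).mul (Ω.perSmooth_tan 0)).add
    ((h.stripGrad_grad u 1).mul (Ω.perSmooth_tan 1)) using 1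
  · ext p; simp only [partialDeriv_tan, hessTT, gradNor, tanComp, norComp]; simp; ring
  · ext p; simp only [partialDeriv_tan, hessTN, tanComp, norComp]; simp; ring

theorem stripGrad_gradNor (h : Ω.Tubular ε) (u : Ω.H2 ε) :
    Ω.StripGrad (gradNor u)
      (fun p => Ω.jac ε p * hessNT u p + Ω.curvature (p 0) * gradTan u p)
      (fun p => -(ε * hessNN u p)) (normalTrace u) := by
  convert! ((h.stripGrad_grad u 0).mul (Ω.perSmooth_nor 0)).add
    ((h.stripGrad_grad u 1).mul (Ω.perSmooth_nor 1)) using 1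
  · ext p; simp only [partialDeriv_nor, hessNT, gradTan, tanComp, norComp]; simp; ring
  · ext p; simp only [partialDeriv_nor, hessNN, norComp]; simp; ring

theorem hessTN_ae_eq (h : Ω.Tubular ε) (u : Ω.H2 ε) :
    hessTN u =ᵐ[𝓁 Ω.refSet] hessNT u := by
  have hs := SobolevH2.hess_symm (Ω.isOpen_thin ε) u
  have hm := (u.memLp_hess 0 1).sub (u.memLp_hess 1 0)
  have hi : ∫ x in Ω.thin ε, (u.hess 0 1 - u.hess 1 0) x ^ 2 = 0 := by
    refine integral_eq_zero_of_ae ?_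
    filter_upwards [hs] with x hx
    simp [hx]
  have hle := h.integral_comp_sq_le hm
  rw [hi, mul_zero] at hle
  filter_upwards [ae_eq_zero_of_integral_sq_nonpos (h.memLp_comp hm) hle] with p hp
  have hp : u.hess 0 1 (Ω.fermi ε p) - u.hess 1 0 (Ω.fermi ε p) = 0 := hp
  simp only [hessTN, hessNT, tanComp, norComp, pull, nor_zero, nor_one]
  linear_combination (-(Ω.tan 0 (p 0) ^ 2 + Ω.tan 1 (p 0) ^ 2)) * hp

/-- The frame is orthonormal, so the Hilbert–Schmidt product of the Hessians may be computed in it.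
-/
theorem hessForm_eq (h : Ω.Tubular ε) (u v : Ω.H2 ε) : u.hessForm v =
    ∫ p in Ω.refSet, ε * Ω.jac ε p * (hessTT u p * hessTT v p + hessTN u p * hessTN v p +
      hessNT u p * hessNT v p + hessNN u p * hessNN v p) := by
  rw [SobolevH2.hessForm, h.integral_thin]
  congr 1; ext p
  simp only [hessTT, hessTN, hessNT, hessNN, tanComp, norComp, pull, nor_zero, nor_one,
    Fin.sum_univ_two]
  have ht := Ω.tan_sq (p 0)
  set a := Ω.tan 0 (p 0)
  set b := Ω.tan 1 (p 0)
  set x := Ω.fermi ε p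
  linear_combination (-(ε * Ω.jac ε p * (u.hess 0 0 x * v.hess 0 0 x + u.hess 0 1 x * v.hess 0 1 x +
    (u.hess 1 0 x * v.hess 1 0 x + u.hess 1 1 x * v.hess 1 1 x)) * (a ^ 2 + b ^ 2 + 1))) * ht

end Tubular

/-! ### Energy estimates -/

/-- The energy of `u` divided by `ε`, plus its boundary norm. -/
def scaledEnergy (μ : ℝ) (u : Ω.H2 ε) : ℝ :=
  (u.hessForm u + μ * Ω.bdryIntegral ε fun j s => normalTrace u j s * normalTrace u j s) / ε +
    Ω.bdryIntegral ε fun j s => bdryVal u j s * bdryVal u j s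

namespace Tubular

theorem scaledEnergy_eq (h : Ω.Tubular ε) (μ : ℝ) (u : Ω.H2 ε) :
    scaledEnergy μ u = h.energy μ u u / ε + h.bdryForm u u := rfl

theorem bdryIntegral_sq (h : Ω.Tubular ε) {x : Fin 2 → ℝ → ℝ}
    (hx : ∀ j, 𝓛 (x j) (Ioc 0 Ω.length)) (j : Fin 2) :
    ∫ s in 0..Ω.length, x j s ^ 2 ≤ 2 * Ω.bdryIntegral ε fun j s => x j s * x j s := by
  have L := Ω.length_pos.le
  have h0 : 0 ≤ ∫ s in 0..Ω.length, x 0 s ^ 2 :=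
    iint_nonneg L fun s _ => sq_nonneg _
  have h1 : 0 ≤ ∫ s in 0..Ω.length, x 1 s ^ 2 :=
    iint_nonneg L fun s _ => sq_nonneg _
  have h2 : ∫ s in 0..Ω.length, x 1 s ^ 2 ≤
      2 * ∫ s in 0..Ω.length, x 1 s * x 1 s * Ω.jac ε !₂[s, 1] := by
    have i1 : IntervalIntegrable (fun s => x 1 s ^ 2) volume 0 Ω.length := by
      simpa only [sq] using intervalIntegrable_mul (hx 1) (hx 1)
    have i2 : IntervalIntegrable (fun s => 2 * (x 1 s * x 1 s * Ω.jac ε !₂[s, 1]))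
        volume 0 Ω.length :=
      ((intervalIntegrable_mul (hx 1) (memLp_mul_one (hx 1)
        (continuous_jac_trace (Ω := Ω) (ε := ε) 1))).const_mul 2).congr fun s _ => by ring
    rw [← iint_const_mul]
    refine iint_mono_on L i1 i2 fun s _ => ?_
    have := (h.jac_mem !₂[s, 1] (by simp)).1
    nlinarith [sq_nonneg (x 1 s)]
  rw [h.bdryIntegral_eq]
  simp only [← sq] at h2 ⊢
  fin_cases j
  · simp only [Fin.zero_eta]; linarith
  · simp only [Fin.mk_one]; linarith

theorem bdryIntegral_nonneg (h : Ω.Tubular ε) {x : Fin 2 → ℝ → ℝ}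
    (hx : ∀ j, 𝓛 (x j) (Ioc 0 Ω.length)) :
    0 ≤ Ω.bdryIntegral ε fun j s => x j s * x j s := by
  have h0 : 0 ≤ ∫ s in 0..Ω.length, x 0 s ^ 2 :=
    iint_nonneg Ω.length_pos.le fun s _ => sq_nonneg _
  linarith [h.bdryIntegral_sq hx 0]

theorem bdryForm_nonneg (h : Ω.Tubular ε) (u : Ω.H2 ε) : 0 ≤ h.bdryForm u u :=
  h.bdryIntegral_nonneg (h.memLp_bdryVal u)

theorem hessForm_nonneg (u : Ω.H2 ε) : 0 ≤ u.hessForm u :=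
  integral_nonneg fun _ => Finset.sum_nonneg fun _ _ => Finset.sum_nonneg fun _ _ =>
    mul_self_nonneg _

theorem energy_nonneg (h : Ω.Tubular ε) {μ : ℝ} (hμ : 0 < μ) (u : Ω.H2 ε) :
    0 ≤ h.energy μ u u := by
  rw [h.energy_apply]
  exact add_nonneg (hessForm_nonneg u)
    (mul_nonneg hμ.le (h.bdryIntegral_nonneg (h.memLp_normalTrace u)))

theorem scaledEnergy_nonneg (h : Ω.Tubular ε) {μ : ℝ} (hμ : 0 < μ) (u : Ω.H2 ε) :
    0 ≤ scaledEnergy μ u := by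
  rw [h.scaledEnergy_eq]
  exact add_nonneg (div_nonneg (h.energy_nonneg hμ u) h.pos.le) (h.bdryForm_nonneg u)

theorem energy_le (h : Ω.Tubular ε) {μ : ℝ} (u : Ω.H2 ε) :
    h.energy μ u u ≤ ε * scaledEnergy μ u := by
  have e0 := h.pos
  have : ε * scaledEnergy μ u = h.energy μ u u + ε * h.bdryForm u u := by
    rw [h.scaledEnergy_eq]; field_simp
  rw [this]
  linarith [mul_nonneg h.pos.le (h.bdryForm_nonneg u)]

theorem integral_bdryVal_sq (h : Ω.Tubular ε) {μ : ℝ} (hμ : 0 < μ) (u : Ω.H2 ε)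
    (j : Fin 2) : ∫ s in 0..Ω.length, bdryVal u j s ^ 2 ≤ 2 * scaledEnergy μ u := by
  have h1 := h.bdryIntegral_sq (h.memLp_bdryVal u) j
  have h2 := div_nonneg (h.energy_nonneg hμ u) h.pos.le
  rw [h.scaledEnergy_eq, h.bdryForm_apply]
  linarith

theorem integral_normalTrace_sq (h : Ω.Tubular ε) {μ : ℝ} (hμ : 0 < μ) (u : Ω.H2 ε)
    (j : Fin 2) : ∫ s in 0..Ω.length, normalTrace u j s ^ 2 ≤
      2 / μ * (ε * scaledEnergy μ u) := by
  have h1 := h.bdryIntegral_sq (h.memLp_normalTrace u) j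
  have h2 := h.energy_le (μ := μ) u
  rw [h.energy_apply] at h2
  have h3 := hessForm_nonneg u
  have h4 : Ω.bdryIntegral ε (fun j s => normalTrace u j s * normalTrace u j s) ≤
      (ε * scaledEnergy μ u) / μ := by
    rw [le_div_iff₀ hμ]; linarith
  calc _ ≤ _ := h1
    _ ≤ 2 * ((ε * scaledEnergy μ u) / μ) := by linarith
    _ = _ := by ring

theorem integral_hess_sq (h : Ω.Tubular ε) {μ : ℝ} (hμ : 0 < μ) (u : Ω.H2 ε) :
    (∫ p in Ω.refSet, hessTT u p ^ 2) + (∫ p in Ω.refSet, hessTN u p ^ 2) +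
      (∫ p in Ω.refSet, hessNT u p ^ 2) + (∫ p in Ω.refSet, hessNN u p ^ 2) ≤
      2 * scaledEnergy μ u := by
  have e0 := h.pos
  have h2 := h.energy_le (μ := μ) u
  rw [h.energy_apply] at h2
  have h3 := mul_nonneg hμ.le (h.bdryIntegral_nonneg (h.memLp_normalTrace u))
  have i1 := (h.memLp_hessTT u).integrable_sq
  have i2 := (h.memLp_hessTN u).integrable_sq
  have i3 := (h.memLp_hessNT u).integrable_sq
  have i4 := (h.memLp_hessNN u).integrable_sq
  have key : ε / 2 * ∫ p in Ω.refSet, (hessTT u p ^ 2 + hessTN u p ^ 2 + hessNT u p ^ 2 +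
      hessNN u p ^ 2) ≤ u.hessForm u := by
    rw [h.hessForm_eq, ← integral_const_mul]
    have hm : ∀ X : Plane → ℝ, 𝓛 X Ω.refSet →
        Integrable (fun p => Ω.jac ε p * (X p * X p)) (𝓁 Ω.refSet) := fun X hX =>
      (integrable_mul_of_memLp (Ω.memLp_mul (Ω.contDiff_jac ε).continuous hX) hX).congr
        (Eventually.of_forall fun p => by simp only; ring)
    refine setIntegral_mono_on ((((i1.add i2).add i3).add i4).const_mul _) ?_
      Ω.isOpen_refSet.measurableSet fun p hp => ?_
    · refine (((((hm _ (h.memLp_hessTT u)).add (hm _ (h.memLp_hessTN u))).add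
        (hm _ (h.memLp_hessNT u))).add (hm _ (h.memLp_hessNN u))).const_mul ε).congr
        (Eventually.of_forall fun p => ?_)
      simp only [Pi.add_apply]; ring
    · have := (h.jac_mem p ⟨by linarith [hp.2.1], by linarith [hp.2.2]⟩).1
      have h5 : 0 ≤ hessTT u p ^ 2 + hessTN u p ^ 2 + hessNT u p ^ 2 + hessNN u p ^ 2 := by
        positivity
      nlinarith [mul_nonneg (mul_nonneg e0.le (sub_nonneg.2 this)) h5]
  have e1 : ∫ p in Ω.refSet, (hessTT u p ^ 2 + hessTN u p ^ 2 + hessNT u p ^ 2 +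
      hessNN u p ^ 2) = (∫ p in Ω.refSet, hessTT u p ^ 2) + (∫ p in Ω.refSet, hessTN u p ^ 2) +
      (∫ p in Ω.refSet, hessNT u p ^ 2) + ∫ p in Ω.refSet, hessNN u p ^ 2 := by
    have a1 := integral_add ((i1.add i2).add i3) i4
    have a2 := integral_add (i1.add i2) i3
    have a3 := integral_add i1 i2
    simp only [Pi.add_apply] at a1 a2 a3
    rw [a1, a2, a3]
  rw [← e1]
  have h6 : ε * (∫ p in Ω.refSet, (hessTT u p ^ 2 + hessTN u p ^ 2 + hessNT u p ^ 2 +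
      hessNN u p ^ 2)) ≤ ε * (2 * scaledEnergy μ u) := by linarith
  exact le_of_mul_le_mul_left h6 e0

end Tubular

variable (Ω) in
/-- Parameters `ε` for which the energy controls the strip norms with the constant `C`. -/
structure Coercive (μ C ε : ℝ) : Prop where
  tubular : Ω.Tubular ε
  val : ∀ u : Ω.H2 ε, ∫ p in Ω.refSet, Ω.pull ε u.val p ^ 2 ≤ C * scaledEnergy μ u
  sub_bdryVal : ∀ (u : Ω.H2 ε) j,
    ∫ p in Ω.refSet, (Ω.pull ε u.val p - bdryVal u j (p 0)) ^ 2 ≤ C * (ε * scaledEnergy μ u)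
  gradNor : ∀ u : Ω.H2 ε,
    ∫ p in Ω.refSet, gradNor u p ^ 2 ≤ C * (ε * scaledEnergy μ u)
  gradTan : ∀ u : Ω.H2 ε, ∫ p in Ω.refSet, gradTan u p ^ 2 ≤ C * scaledEnergy μ u
  tangentTrace : ∀ (u : Ω.H2 ε) j,
    ∫ s in 0..Ω.length, tangentTrace u j s ^ 2 ≤ C * scaledEnergy μ u

theorem integral_mul_neg_sq (X : Plane → ℝ) :
    ∫ p in Ω.refSet, (-(ε * X p)) ^ 2 = ε ^ 2 * ∫ p in Ω.refSet, X p ^ 2 := by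
  rw [← integral_const_mul]; congr 1; ext p; ring

theorem StripGrad.integral_sq_le_trace {F Fs Ft : Plane → ℝ} {g : Fin 2 → ℝ → ℝ}
    (h : Ω.StripGrad F Fs Ft g) (j : Fin 2) : ∫ p in Ω.refSet, F p ^ 2 ≤
      2 * (∫ p in Ω.refSet, Ft p ^ 2) + 2 * ∫ s in 0..Ω.length, g j s ^ 2 := by
  have hm := Ω.memLp_fst (h.memg j)
  have h1 := integral_sq_add_le (h.memF.sub hm) hm
  simp only [Pi.sub_apply, sub_add_cancel] at h1
  rw [Ω.integral_refSet_fst (fun s => g j s ^ 2)] at h1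
  linarith [h.integral_sub_trace_le j]

theorem StripGrad.integral_trace_sq_le {F Fs Ft : Plane → ℝ} {g : Fin 2 → ℝ → ℝ}
    (h : Ω.StripGrad F Fs Ft g) (j : Fin 2) : ∫ s in 0..Ω.length, g j s ^ 2 ≤
      2 * (∫ p in Ω.refSet, F p ^ 2) + 2 * ∫ p in Ω.refSet, Ft p ^ 2 := by
  have hm := Ω.memLp_fst (h.memg j)
  have h1 := integral_sq_sub_le h.memF (h.memF.sub hm)
  simp only [Pi.sub_apply, sub_sub_cancel] at h1
  rw [Ω.integral_refSet_fst (fun s => g j s ^ 2)] at h1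
  linarith [h.integral_sub_trace_le j]

end SmoothDomain

/-! ### Tangential derivatives of traces, a Poincaré inequality, uniform coercivity -/

namespace SmoothDomain

variable {Ω : SmoothDomain} {ε : ℝ}

/-- The boundary values of the horizontal derivative are the derivative of the boundary values. -/
theorem StripGrad.trace_horiz {F Fs Ft Fss Fst Fts Ftt : Plane → ℝ} {g gs gt : Fin 2 → ℝ → ℝ}
    (h : Ω.StripGrad F Fs Ft g) (hs : Ω.StripGrad Fs Fss Fst gs) (ht : Ω.StripGrad Ft Fts Ftt gt)
    (hc : Fst =ᵐ[𝓁 Ω.refSet] Fts) (j : Fin 2) {χ : ℝ → ℝ} (hχ : 𝒞 χ)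
    (hp : Periodic χ Ω.length) :
    ∫ s in 0..Ω.length, (g j s * deriv χ s + gs j s * χ s) = 0 := by
  have hχ' : 𝒞 (deriv χ) := contDiff_infty_deriv hχ
  have key : ∀ θ : ℝ → ℝ, 𝒞 θ →
      (∫ s in 0..Ω.length, (g 1 s * deriv χ s + gs 1 s * χ s)) * θ 1 -
      (∫ s in 0..Ω.length, (g 0 s * deriv χ s + gs 0 s * χ s)) * θ 0 = 0 := by
    intro θ hθ
    have hθ' : 𝒞 (deriv θ) := contDiff_infty_deriv hθ
    have P1 : Ω.PerSmooth fun p => deriv χ (p 0) := .fst hχ' hp.deriv_periodic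
    have P0 : Ω.PerSmooth fun p => χ (p 0) := .fst hχ hp
    have T0 : Ω.PerSmooth fun p => θ (p 1) := .snd hθ
    have T1 : Ω.PerSmooth fun p => deriv θ (p 1) := .snd hθ'
    have dχ : ∀ i p, 𝒟 i (fun p : Plane => χ (p 0)) p =
        if i = 0 then deriv χ (p 0) else 0 := fun i p =>
      partialDeriv_coord i 0 ((hχ.differentiable (by simp) _).hasDerivAt)
    have dχ' : ∀ i p, 𝒟 i (fun p : Plane => deriv χ (p 0)) p =
        if i = 0 then deriv (deriv χ) (p 0) else 0 := fun i p =>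
      partialDeriv_coord i 0 ((hχ'.differentiable (by simp) _).hasDerivAt)
    have dθ : ∀ i p, 𝒟 i (fun p : Plane => θ (p 1)) p =
        if i = 1 then deriv θ (p 1) else 0 := fun i p =>
      partialDeriv_coord i 1 ((hθ.differentiable (by simp) _).hasDerivAt)
    have dθ' : ∀ i p, 𝒟 i (fun p : Plane => deriv θ (p 1)) p =
        if i = 1 then deriv (deriv θ) (p 1) else 0 := fun i p =>
      partialDeriv_coord i 1 ((hθ'.differentiable (by simp) _).hasDerivAt)
    -- Four integrations by parts against `χ'θ`, `χθ'` and `χθ`. In their alternating sum the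
    -- interior terms cancel, since the mixed derivatives agree. The choices `θ = 1 - t` and `θ = t`
    -- then isolate the two sides.
    have a1 := h.vert _ (P1.mul T0)
    have a2 := h.horiz _ (P0.mul T1)
    have a3 := ht.horiz _ (P0.mul T0)
    have a4 := hs.vert _ (P0.mul T0)
    simp only [partialDeriv_mul (P1.smooth.diffAt _) (T0.smooth.diffAt _),
      partialDeriv_mul (P0.smooth.diffAt _) (T0.smooth.diffAt _),
      partialDeriv_mul (P0.smooth.diffAt _) (T1.smooth.diffAt _), dχ, dχ', dθ, dθ'] at a1 a2 a3 a4
    simp only [one_ne_zero, if_false, zero_mul, zero_add, if_true, zero_ne_one, mul_zero,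
      add_zero, Matrix.cons_val_zero, Matrix.cons_val_one, Matrix.cons_val_fin_one] at a1 a2 a3 a4
    have e4 : ∫ p in Ω.refSet, (Fs p * (χ (p 0) * deriv θ (p 1)) + Fst p * (χ (p 0) * θ (p 1))) =
        ∫ p in Ω.refSet, (Fs p * (χ (p 0) * deriv θ (p 1)) + Fts p * (χ (p 0) * θ (p 1))) := by
      refine integral_congr_ae ?_
      filter_upwards [hc] with p hp
      rw [hp]
    rw [e4] at a4
    have i1 := integrable_mul_continuous h.memF (P1.mul T1).cont
    have i2 := integrable_mul_continuous h.memT (P1.mul T0).cont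
    have i3 := integrable_mul_continuous hs.memF (P0.mul T1).cont
    have i4 := integrable_mul_continuous ht.memS (P0.mul T0).cont
    rw [integral_add i1 i2] at a1
    rw [integral_add i1 i3] at a2
    rw [integral_add i2 i4] at a3
    rw [integral_add i3 i4] at a4
    have hj : ∀ j : Fin 2, ∀ t : ℝ, (∫ s in 0..Ω.length, (g j s * deriv χ s + gs j s * χ s)) *
        θ t = (∫ s in 0..Ω.length, g j s * (deriv χ s * θ t)) +
        ∫ s in 0..Ω.length, gs j s * (χ s * θ t) := by
      intro j t
      rw [iint_add (intervalIntegrable_mul_continuous (h.memg j) hχ'.continuous)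
        (intervalIntegrable_mul_continuous (hs.memg j) hχ.continuous), add_mul,
        ← iint_mul_const, ← iint_mul_const]
      simp only [mul_assoc]
    rw [hj, hj]
    linarith
  have k0 := key (fun t => 1 - t) (contDiff_const.sub contDiff_id)
  have k1 := key (fun t => t) contDiff_id
  simp only [sub_self, mul_zero, sub_zero, mul_one, zero_sub, neg_eq_zero] at k0 k1
  fin_cases j
  exacts [k0, k1]

theorem Tubular.stripGrad_horiz (h : Ω.Tubular ε) (u : Ω.H2 ε) :
    Ω.StripGrad (fun p => Ω.jac ε p * gradTan u p)
      (fun p => -(ε * p 1 * deriv Ω.curvature (p 0)) * gradTan u p +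
        Ω.jac ε p * (Ω.jac ε p * hessTT u p - Ω.curvature (p 0) * gradNor u p))
      (fun p => -(ε * Ω.curvature (p 0)) * gradTan u p + Ω.jac ε p * -(ε * hessTN u p))
      (fun j s => Ω.jac ε !₂[s, ((j : ℕ) : ℝ)] * tangentTrace u j s) := by
  have := (h.stripGrad_gradTan u).mul (Ω.perSmooth_jac ε)
  simpa only [(Ω.partialDeriv_jac ε _).1, (Ω.partialDeriv_jac ε _).2] using this

theorem Tubular.stripGrad_vert (h : Ω.Tubular ε) (u : Ω.H2 ε) :
    Ω.StripGrad (fun p => -(ε * gradNor u p))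
      (fun p => -(ε * (Ω.jac ε p * hessNT u p + Ω.curvature (p 0) * gradTan u p)))
      (fun p => -(ε * -(ε * hessNN u p))) (fun j s => -(ε * normalTrace u j s)) := by
  have := (h.stripGrad_gradNor u).const_mul (-ε)
  simpa only [neg_mul] using this

theorem Tubular.bdryVal_horiz (h : Ω.Tubular ε) (u : Ω.H2 ε) (j : Fin 2)
    {χ : ℝ → ℝ} (hχ : 𝒞 χ) (hp : Periodic χ Ω.length) :
    ∫ s in 0..Ω.length, (bdryVal u j s * deriv χ s +
      Ω.jac ε !₂[s, ((j : ℕ) : ℝ)] * tangentTrace u j s * χ s) = 0 := by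
  refine (h.stripGrad_pull u).trace_horiz (h.stripGrad_horiz u) (h.stripGrad_vert u) ?_ j hχ hp
  filter_upwards [h.hessTN_ae_eq u] with p hp
  rw [hp]; ring

theorem sq_add_three_le (x y z : ℝ) : (x + y + z) ^ 2 ≤ 3 * x ^ 2 + 3 * y ^ 2 + 3 * z ^ 2 := by
  nlinarith [sq_nonneg (x - y), sq_nonneg (y - z), sq_nonneg (x - z)]

/-- Pythagoras: `F` minus its vertical average is orthogonal to every function of `s` alone. -/
theorem integral_sq_sub_average {F : Plane → ℝ} (hF : 𝓛 F Ω.refSet)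
    {a : ℝ → ℝ} (ha : 𝓛 a (Ioc 0 Ω.length)) :
    ∫ p in Ω.refSet, (F p - a (p 0)) ^ 2 =
      (∫ p in Ω.refSet, (F p - ∫ t in 0..1, F !₂[p 0, t]) ^ 2) +
      ∫ s in 0..Ω.length, ((∫ t in 0..1, F !₂[s, t]) - a s) ^ 2 := by
  have mA := memLp_average hF
  set A : ℝ → ℝ := fun s => ∫ t in 0..1, F !₂[s, t] with hA
  have md := mA.sub ha
  have e1 := integral_mul_average hF md
  have e2 := Ω.integral_refSet_fst fun s => A s * (A - a) s
  have i1 := integrable_mul_of_memLp hF (Ω.memLp_fst md)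
  have i2 := integrable_mul_of_memLp (Ω.memLp_fst mA) (Ω.memLp_fst md)
  have i3 := (hF.sub (Ω.memLp_fst mA)).integrable_sq
  have i4 := (Ω.memLp_fst md).integrable_sq
  rw [← Ω.integral_refSet_fst fun s => (A s - a s) ^ 2]
  have a1 := integral_sub i1 i2
  have a2 := integral_add i3 i4
  have a3 := integral_add (i3.add i4) ((i1.sub i2).const_mul 2)
  rw [integral_const_mul] at a3
  simp only [Pi.add_apply, Pi.sub_apply] at a1 a2 a3 e1 e2
  rw [a1, e1, e2, sub_self, mul_zero, add_zero, a2] at a3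
  rw [← a3]
  congr 1; ext p; ring

/-- A weighted Poincaré inequality. -/
theorem StripGrad.integral_sq_le_grad {F Fs Ft w : Plane → ℝ} {g : Fin 2 → ℝ → ℝ}
    (h : Ω.StripGrad F Fs Ft g) (hw : Continuous w)
    (hb : ∀ p ∈ Ω.refSet, w p ∈ Icc (1 / 2 : ℝ) (3 / 2)) (h0 : ∫ p in Ω.refSet, w p * F p = 0) :
    ∫ p in Ω.refSet, F p ^ 2 ≤
      20 * ((∫ p in Ω.refSet, Ft p ^ 2) + Ω.length ^ 2 * ∫ p in Ω.refSet, Fs p ^ 2) := by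
  have L := Ω.length_pos
  have nn : ∀ X : Plane → ℝ, 0 ≤ ∫ p in Ω.refSet, X p ^ 2 := fun X =>
    integral_nonneg fun p => sq_nonneg _
  have mA := memLp_average h.memF
  have mk := memLp_average h.memS
  set A : ℝ → ℝ := fun s => ∫ t in 0..1, F !₂[s, t] with hA
  set k : ℝ → ℝ := fun s => ∫ t in 0..1, Fs !₂[s, t] with hk
  -- Tests that depend on `s` alone show that the vertical average `A` of `F` has the average of
  -- `Fs` as weak derivative, so `A` is close to a constant `c`.
  obtain ⟨-, c, hc⟩ := ae_eq_primitive mA mk fun χ hχ pχ => by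
    have d := (contDiff_infty_deriv hχ).continuous
    have e := h.horiz _ (PerSmooth.fst hχ pχ)
    simp only [partialDeriv_coord 0 0 ((hχ.differentiable (by simp) _).hasDerivAt), if_true] at e
    have m0 := memLp_continuous_one (Ω := Ω) d
    have m1 := memLp_continuous_one (Ω := Ω) hχ.continuous
    rw [integral_add (integrable_mul_of_memLp h.memF (Ω.memLp_fst m0))
      (integrable_mul_of_memLp h.memS (Ω.memLp_fst m1)), integral_mul_average h.memF m0,
      integral_mul_average h.memS m1] at e
    rwa [iint_add (intervalIntegrable_mul_continuous mA d)
      (intervalIntegrable_mul_continuous mk hχ.continuous)]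
  have kS : ∫ s in 0..Ω.length, k s ^ 2 ≤ ∫ p in Ω.refSet, Fs p ^ 2 := by
    have := integral_sq_sub_average h.memS (Ω := Ω) (a := fun _ => 0) (memLp_const 0)
    simp only [sub_zero] at this
    linarith [nn fun p => Fs p - k (p 0)]
  set S := ∫ p in Ω.refSet, Fs p ^ 2 with hS
  set T := ∫ p in Ω.refSet, Ft p ^ 2 with hT
  have mc : 𝓛 (fun _ : ℝ => c) (Ioc 0 Ω.length) := memLp_const c
  have Ac : ∫ s in 0..Ω.length, (A s - c) ^ 2 ≤ Ω.length ^ 2 * S := by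
    have le : ∫ s in 0..Ω.length, (A s - c) ^ 2 ≤
        ∫ s in 0..Ω.length, S * Ω.length := by
      rw [integral_of_le L.le, integral_of_le L.le]
      refine integral_mono_ae (mA.sub mc).integrable_sq (integrable_const _) ?_
      filter_upwards [hc, ae_restrict_mem measurableSet_Ioc] with s hs hm
      have := abs_primitive_sub_le mk kS (Ioc_subset_Icc_self hm) (left_mem_Icc.2 L.le)
      rw [intervalIntegral.integral_same, sub_zero, sub_zero, abs_of_pos hm.1,
        ← Real.sqrt_mul (nn _)] at this
      rw [hs, add_sub_cancel_left, ← sq_abs]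
      calc _ ≤ √(S * s) ^ 2 := by gcongr
        _ = S * s := Real.sq_sqrt (mul_nonneg (nn _) hm.1.le)
        _ ≤ _ := mul_le_mul_of_nonneg_left hm.2 (nn _)
    simp only [iint_const, sub_zero, smul_eq_mul] at le
    linarith
  -- Among functions of `s` the average is closest to `F`, so its distance to `F` is at most that of
  -- the boundary values, which the vertical derivative bounds.
  have p1 := integral_sq_sub_average h.memF (h.memg 0)
  have p2 := integral_sq_sub_average h.memF mc
  have tr := h.integral_sub_trace_le 0
  have n1 : 0 ≤ ∫ s in 0..Ω.length, (A s - g 0 s) ^ 2 :=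
    iint_nonneg L.le fun s _ => sq_nonneg _
  have Fc : ∫ p in Ω.refSet, (F p - c) ^ 2 ≤ T + Ω.length ^ 2 * S := by linarith
  set D := T + Ω.length ^ 2 * S with hD
  have mC : 𝓛 (fun _ : Plane => c) Ω.refSet := Ω.memLp_fst mc
  have mw := Ω.memLp_continuous hw
  have iw : Integrable w (𝓁 Ω.refSet) := mw.integrable (by norm_num)
  have cst : ∀ x : ℝ, ∫ _ in Ω.refSet, x = Ω.length * x := fun x => by
    rw [Ω.integral_refSet_fst fun _ => x]; simp
  have w1 : Ω.length * (1 / 2) ≤ ∫ p in Ω.refSet, w p := by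
    rw [← cst]
    exact setIntegral_mono_on (integrable_const _) iw Ω.isOpen_refSet.measurableSet
      fun p hp => (hb p hp).1
  have w2 : ∫ p in Ω.refSet, w p ^ 2 ≤ Ω.length * (9 / 4) := by
    rw [← cst]
    refine setIntegral_mono_on mw.integrable_sq (integrable_const _)
      Ω.isOpen_refSet.measurableSet fun p hp => ?_
    nlinarith [(hb p hp).1, (hb p hp).2]
  have cs := integral_mul_sq_le mw (h.memF.sub mC)
  have ev : ∫ p in Ω.refSet, w p * (F p - c) = -(c * ∫ p in Ω.refSet, w p) := by
    simp only [mul_sub]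
    rw [integral_sub (integrable_mul_of_memLp mw h.memF) (integrable_mul_of_memLp mw mC), h0,
      integral_mul_const]
    ring
  simp only [Pi.sub_apply] at cs
  rw [ev] at cs
  have D0 : 0 ≤ D := (nn fun p => F p - c).trans Fc
  have c1 : c ^ 2 * (Ω.length * (1 / 2)) ^ 2 ≤ Ω.length * (9 / 4) * D := by
    calc _ ≤ c ^ 2 * (∫ p in Ω.refSet, w p) ^ 2 := by gcongr
      _ = (-(c * ∫ p in Ω.refSet, w p)) ^ 2 := by ring
      _ ≤ _ := cs.trans (mul_le_mul w2 Fc (nn _) (by positivity))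
  -- The weighted mean of `F` vanishes and the weight lies in `[1/2, 3/2]`, so `c` is controlled by
  -- `F - c`. Adding `2D` and `2 · 9D` gives the constant 20.
  have c2 : Ω.length * c ^ 2 ≤ 9 * D := by
    refine le_of_mul_le_mul_left (a := Ω.length) ?_ L
    linarith
  have fin := integral_sq_add_le (h.memF.sub mC) mC
  simp only [Pi.sub_apply, sub_add_cancel, cst] at fin
  linarith

/-- The energy contains `μ` times the squared normal derivative on the boundary, which is therefore
`O(εN)` there; across the strip it changes at rate `ε` times the Hessian, so it is `O(εN)` inside
too. It is also, up to the factor `-ε`, the vertical derivative of `u`, which gives the distance to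
the boundary values. The tangential derivative has no such smallness and is bounded by the Poincaré
inequality. -/
theorem exists_coercive {μ : ℝ} (hμ : 0 < μ) :
    ∃ C > 0, ∀ᶠ ε in 𝓝[>] (0 : ℝ), Ω.Coercive μ C ε := by
  obtain ⟨K, hK, hκ⟩ := Ω.exists_curvature_bound
  set D := 4 + 4 / μ with hD
  have D0 : 0 < D := by positivity
  set E := 20 * (2 + Ω.length ^ 2 * (9 + 2 * K ^ 2 * D)) with hE
  have E0 : 0 < E := by positivity
  refine ⟨D + (2 * D + 4) + (2 * E + 4) , by positivity, ?_⟩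
  filter_upwards [Ω.eventually_tubular] with ε h
  have e0 := h.pos
  have e1 := h.le_one
  have N0 := fun u : Ω.H2 ε => h.scaledEnergy_nonneg hμ u
  have eN : ∀ u : Ω.H2 ε, 0 ≤ ε * scaledEnergy μ u := fun u => mul_nonneg e0.le (N0 u)
  have eN1 : ∀ u : Ω.H2 ε, ε * scaledEnergy μ u ≤ scaledEnergy μ u := fun u =>
    mul_le_of_le_one_left (N0 u) e1
  have eN2 : ∀ u : Ω.H2 ε, ε ^ 2 * scaledEnergy μ u ≤ ε * scaledEnergy μ u := fun u => by
    have := mul_le_mul_of_nonneg_left (eN1 u) e0.le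
    nlinarith
  have nn : ∀ X : Plane → ℝ, 0 ≤ ∫ p in Ω.refSet, X p ^ 2 := fun X =>
    integral_nonneg fun p => sq_nonneg _
  have hB : ∀ u : Ω.H2 ε, ∫ p in Ω.refSet, gradNor u p ^ 2 ≤
      D * (ε * scaledEnergy μ u) := fun u => by
    have h1 := (h.stripGrad_gradNor u).integral_sq_le_trace 0
    rw [integral_mul_neg_sq] at h1
    have h2 := h.integral_normalTrace_sq hμ u 0
    have h3 := h.integral_hess_sq hμ u
    have h4 : ∫ p in Ω.refSet, hessNN u p ^ 2 ≤ 2 * scaledEnergy μ u := by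
      linarith [nn (hessTT u), nn (hessTN u), nn (hessNT u)]
    have h5 := mul_le_mul_of_nonneg_left h4 (sq_nonneg ε)
    have h6 := eN2 u
    have : D * (ε * scaledEnergy μ u) = 4 * (ε * scaledEnergy μ u) +
        2 * (2 / μ * (ε * scaledEnergy μ u)) := by rw [hD]; ring
    rw [this]
    linarith
  have hS : ∀ (u : Ω.H2 ε) j,
      ∫ p in Ω.refSet, (Ω.pull ε u.val p - bdryVal u j (p 0)) ^ 2 ≤ D * (ε * scaledEnergy μ u) :=
    fun u j => by
    have h1 := (h.stripGrad_pull u).integral_sub_trace_le j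
    rw [integral_mul_neg_sq] at h1
    have h2 : ε ^ 2 * ∫ p in Ω.refSet, gradNor u p ^ 2 ≤ ∫ p in Ω.refSet, gradNor u p ^ 2 :=
      mul_le_of_le_one_left (nn _) (by nlinarith)
    linarith [hB u]
  have hU : ∀ u : Ω.H2 ε, ∫ p in Ω.refSet, Ω.pull ε u.val p ^ 2 ≤
      (2 * D + 4) * scaledEnergy μ u := fun u => by
    have hm := Ω.memLp_fst (h.memLp_bdryVal u 0)
    have h1 := integral_sq_add_le ((h.memLp_val u).sub hm) hm
    simp only [Pi.sub_apply, sub_add_cancel] at h1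
    rw [Ω.integral_refSet_fst (fun s => bdryVal u 0 s ^ 2)] at h1
    have h2 := hS u 0
    have h3 := h.integral_bdryVal_sq hμ u 0
    have h4 := mul_le_mul_of_nonneg_left (eN1 u) D0.le
    linarith
  have hA : ∀ u : Ω.H2 ε, ∫ p in Ω.refSet, gradTan u p ^ 2 ≤
      E * scaledEnergy μ u := fun u => by
    have hjac : ∀ p ∈ Ω.refSet, Ω.jac ε p ∈ Icc (1 / 2 : ℝ) (3 / 2) := fun p hp =>
      h.jac_mem p ⟨by linarith [hp.2.1], by linarith [hp.2.2]⟩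
    have cJ := (Ω.contDiff_jac ε).continuous
    -- Testing with the constant 1: the horizontal derivative of a function periodic in `s`
    -- integrates to zero. This is the weighted mean condition with weight `jac`.
    have mean := (h.stripGrad_pull u).horiz (fun _ => 1) ⟨contDiff_const, fun _ _ => rfl⟩
    simp only [partialDeriv, fderiv_fun_const, Pi.zero_apply, zero_apply,
      mul_zero, zero_add, mul_one] at mean
    have h1 := (h.stripGrad_gradTan u).integral_sq_le_grad cJ hjac mean
    have mT := h.memLp_hessTT u
    have mB := h.memLp_gradNor u
    have h2 := integral_sq_sub_le (Ω.memLp_mul cJ mT) (Ω.memLp_mul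
      (Ω.contDiff_curvature.continuous.comp (Plane.continuous_apply 0)) mB)
    have h3 := integral_sq_mono (f := fun p => Ω.jac ε p * hessTT u p) (C := 3 / 2) mT
      (Ω.ae_refSet fun p hp => by
        rw [abs_mul, abs_of_pos (by linarith [(hjac p hp).1])]
        exact mul_le_mul_of_nonneg_right (hjac p hp).2 (abs_nonneg _))
    have h4 := integral_sq_mono (f := fun p => Ω.curvature (p 0) * gradNor u p) (C := K) mB
      (Ω.ae_refSet fun p hp => by
        rw [abs_mul]
        exact mul_le_mul_of_nonneg_right (hκ _) (abs_nonneg _))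
    simp only [Function.comp_apply] at h2
    rw [integral_mul_neg_sq] at h1
    have h5 := h.integral_hess_sq hμ u
    have n1 := nn (hessTT u)
    have n2 := nn (hessTN u)
    have n3 := nn (hessNT u)
    have n4 := nn (hessNN u)
    have h6 : ε ^ 2 * ∫ p in Ω.refSet, hessTN u p ^ 2 ≤ ∫ p in Ω.refSet, hessTN u p ^ 2 :=
      mul_le_of_le_one_left (nn _) (by nlinarith)
    have h7 := mul_le_mul_of_nonneg_left ((hB u).trans (mul_le_mul_of_nonneg_left (eN1 u) D0.le))
      (sq_nonneg K)
    have h8 : ∫ p in Ω.refSet, (Ω.jac ε p * hessTT u p - Ω.curvature (p 0) * gradNor u p) ^ 2 ≤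
        (9 + 2 * K ^ 2 * D) * scaledEnergy μ u := by linarith
    have h9 := mul_le_mul_of_nonneg_left h8 (sq_nonneg Ω.length)
    rw [hE]
    linarith
  have hT : ∀ (u : Ω.H2 ε) j,
      ∫ s in 0..Ω.length, tangentTrace u j s ^ 2 ≤ (2 * E + 4) * scaledEnergy μ u :=
    fun u j => by
    have h1 := (h.stripGrad_gradTan u).integral_trace_sq_le j
    rw [integral_mul_neg_sq] at h1
    have h4 := h.integral_hess_sq hμ u
    have h5 : ∫ p in Ω.refSet, hessTN u p ^ 2 ≤ 2 * scaledEnergy μ u := by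
      linarith [nn (hessNN u), nn (hessTT u), nn (hessNT u)]
    have h2 : ε ^ 2 * ∫ p in Ω.refSet, hessTN u p ^ 2 ≤ ∫ p in Ω.refSet, hessTN u p ^ 2 :=
      mul_le_of_le_one_left (nn _) (by nlinarith)
    linarith [hA u]
  have up : ∀ {a N X : ℝ}, 0 ≤ N → a ≤ D + (2 * D + 4) + (2 * E + 4) → X ≤ a * N →
      X ≤ (D + (2 * D + 4) + (2 * E + 4)) * N := fun hN ha hX =>
    hX.trans (mul_le_mul_of_nonneg_right ha hN)
  exact ⟨h, fun u => up (N0 u) (by linarith) (hU u), fun u j => up (eN u) (by linarith) (hS u j),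
    fun u => up (eN u) (by linarith) (hB u), fun u => up (N0 u) (by linarith) (hA u),
    fun u j => up (N0 u) (by linarith) (hT u j)⟩

end SmoothDomain

/-! ### Smooth functions on the strip and lifts from the boundary curve -/

namespace SmoothDomain

variable {Ω : SmoothDomain} {ε : ℝ}

theorem stripGrad_one : Ω.StripGrad (fun _ => 1) (fun _ => 0) (fun _ => 0) (fun _ _ => 1) := by
  refine ⟨memLp_const _, memLp_const _, memLp_const _, fun j => memLp_const _, fun χ hχ => ?_,
    fun χ hχ => ?_⟩
  · have hd : ∀ s t, HasDerivAt (fun s => χ !₂[s, t]) (𝒟 0 χ !₂[s, t]) s := fun s t => by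
      rw [partialDeriv_eq_deriv hχ.smooth]
      simpa using ((hχ.trace t).1.differentiable (by simp) s).hasDerivAt
    have hi : Integrable (𝒟 0 χ) (𝓁 Ω.refSet) :=
      (Ω.memLp_continuous (hχ.partialDeriv 0).cont).integrable (by norm_num)
    simp only [one_mul, zero_mul, add_zero]
    rw [Ω.integral_refSet_prod_symm hi]
    have : ∀ t : ℝ, ∫ s in 0..Ω.length, 𝒟 0 χ !₂[s, t] = 0 := fun t => by
      rw [iint_ftc (fun s _ => hd s t)
        (((hχ.partialDeriv 0).trace t).1.continuous.intervalIntegrable _ _)]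
      have := hχ.per 0 t
      rw [zero_add] at this
      rw [this, sub_self]
    simp [this]
  · have hd : ∀ s t, HasDerivAt (fun t => χ !₂[s, t]) (𝒟 1 χ !₂[s, t]) t := fun s t => by
      have : 𝒞 fun t => χ !₂[s, t] :=
        hχ.smooth.comp (Plane.contDiff_mk contDiff_const contDiff_id)
      rw [partialDeriv_eq_deriv hχ.smooth]
      simpa using (this.differentiable (by simp) t).hasDerivAt
    have hi : Integrable (𝒟 1 χ) (𝓁 Ω.refSet) :=
      (Ω.memLp_continuous (hχ.partialDeriv 1).cont).integrable (by norm_num)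
    simp only [one_mul, zero_mul, add_zero]
    rw [Ω.integral_refSet_prod hi, ← iint_sub
      ((hχ.trace 1).1.continuous.intervalIntegrable _ _)
      ((hχ.trace 0).1.continuous.intervalIntegrable _ _)]
    refine iint_congr fun s _ => ?_
    have hc : Continuous fun t : ℝ => 𝒟 1 χ !₂[s, t] :=
      (hχ.partialDeriv 1).cont.comp (by fun_prop)
    exact iint_ftc (fun t _ => hd s t)
      (hc.intervalIntegrable _ _)

theorem PerSmooth.stripGrad {Z : Plane → ℝ} (hZ : Ω.PerSmooth Z) :
    Ω.StripGrad Z (𝒟 0 Z) (𝒟 1 Z) (fun j s => Z !₂[s, ((j : ℕ) : ℝ)]) := by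
  simpa using stripGrad_one.mul hZ

/-- Serves to read off the gradient and Hessian components of a lift, and its traces, from explicit
formulas on the strip. -/
theorem StripGrad.deriv_unique {F Fs Ft F' Fs' Ft' : Plane → ℝ} {g g' : Fin 2 → ℝ → ℝ}
    (h : Ω.StripGrad F Fs Ft g) (h' : Ω.StripGrad F' Fs' Ft' g')
    (hF : F =ᵐ[𝓁 Ω.refSet] F') :
    Fs =ᵐ[𝓁 Ω.refSet] Fs' ∧ Ft =ᵐ[𝓁 Ω.refSet] Ft' ∧
      ∀ j, g j =ᵐ[𝓁 (Ioc 0 Ω.length)] g' j := by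
  have hd := h.sub h'
  have h0 : (fun p => F p - F' p) =ᵐ[𝓁 Ω.refSet] 0 := by
    filter_upwards [hF] with p hp
    simp [hp]
  have h1 := hd.isWeakPartial.1.ae_eq_zero Ω.isOpen_refSet hd.memS h0
  have h2 := hd.isWeakPartial.2.ae_eq_zero Ω.isOpen_refSet hd.memT h0
  refine ⟨?_, ?_, fun j => ?_⟩
  · filter_upwards [h1] with p hp
    exact sub_eq_zero.1 hp
  · filter_upwards [h2] with p hp
    exact sub_eq_zero.1 hp
  · have h3 := hd.integral_trace_sq_le j
    have z : ∀ X : Plane → ℝ, X =ᵐ[𝓁 Ω.refSet] 0 → ∫ p in Ω.refSet, X p ^ 2 = 0 :=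
      fun X hX => by
        refine integral_eq_zero_of_ae ?_
        filter_upwards [hX] with p hp
        simp [hp]
    rw [z _ h0, z _ h2, integral_of_le Ω.length_pos.le] at h3
    filter_upwards [ae_eq_zero_of_integral_sq_nonpos (hd.memg j) (by linarith)] with s hs
    exact sub_eq_zero.1 hs

/-! ### Lifts of functions on the boundary curve -/

/-- `v` is the extension of `w` constant along the normals; `S` is its tangential derivative. -/
structure IsLift (c : ℝ) (w : ℝ → ℝ) (v : Ω.H2 ε) (S : Plane → ℝ) : Prop where
  smooth : Ω.PerSmooth S
  jac_mul : ∀ p ∈ Ω.refSet, Ω.jac ε p * S p = deriv w (p 0)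
  val : Ω.pull ε v.val =ᵐ[𝓁 Ω.refSet] fun p => w (p 0)
  hessTT : (fun p => Ω.jac ε p * hessTT v p) =ᵐ[𝓁 Ω.refSet] 𝒟 0 S
  hessTN : (fun p => Ω.jac ε p * hessTN v p) =ᵐ[𝓁 Ω.refSet]
    fun p => -(Ω.curvature (p 0) * S p)
  hessNT : (fun p => Ω.jac ε p * hessNT v p) =ᵐ[𝓁 Ω.refSet]
    fun p => -(Ω.curvature (p 0) * S p)
  hessNN : hessNN v =ᵐ[𝓁 Ω.refSet] 0
  bdryVal : ∀ j, bdryVal v j =ᵐ[𝓁 (Ioc 0 Ω.length)] w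
  normalTrace : ∀ j, normalTrace v j =ᵐ[𝓁 (Ioc 0 Ω.length)] 0
  bound : ∀ p ∈ Ω.refSet, |𝒟 0 S p - Ω.jac ε p * deriv (deriv w) (p 0)| ≤ c * ε
  bound' : ∀ p ∈ Ω.refSet, |Ω.curvature (p 0) * S p -
    Ω.jac ε p * (Ω.curvature (p 0) * deriv w (p 0))| ≤ c * ε

theorem abs_one_sub_jac_le {K : ℝ} (hκ : ∀ s, |Ω.curvature s| ≤ K) (hε : 0 ≤ ε) {p : Plane}
    (hp : p 1 ∈ Icc (0 : ℝ) 1) : |1 - Ω.jac ε p| ≤ ε * K := by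
  have : 1 - Ω.jac ε p = ε * (p 1 * Ω.curvature (p 0)) := by simp only [jac]; ring
  rw [this, abs_mul, abs_mul, abs_of_nonneg hε, abs_of_nonneg hp.1]
  refine mul_le_mul_of_nonneg_left ?_ hε
  exact (mul_le_of_le_one_left (abs_nonneg _) hp.2).trans (hκ _)

/-- The function `w(s)`, cut off in `t`, is pushed forward. Its normal derivative vanishes on the
strip and its tangential derivative is `S = w' / jac`; differentiating once more through the frame
identities gives the Hessian. All errors come from `jac - 1 = O(ε)` and its `s`-derivative, so the
constant does not depend on `ε`. -/
theorem exists_lift {w : ℝ → ℝ} (hw : 𝒞 w) (hp : Periodic w Ω.length) :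
    ∃ c > 0, ∀ ε, Ω.Tubular ε → ∃ (v : Ω.H2 ε) (S : Plane → ℝ), IsLift c w v S := by
  obtain ⟨K, hK, hκ⟩ := Ω.exists_curvature_bound
  obtain ⟨K', hK', hκ'⟩ := Ω.curvature_periodic.deriv_periodic.exists_abs_le Ω.length_pos.ne'
    (Ω.contDiff_curvature.continuous_deriv (by simp))
  have hw1 : 𝒞 (deriv w) := contDiff_infty_deriv hw
  have hw2 : 𝒞 (deriv (deriv w)) := contDiff_infty_deriv hw1
  obtain ⟨W1, hW1, hb1⟩ := hp.deriv_periodic.exists_abs_le Ω.length_pos.ne' hw1.continuous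
  obtain ⟨W2, hW2, hb2⟩ := hp.deriv_periodic.deriv_periodic.exists_abs_le Ω.length_pos.ne'
    hw2.continuous
  -- The first two terms serve `bound` and the last serves `bound'`. The factors come from `|1 -
  -- jac²| ≤ (5/2) εK`, `|S| ≤ 2 W1`, and a factor 2 for division by `jac ≥ 1/2`.
  refine ⟨5 * K * W2 + 4 * K' * W1 + 5 * K * (K * W1), by positivity, fun ε h => ?_⟩
  have e0 := h.pos
  have hζ : Ω.PerSmooth fun p => stripCutoff (p 1) * w (p 0) :=
    (PerSmooth.snd contDiff_stripCutoff).mul (.fst hw hp)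
  have hZ : Ω.PerSmooth fun p => stripCutoff (p 1) * deriv w (p 0) :=
    (PerSmooth.snd contDiff_stripCutoff).mul (.fst hw1 hp.deriv_periodic)
  obtain ⟨ψ, h1, h2, h3, -⟩ := h.exists_push hζ (α := -(1 / 2)) (β := 3 / 2) (by norm_num)
    (by norm_num) (fun p hp => by rw [stripCutoff_eq_zero hp, zero_mul])
  set S : Plane → ℝ := fun p => stripCutoff (p 1) * deriv w (p 0) / Ω.jac ε p with hS
  have PS : Ω.PerSmooth S := h.perSmooth_div_jac hZ (a := -(1 / 2)) (b := 3 / 2) (by norm_num)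
    (by norm_num) (fun p hp => by rw [stripCutoff_eq_zero hp, zero_mul])
  have hjac : ∀ p ∈ Ω.refSet, Ω.jac ε p ∈ Icc (1 / 2 : ℝ) (3 / 2) := fun p hp =>
    h.jac_mem p ⟨by linarith [hp.2.1], by linarith [hp.2.2]⟩
  have hpos : ∀ p ∈ Ω.refSet, 0 < Ω.jac ε p := fun p hp => by linarith [(hjac p hp).1]
  have hJS : ∀ p ∈ Ω.refSet, Ω.jac ε p * S p = deriv w (p 0) := fun p hp => by
    simp only [hS]
    rw [mul_div_cancel₀ _ (hpos p hp).ne', stripCutoff_eq_one (Ioo_subset_Icc_self hp.2), one_mul]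
  set v := SobolevH2.ofSmooth (Ω.thin ε) ψ h1 h2
  have hval : Ω.pull ε v.val =ᵐ[𝓁 Ω.refSet] fun p => w (p 0) :=
    Ω.ae_refSet fun p hp => by
      have := h3 p ⟨by linarith [hp.2.1], by linarith [hp.2.2]⟩
      rw [stripCutoff_eq_one (Ioo_subset_Icc_self hp.2), one_mul] at this
      exact this
  have hdw : ∀ (c : ℝ → ℝ) (_ : 𝒞 c) i p, 𝒟 i (fun p : Plane => c (p 0)) p =
      if i = 0 then deriv c (p 0) else 0 := fun c hc i p =>
    partialDeriv_coord i 0 ((hc.differentiable (by simp) _).hasDerivAt)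
  obtain ⟨u1, u2, u3⟩ := (h.stripGrad_pull v).deriv_unique
    (PerSmooth.fst hw hp : Ω.PerSmooth _).stripGrad hval
  have hA : gradTan v =ᵐ[𝓁 Ω.refSet] S := by
    filter_upwards [u1, Ω.ae_refSet hJS, Ω.ae_refSet hpos] with p a1 a2 a3
    rw [hdw w hw, if_pos rfl, ← a2] at a1
    exact mul_left_cancel₀ a3.ne' a1
  have hB : gradNor v =ᵐ[𝓁 Ω.refSet] fun _ => 0 := by
    filter_upwards [u2] with p a1
    rw [hdw w hw, if_neg one_ne_zero, neg_eq_zero] at a1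
    exact (mul_eq_zero.1 a1).resolve_left e0.ne'
  obtain ⟨v1, -, -⟩ := (h.stripGrad_gradTan v).deriv_unique PS.stripGrad hA
  obtain ⟨x1, x2, x3⟩ := (h.stripGrad_gradNor v).deriv_unique
    (PerSmooth.const 0 : Ω.PerSmooth _).stripGrad hB
  have hz : ∀ i (p : Plane), 𝒟 i (fun _ : Plane => (0 : ℝ)) p = 0 := fun i p => by
    simp [partialDeriv]
  have hNT : (fun p => Ω.jac ε p * hessNT v p) =ᵐ[𝓁 Ω.refSet]
      fun p => -(Ω.curvature (p 0) * S p) := by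
    filter_upwards [x1, hA] with p a1 a2
    rw [hz, a2] at a1
    linarith
  have hSd : ∀ p ∈ Ω.refSet, Ω.jac ε p * 𝒟 0 S p =
      deriv (deriv w) (p 0) + ε * p 1 * deriv Ω.curvature (p 0) * S p := fun p hp => by
    have e : 𝒟 0 (fun p => Ω.jac ε p * S p) p =
        𝒟 0 (fun p : Plane => deriv w (p 0)) p := by
      refine partialDeriv_congr ?_ 0
      filter_upwards [Ω.isOpen_refSet.mem_nhds hp] with q hq using hJS q hq
    rw [partialDeriv_mul ((Ω.contDiff_jac ε).diffAt p) (PS.smooth.diffAt p), hdw _ hw1, if_pos rfl,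
      (Ω.partialDeriv_jac ε p).1] at e
    linarith
  have hSb : ∀ p ∈ Ω.refSet, |S p| ≤ 2 * W1 := fun p hp => by
    have a1 := congrArg abs (hJS p hp)
    rw [abs_mul, abs_of_pos (hpos p hp)] at a1
    nlinarith [hb1 (p 0), (hjac p hp).1, abs_nonneg (S p)]
  have hsq : ∀ p ∈ Ω.refSet, |1 - Ω.jac ε p ^ 2| ≤ 5 / 2 * (ε * K) := fun p hp => by
    have a1 := abs_one_sub_jac_le hκ e0.le (Ioo_subset_Icc_self hp.2)
    have : 1 - Ω.jac ε p ^ 2 = (1 + Ω.jac ε p) * (1 - Ω.jac ε p) := by ring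
    rw [this, abs_mul, abs_of_pos (by linarith [hpos p hp])]
    exact mul_le_mul (by linarith [(hjac p hp).2]) a1 (abs_nonneg _) (by norm_num)
  have half : ∀ p ∈ Ω.refSet, ∀ X Y : ℝ, Ω.jac ε p * X = Y → |X| ≤ 2 * |Y| := fun p hp X Y e => by
    rw [← e, abs_mul, abs_of_pos (hpos p hp)]
    nlinarith [(hjac p hp).1, abs_nonneg X]
  refine ⟨v, S, PS, hJS, hval, ?_, ?_, hNT, ?_, fun j => ?_, fun j => ?_, fun p hp => ?_,
    fun p hp => ?_⟩
  · filter_upwards [v1, hB] with p a1 a2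
    rw [a2] at a1
    simpa using a1
  · filter_upwards [hNT, h.hessTN_ae_eq v] with p a1 a2
    rw [a2, a1]
  · filter_upwards [x2] with p a1
    rw [hz, neg_eq_zero] at a1
    exact (mul_eq_zero.1 a1).resolve_left e0.ne'
  · filter_upwards [u3 j] with s a1
    simpa using a1
  · exact x3 j
  · refine (half p hp _ (deriv (deriv w) (p 0) * (1 - Ω.jac ε p ^ 2) +
      ε * (p 1 * (deriv Ω.curvature (p 0) * S p))) ?_).trans ?_
    · rw [mul_sub, hSd p hp]; ring
    · have a1 : |deriv (deriv w) (p 0) * (1 - Ω.jac ε p ^ 2)| ≤ W2 * (5 / 2 * (ε * K)) := by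
        rw [abs_mul]; exact mul_le_mul (hb2 _) (hsq p hp) (abs_nonneg _) hW2.le
      have a2 : |ε * (p 1 * (deriv Ω.curvature (p 0) * S p))| ≤ ε * (K' * (2 * W1)) := by
        rw [abs_mul, abs_mul, abs_mul, abs_of_pos e0, abs_of_pos hp.2.1]
        refine mul_le_mul_of_nonneg_left ?_ e0.le
        exact (mul_le_of_le_one_left (by positivity) hp.2.2.le).trans
          (mul_le_mul (hκ' _) (hSb p hp) (abs_nonneg _) hK'.le)
      have a3 := abs_add_le (deriv (deriv w) (p 0) * (1 - Ω.jac ε p ^ 2))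
        (ε * (p 1 * (deriv Ω.curvature (p 0) * S p)))
      have a4 : 0 ≤ 5 * K * (K * W1) * ε := by positivity
      linarith
  · refine (half p hp _ (Ω.curvature (p 0) * deriv w (p 0) * (1 - Ω.jac ε p ^ 2)) ?_).trans ?_
    · rw [← hJS p hp]; ring
    · have a1 : |Ω.curvature (p 0) * deriv w (p 0) * (1 - Ω.jac ε p ^ 2)| ≤
          K * W1 * (5 / 2 * (ε * K)) := by
        rw [abs_mul, abs_mul]
        exact mul_le_mul (mul_le_mul (hκ _) (hb1 _) (abs_nonneg _) hK.le) (hsq p hp)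
          (abs_nonneg _) (by positivity)
      have a4 : 0 ≤ (5 * K * W2 + 4 * K' * W1) * ε := by positivity
      linarith

variable (Ω) in
/-- The differential operator of the limit problem. -/
def limitOp (w : ℝ → ℝ) (s : ℝ) : ℝ :=
  deriv (deriv (deriv (deriv w))) s - 2 * deriv (fun r => Ω.curvature r ^ 2 * deriv w r) s

theorem sq_integral_mul_le {X c : Plane → ℝ} (hX : 𝓛 X Ω.refSet)
    (hc : Continuous c) {k : ℝ} (hk : ∀ p ∈ Ω.refSet, |c p| ≤ k) :
    (∫ p in Ω.refSet, X p * c p) ^ 2 ≤ (∫ p in Ω.refSet, X p ^ 2) * (k ^ 2 * Ω.length) := by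
  refine (integral_mul_sq_le hX (Ω.memLp_continuous hc)).trans ?_
  refine mul_le_mul_of_nonneg_left ?_ (integral_nonneg fun p => sq_nonneg _)
  have e : ∫ _ in Ω.refSet, k ^ 2 = k ^ 2 * Ω.length := by
    rw [Ω.integral_refSet_fst fun _ => k ^ 2]; simp; ring
  rw [← e]
  refine setIntegral_mono_on (Ω.memLp_continuous hc).integrable_sq (integrable_const _)
    Ω.isOpen_refSet.measurableSet fun p hp => ?_
  rw [← sq_abs]
  exact pow_le_pow_left₀ (abs_nonneg _) (hk p hp) 2

theorem integral_mul_sub {X c d : Plane → ℝ} (hX : 𝓛 X Ω.refSet)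
    (hc : Continuous c) (hd : Continuous d) : ∫ p in Ω.refSet, X p * (c p - d p) =
      (∫ p in Ω.refSet, X p * c p) - ∫ p in Ω.refSet, X p * d p := by
  rw [← integral_sub (integrable_mul_continuous hX hc) (integrable_mul_continuous hX hd)]
  congr 1; ext p; ring

/-- The lift has no normal derivative, so the term with `μ` drops out. The density `jac` of the
volume is absorbed in the Hessian of the lift, and the two equal mixed components give the factor 2.
-/
theorem energy_lift_eq {c μ : ℝ} {w : ℝ → ℝ} (h : Ω.Tubular ε) {v : Ω.H2 ε}
    {S : Plane → ℝ} (hv : IsLift c w v S) (u : Ω.H2 ε) :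
    h.energy μ u v = ε * ((∫ p in Ω.refSet, hessTT u p * 𝒟 0 S p) -
      2 * ∫ p in Ω.refSet, hessNT u p * (Ω.curvature (p 0) * S p)) := by
  have c1 := (hv.smooth.partialDeriv 0).cont
  have c2 := (Ω.perSmooth_curvature.mul hv.smooth).cont
  have hb : Ω.bdryIntegral ε (fun j s => normalTrace u j s * normalTrace v j s) = 0 := by
    have z : ∀ j, ∀ a : ℝ → ℝ, ∫ s in 0..Ω.length,
        normalTrace u j s * normalTrace v j s * a s = 0 := fun j a => by
      rw [integral_of_le Ω.length_pos.le]
      refine integral_eq_zero_of_ae ?_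
      filter_upwards [hv.normalTrace j] with s hs
      simp [hs]
    have z0 := z 0 fun _ => 1
    simp only [mul_one] at z0
    rw [h.bdryIntegral_eq, z0, z, add_zero]
  rw [h.energy_apply, hb, mul_zero, add_zero, h.hessForm_eq, ← integral_const_mul,
    ← integral_sub (integrable_mul_continuous (h.memLp_hessTT u) c1)
      ((integrable_mul_continuous (h.memLp_hessNT u) c2).const_mul 2), ← integral_const_mul]
  refine integral_congr_ae ?_
  filter_upwards [hv.hessTT, hv.hessTN, hv.hessNT, hv.hessNN, h.hessTN_ae_eq u] with p a1 a2 a3 a4 a5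
  rw [a4, a5]
  simp only [Pi.zero_apply, mul_zero, add_zero]
  rw [← a1]
  linear_combination ε * hessNT u p * a2 + ε * hessNT u p * a3

theorem sq_combination_le (x y z t : ℝ) :
    (x - 2 * y + z + t) ^ 2 ≤ 4 * (x ^ 2 + 4 * y ^ 2 + z ^ 2 + t ^ 2) := by
  nlinarith [sq_nonneg (x + 2 * y), sq_nonneg (x - z), sq_nonneg (x - t),
    sq_nonneg (2 * y + z), sq_nonneg (2 * y + t), sq_nonneg (z - t)]

set_option maxHeartbeats 1600000 in
-- The identities for the horizontal derivatives of `u`, `gradTan` and `gradNor` are tested with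
-- `Y`, `w''` and `κw'`, which moves all derivatives to `w`. What remains pairs the Hessian of `u`
-- with the `O(ε)` errors of the lift, the tangential derivative with `1 - jac`, and the small
-- normal derivative with a bounded function; each square is `O(εN)`. In the boundary form both
-- traces are replaced by `u` itself at a cost of the same order.
theorem exists_energy_lift {μ : ℝ} (hμ : 0 < μ) {C : ℝ} (hC : 0 < C) {w : ℝ → ℝ}
    (hw : 𝒞 w) (hp : Periodic w Ω.length) {c : ℝ} (hc : 0 < c) :
    ∃ D > 0, ∀ ε (hco : Ω.Coercive μ C ε) (v : Ω.H2 ε) (S : Plane → ℝ),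
      IsLift c w v S → ∀ u : Ω.H2 ε,
      (hco.tubular.energy μ u v / ε - ∫ p in Ω.refSet, Ω.pull ε u.val p * Ω.limitOp w (p 0)) ^ 2 ≤
        D * (ε * scaledEnergy μ u) ∧
      (hco.tubular.bdryForm u v - 2 * ∫ p in Ω.refSet, Ω.pull ε u.val p * w (p 0)) ^ 2 ≤
        D * (ε * scaledEnergy μ u) := by
  obtain ⟨K, hK, hκ⟩ := Ω.exists_curvature_bound
  have L := Ω.length_pos
  have sm : ∀ {f : ℝ → ℝ}, 𝒞 f → 𝒞 (deriv f) := fun hf =>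
    contDiff_infty_deriv hf
  have κs := Ω.contDiff_curvature
  have w1 := sm hw
  have w2 := sm w1
  have w3 := sm w2
  have w4 := sm w3
  have p1 := hp.deriv_periodic
  have p2 := p1.deriv_periodic
  have p3 := p2.deriv_periodic
  have κp := Ω.curvature_periodic
  set k1 : ℝ → ℝ := fun r => Ω.curvature r * deriv w r with hk1
  have sk1 : 𝒞 k1 := κs.mul w1
  have pk1 : Periodic k1 Ω.length := fun s => by simp only [hk1]; rw [κp s, p1 s]
  set k2 : ℝ → ℝ := fun r => Ω.curvature r ^ 2 * deriv w r with hk2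
  have sk2 : 𝒞 k2 := (κs.pow 2).mul w1
  have pk2 : Periodic k2 Ω.length := fun s => by simp only [hk2]; rw [κp s, p1 s]
  set k3 : ℝ → ℝ := fun r => Ω.curvature r * deriv (deriv w) r with hk3
  have sk3 : 𝒞 k3 := κs.mul w2
  have pk3 : Periodic k3 Ω.length := fun s => by simp only [hk3]; rw [κp s, p2 s]
  -- Chosen so that `Y' = -limitOp w`: testing the horizontal derivative of `u` with `Y` converts `∫
  -- u limitOp w` into a pairing with the tangential derivative.
  set Y : ℝ → ℝ := fun r => 2 * k2 r - deriv (deriv (deriv w)) r with hY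
  have sY : 𝒞 Y := (contDiff_const.mul sk2).sub w3
  have pY : Periodic Y Ω.length := fun s => by simp only [hY]; rw [pk2 s, p3 s]
  -- Collects everything that multiplies the normal derivative after integration by parts.
  set q : ℝ → ℝ := fun r => 2 * deriv k1 r + k3 r with hq
  have sq' : 𝒞 q := (contDiff_const.mul (sm sk1)).add sk3
  have pq : Periodic q Ω.length := fun s => by
    simp only [hq]; rw [pk1.deriv_periodic s, pk3 s]
  obtain ⟨MY, hMY, bY⟩ := pY.exists_abs_le L.ne' sY.continuous
  obtain ⟨Mq, hMq, bq⟩ := pq.exists_abs_le L.ne' sq'.continuous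
  obtain ⟨Mw, hMw, bw⟩ := hp.exists_abs_le L.ne' hw.continuous
  have co : ∀ {f : ℝ → ℝ}, 𝒞 f → Continuous fun p : Plane => f (p 0) := fun hf =>
    hf.continuous.comp (Plane.continuous_apply 0)
  -- One constant for both estimates: the group with 4 bounds the four error terms of the energy,
  -- where `10 = 2 + 4 · 2`, and the group with 3 bounds the three error terms of the boundary form.
  refine ⟨4 * (10 * c ^ 2 * Ω.length + C * (Mq ^ 2 * Ω.length) +
    C * ((K * MY) ^ 2 * Ω.length)) + 3 * (2 * (C * (Mw ^ 2 * Ω.length)) +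
    2 * ((K * Mw) ^ 2 * Ω.length)), by positivity, fun ε hco v S hv u => ?_⟩
  have h := hco.tubular
  have e0 := h.pos
  have e1 := h.le_one
  set N := scaledEnergy μ u with hN
  have N0 : 0 ≤ N := h.scaledEnergy_nonneg hμ u
  have e2 : ε ^ 2 * N ≤ ε * N := mul_le_mul_of_nonneg_right (by nlinarith) N0
  have nn : ∀ X : Plane → ℝ, 0 ≤ ∫ p in Ω.refSet, X p ^ 2 := fun X =>
    integral_nonneg fun p => sq_nonneg _
  have eN : 0 ≤ ε * N := mul_nonneg e0.le N0
  have mA := h.memLp_gradTan u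
  have mB := h.memLp_gradNor u
  have mT := h.memLp_hessTT u
  have mN := h.memLp_hessNT u
  have mU := h.memLp_val u
  have cJ := (Ω.contDiff_jac ε).continuous
  have hdw : ∀ (c : ℝ → ℝ) (_ : 𝒞 c) p, 𝒟 0 (fun p : Plane => c (p 0)) p =
      deriv c (p 0) := fun c hc p => by
    rw [partialDeriv_coord 0 0 ((hc.differentiable (by simp) _).hasDerivAt), if_pos rfl]
  constructor
  · have I1 := (h.stripGrad_pull u).horiz _ (PerSmooth.fst sY pY)
    have I2 := (h.stripGrad_gradTan u).horiz _ (PerSmooth.fst w2 p2)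
    have I3 := (h.stripGrad_gradNor u).horiz _ (PerSmooth.fst sk1 pk1)
    simp only [hdw _ sY, hdw _ w2, hdw _ sk1] at I1 I2 I3
    have f1 : (∫ p in Ω.refSet, Ω.pull ε u.val p * deriv Y (p 0)) +
        ∫ p in Ω.refSet, gradTan u p * (Ω.jac ε p * Y (p 0)) = 0 := by
      have a1 := integral_add (integrable_mul_continuous mU (co (sm sY)))
        (integrable_mul_continuous mA (cJ.mul (co sY)))
      simp only [Pi.mul_apply] at a1
      rw [← I1, ← a1]
      congr 1; ext p; ring
    have f2 : (∫ p in Ω.refSet, gradTan u p * deriv (deriv (deriv w)) (p 0)) +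
        (∫ p in Ω.refSet, hessTT u p * (Ω.jac ε p * deriv (deriv w) (p 0))) -
        ∫ p in Ω.refSet, gradNor u p * k3 (p 0) = 0 := by
      have a1 := integrable_mul_continuous mA (co w3)
      have a2 := integrable_mul_continuous mT (cJ.mul (co w2))
      have a3 := integrable_mul_continuous mB (co sk3)
      have b1 := integral_add a1 a2
      have b2 := integral_sub (a1.add a2) a3
      simp only [Pi.add_apply, Pi.mul_apply] at b1 b2
      rw [← b1, ← b2, ← I2]
      congr 1; ext p; simp only [hk3]; ring
    have f3 : (∫ p in Ω.refSet, gradNor u p * deriv k1 (p 0)) +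
        (∫ p in Ω.refSet, hessNT u p * (Ω.jac ε p * k1 (p 0))) +
        ∫ p in Ω.refSet, gradTan u p * k2 (p 0) = 0 := by
      have a1 := integrable_mul_continuous mB (co (sm sk1))
      have a2 := integrable_mul_continuous mN (cJ.mul (co sk1))
      have a3 := integrable_mul_continuous mA (co sk2)
      have b1 := integral_add a1 a2
      have b2 := integral_add (a1.add a2) a3
      simp only [Pi.add_apply, Pi.mul_apply] at b1 b2
      rw [← b1, ← b2, ← I3]
      congr 1; ext p; simp only [hk1, hk2]; ring
    have f4 : ∫ p in Ω.refSet, gradTan u p * Y (p 0) =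
        2 * (∫ p in Ω.refSet, gradTan u p * k2 (p 0)) -
          ∫ p in Ω.refSet, gradTan u p * deriv (deriv (deriv w)) (p 0) := by
      rw [← integral_const_mul, ← integral_sub ((integrable_mul_continuous mA (co sk2)).const_mul 2)
        (integrable_mul_continuous mA (co w3))]
      congr 1; ext p; simp only [hY]; ring
    have f5 : ∫ p in Ω.refSet, gradNor u p * q (p 0) =
        2 * (∫ p in Ω.refSet, gradNor u p * deriv k1 (p 0)) +
          ∫ p in Ω.refSet, gradNor u p * k3 (p 0) := by
      rw [← integral_const_mul, ← integral_add
        ((integrable_mul_continuous mB (co (sm sk1))).const_mul 2)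
        (integrable_mul_continuous mB (co sk3))]
      congr 1; ext p; simp only [hq]; ring
    have f6 : ∫ p in Ω.refSet, Ω.pull ε u.val p * Ω.limitOp w (p 0) =
        -∫ p in Ω.refSet, Ω.pull ε u.val p * deriv Y (p 0) := by
      rw [← integral_neg]
      congr 1; ext p
      have : deriv Y (p 0) = -Ω.limitOp w (p 0) := by
        have d1 := (sk2.differentiable (by simp) (p 0)).hasDerivAt
        have d2 := (w3.differentiable (by simp) (p 0)).hasDerivAt
        have d3 : HasDerivAt Y _ (p 0) := (d1.const_mul 2).sub d2
        rw [d3.deriv, limitOp]; ring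
      rw [this]; ring
    have cS := (hv.smooth.partialDeriv 0).cont
    have cκS : Continuous fun p : Plane => Ω.curvature (p 0) * S p :=
      (Ω.perSmooth_curvature.mul hv.smooth).cont
    have g1 := integral_mul_sub mT cS (cJ.mul (co w2))
    have g2 := integral_mul_sub mN cκS (cJ.mul (co sk1))
    have g4 := integral_mul_sub mA (co sY) (cJ.mul (co sY))
    simp only [Pi.mul_apply] at g1 g2 g4
    have e : h.energy μ u v / ε - ∫ p in Ω.refSet, Ω.pull ε u.val p * Ω.limitOp w (p 0) =
        (∫ p in Ω.refSet, hessTT u p * (𝒟 0 S p - Ω.jac ε p * deriv (deriv w) (p 0))) -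
        2 * (∫ p in Ω.refSet, hessNT u p * (Ω.curvature (p 0) * S p - Ω.jac ε p * k1 (p 0))) +
        (∫ p in Ω.refSet, gradNor u p * q (p 0)) +
        ∫ p in Ω.refSet, gradTan u p * (Y (p 0) - Ω.jac ε p * Y (p 0)) := by
      rw [energy_lift_eq h hv u, mul_div_cancel_left₀ _ e0.ne', g1, g2, g4, f4, f5, f6]
      linarith
    rw [e]
    have b1 := sq_integral_mul_le mT (cS.sub (cJ.mul (co w2))) hv.bound
    have b2 := sq_integral_mul_le mN (cκS.sub (cJ.mul (co sk1))) hv.bound'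
    have b3 := sq_integral_mul_le mB (co sq') (fun p _ => bq (p 0))
    have b4 := sq_integral_mul_le mA ((co sY).sub (cJ.mul (co sY))) (k := ε * K * MY)
      (fun p hp => by
        have : Y (p 0) - Ω.jac ε p * Y (p 0) = (1 - Ω.jac ε p) * Y (p 0) := by ring
        simp only [Pi.sub_apply, Pi.mul_apply]
        rw [this, abs_mul]
        exact mul_le_mul (abs_one_sub_jac_le hκ e0.le (Ioo_subset_Icc_self hp.2)) (bY _)
          (abs_nonneg _) (by positivity))
    simp only [Pi.sub_apply, Pi.mul_apply] at b1 b2 b3 b4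
    have hh := h.integral_hess_sq hμ u
    have hT : ∫ p in Ω.refSet, hessTT u p ^ 2 ≤ 2 * N := by
      linarith [nn (hessNN u), nn (hessTN u), nn (hessNT u)]
    have hNT : ∫ p in Ω.refSet, hessNT u p ^ 2 ≤ 2 * N := by
      linarith [nn (hessNN u), nn (hessTN u), nn (hessTT u)]
    have hBB := hco.gradNor u
    have hAA := hco.gradTan u
    have d1 : (∫ p in Ω.refSet, hessTT u p ^ 2) * ((c * ε) ^ 2 * Ω.length) ≤
        2 * c ^ 2 * Ω.length * (ε * N) := by
      calc _ ≤ 2 * N * ((c * ε) ^ 2 * Ω.length) := mul_le_mul_of_nonneg_right hT (by positivity)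
        _ = 2 * c ^ 2 * Ω.length * (ε ^ 2 * N) := by ring
        _ ≤ _ := mul_le_mul_of_nonneg_left e2 (by positivity)
    have d2 : (∫ p in Ω.refSet, hessNT u p ^ 2) * ((c * ε) ^ 2 * Ω.length) ≤
        2 * c ^ 2 * Ω.length * (ε * N) := by
      calc _ ≤ 2 * N * ((c * ε) ^ 2 * Ω.length) := mul_le_mul_of_nonneg_right hNT (by positivity)
        _ = 2 * c ^ 2 * Ω.length * (ε ^ 2 * N) := by ring
        _ ≤ _ := mul_le_mul_of_nonneg_left e2 (by positivity)
    have d3 : (∫ p in Ω.refSet, gradNor u p ^ 2) * (Mq ^ 2 * Ω.length) ≤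
        C * (Mq ^ 2 * Ω.length) * (ε * N) := by
      calc _ ≤ C * (ε * N) * (Mq ^ 2 * Ω.length) := mul_le_mul_of_nonneg_right hBB (by positivity)
        _ = _ := by ring
    have d4 : (∫ p in Ω.refSet, gradTan u p ^ 2) * ((ε * K * MY) ^ 2 * Ω.length) ≤
        C * ((K * MY) ^ 2 * Ω.length) * (ε * N) := by
      calc _ ≤ C * N * ((ε * K * MY) ^ 2 * Ω.length) :=
            mul_le_mul_of_nonneg_right hAA (by positivity)
        _ = C * ((K * MY) ^ 2 * Ω.length) * (ε ^ 2 * N) := by ring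
        _ ≤ _ := mul_le_mul_of_nonneg_left e2 (by positivity)
    refine (sq_combination_le _ _ _ _).trans ?_
    have pos : 0 ≤ 3 * (2 * (C * (Mw ^ 2 * Ω.length)) + 2 * ((K * Mw) ^ 2 * Ω.length)) * (ε * N) :=
      by positivity
    linarith
  · have hg := fun j => h.memLp_bdryVal u j
    have mg := fun j => Ω.memLp_fst (hg j)
    have cw : Continuous fun p : Plane => w (p 0) := co hw
    have cj := continuous_jac_trace (Ω := Ω) (ε := ε) 1
    have t : ∀ j : Fin 2, ∫ p in Ω.refSet, (Ω.pull ε u.val p - bdryVal u j (p 0)) * w (p 0) =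
        (∫ p in Ω.refSet, Ω.pull ε u.val p * w (p 0)) -
          ∫ s in 0..Ω.length, bdryVal u j s * w s := fun j => by
      rw [← Ω.integral_refSet_fst fun s => bdryVal u j s * w s,
        ← integral_sub (integrable_mul_continuous mU cw) (integrable_mul_continuous (mg j) cw)]
      congr 1; ext p; ring
    have hb : h.bdryForm u v = (∫ s in 0..Ω.length, bdryVal u 0 s * w s) +
        ∫ s in 0..Ω.length, bdryVal u 1 s * (w s * Ω.jac ε !₂[s, 1]) := by
      rw [h.bdryForm_apply, h.bdryIntegral_eq]
      congr 1
      · rw [integral_of_le L.le, integral_of_le L.le]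
        refine integral_congr_ae ?_
        filter_upwards [hv.bdryVal 0] with s hs
        rw [hs]
      · rw [integral_of_le L.le, integral_of_le L.le]
        refine integral_congr_ae ?_
        filter_upwards [hv.bdryVal 1] with s hs
        rw [hs]; ring
    have h1 : ∫ s in 0..Ω.length, bdryVal u 1 s * (w s * (Ω.jac ε !₂[s, 1] - 1)) =
        (∫ s in 0..Ω.length, bdryVal u 1 s * (w s * Ω.jac ε !₂[s, 1])) -
          ∫ s in 0..Ω.length, bdryVal u 1 s * w s := by
      have i1 := intervalIntegrable_mul_continuous (hg 1) (hw.continuous.mul cj)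
      have i2 := intervalIntegrable_mul_continuous (hg 1) hw.continuous
      have := iint_sub i1 i2
      simp only [Pi.mul_apply] at this
      rw [← this]
      congr 1; ext s; ring
    have e : h.bdryForm u v - 2 * ∫ p in Ω.refSet, Ω.pull ε u.val p * w (p 0) =
        -(∫ p in Ω.refSet, (Ω.pull ε u.val p - bdryVal u 0 (p 0)) * w (p 0)) +
        -(∫ p in Ω.refSet, (Ω.pull ε u.val p - bdryVal u 1 (p 0)) * w (p 0)) +
        ∫ s in 0..Ω.length, bdryVal u 1 s * (w s * (Ω.jac ε !₂[s, 1] - 1)) := by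
      rw [t, t, h1, hb]; ring
    rw [e]
    have b := fun j => sq_integral_mul_le (mU.sub (mg j)) cw (fun p _ => bw (p 0))
    have b3 : (∫ s in 0..Ω.length, bdryVal u 1 s * (w s * (Ω.jac ε !₂[s, 1] - 1))) ^ 2 ≤
        2 * N * ((ε * K * Mw) ^ 2 * Ω.length) := by
      rw [← Ω.integral_refSet_fst fun s => bdryVal u 1 s * (w s * (Ω.jac ε !₂[s, 1] - 1))]
      have cc : Continuous fun p : Plane => w (p 0) * (Ω.jac ε !₂[p 0, 1] - 1) :=
        cw.mul ((cj.comp (Plane.continuous_apply 0)).sub continuous_const)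
      refine (sq_integral_mul_le (mg 1) cc (k := ε * K * Mw) fun p _ => ?_).trans ?_
      · rw [abs_mul, mul_comm, abs_sub_comm]
        exact mul_le_mul (abs_one_sub_jac_le hκ e0.le (by simp)) (bw _) (abs_nonneg _)
          (by positivity)
      · rw [Ω.integral_refSet_fst fun s => bdryVal u 1 s ^ 2]
        exact mul_le_mul_of_nonneg_right (h.integral_bdryVal_sq hμ u 1) (by positivity)
    have b3' : 2 * N * ((ε * K * Mw) ^ 2 * Ω.length) ≤ 2 * ((K * Mw) ^ 2 * Ω.length) * (ε * N) := by
      calc _ = 2 * ((K * Mw) ^ 2 * Ω.length) * (ε ^ 2 * N) := by ring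
        _ ≤ _ := mul_le_mul_of_nonneg_left e2 (by positivity)
    have b' : ∀ j : Fin 2, (∫ p in Ω.refSet, (Ω.pull ε u.val p - bdryVal u j (p 0)) * w (p 0)) ^ 2 ≤
        C * (Mw ^ 2 * Ω.length) * (ε * N) := fun j => by
      refine (b j).trans ?_
      calc _ ≤ C * (ε * N) * (Mw ^ 2 * Ω.length) :=
            mul_le_mul_of_nonneg_right (hco.sub_bdryVal u j) (by positivity)
        _ = _ := by ring
    refine (sq_add_three_le _ _ _).trans ?_
    rw [neg_sq, neg_sq]
    have pos : 0 ≤ 4 * (10 * c ^ 2 * Ω.length + C * (Mq ^ 2 * Ω.length) +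
      C * ((K * MY) ^ 2 * Ω.length)) * (ε * N) := by positivity
    have := b' 0
    have := b' 1
    linarith

end SmoothDomain

namespace SmoothDomain

variable {Ω : SmoothDomain}

/-! ### Compactness for functions of one variable -/

variable (Ω) in
/-- The first end point of the period. -/
def startPt : Icc 0 Ω.length := ⟨0, left_mem_Icc.2 Ω.length_pos.le⟩

variable (Ω) in
/-- The last end point of the period. -/
def endPt : Icc 0 Ω.length := ⟨Ω.length, right_mem_Icc.2 Ω.length_pos.le⟩

variable (Ω) in
/-- Periodic functions with a bound for the supremum and the Hölder norm of exponent `1/2`. -/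
def holderBall (R : ℝ) : Set (BoundedContinuousFunction (Icc 0 Ω.length) ℝ) :=
  {f | (∀ x, |f x| ≤ R) ∧ (∀ x y, |f x - f y| ≤ R * √(dist x y)) ∧ f Ω.startPt = f Ω.endPt}

/-- Arzelà–Ascoli. Equality of the values at the two end points is kept as a closed condition, so
limits extend to continuous periodic functions. -/
theorem isCompact_holderBall (R : ℝ) : IsCompact (Ω.holderBall R) := by
  have ce : ∀ x, Continuous fun f : BoundedContinuousFunction (Icc 0 Ω.length) ℝ => f x :=
    fun x => continuous_eval_const x
  refine BoundedContinuousFunction.arzela_ascoli₂ (Icc (-R) R) isCompact_Icc _ ?_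
    (fun f x hf => abs_le.1 (hf.1 x)) ?_
  · have : Ω.holderBall R = (⋂ x, {f | |f x| ≤ R}) ∩
        ((⋂ x, ⋂ y, {f | |f x - f y| ≤ R * √(dist x y)}) ∩ {f | f Ω.startPt = f Ω.endPt}) := by
      ext f; simp only [holderBall, mem_inter_iff, mem_iInter, mem_ofPred_eq]
    rw [this]
    refine (isClosed_iInter fun x => isClosed_le (ce x).abs continuous_const).inter
      ((isClosed_iInter fun x => isClosed_iInter fun y => isClosed_le
        ((ce x).sub (ce y)).abs continuous_const).inter (isClosed_eq (ce _) (ce _)))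
  · refine Metric.equicontinuous_of_continuity_modulus (fun r => R * √r) ?_ _
      fun x y f => f.2.2.1 x y
    have : Continuous fun r : ℝ => R * √r := by fun_prop
    simpa using this.tendsto 0

variable (Ω) in
/-- The restriction of a function on the period to the interval, extended by constants. -/
def extendPeriod (f : BoundedContinuousFunction (Icc 0 Ω.length) ℝ) : ℝ → ℝ :=
  IccExtend Ω.length_pos.le f

theorem continuous_extendPeriod (f : BoundedContinuousFunction (Icc 0 Ω.length) ℝ) :
    Continuous (Ω.extendPeriod f) := f.continuous.Icc_extend'

theorem extendPeriod_apply (f : BoundedContinuousFunction (Icc 0 Ω.length) ℝ) {s : ℝ}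
    (hs : s ∈ Icc 0 Ω.length) : Ω.extendPeriod f s = f ⟨s, hs⟩ := IccExtend_of_mem _ _ hs

theorem abs_extendPeriod_sub_le (f g : BoundedContinuousFunction (Icc 0 Ω.length) ℝ) (s : ℝ) :
    |Ω.extendPeriod f s - Ω.extendPeriod g s| ≤ dist f g :=
  BoundedContinuousFunction.dist_coe_le_dist (f := f) (g := g) _

/-- The embedding of `H¹` of the circle into Hölder functions, with a radius depending only on `M`
and the length. The modulus of continuity is that of a primitive; averaging `G(s)² ≤ 2G(t)² + 2(G(s)
- G(t))²` over `t` bounds the supremum. -/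
theorem exists_mem_holderBall (M : ℝ) : ∃ R, ∀ g k : ℝ → ℝ,
    𝓛 g (Ioc 0 Ω.length) → 𝓛 k (Ioc 0 Ω.length) →
    (∀ χ : ℝ → ℝ, 𝒞 χ → Periodic χ Ω.length →
      ∫ s in 0..Ω.length, (g s * deriv χ s + k s * χ s) = 0) →
    ∫ s in 0..Ω.length, g s ^ 2 ≤ M → ∫ s in 0..Ω.length, k s ^ 2 ≤ M →
    ∃ f ∈ Ω.holderBall R, g =ᵐ[𝓁 (Ioc 0 Ω.length)] Ω.extendPeriod f := by
  have L := Ω.length_pos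
  refine ⟨√((2 * M + 2 * M * Ω.length ^ 2) / Ω.length) + √M, fun g k hg hk h h1 h2 => ?_⟩
  have M0 : 0 ≤ M := le_trans (iint_nonneg L.le fun s _ => sq_nonneg _) h1
  obtain ⟨k0, c, hc⟩ := ae_eq_primitive hg hk h
  set G : ℝ → ℝ := fun s => c + ∫ r in 0..s, k r with hG
  have mod : ∀ {s t}, s ∈ Icc 0 Ω.length → t ∈ Icc 0 Ω.length → |G s - G t| ≤ √M * √|s - t| :=
    fun hs ht => by
      simp only [hG, add_sub_add_left_eq_sub]
      exact abs_primitive_sub_le hk h2 hs ht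
  have sup : ∀ {s}, s ∈ Icc 0 Ω.length →
      |G s| ≤ √((2 * M + 2 * M * Ω.length ^ 2) / Ω.length) := fun {s} hs => by
    refine Real.abs_le_sqrt ((le_div_iff₀ L).2 ?_)
    have i : IntervalIntegrable (fun t => 2 * g t ^ 2 + 2 * (M * Ω.length)) volume 0 Ω.length := by
      refine IntervalIntegrable.add (IntervalIntegrable.const_mul ?_ 2) (by simp)
      simpa only [sq] using intervalIntegrable_mul hg hg
    have : ∫ t in 0..Ω.length, G s ^ 2 ≤
        ∫ t in 0..Ω.length, (2 * g t ^ 2 + 2 * (M * Ω.length)) := by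
      rw [integral_of_le L.le, integral_of_le L.le]
      refine integral_mono_ae (integrable_const _)
        (by rwa [intervalIntegrable_iff, uIoc_of_le L.le] at i) ?_
      filter_upwards [hc, ae_restrict_mem measurableSet_Ioc] with t ht htm
      have ht' := mod hs (Ioc_subset_Icc_self htm)
      have a1 : |s - t| ≤ Ω.length := by
        rw [abs_le]; constructor <;> linarith [hs.1, hs.2, htm.1, htm.2]
      have a2 : (G s - G t) ^ 2 ≤ M * Ω.length := by
        rw [← sq_abs]
        calc _ ≤ (√M * √|s - t|) ^ 2 := by gcongr
          _ = M * |s - t| := by rw [mul_pow, Real.sq_sqrt M0, Real.sq_sqrt (abs_nonneg _)]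
          _ ≤ _ := by gcongr
      rw [ht]
      nlinarith [sq_nonneg (G s - 2 * G t)]
    rw [iint_add _ (by simp)] at this
    · rw [iint_const_mul] at this
      simp only [iint_const, sub_zero, smul_eq_mul] at this
      linarith
    · refine IntervalIntegrable.const_mul ?_ 2
      simpa only [sq] using intervalIntegrable_mul hg hg
  have cG : ContinuousOn G (Icc 0 Ω.length) := fun s hs => by
    refine Metric.continuousWithinAt_iff'.2 fun δ hδ => ?_
    have : ContinuousWithinAt (fun t => √M * √|t - s|) (Icc 0 Ω.length) s := by
      apply Continuous.continuousWithinAt; fun_prop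
    have := (this.tendsto.eventually_lt_const (u := δ) (by simpa using hδ))
    filter_upwards [this, self_mem_nhdsWithin] with t ht htm
    exact (mod htm hs).trans_lt ht
  refine ⟨BoundedContinuousFunction.mkOfCompact ⟨(Icc 0 Ω.length).domRestrict G, cG.domRestrict⟩,
    ⟨fun x => ?_, fun x y => ?_, ?_⟩, ?_⟩
  · exact (sup x.2).trans (le_add_of_nonneg_right (Real.sqrt_nonneg _))
  · refine (mod x.2 y.2).trans ?_
    exact mul_le_mul_of_nonneg_right (le_add_of_nonneg_left (Real.sqrt_nonneg _))
      (Real.sqrt_nonneg _)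
  · change G 0 = G Ω.length
    simp only [hG]
    rw [k0]; simp
  · filter_upwards [hc, ae_restrict_mem measurableSet_Ioc] with s hs hm
    rw [hs, extendPeriod_apply _ (Ioc_subset_Icc_self hm)]
    rfl

/-- The periodic extension of a function on the period with equal values at the end points. -/
theorem exists_periodic_extension {f : BoundedContinuousFunction (Icc 0 Ω.length) ℝ}
    (hf : f Ω.startPt = f Ω.endPt) :
    ∃ g : ℝ → ℝ, Continuous g ∧ Periodic g Ω.length ∧
      ∀ s ∈ Icc 0 Ω.length, g s = Ω.extendPeriod f s := by
  have L := Ω.length_pos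
  have : Fact (0 < Ω.length) := ⟨L⟩
  have e0 : Ω.extendPeriod f 0 = Ω.extendPeriod f Ω.length := by
    rw [extendPeriod_apply f (left_mem_Icc.2 L.le), extendPeriod_apply f (right_mem_Icc.2 L.le)]
    exact hf
  have cl : Continuous (AddCircle.liftIco Ω.length 0 (Ω.extendPeriod f)) :=
    AddCircle.liftIco_continuous (by simpa using e0) (continuous_extendPeriod f).continuousOn
  have ev : ∀ s ∈ Ico 0 Ω.length,
      AddCircle.liftIco Ω.length 0 (Ω.extendPeriod f) (s : AddCircle Ω.length) =
        Ω.extendPeriod f s := fun s hs => AddCircle.liftIco_coe_apply (by simpa using hs)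
  refine ⟨fun s => AddCircle.liftIco Ω.length 0 (Ω.extendPeriod f) (s : AddCircle Ω.length),
    cl.comp (AddCircle.continuous_mk' _), fun s => ?_, fun s hs => ?_⟩
  · simp
  · rcases hs.2.lt_or_eq with h | h
    · exact ev s ⟨hs.1, h⟩
    · subst h
      rw [← e0, ← ev 0 ⟨le_rfl, L⟩]
      simp only [AddCircle.coe_period, AddCircle.coe_zero]

end SmoothDomain

namespace SmoothDomain

variable {Ω : SmoothDomain}

/-! ### The differential operator of the limit problem -/

theorem hasDerivAt_of_contDiff {f : ℝ → ℝ} (hf : 𝒞 f) (s : ℝ) :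
    HasDerivAt f (deriv f s) s := (hf.differentiable (by simp) s).hasDerivAt

theorem integral_mul_deriv_smooth {f g : ℝ → ℝ} (hf : 𝒞 f) (hg : 𝒞 g)
    (pf : Periodic f Ω.length) (pg : Periodic g Ω.length) :
    ∫ s in 0..Ω.length, f s * deriv g s = -∫ s in 0..Ω.length, deriv f s * g s :=
  integral_mul_deriv_of_periodic (hasDerivAt_of_contDiff hf) (hasDerivAt_of_contDiff hg)
    (hf.continuous_deriv (by simp)) (hg.continuous_deriv (by simp)) pf pg

theorem contDiff_sq_curvature_mul {w : ℝ → ℝ} (hw : 𝒞 w) :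
    𝒞 fun r => Ω.curvature r ^ 2 * deriv w r :=
  (Ω.contDiff_curvature.pow 2).mul (contDiff_infty_deriv hw)

theorem periodic_sq_curvature_mul {w : ℝ → ℝ} (hp : Periodic w Ω.length) :
    Periodic (fun r => Ω.curvature r ^ 2 * deriv w r) Ω.length := fun s => by
  simp only
  rw [Ω.curvature_periodic s, hp.deriv_periodic s]

theorem contDiff_limitOp {w : ℝ → ℝ} (hw : 𝒞 w) : 𝒞 (Ω.limitOp w) :=
  (contDiff_infty_deriv (contDiff_infty_deriv (contDiff_infty_deriv (contDiff_infty_deriv hw)))).sub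
    (contDiff_const.mul (contDiff_infty_deriv (contDiff_sq_curvature_mul hw)))

theorem periodic_limitOp {w : ℝ → ℝ} (hp : Periodic w Ω.length) :
    Periodic (Ω.limitOp w) Ω.length := fun s => by
  simp only [limitOp]
  rw [hp.deriv_periodic.deriv_periodic.deriv_periodic.deriv_periodic s,
    (periodic_sq_curvature_mul hp).deriv_periodic s]

/-- Periodicity removes the boundary terms of the integrations by parts. The resulting form is
visibly symmetric and nonnegative. -/
theorem integral_mul_limitOp {f w : ℝ → ℝ} (hf : 𝒞 f) (hw : 𝒞 w)
    (pf : Periodic f Ω.length) (pw : Periodic w Ω.length) :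
    ∫ s in 0..Ω.length, f s * Ω.limitOp w s =
      ∫ s in 0..Ω.length, (deriv (deriv f) s * deriv (deriv w) s +
        2 * (Ω.curvature s ^ 2 * deriv f s * deriv w s)) := by
  have f1 := contDiff_infty_deriv hf
  have f2 := contDiff_infty_deriv f1
  have w1 := contDiff_infty_deriv hw
  have w2 := contDiff_infty_deriv w1
  have w3 := contDiff_infty_deriv w2
  have w4 := contDiff_infty_deriv w3
  have k := contDiff_sq_curvature_mul (Ω := Ω) hw
  have e1 := integral_mul_deriv_smooth (Ω := Ω) hf w3 pf
    pw.deriv_periodic.deriv_periodic.deriv_periodic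
  have e2 := integral_mul_deriv_smooth (Ω := Ω) f1 w2 pf.deriv_periodic
    pw.deriv_periodic.deriv_periodic
  have e3 := integral_mul_deriv_smooth (Ω := Ω) hf k pf (periodic_sq_curvature_mul pw)
  have ii : ∀ {a : ℝ → ℝ}, Continuous a → IntervalIntegrable a volume 0 Ω.length :=
    fun ha => ha.intervalIntegrable _ _
  have c0 := hf.continuous
  have c1 := f1.continuous
  have c2 := f2.continuous
  have d2 := w2.continuous
  have d4 := w4.continuous
  have ck := k.continuous
  have ck' := (contDiff_infty_deriv k).continuous
  have l : ∫ s in 0..Ω.length, f s * Ω.limitOp w s =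
      (∫ s in 0..Ω.length, f s * deriv (deriv (deriv (deriv w))) s) -
        2 * ∫ s in 0..Ω.length, f s * deriv (fun r => Ω.curvature r ^ 2 * deriv w r) s := by
    rw [← iint_const_mul, ← iint_sub
      (ii (by fun_prop)) (ii (by fun_prop))]
    congr 1; ext s; rw [limitOp]; ring
  have r : ∫ s in 0..Ω.length, (deriv (deriv f) s * deriv (deriv w) s +
        2 * (Ω.curvature s ^ 2 * deriv f s * deriv w s)) =
      (∫ s in 0..Ω.length, deriv (deriv f) s * deriv (deriv w) s) +
        2 * ∫ s in 0..Ω.length, deriv f s * (Ω.curvature s ^ 2 * deriv w s) := by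
    rw [← iint_const_mul, ← iint_add
      (ii (by fun_prop)) (ii (by fun_prop))]
    congr 1; ext s; ring
  rw [l, r, e1, e2, e3]; ring

theorem integral_limitOp_symm {f w : ℝ → ℝ} (hf : 𝒞 f) (hw : 𝒞 w)
    (pf : Periodic f Ω.length) (pw : Periodic w Ω.length) :
    ∫ s in 0..Ω.length, f s * Ω.limitOp w s =
      ∫ s in 0..Ω.length, w s * Ω.limitOp f s := by
  rw [integral_mul_limitOp hf hw pf pw, integral_mul_limitOp hw hf pw pf]
  congr 1; ext s; ring

/-- Trades one more derivative on the test function for one more degree of smoothness of the factor.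
The mean of `b` may be dropped, since `χ'` has mean zero. -/
theorem exists_primitive_pairing {m : ℕ} {b : ℝ → ℝ} (hb : ContDiff ℝ m b)
    (pb : Periodic b Ω.length) :
    ∃ B : ℝ → ℝ, ContDiff ℝ ((m + 1 : ℕ) : WithTop ℕ∞) B ∧ Periodic B Ω.length ∧
      ∀ χ : ℝ → ℝ, 𝒞 χ → Periodic χ Ω.length →
        ∫ s in 0..Ω.length, b s * deriv χ s =
          -∫ s in 0..Ω.length, B s * deriv (deriv χ) s := by
  obtain ⟨B, d, pB, -⟩ := exists_periodic_primitive Ω.length_pos hb.continuous pb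
  set c := (∫ r in 0..Ω.length, b r) / Ω.length
  refine ⟨B, contDiff_of_hasDerivAt d (hb.sub contDiff_const), pB, fun χ hχ pχ => ?_⟩
  have c1 := hχ.continuous_deriv (by simp)
  have c2 := (contDiff_infty_deriv hχ).continuous_deriv (by simp)
  rw [integral_mul_deriv_of_periodic d (hasDerivAt_of_contDiff (contDiff_infty_deriv hχ))
    (hb.continuous.sub continuous_const) c2 pB pχ.deriv_periodic, neg_neg]
  have z := integral_deriv_of_periodic (hasDerivAt_of_contDiff hχ) c1 pχ
  have : ∫ s in 0..Ω.length, (b s - c) * deriv χ s =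
      (∫ s in 0..Ω.length, b s * deriv χ s) - c * ∫ s in 0..Ω.length, deriv χ s := by
    have cb := hb.continuous
    rw [← iint_const_mul, ← iint_sub
      intervalIntegrable_cont
      intervalIntegrable_cont]
    congr 1; ext s; ring
  rw [this, z]; ring

/-- A continuous function is determined up to a constant by its pairing with fourth derivatives. -/
theorem eq_const_of_pairing {f : ℝ → ℝ} (hf : Continuous f) (pf : Periodic f Ω.length)
    (h : ∀ χ : ℝ → ℝ, 𝒞 χ → Periodic χ Ω.length →
      ∫ s in 0..Ω.length, f s * deriv (deriv (deriv (deriv χ))) s = 0) :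
    ∃ c, f = fun _ => c := by
  have L := Ω.length_pos
  have step : ∀ X : ℝ → ℝ, 𝒞 X → Periodic X Ω.length →
      ∃ Y : ℝ → ℝ, 𝒞 Y ∧ Periodic Y Ω.length ∧
        deriv (deriv Y) = deriv X := fun X hX pX => by
    obtain ⟨Y, d, pY, -⟩ := exists_periodic_primitive L hX.continuous pX
    refine ⟨Y, contDiff_infty_of_hasDerivAt d (hX.sub contDiff_const), pY, ?_⟩
    rw [funext fun s => (d s).deriv]
    ext s; simp
  obtain ⟨c, hc⟩ := ae_eq_const_of_periodic (Ω := Ω) (memLp_continuous_one hf) fun χ hχ pχ => by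
    obtain ⟨X1, h1, p1, e1⟩ := step χ hχ pχ
    obtain ⟨X2, h2, p2, e2⟩ := step X1 h1 p1
    obtain ⟨X3, h3, p3, e3⟩ := step X2 h2 p2
    have := h X3 h3 p3
    rwa [e3, e2, e1] at this
  refine ⟨c, ?_⟩
  rw [Measure.restrict_congr_set Ioc_ae_eq_Icc] at hc
  have eq := Measure.eqOn_Icc_of_ae_eq volume L.ne hc hf.continuousOn continuousOn_const
  ext s
  obtain ⟨y, hy, e⟩ := pf.exists_mem_Ico₀ L s
  rw [e]
  exact eq (Ico_subset_Icc_self hy)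

theorem limitOp_eq {w : ℝ → ℝ} (hw : 𝒞 w) (s : ℝ) :
    Ω.limitOp w s = deriv (deriv (deriv (deriv w))) s - (2 * Ω.curvature s ^ 2) *
      deriv (deriv w) s - (4 * (Ω.curvature s * deriv Ω.curvature s)) * deriv w s := by
  have d := ((hasDerivAt_of_contDiff Ω.contDiff_curvature s).pow 2).mul
    (hasDerivAt_of_contDiff (contDiff_infty_deriv hw) s)
  have d' : HasDerivAt (fun r => Ω.curvature r ^ 2 * deriv w r) _ s := d
  rw [limitOp, d'.deriv]
  simp only [Pi.pow_apply]
  push_cast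
  ring

/-- Continuous weak solutions of the limit problem are smooth. -/
theorem contDiff_of_weak_solution {g : ℝ → ℝ} {Λ : ℝ} (hg : Continuous g)
    (pg : Periodic g Ω.length)
    (h : ∀ χ : ℝ → ℝ, 𝒞 χ → Periodic χ Ω.length →
      ∫ s in 0..Ω.length, g s * Ω.limitOp χ s =
        2 * Λ * ∫ s in 0..Ω.length, g s * χ s) :
    𝒞 g := by
  have L := Ω.length_pos
  have κs := Ω.contDiff_curvature
  have κp := Ω.curvature_periodic
  have main : ∀ m : ℕ, ContDiff ℝ m g := by
    intro m
    -- Bootstrap: if `g` is `C^m`, primitives rewrite all terms of the weak equation except the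
    -- leading one as `∫ F χ''''` with `F` smoother than `g` is known to be. Then `g - F` is
    -- constant and `g` gains a derivative.
    induction m with
    | zero => exact contDiff_zero.2 hg
    | succ m ih =>
      have le : ((m : ℕ) : WithTop ℕ∞) ≤ (∞ : WithTop ℕ∞) := by exact_mod_cast le_top
      have ha : ContDiff ℝ m fun s => 2 * Ω.curvature s ^ 2 * g s :=
        (contDiff_const.mul ((κs.of_le le).pow 2)).mul ih
      have pa : Periodic (fun s => 2 * Ω.curvature s ^ 2 * g s) Ω.length := fun s => by
        simp only
        rw [κp s, pg s]
      have hb : ContDiff ℝ m fun s => 4 * (Ω.curvature s * deriv Ω.curvature s) * g s :=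
        (contDiff_const.mul ((κs.of_le le).mul ((contDiff_infty_deriv κs).of_le le))).mul ih
      have pb : Periodic (fun s => 4 * (Ω.curvature s * deriv Ω.curvature s) * g s)
          Ω.length := fun s => by
        simp only
        rw [κp s, pg s, κp.deriv_periodic s]
      obtain ⟨D, dD, pD, -⟩ := exists_periodic_primitive L hg pg
      set c := (∫ r in 0..Ω.length, g r) / Ω.length with hc
      have sD := contDiff_of_hasDerivAt dD (ih.sub contDiff_const)
      have hD : ContDiff ℝ m D := sD.of_le (by exact_mod_cast Nat.le_succ m)
      obtain ⟨B, hB, pB, eB⟩ := exists_primitive_pairing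
        (hb.sub (contDiff_const.mul hD) : ContDiff ℝ m fun s =>
          4 * (Ω.curvature s * deriv Ω.curvature s) * g s - 2 * Λ * D s)
        (fun s => by have := pb s; simp only at this ⊢; rw [this, pD s])
      have hB' : ContDiff ℝ m B := hB.of_le (by exact_mod_cast Nat.le_succ m)
      obtain ⟨E, hE, pE, eE⟩ := exists_primitive_pairing
        (ha.sub hB' : ContDiff ℝ m fun s => 2 * Ω.curvature s ^ 2 * g s - B s)
        (fun s => by have := pa s; simp only at this ⊢; rw [this, pB s])
      obtain ⟨F, hF, pF, eF⟩ := exists_primitive_pairing hE pE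
      have ii : ∀ {a : ℝ → ℝ}, Continuous a → IntervalIntegrable a volume 0 Ω.length :=
        fun ha => ha.intervalIntegrable _ _
      obtain ⟨k, hk⟩ := eq_const_of_pairing (hg.sub hF.continuous)
        (fun s => by simp only [Pi.sub_apply]; rw [pg s, pF s]) fun χ hχ pχ => by
        have x1 := contDiff_infty_deriv hχ
        have x2 := contDiff_infty_deriv x1
        have x3 := contDiff_infty_deriv x2
        have x4 := contDiff_infty_deriv x3
        have E1 := eF _ x2 pχ.deriv_periodic.deriv_periodic
        have E2 := eE _ x1 pχ.deriv_periodic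
        have E3 := eB _ hχ pχ
        have E4 := integral_mul_deriv_of_periodic dD (hasDerivAt_of_contDiff hχ)
          (hg.sub continuous_const) x1.continuous pD pχ
        have E5 := h χ hχ pχ
        have E6 := h (fun _ => 1) contDiff_const fun _ => rfl
        -- Testing with the constant 1 shows that subtracting the mean of `g` in the primitive `D`
        -- changes nothing.
        have g0 : 2 * Λ * c = 0 := by
          have : ∀ s, Ω.limitOp (fun _ => (1 : ℝ)) s = 0 := fun s => by
            simp [limitOp_eq contDiff_const]
          simp only [this, mul_zero, iint_zero, mul_one] at E6
          rw [hc, ← mul_div_assoc, ← E6, zero_div]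
        have cg := hg
        have cκ := κs.continuous
        have cκ' := (contDiff_infty_deriv κs).continuous
        have cx := hχ.continuous
        have c1 := x1.continuous
        have c2 := x2.continuous
        have c4 := x4.continuous
        have cD := hD.continuous
        have cB := hB.continuous
        have cF := hF.continuous
        have F1 : ∫ s in 0..Ω.length, g s * Ω.limitOp χ s =
            (∫ s in 0..Ω.length, g s * deriv (deriv (deriv (deriv χ))) s) -
            (∫ s in 0..Ω.length, 2 * Ω.curvature s ^ 2 * g s * deriv (deriv χ) s) -
            ∫ s in 0..Ω.length,
              4 * (Ω.curvature s * deriv Ω.curvature s) * g s * deriv χ s := by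
          rw [← iint_sub (ii (by fun_prop)) (ii (by fun_prop)),
            ← iint_sub (ii (by fun_prop)) (ii (by fun_prop))]
          congr 1; ext s; rw [limitOp_eq hχ]; ring
        have F2 : ∫ s in 0..Ω.length, (2 * Ω.curvature s ^ 2 * g s - B s) *
              deriv (deriv χ) s =
            (∫ s in 0..Ω.length, 2 * Ω.curvature s ^ 2 * g s * deriv (deriv χ) s) -
            ∫ s in 0..Ω.length, B s * deriv (deriv χ) s := by
          rw [← iint_sub (ii (by fun_prop)) (ii (by fun_prop))]
          congr 1; ext s; ring
        have F3 : ∫ s in 0..Ω.length,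
              (4 * (Ω.curvature s * deriv Ω.curvature s) * g s - 2 * Λ * D s) * deriv χ s =
            (∫ s in 0..Ω.length,
              4 * (Ω.curvature s * deriv Ω.curvature s) * g s * deriv χ s) -
            2 * Λ * ∫ s in 0..Ω.length, D s * deriv χ s := by
          rw [← iint_const_mul,
            ← iint_sub (ii (by fun_prop)) (ii (by fun_prop))]
          congr 1; ext s; ring
        have F4 : ∫ s in 0..Ω.length, (g s - c) * χ s =
            (∫ s in 0..Ω.length, g s * χ s) - c * ∫ s in 0..Ω.length, χ s := by
          rw [← iint_const_mul,
            ← iint_sub (ii (by fun_prop)) (ii (by fun_prop))]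
          congr 1; ext s; ring
        have F5 : ∫ s in 0..Ω.length, (g - F) s * deriv (deriv (deriv (deriv χ))) s =
            (∫ s in 0..Ω.length, g s * deriv (deriv (deriv (deriv χ))) s) -
            ∫ s in 0..Ω.length, F s * deriv (deriv (deriv (deriv χ))) s := by
          rw [← iint_sub (ii (by fun_prop)) (ii (by fun_prop))]
          congr 1; ext s; simp only [Pi.sub_apply]; ring
        rw [F5]
        rw [F2] at E2
        rw [F3] at E3
        rw [F4] at E4
        rw [F1] at E5
        linear_combination E5 + E2 + E3 + 2 * Λ * E4 - E1 +
          (∫ s in 0..Ω.length, χ s) * g0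
      have : g = fun s => F s + k := by
        ext s
        have := congrFun hk s
        simp only [Pi.sub_apply] at this
        linarith
      rw [this]
      exact (hF.add contDiff_const).of_le (by exact_mod_cast Nat.le_succ _)
  exact contDiff_infty.2 main

/-- Symmetry turns the weak equation into orthogonality of the residual to all tests. The residual
is itself a test, so the integral of its square vanishes. -/
theorem limitOp_eq_of_weak_solution {g : ℝ → ℝ} {Λ : ℝ} (hg : 𝒞 g)
    (pg : Periodic g Ω.length)
    (h : ∀ χ : ℝ → ℝ, 𝒞 χ → Periodic χ Ω.length →
      ∫ s in 0..Ω.length, g s * Ω.limitOp χ s =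
        2 * Λ * ∫ s in 0..Ω.length, g s * χ s) (s : ℝ) :
    Ω.limitOp g s = 2 * Λ * g s := by
  have L := Ω.length_pos
  set r : ℝ → ℝ := fun s => Ω.limitOp g s - 2 * Λ * g s with hr
  have sr : 𝒞 r := (contDiff_limitOp hg).sub (contDiff_const.mul hg)
  have pr : Periodic r Ω.length := fun s => by
    simp only [hr]; rw [periodic_limitOp pg s, pg s]
  have e := h r sr pr
  rw [integral_limitOp_symm hg sr pg pr] at e
  have i0 : ∫ s in 0..Ω.length, r s * r s = 0 := by
    have : ∫ s in 0..Ω.length, r s * r s = (∫ s in 0..Ω.length, r s * Ω.limitOp g s) -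
        2 * Λ * ∫ s in 0..Ω.length, g s * r s := by
      have c1 := sr.continuous
      have c2 := (contDiff_limitOp (Ω := Ω) hg).continuous
      have c3 := hg.continuous
      rw [← iint_const_mul, ← iint_sub
        intervalIntegrable_cont
        intervalIntegrable_cont]
      congr 1; ext s; simp only [hr]; ring
    rw [this, e, sub_self]
  obtain ⟨y, hy, ey⟩ := pr.exists_mem_Ico₀ L s
  suffices r y = 0 by
    rw [← ey] at this
    exact sub_eq_zero.1 this
  by_contra hne
  have : 0 < ∫ s in 0..Ω.length, r s * r s :=
    intervalIntegral.integral_pos L (sr.continuous.mul sr.continuous).continuousOn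
      (fun s _ => mul_self_nonneg _) ⟨y, Ico_subset_Icc_self hy, mul_self_pos.2 hne⟩
  exact this.ne' i0

end SmoothDomain

/-! ### Convergence in `L²` -/

section SquareIntegrableLimits

variable {α : Type*} [MeasurableSpace α] {μ : Measure α}

theorem norm_toLp_sq {f : α → ℝ} (hf : MemLp f 2 μ) : ‖hf.toLp f‖ ^ 2 = ∫ x, f x ^ 2 ∂μ := by
  rw [← real_inner_self_eq_norm_sq, L2.inner_def]
  refine integral_congr_ae ?_
  filter_upwards [hf.coeFn_toLp] with x hx
  rw [hx]
  simp [sq]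

theorem exists_l2_limit {f : ℕ → α → ℝ} (hf : ∀ n, MemLp (f n) 2 μ)
    (hc : ∀ δ > 0, ∃ N, ∀ n ≥ N, ∀ m ≥ N, ∫ x, (f n x - f m x) ^ 2 ∂μ ≤ δ) :
    ∃ g, MemLp g 2 μ ∧ Tendsto (fun n => ∫ x, (f n x - g x) ^ 2 ∂μ) atTop (𝓝 0) := by
  have e : ∀ {g h : α → ℝ} (hg : MemLp g 2 μ) (hh : MemLp h 2 μ),
      dist (hg.toLp g) (hh.toLp h) ^ 2 = ∫ x, (g x - h x) ^ 2 ∂μ := fun hg hh => by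
    rw [dist_eq_norm, ← MemLp.toLp_sub, norm_toLp_sq]
    rfl
  have cs : CauchySeq fun n => (hf n).toLp (f n) := by
    refine Metric.cauchySeq_iff.2 fun δ hδ => ?_
    obtain ⟨N, hN⟩ := hc (δ ^ 2 / 2) (by positivity)
    refine ⟨N, fun n hn m hm => ?_⟩
    refine lt_of_pow_lt_pow_left₀ 2 hδ.le ?_
    rw [e]
    linarith [hN n hn m hm, pow_pos hδ 2]
  obtain ⟨g, hg⟩ := cauchySeq_tendsto_of_complete cs
  refine ⟨g, Lp.memLp g, ?_⟩
  have := ((tendsto_iff_dist_tendsto_zero.1 hg).pow 2)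
  rw [zero_pow two_ne_zero] at this
  refine this.congr fun n => ?_
  rw [← e (hf n) (Lp.memLp g), Lp.toLp_coeFn]

theorem tendsto_integral_mul_of_l2 {ι : Type*} {l : Filter ι} {f : ι → α → ℝ} {g h : α → ℝ}
    (hf : ∀ n, MemLp (f n) 2 μ) (hg : MemLp g 2 μ) (hh : MemLp h 2 μ)
    (hc : Tendsto (fun n => ∫ x, (f n x - g x) ^ 2 ∂μ) l (𝓝 0)) :
    Tendsto (fun n => ∫ x, f n x * h x ∂μ) l (𝓝 (∫ x, g x * h x ∂μ)) := by
  rw [tendsto_iff_dist_tendsto_zero]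
  have key : ∀ n, dist (∫ x, f n x * h x ∂μ) (∫ x, g x * h x ∂μ) ≤
      √((∫ x, (f n x - g x) ^ 2 ∂μ) * ∫ x, h x ^ 2 ∂μ) := fun n => by
    rw [Real.dist_eq, ← integral_sub (integrable_mul_of_memLp (hf n) hh)
      (integrable_mul_of_memLp hg hh)]
    refine Real.abs_le_sqrt ?_
    have := integral_mul_sq_le ((hf n).sub hg) hh
    simp only [Pi.sub_apply, sub_mul] at this
    exact this
  have lim : Tendsto (fun n => √((∫ x, (f n x - g x) ^ 2 ∂μ) * ∫ x, h x ^ 2 ∂μ)) l (𝓝 0) := by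
    have := (hc.mul_const (∫ x, h x ^ 2 ∂μ)).sqrt
    simpa using this
  exact squeeze_zero (fun _ => dist_nonneg) key lim

end SquareIntegrableLimits

theorem IsWeakPartial.of_tendsto {U : Set Plane} {i : Fin 2} {f g : ℕ → Plane → ℝ}
    {f' g' : Plane → ℝ} (h : ∀ n, IsWeakPartial U i (f n) (g n))
    (hf : ∀ n, 𝓛 (f n) U) (hg : ∀ n, 𝓛 (g n) U)
    (hf' : 𝓛 f' U) (hg' : 𝓛 g' U)
    (lf : Tendsto (fun n => ∫ x in U, (f n x - f' x) ^ 2) atTop (𝓝 0))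
    (lg : Tendsto (fun n => ∫ x in U, (g n x - g' x) ^ 2) atTop (𝓝 0)) :
    IsWeakPartial U i f' g' := by
  intro ψ h1 h2 h3
  have ht : IsTest U ψ := ⟨h1, h2, h3⟩
  have a := tendsto_integral_mul_of_l2 hf hf' ((ht.partialDeriv i).memLp _) lf
  have b := (tendsto_integral_mul_of_l2 hg hg' (ht.memLp _) lg).neg
  exact tendsto_nhds_unique a (b.congr fun n => (h n ψ h1 h2 h3).symm)

theorem SobolevH2.exists_limit {U : Set Plane} {v : ℕ → SobolevH2 U}
    (h0 : ∀ δ > 0, ∃ N, ∀ n ≥ N, ∀ m ≥ N, ∫ x in U, ((v n).val x - (v m).val x) ^ 2 ≤ δ)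
    (h1 : ∀ i, ∀ δ > 0, ∃ N, ∀ n ≥ N, ∀ m ≥ N,
      ∫ x in U, ((v n).grad i x - (v m).grad i x) ^ 2 ≤ δ)
    (h2 : ∀ i j, ∀ δ > 0, ∃ N, ∀ n ≥ N, ∀ m ≥ N,
      ∫ x in U, ((v n).hess i j x - (v m).hess i j x) ^ 2 ≤ δ) :
    ∃ w : SobolevH2 U, Tendsto (fun n => ∫ x in U, (v n - w).val x ^ 2) atTop (𝓝 0) ∧
      (∀ i, Tendsto (fun n => ∫ x in U, (v n - w).grad i x ^ 2) atTop (𝓝 0)) ∧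
      ∀ i j, Tendsto (fun n => ∫ x in U, (v n - w).hess i j x ^ 2) atTop (𝓝 0) := by
  obtain ⟨f, hf, lf⟩ := exists_l2_limit (fun n => (v n).memLp_val) h0
  choose g hg lg using fun i => exists_l2_limit (fun n => (v n).memLp_grad i) (h1 i)
  choose k hk lk using fun i j => exists_l2_limit (fun n => (v n).memLp_hess i j) (h2 i j)
  exact ⟨⟨f, g, k, hf, hg, hk,
    fun i => .of_tendsto (fun n => (v n).weak_grad i) (fun n => (v n).memLp_val)
      (fun n => (v n).memLp_grad i) hf (hg i) lf (lg i),
    fun i j => .of_tendsto (fun n => (v n).weak_hess i j) (fun n => (v n).memLp_grad i)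
      (fun n => (v n).memLp_hess i j) (hg i) (hk i j) (lg i) (lk i j)⟩, lf, lg, lk⟩

namespace SmoothDomain

variable {Ω : SmoothDomain} {ε : ℝ}

/-! ### The forms of the Steklov problem on a fixed tubular neighbourhood -/

theorem Tubular.integral_thin_sq_le (h : Ω.Tubular ε) {f : Plane → ℝ}
    (hf : 𝓛 f (Ω.thin ε)) :
    ∫ x in Ω.thin ε, f x ^ 2 ≤ 2 * (ε * ∫ p in Ω.refSet, Ω.pull ε f p ^ 2) := by
  rw [h.integral_thin, ← integral_const_mul, ← integral_const_mul]
  have hc : 𝓛 (Ω.pull ε f) Ω.refSet := h.memLp_comp hf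
  have e0 := h.pos
  refine integral_mono_of_nonneg ?_ ((hc.integrable_sq.const_mul _).const_mul _) ?_
  · refine (ae_restrict_iff' Ω.isOpen_refSet.measurableSet).2 (ae_of_all _ fun p hp => ?_)
    have := (h.jac_mem p ⟨by linarith [hp.2.1], by linarith [hp.2.2]⟩).1
    simp only [Pi.zero_apply]
    positivity
  · refine (ae_restrict_iff' Ω.isOpen_refSet.measurableSet).2 (ae_of_all _ fun p hp => ?_)
    have := (h.jac_mem p ⟨by linarith [hp.2.1], by linarith [hp.2.2]⟩).2
    simp only [pull]
    have h5 : 0 ≤ ε * f (Ω.fermi ε p) ^ 2 := by positivity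
    nlinarith

theorem Tubular.bdryIntegral_le (h : Ω.Tubular ε) {x : Fin 2 → ℝ → ℝ}
    (hx : ∀ j, 𝓛 (x j) (Ioc 0 Ω.length)) :
    Ω.bdryIntegral ε (fun j s => x j s * x j s) ≤
      2 * (∫ s in 0..Ω.length, x 0 s ^ 2) + 2 * ∫ s in 0..Ω.length, x 1 s ^ 2 := by
  have L := Ω.length_pos.le
  have h0 : 0 ≤ ∫ s in 0..Ω.length, x 0 s ^ 2 :=
    iint_nonneg L fun s _ => sq_nonneg _
  have h1 : ∫ s in 0..Ω.length, x 1 s * x 1 s * Ω.jac ε !₂[s, 1] ≤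
      2 * ∫ s in 0..Ω.length, x 1 s ^ 2 := by
    rw [← iint_const_mul]
    refine iint_mono_on L ?_ ?_ fun s _ => ?_
    · have := intervalIntegrable_mul (hx 1) (memLp_mul_one (hx 1) (continuous_jac_trace (Ω := Ω) (ε := ε) 1))
      refine this.congr ?_
      exact fun s _ => by ring
    · refine IntervalIntegrable.const_mul ?_ 2
      simpa only [sq] using intervalIntegrable_mul (hx 1) (hx 1)
    · have := (h.jac_mem !₂[s, 1] (by simp)).2
      nlinarith [sq_nonneg (x 1 s)]
  rw [h.bdryIntegral_eq]
  simp only [← sq] at h1 ⊢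
  linarith

theorem pull_grad_eq (u : Ω.H2 ε) (i : Fin 2) (p : Plane) :
    Ω.pull ε (u.grad i) p = Ω.tan i (p 0) * gradTan u p + Ω.nor i (p 0) * gradNor u p := by
  have ht := Ω.tan_sq (p 0)
  fin_cases i
  · simp only [gradTan, gradNor, tanComp, norComp, nor_zero, nor_one, Fin.zero_eta]
    linear_combination -(Ω.pull ε (u.grad 0) p) * ht
  · simp only [gradTan, gradNor, tanComp, norComp, nor_zero, nor_one, Fin.mk_one]
    linear_combination -(Ω.pull ε (u.grad 1) p) * ht

theorem integral_grad_sq_le (h : Ω.Tubular ε) (u : Ω.H2 ε) (i : Fin 2) :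
    ∫ p in Ω.refSet, Ω.pull ε (u.grad i) p ^ 2 ≤
      2 * (∫ p in Ω.refSet, gradTan u p ^ 2) + 2 * ∫ p in Ω.refSet, gradNor u p ^ 2 := by
  have i1 := ((h.memLp_gradTan u).integrable_sq.const_mul 2)
  have i2 := ((h.memLp_gradNor u).integrable_sq.const_mul 2)
  rw [← integral_const_mul, ← integral_const_mul, ← integral_add i1 i2]
  refine integral_mono_of_nonneg (ae_of_all _ fun p => sq_nonneg _) (i1.add i2)
    (ae_of_all _ fun p => ?_)
  simp only
  rw [pull_grad_eq]
  have ht := Ω.tan_sq (p 0)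
  set a := Ω.tan 0 (p 0)
  set b := Ω.tan 1 (p 0)
  set x := gradTan u p
  set y := gradNor u p
  fin_cases i <;> simp only [nor_zero, nor_one, Fin.zero_eta, Fin.mk_one]
  · have : (a * x + b * y) ^ 2 + (b * x - a * y) ^ 2 = x ^ 2 + y ^ 2 := by
      linear_combination (x ^ 2 + y ^ 2) * ht
    nlinarith [sq_nonneg (b * x - a * y), sq_nonneg x, sq_nonneg y]
  · have : (a * x + b * y) ^ 2 + (b * x - a * y) ^ 2 = x ^ 2 + y ^ 2 := by
      linear_combination (x ^ 2 + y ^ 2) * ht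
    nlinarith [sq_nonneg (a * x + b * y), sq_nonneg x, sq_nonneg y]

theorem hess_sq_le_hessForm {U : Set Plane} (u : SobolevH2 U) (i j : Fin 2) :
    ∫ x in U, u.hess i j x ^ 2 ≤ u.hessForm u := by
  have hi : ∀ i j, Integrable (fun x => u.hess i j x * u.hess i j x) (𝓁 U) :=
    fun i j => integrable_mul_of_memLp (u.memLp_hess i j) (u.memLp_hess i j)
  refine integral_mono_of_nonneg (ae_of_all _ fun p => sq_nonneg _)
    (integrable_finsetSum _ fun i _ => integrable_finsetSum _ fun j _ => hi i j)
    (ae_of_all _ fun p => ?_)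
  simp only [sq]
  refine (Finset.single_le_sum (f := fun j => u.hess i j p * u.hess i j p)
    (fun j _ => mul_self_nonneg _) (Finset.mem_univ j)).trans ?_
  exact Finset.single_le_sum (f := fun i => ∑ j, u.hess i j p * u.hess i j p)
    (fun i _ => Finset.sum_nonneg fun j _ => mul_self_nonneg _) (Finset.mem_univ i)

theorem hessForm_self_eq {U : Set Plane} (u : SobolevH2 U) :
    u.hessForm u = ∑ i : Fin 2, ∑ j : Fin 2, ∫ x in U, u.hess i j x ^ 2 := by
  have hi : ∀ i j, Integrable (fun x => u.hess i j x * u.hess i j x) (𝓁 U) :=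
    fun i j => integrable_mul_of_memLp (u.memLp_hess i j) (u.memLp_hess i j)
  rw [SobolevH2.hessForm, integral_finsetSum _ fun i _ => integrable_finsetSum _ fun j _ => hi i j]
  refine Finset.sum_congr rfl fun i _ => ?_
  rw [integral_finsetSum _ fun j _ => hi i j]
  simp only [sq]

theorem bdryForm_le_energy_add {μ : ℝ} (hμ : 0 < μ) (h : Ω.Tubular ε) (u : Ω.H2 ε) :
    h.bdryForm u u ≤ (h.energy μ + h.bdryForm) u u := by
  have := h.energy_nonneg hμ u
  simp only [LinearMap.add_apply]
  linarith

theorem scaledEnergy_le_of_tubular {μ : ℝ} (h : Ω.Tubular ε)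
    (u : Ω.H2 ε) : ε * scaledEnergy μ u ≤ (h.energy μ + h.bdryForm) u u := by
  have e0 := h.pos
  have e1 := h.le_one
  have : ε * scaledEnergy μ u = h.energy μ u u + ε * h.bdryForm u u := by
    rw [h.scaledEnergy_eq]; field_simp
  rw [this]
  simp only [LinearMap.add_apply]
  nlinarith [h.bdryForm_nonneg u]

theorem tendsto_integral_pull_sq (h : Ω.Tubular ε) {f : ℕ → Plane → ℝ}
    (hf : ∀ n, 𝓛 (f n) (Ω.thin ε))
    (hl : Tendsto (fun n => ∫ x in Ω.thin ε, f n x ^ 2) atTop (𝓝 0)) :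
    Tendsto (fun n => ∫ p in Ω.refSet, Ω.pull ε (f n) p ^ 2) atTop (𝓝 0) := by
  refine squeeze_zero (fun n => integral_nonneg fun p => sq_nonneg _)
    (fun n => h.integral_comp_sq_le (hf n)) ?_
  simpa using hl.const_mul (2 / ε)

theorem integral_norComp_sq_le {G : Fin 2 → Plane → ℝ}
    (hG : ∀ i, 𝓛 (G i) Ω.refSet) :
    ∫ p in Ω.refSet, Ω.norComp G p ^ 2 ≤
      (∫ p in Ω.refSet, G 0 p ^ 2) + ∫ p in Ω.refSet, G 1 p ^ 2 := by
  rw [← integral_add (hG 0).integrable_sq (hG 1).integrable_sq]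
  refine integral_mono_of_nonneg (ae_of_all _ fun p => sq_nonneg _)
    ((hG 0).integrable_sq.add (hG 1).integrable_sq) (ae_of_all _ fun p => ?_)
  simp only [norComp, nor_zero, nor_one]
  have ht := Ω.tan_sq (p 0)
  set a := Ω.tan 0 (p 0)
  set b := Ω.tan 1 (p 0)
  have : (b * G 0 p + -a * G 1 p) ^ 2 + (a * G 0 p + b * G 1 p) ^ 2 = G 0 p ^ 2 + G 1 p ^ 2 := by
    linear_combination (G 0 p ^ 2 + G 1 p ^ 2) * ht
  nlinarith [sq_nonneg (a * G 0 p + b * G 1 p)]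

theorem tendsto_integral_trace_sq {F Fs Ft : ℕ → Plane → ℝ} {g : ℕ → Fin 2 → ℝ → ℝ}
    (hs : ∀ n, Ω.StripGrad (F n) (Fs n) (Ft n) (g n))
    (hF : Tendsto (fun n => ∫ p in Ω.refSet, F n p ^ 2) atTop (𝓝 0))
    (hFt : Tendsto (fun n => ∫ p in Ω.refSet, Ft n p ^ 2) atTop (𝓝 0)) (j : Fin 2) :
    Tendsto (fun n => ∫ s in 0..Ω.length, g n j s ^ 2) atTop (𝓝 0) := by
  refine squeeze_zero
    (fun n => iint_nonneg Ω.length_pos.le fun p _ => sq_nonneg _)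
    (fun n => (hs n).integral_trace_sq_le j) ?_
  simpa using (hF.const_mul 2).add (hFt.const_mul 2)

/-- Continuity of the forms, boundary terms included, in the `H²` norm for fixed `ε`. It shows that
an `H²` limit is also a limit in the form norm. -/
theorem tendsto_energy_add {μ : ℝ} (hμ : 0 < μ) (h : Ω.Tubular ε)
    {z : ℕ → Ω.H2 ε}
    (h0 : Tendsto (fun n => ∫ x in Ω.thin ε, (z n).val x ^ 2) atTop (𝓝 0))
    (h1 : ∀ i, Tendsto (fun n => ∫ x in Ω.thin ε, (z n).grad i x ^ 2) atTop (𝓝 0))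
    (h2 : ∀ i j, Tendsto (fun n => ∫ x in Ω.thin ε, (z n).hess i j x ^ 2) atTop (𝓝 0)) :
    Tendsto (fun n => (h.energy μ + h.bdryForm) (z n) (z n)) atTop (𝓝 0) := by
  have p0 := tendsto_integral_pull_sq h (fun n => (z n).memLp_val) h0
  have p1 := fun i => tendsto_integral_pull_sq h (fun n => (z n).memLp_grad i) (h1 i)
  have p2 := fun i j => tendsto_integral_pull_sq h (fun n => (z n).memLp_hess i j) (h2 i j)
  have nor : ∀ {G : ℕ → Fin 2 → Plane → ℝ},
      (∀ n i, 𝓛 (G n i) Ω.refSet) →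
      (∀ i, Tendsto (fun n => ∫ p in Ω.refSet, G n i p ^ 2) atTop (𝓝 0)) →
      Tendsto (fun n => ∫ p in Ω.refSet, (-(ε * Ω.norComp (G n) p)) ^ 2) atTop (𝓝 0) :=
    fun {G} hG hl => by
      simp only [integral_mul_neg_sq]
      have : Tendsto (fun n => ∫ p in Ω.refSet, Ω.norComp (G n) p ^ 2) atTop (𝓝 0) :=
        squeeze_zero (fun n => integral_nonneg fun p => sq_nonneg _)
          (fun n => integral_norComp_sq_le (hG n)) (by simpa using (hl 0).add (hl 1))
      simpa using this.const_mul (ε ^ 2)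
  have tv := tendsto_integral_trace_sq (fun n => h.stripGrad_val (z n)) p0
    (nor (fun n i => h.memLp_comp ((z n).memLp_grad i)) p1)
  have tg := fun i => tendsto_integral_trace_sq (fun n => h.stripGrad_grad (z n) i) (p1 i)
    (nor (fun n j => h.memLp_comp ((z n).memLp_hess i j)) (p2 i))
  have tn : ∀ j, Tendsto (fun n => ∫ s in 0..Ω.length, normalTrace (z n) j s ^ 2)
      atTop (𝓝 0) := fun j => by
    refine squeeze_zero
      (fun n => iint_nonneg Ω.length_pos.le fun p _ => sq_nonneg _)
      (fun n => ?_) (by simpa using (tg 0 j).add (tg 1 j))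
    have m0 := (h.stripGrad_grad (z n) 0).memg j
    have m1 := (h.stripGrad_grad (z n) 1).memg j
    have i0 : IntervalIntegrable (fun s => Ω.trace ε ((z n).grad 0) ((z n).hess 0) j s ^ 2)
        volume 0 Ω.length := by simpa only [sq] using intervalIntegrable_mul m0 m0
    have i1 : IntervalIntegrable (fun s => Ω.trace ε ((z n).grad 1) ((z n).hess 1) j s ^ 2)
        volume 0 Ω.length := by simpa only [sq] using intervalIntegrable_mul m1 m1
    have i2 : IntervalIntegrable (fun s => normalTrace (z n) j s ^ 2) volume 0 Ω.length := by
      simpa only [sq] using intervalIntegrable_mul (h.memLp_normalTrace (z n) j)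
        (h.memLp_normalTrace (z n) j)
    rw [← iint_add i0 i1]
    refine iint_mono_on Ω.length_pos.le i2 (i0.add i1) fun s _ => ?_
    simp only [normalTrace, nor_zero, nor_one]
    set x := Ω.trace ε ((z n).grad 0) ((z n).hess 0) j s
    set y := Ω.trace ε ((z n).grad 1) ((z n).hess 1) j s
    have ht := Ω.tan_sq s
    have : (Ω.tan 1 s * x + -Ω.tan 0 s * y) ^ 2 + (Ω.tan 0 s * x + Ω.tan 1 s * y) ^ 2 =
        x ^ 2 + y ^ 2 := by linear_combination (x ^ 2 + y ^ 2) * ht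
    nlinarith [sq_nonneg (Ω.tan 0 s * x + Ω.tan 1 s * y)]
  have lim : Tendsto (fun n => (∑ i : Fin 2, ∑ j : Fin 2, ∫ x in Ω.thin ε, (z n).hess i j x ^ 2) +
      μ * (2 * (∫ s in 0..Ω.length, normalTrace (z n) 0 s ^ 2) +
        2 * ∫ s in 0..Ω.length, normalTrace (z n) 1 s ^ 2) +
      (2 * (∫ s in 0..Ω.length, bdryVal (z n) 0 s ^ 2) +
        2 * ∫ s in 0..Ω.length, bdryVal (z n) 1 s ^ 2)) atTop (𝓝 0) := by
    have a := tendsto_finsetSum Finset.univ fun i _ => tendsto_finsetSum Finset.univ fun j _ =>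
      h2 i j
    have b := (((tn 0).const_mul 2).add ((tn 1).const_mul 2)).const_mul μ
    have c := ((tv 0).const_mul 2).add ((tv 1).const_mul 2)
    simpa using (a.add b).add c
  refine squeeze_zero (fun n => (h.bdryForm_nonneg _).trans (bdryForm_le_energy_add hμ h _))
    (fun n => ?_) lim
  simp only [LinearMap.add_apply]
  rw [h.energy_apply, h.bdryForm_apply, hessForm_self_eq]
  gcongr
  · exact h.bdryIntegral_le (h.memLp_normalTrace (z n))
  · exact h.bdryIntegral_le (h.memLp_bdryVal (z n))

end SmoothDomain

/-! ### Compactness of the boundary form and infinite dimension -/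

namespace SmoothDomain

variable {Ω : SmoothDomain} {ε μ C : ℝ}

/-- The traces have `jac * tangentTrace` as derivative along the curve up to sign, and both are
bounded in `L²` by the scaled energy. The radius is the same for all admissible `ε`, so the lemma
serves both the spectrum at fixed `ε` and the limit `ε → 0`. -/
theorem exists_bdryVal_mem_holderBall (hμ : 0 < μ) (hC : 0 < C) (M : ℝ) :
    ∃ R, ∀ ε, Ω.Coercive μ C ε → ∀ u : Ω.H2 ε, scaledEnergy μ u ≤ M →
      ∀ j, ∃ f ∈ Ω.holderBall R, bdryVal u j =ᵐ[𝓁 (Ioc 0 Ω.length)]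
        Ω.extendPeriod f := by
  have L := Ω.length_pos
  obtain ⟨R, hR⟩ := exists_mem_holderBall (Ω := Ω) (max (2 * M) (4 * (C * M)))
  refine ⟨R, fun ε hco u hu j => ?_⟩
  have h := hco.tubular
  have cj := continuous_jac_trace (Ω := Ω) (ε := ε) ((j : ℕ) : ℝ)
  have mt := (h.stripGrad_gradTan u).memg j
  have mk := memLp_mul_one mt cj
  refine hR _ _ (h.memLp_bdryVal u j) mk (fun χ hχ hp => h.bdryVal_horiz u j hχ hp)
    (((h.integral_bdryVal_sq hμ u j).trans (by linarith)).trans (le_max_left _ _)) ?_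
  have i1 : IntervalIntegrable (fun s => (Ω.jac ε !₂[s, ((j : ℕ) : ℝ)] * tangentTrace u j s) ^ 2)
      volume 0 Ω.length := by
    simpa only [sq] using intervalIntegrable_mul mk mk
  have i2 : IntervalIntegrable (fun s => 4 * tangentTrace u j s ^ 2) volume 0 Ω.length := by
    refine IntervalIntegrable.const_mul ?_ 4
    simpa only [sq] using intervalIntegrable_mul mt mt
  refine (iint_mono_on L.le i1 i2 fun s _ => ?_).trans ?_
  · have hj : ((j : ℕ) : ℝ) ∈ Icc (-1 : ℝ) 2 := by fin_cases j <;> norm_num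
    have := h.jac_mem !₂[s, ((j : ℕ) : ℝ)] (by simpa using hj)
    rw [mul_pow]
    have h4 : Ω.jac ε !₂[s, ((j : ℕ) : ℝ)] ^ 2 ≤ 4 := by nlinarith [this.1, this.2]
    exact mul_le_mul_of_nonneg_right h4 (sq_nonneg _)
  · rw [iint_const_mul]
    refine le_trans ?_ (le_max_right _ _)
    have := hco.tangentTrace u j
    nlinarith

theorem integral_sq_sub_of_extendPeriod {f g : ℝ → ℝ}
    {F G : BoundedContinuousFunction (Icc 0 Ω.length) ℝ}
    (hf : f =ᵐ[𝓁 (Ioc 0 Ω.length)] Ω.extendPeriod F)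
    (hg : g =ᵐ[𝓁 (Ioc 0 Ω.length)] Ω.extendPeriod G) :
    ∫ s in 0..Ω.length, (f s - g s) ^ 2 ≤ Ω.length * dist F G ^ 2 := by
  have L := Ω.length_pos
  have : ∫ s in 0..Ω.length, (f s - g s) ^ 2 =
      ∫ s in 0..Ω.length, (Ω.extendPeriod F s - Ω.extendPeriod G s) ^ 2 := by
    rw [integral_of_le L.le, integral_of_le L.le]
    refine integral_congr_ae ?_
    filter_upwards [hf, hg] with s h1 h2
    rw [h1, h2]
  rw [this]
  have cF := continuous_extendPeriod F
  have cG := continuous_extendPeriod G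
  calc _ ≤ ∫ s in 0..Ω.length, dist F G ^ 2 := by
        refine iint_mono_on L.le
          intervalIntegrable_cont (by simp) fun s _ => ?_
        rw [← sq_abs]
        have := abs_extendPeriod_sub_le F G s
        gcongr
    _ = _ := by simp

theorem Tubular.bdryVal_sub (h : Ω.Tubular ε) (u v : Ω.H2 ε) (j : Fin 2) :
    bdryVal (u - v) j =ᵐ[𝓁 (Ioc 0 Ω.length)] fun s => bdryVal u j s - bdryVal v j s := by
  have e : u - v = u + (-1 : ℝ) • v := by rw [neg_one_smul, sub_eq_add_neg]
  rw [e]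
  filter_upwards [h.bdryVal_add u ((-1 : ℝ) • v) j, h.bdryVal_smul (-1) v j] with s h1 h2
  rw [h1, h2]; ring

/-- Constants have no energy, so the boundary form is added to obtain a norm that dominates it.
Compactness comes from the Hölder ball, and completeness from coercivity, which at fixed `ε`
controls the full `H²` norm. -/
theorem Coercive.formPair (hμ : 0 < μ) (hC : 0 < C) (hco : Ω.Coercive μ C ε) :
    FormPair (hco.tubular.energy μ + hco.tubular.bdryForm) hco.tubular.bdryForm := by
  have h := hco.tubular
  have e0 := h.pos
  have L := Ω.length_pos
  refine ⟨fun u v => ?_, h.bdryForm_symm, h.bdryForm_nonneg, bdryForm_le_energy_add hμ h, ?_, ?_⟩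
  · simp only [LinearMap.add_apply]
    rw [h.energy_symm, h.bdryForm_symm]
  · intro v M hM
    obtain ⟨R, hR⟩ := exists_bdryVal_mem_holderBall (Ω := Ω) hμ hC (M / ε)
    have hN : ∀ n, scaledEnergy μ (v n) ≤ M / ε := fun n => by
      rw [le_div_iff₀ e0, mul_comm]
      exact (scaledEnergy_le_of_tubular h (v n)).trans (hM n)
    choose f hf ef using fun n => hR ε hco (v n) (hN n)
    have K := (isCompact_holderBall (Ω := Ω) R).prod (isCompact_holderBall (Ω := Ω) R)
    obtain ⟨g, -, φ, hφ, lim⟩ := K.tendsto_subseq (x := fun n => (f n 0, f n 1))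
      fun n => ⟨hf n 0, hf n 1⟩
    refine ⟨φ, hφ, fun δ hδ => ?_⟩
    -- Each boundary curve then contributes at most `δ / 4`, and the comparison with the boundary
    -- integral doubles both.
    set η := √(δ / (4 * Ω.length)) with hη
    have η0 : 0 < η := Real.sqrt_pos.2 (by positivity)
    obtain ⟨N, hN⟩ := Metric.cauchySeq_iff.1 lim.cauchySeq η η0
    refine ⟨N, fun n hn m hm => ?_⟩
    have hd := hN n hn m hm
    rw [h.bdryForm_apply]
    refine (h.bdryIntegral_le (h.memLp_bdryVal _)).trans ?_
    have bound : ∀ j, dist (f (φ n) j) (f (φ m) j) ≤ η →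
        ∫ s in 0..Ω.length, bdryVal (v (φ n) - v (φ m)) j s ^ 2 ≤ δ / 4 := fun j hj => by
      have : ∫ s in 0..Ω.length, bdryVal (v (φ n) - v (φ m)) j s ^ 2 =
          ∫ s in 0..Ω.length, (bdryVal (v (φ n)) j s - bdryVal (v (φ m)) j s) ^ 2 := by
        rw [integral_of_le L.le, integral_of_le L.le]
        refine integral_congr_ae ?_
        filter_upwards [h.bdryVal_sub (v (φ n)) (v (φ m)) j] with s hs
        rw [hs]
      rw [this]
      refine (integral_sq_sub_of_extendPeriod (ef (φ n) j) (ef (φ m) j)).trans ?_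
      calc _ ≤ Ω.length * η ^ 2 := by gcongr
        _ = δ / 4 := by rw [hη, Real.sq_sqrt (by positivity)]; field_simp
    have d0 := bound 0 ((le_max_left _ _).trans hd.le)
    have d1 := bound 1 ((le_max_right _ _).trans hd.le)
    linarith
  · intro v hv
    have comp : ∀ {X : Ω.H2 ε → Plane → ℝ} {k : ℝ}, 0 < k →
        (∀ u w x, X (u - w) x = X u x - X w x) →
        (∀ u, ∫ x in Ω.thin ε, X u x ^ 2 ≤ k * (h.energy μ + h.bdryForm) u u) →
        ∀ δ > 0, ∃ N, ∀ n ≥ N, ∀ m ≥ N, ∫ x in Ω.thin ε, (X (v n) x - X (v m) x) ^ 2 ≤ δ :=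
      fun {X k} hk hX hb δ hδ => by
        obtain ⟨N, hN⟩ := hv (δ / k) (by positivity)
        refine ⟨N, fun n hn m hm => ?_⟩
        simp only [← hX]
        refine (hb _).trans ?_
        calc _ ≤ k * (δ / k) := by gcongr; exact hN n hn m hm
          _ = δ := by field_simp
    have B := scaledEnergy_le_of_tubular (μ := μ) h
    obtain ⟨w, w0, w1, w2⟩ := SobolevH2.exists_limit (v := v)
      (comp (X := fun u => u.val) (k := 2 * C) (by positivity) (fun _ _ _ => rfl) fun u => by
        refine (h.integral_thin_sq_le u.memLp_val).trans ?_
        calc _ ≤ 2 * (ε * (C * scaledEnergy μ u)) := by gcongr; exact hco.val u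
          _ = 2 * C * (ε * scaledEnergy μ u) := by ring
          _ ≤ _ := by gcongr; exact B u)
      (fun i => comp (X := fun u => u.grad i) (k := 8 * C) (by positivity) (fun _ _ _ => rfl)
        fun u => by
          refine (h.integral_thin_sq_le (u.memLp_grad i)).trans ?_
          have N0 := h.scaledEnergy_nonneg hμ u
          have e1 := h.le_one
          have hA := hco.gradTan u
          have hB := hco.gradNor u
          have hB' : C * (ε * scaledEnergy μ u) ≤ C * scaledEnergy μ u := by
            gcongr; nlinarith
          have hg := integral_grad_sq_le h u i
          calc _ ≤ 2 * (ε * (4 * (C * scaledEnergy μ u))) := by gcongr; linarith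
            _ = 8 * C * (ε * scaledEnergy μ u) := by ring
            _ ≤ _ := by gcongr; exact B u)
      (fun i j => comp (X := fun u => u.hess i j) (k := 1) one_pos (fun _ _ _ => rfl) fun u => by
        refine (hess_sq_le_hessForm u i j).trans ?_
        rw [one_mul, LinearMap.add_apply, LinearMap.add_apply, h.energy_apply]
        have := mul_nonneg hμ.le (h.bdryIntegral_nonneg (h.memLp_normalTrace u))
        linarith [h.bdryForm_nonneg u])
    refine ⟨w, fun δ hδ => ?_⟩
    have := (tendsto_energy_add hμ h w0 w1 w2).eventually_le_const hδ
    exact eventually_atTop.1 this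

/-! ### Test functions with disjoint supports -/

variable (Ω) in
-- Normalized bumps inside the disjoint intervals between `L/(i + 2)` and `L/(i + 1)`, where `L` is
-- the length. They witness infinite dimension and provide trial spaces of every dimension that do
-- not depend on `ε`.
theorem exists_disjoint_bumps : ∃ w : ℕ → ℝ → ℝ, (∀ i, 𝒞 (w i)) ∧
    (∀ i, Periodic (w i) Ω.length) ∧
    ∀ i j, 2 * ∫ s in 0..Ω.length, w i s * w j s = if i = j then 1 else 0 := by
  have L := Ω.length_pos
  set x : ℕ → ℝ := fun i => Ω.length / (i + 1) with hx
  have xpos : ∀ i, 0 < x i := fun i => by simp only [hx]; positivity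
  have anti : StrictAnti x := strictAnti_nat_of_succ_lt fun i => by
    simp only [hx]
    push_cast
    exact div_lt_div_of_pos_left L (by positivity) (by linarith)
  have x0 : ∀ i, x i ≤ Ω.length := fun i => by
    have := anti.antitone (Nat.zero_le i)
    simpa [hx] using this
  have d : ∀ i, x (i + 1) < x i := fun i => anti (Nat.lt_succ_self i)
  let b : ∀ i, ContDiffBump ((x (i + 1) + x i) / 2) := fun i =>
    ⟨(x i - x (i + 1)) / 8, (x i - x (i + 1)) / 4, by linarith [d i], by linarith [d i]⟩
  have rO : ∀ i, (b i).rOut = (x i - x (i + 1)) / 4 := fun _ => rfl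
  have bz : ∀ i s, s ∉ Ioo (x (i + 1)) (x i) → b i s = 0 := fun i s hs => by
    refine (b i).zero_of_le_dist ?_
    rw [Real.dist_eq]
    by_contra hlt
    have := abs_lt.1 (not_le.1 hlt)
    rw [rO] at this
    refine hs ⟨?_, ?_⟩ <;> linarith [this.1, this.2, d i]
  have bs : ∀ i, tsupport (b i) ⊆ Ioo 0 Ω.length := fun i => by
    rw [(b i).tsupport_eq]
    intro s hs
    have := abs_le.1 (Real.dist_eq s _ ▸ Metric.mem_closedBall.1 hs)
    have h1 := xpos (i + 1)
    have h2 := x0 i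
    rw [rO] at this
    refine ⟨?_, ?_⟩ <;> linarith [this.1, this.2, d i]
  choose χ sχ pχ eχ using fun i =>
    exists_periodization_real (Ω := Ω) (b i).contDiff (b i).hasCompactSupport (bs i)
  have pos : ∀ i, 0 < 2 * ∫ s in 0..Ω.length, χ i s * χ i s := fun i => by
    refine mul_pos two_pos (intervalIntegral.integral_pos L
      ((sχ i).continuous.mul (sχ i).continuous).continuousOn (fun s _ => mul_self_nonneg _)
      ⟨(x (i + 1) + x i) / 2, ?_, ?_⟩)
    · have h1 := xpos (i + 1)
      have h2 := x0 i
      constructor <;> linarith [d i]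
    · rw [eχ i _ (by have h1 := xpos (i + 1); have h2 := x0 i; constructor <;> linarith [d i])]
      have : b i ((x (i + 1) + x i) / 2) = 1 := (b i).one_of_mem_closedBall 
        (Metric.mem_closedBall_self (b i).rIn_pos.le)
      rw [this]; norm_num
  refine ⟨fun i s => (√(2 * ∫ s in 0..Ω.length, χ i s * χ i s))⁻¹ * χ i s,
    fun i => contDiff_const.mul (sχ i), fun i s => by simp only; rw [pχ i s], fun i j => ?_⟩
  have e : ∀ s, (√(2 * ∫ s in 0..Ω.length, χ i s * χ i s))⁻¹ * χ i s *
      ((√(2 * ∫ s in 0..Ω.length, χ j s * χ j s))⁻¹ * χ j s) =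
      ((√(2 * ∫ s in 0..Ω.length, χ i s * χ i s))⁻¹ *
        (√(2 * ∫ s in 0..Ω.length, χ j s * χ j s))⁻¹) * (χ i s * χ j s) := fun s => by ring
  simp only [e]
  rw [iint_const_mul]
  split_ifs with hij
  · subst hij
    have hp := pos i
    set m := ∫ s in 0..Ω.length, χ i s * χ i s
    have : √(2 * m) * √(2 * m) = 2 * m := Real.mul_self_sqrt hp.le
    have hs := (Real.sqrt_pos.2 hp).ne'
    have hm : m ≠ 0 := by intro h0; rw [h0] at hp; simp at hp
    rw [← mul_inv, this]
    field_simp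
  · have : ∫ s in 0..Ω.length, χ i s * χ j s = ∫ s in 0..Ω.length, (0 : ℝ) := by
      refine iint_congr fun s hs => ?_
      rw [uIcc_of_le L.le] at hs
      rw [eχ i s hs, eχ j s hs]
      by_cases h1 : s ∈ Ioo (x (i + 1)) (x i)
      · rw [bz j s, mul_zero]
        intro h2
        rcases lt_or_gt_of_ne hij with h | h
        · have := anti.antitone h
          linarith [h1.1, h2.2]
        · have := anti.antitone h
          linarith [h2.1, h1.2]
      · rw [bz i s h1, zero_mul]
    rw [this]; simp

end SmoothDomain

/-- There are `n` linear conditions on `n + 1` coefficients: the trial vector of the min-max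
principle. -/
theorem exists_ne_zero_orthogonal {V : Type*} [AddCommGroup V] [Module ℝ V]
    (b : V →ₗ[ℝ] V →ₗ[ℝ] ℝ) {n : ℕ} (f : ℕ → V) (v : Fin (n + 1) → V) :
    ∃ c : Fin (n + 1) → ℝ, c ≠ 0 ∧ ∀ j < n, b (f j) (∑ i, c i • v i) = 0 := by
  set T : (Fin (n + 1) → ℝ) →ₗ[ℝ] (Fin n → ℝ) :=
    LinearMap.pi fun j => (b (f j)) ∘ₗ (Fintype.linearCombination ℝ v) with hT
  obtain ⟨c, hc, c0⟩ := Submodule.exists_mem_ne_zero_of_ne_bot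
    (LinearMap.ker_ne_bot_of_finrank_lt (f := T) (by simp))
  refine ⟨c, c0, fun j hj => ?_⟩
  have := congrFun (LinearMap.mem_ker.1 hc) ⟨j, hj⟩
  simpa [hT, Fintype.linearCombination_apply] using this

/-! ### Existence of the Steklov spectrum and its variational principle -/

namespace SmoothDomain

variable {Ω : SmoothDomain} {ε μ C : ℝ}

theorem Tubular.bdryVal_sum (h : Ω.Tubular ε) {ι : Type*} (s : Finset ι) (c : ι → ℝ)
    (v : ι → Ω.H2 ε) (j : Fin 2) :
    bdryVal (∑ i ∈ s, c i • v i) j =ᵐ[𝓁 (Ioc 0 Ω.length)]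
      fun r => ∑ i ∈ s, c i * bdryVal (v i) j r := by
  classical
  induction s using Finset.induction_on with
  | empty =>
    have := h.bdryVal_smul 0 (0 : Ω.H2 ε) j
    rw [zero_smul] at this
    filter_upwards [this] with r hr
    rw [Finset.sum_empty, hr]; simp
  | insert i s hi ih =>
    rw [Finset.sum_insert hi]
    filter_upwards [h.bdryVal_add (c i • v i) (∑ i ∈ s, c i • v i) j, h.bdryVal_smul (c i) (v i) j,
      ih] with r h1 h2 h3
    rw [h1, h2, h3, Finset.sum_insert hi]

theorem integral_combination_sq {ι : Type*} [Fintype ι] [DecidableEq ι] {w : ι → ℝ → ℝ}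
    (hw : ∀ i, 𝒞 (w i))
    (ho : ∀ i j, 2 * ∫ s in 0..Ω.length, w i s * w j s = if i = j then 1 else 0)
    (c : ι → ℝ) : 2 * ∫ s in 0..Ω.length, (∑ i, c i * w i s) ^ 2 = ∑ i, c i ^ 2 := by
  have cw := fun i => (hw i).continuous
  have ci : ∀ i j, IntervalIntegrable (fun s => c i * c j * (w i s * w j s)) volume 0 Ω.length :=
    fun i j => Continuous.intervalIntegrable (by fun_prop) _ _
  have cs : ∀ i, IntervalIntegrable (fun s => ∑ j, c i * c j * (w i s * w j s)) volume 0 Ω.length :=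
    fun i => Continuous.intervalIntegrable (by fun_prop) _ _
  have e : ∀ s, (∑ i, c i * w i s) ^ 2 = ∑ i, ∑ j, c i * c j * (w i s * w j s) := fun s => by
    rw [sq, Finset.sum_mul_sum]
    refine Finset.sum_congr rfl fun i _ => Finset.sum_congr rfl fun j _ => by ring
  simp only [e]
  rw [intervalIntegral.integral_finsetSum fun i _ => cs i,
    Finset.mul_sum]
  refine Finset.sum_congr rfl fun i _ => ?_
  rw [intervalIntegral.integral_finsetSum fun j _ => ci i j, Finset.mul_sum]
  have : ∀ j, 2 * ∫ s in 0..Ω.length, c i * c j * (w i s * w j s) =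
      c i * c j * if i = j then 1 else 0 := fun j => by
    rw [← ho i j, iint_const_mul]; ring
  simp only [this]
  simp [sq]

/-- The traces of the lifted bumps are the bumps themselves, which are orthonormal. A nonzero
combination of `n + 1` lifts therefore has a nonzero trace. -/
theorem Tubular.exists_orthogonal (h : Ω.Tubular ε) (n : ℕ) (f : ℕ → Ω.H2 ε) :
    ∃ v, (∀ j < n, h.bdryForm (f j) v = 0) ∧ 0 < h.bdryForm v v := by
  have L := Ω.length_pos
  obtain ⟨w, sw, pw, ow⟩ := Ω.exists_disjoint_bumps
  choose c hc ex using fun i => exists_lift (sw i) (pw i)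
  choose v S hv using fun i => ex i ε h
  obtain ⟨k, k0, hk⟩ := exists_ne_zero_orthogonal h.bdryForm f fun i : Fin (n + 1) => v i
  refine ⟨_, hk, ?_⟩
  set z := ∑ i : Fin (n + 1), k i • v i with hz
  have hb := h.bdryIntegral_sq (h.memLp_bdryVal z) 0
  have e : ∫ s in 0..Ω.length, bdryVal z 0 s ^ 2 =
      ∫ s in 0..Ω.length, (∑ i : Fin (n + 1), k i * w i s) ^ 2 := by
    rw [integral_of_le L.le, integral_of_le L.le]
    refine integral_congr_ae ?_
    filter_upwards [h.bdryVal_sum Finset.univ k (fun i => v i) 0,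
      ae_all_iff.2 fun i : Fin (n + 1) => (hv i).bdryVal 0] with s h1 h2
    rw [h1]
    simp only [h2]
  have sum := integral_combination_sq (Ω := Ω) (fun i : Fin (n + 1) => sw i)
    (fun i j => by rw [ow]; simp only [Fin.ext_iff]) k
  have pos : 0 < ∑ i, k i ^ 2 := by
    obtain ⟨i, hi⟩ := Function.ne_iff.1 k0
    exact Finset.sum_pos' (fun i _ => sq_nonneg _) ⟨i, Finset.mem_univ i, by
      have : k i ≠ 0 := hi
      positivity⟩
  rw [h.bdryForm_apply]
  linarith

theorem Coercive.ae_eq_zero (hco : Ω.Coercive μ C ε) {v : Ω.H2 ε}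
    (h0 : hco.tubular.energy μ v v = 0) (h1 : hco.tubular.bdryForm v v = 0) :
    v.val =ᵐ[𝓁 (Ω.thin ε)] 0 := by
  have h := hco.tubular
  refine h.ae_eq_zero_of_comp v.memLp_val (ae_eq_zero_of_integral_sq_nonpos
    (h.memLp_comp v.memLp_val) ((hco.val v).trans ?_))
  rw [h.scaledEnergy_eq, h0, h1]; simp

theorem Tubular.bdryForm_eq_zero (h : Ω.Tubular ε) {v : Ω.H2 ε}
    (hv : v.val =ᵐ[𝓁 (Ω.thin ε)] 0) : h.bdryForm v v = 0 := by
  have hg := fun i => (v.weak_grad i).ae_eq_zero (Ω.isOpen_thin ε) (v.memLp_grad i) hv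
  have z : ∀ {f : Plane → ℝ}, 𝓛 f (Ω.thin ε) →
      f =ᵐ[𝓁 (Ω.thin ε)] 0 → Ω.pull ε f =ᵐ[𝓁 Ω.refSet] 0 :=
    fun {f} hf h0 => by
      refine ae_eq_zero_of_integral_sq_nonpos (h.memLp_comp hf)
        ((h.integral_comp_sq_le hf).trans (le_of_eq ?_))
      have : ∫ x in Ω.thin ε, f x ^ 2 = 0 := by
        refine integral_eq_zero_of_ae ?_
        filter_upwards [h0] with x hx
        rw [hx]; simp
      rw [this, mul_zero]
  have b0 : ∀ j, ∫ s in 0..Ω.length, bdryVal v j s ^ 2 ≤ 0 := fun j => by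
    refine ((h.stripGrad_val v).integral_trace_sq_le j).trans (le_of_eq ?_)
    have e1 : ∫ p in Ω.refSet, Ω.pull ε v.val p ^ 2 = 0 := by
      refine integral_eq_zero_of_ae ?_
      filter_upwards [z v.memLp_val hv] with p hp
      rw [hp]; simp
    have e2 : ∫ p in Ω.refSet, (-(ε * Ω.norComp (fun i => Ω.pull ε (v.grad i)) p)) ^ 2 = 0 := by
      refine integral_eq_zero_of_ae ?_
      filter_upwards [z (v.memLp_grad 0) (hg 0), z (v.memLp_grad 1) (hg 1)] with p h0 h1
      simp [norComp, h0, h1]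
    rw [e1, e2]; ring
  refine le_antisymm ?_ (h.bdryForm_nonneg v)
  rw [h.bdryForm_apply]
  refine (h.bdryIntegral_le (h.memLp_bdryVal v)).trans ?_
  linarith [b0 0, b0 1]

/-- The first form of the pair is the energy plus the boundary form, so its eigenvalues exceed the
Steklov eigenvalues by 1. An eigenfunction orthogonal to the whole system has zero boundary norm,
because the eigenvalues tend to infinity; then its energy is zero and by coercivity it vanishes
almost everywhere. -/
theorem Coercive.exists_eigensystem (hμ : 0 < μ) (hC : 0 < C) (hco : Ω.Coercive μ C ε) :
    ∃ lam u, Ω.IsSteklovEigensystem μ ε lam u := by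
  have h := hco.tubular
  obtain ⟨lam, u, mono, top, eig, orth, vari⟩ :=
    (hco.formPair hμ hC).exists_eigensystem h.exists_orthogonal
  refine ⟨fun k => lam k - 1, u, fun i j hij => sub_le_sub_right (mono hij) 1,
    tendsto_atTop_add_const_right _ (-1) top, fun k => h.isSteklovSolution_iff.2 fun v => ?_,
    fun k l => orth k l, fun Λ v hv ho => ?_⟩
  · have := eig k v
    simp only [LinearMap.add_apply] at this
    linarith
  · have ha := h.isSteklovSolution_iff.1 hv v
    have b0 : h.bdryForm v v = 0 := by
      by_contra hne
      have pos := lt_of_le_of_ne (h.bdryForm_nonneg v) (Ne.symm hne)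
      obtain ⟨n, hn⟩ := (top.eventually_gt_atTop
        ((h.energy μ + h.bdryForm) v v / h.bdryForm v v)).exists
      rw [div_lt_iff₀ pos] at hn
      exact absurd (vari n v fun j _ => by rw [h.bdryForm_symm]; exact ho j) (not_le.2 hn)
    exact hco.ae_eq_zero (by rw [ha, b0, mul_zero]) b0

theorem IsSteklovEigensystem.energy_eq {lam : ℕ → ℝ} {u : ℕ → Ω.H2 ε}
    (hs : Ω.IsSteklovEigensystem μ ε lam u) (h : Ω.Tubular ε) (k : ℕ) (v : Ω.H2 ε) :
    h.energy μ (u k) v = lam k * h.bdryForm (u k) v :=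
  h.isSteklovSolution_iff.1 (hs.solution k) v

theorem IsSteklovEigensystem.bdryForm_eq {lam : ℕ → ℝ} {u : ℕ → Ω.H2 ε}
    (hs : Ω.IsSteklovEigensystem μ ε lam u) (h : Ω.Tubular ε) (k l : ℕ) :
    h.bdryForm (u k) (u l) = if k = l then 1 else 0 := hs.orthonormal k l

/-- Needed for an arbitrary eigensystem, not only the constructed one, because the theorem allows
any choice of eigenfunctions. The shift by 1 is undone at the end. -/
theorem IsSteklovEigensystem.variational {lam : ℕ → ℝ} {u : ℕ → Ω.H2 ε}
    (hs : Ω.IsSteklovEigensystem μ ε lam u) (hμ : 0 < μ) (hC : 0 < C) (hco : Ω.Coercive μ C ε)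
    {k : ℕ} {v : Ω.H2 ε} (hv : ∀ j < k, hco.tubular.bdryForm v (u j) = 0) :
    lam k * hco.tubular.bdryForm v v ≤ hco.tubular.energy μ v v := by
  have h := hco.tubular
  have := (hco.formPair hμ hC).variational h.exists_orthogonal (lam := fun k => lam k + 1) (u := u)
    (fun i j hij => add_le_add_left (hs.monotone hij) 1)
    (tendsto_atTop_add_const_right _ 1 hs.unbounded)
    (fun k v => by simp only [LinearMap.add_apply]; rw [hs.energy_eq h]; ring)
    (hs.bdryForm_eq h)
    (fun t v hv ho => h.bdryForm_eq_zero (hs.exhaustive (t - 1) v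
      (h.isSteklovSolution_iff.2 fun w => by
        have := hv w
        simp only [LinearMap.add_apply] at this
        linarith) ho)) hv
  simp only [LinearMap.add_apply] at this
  linarith

theorem IsSteklovEigensystem.nonneg {lam : ℕ → ℝ} {u : ℕ → Ω.H2 ε}
    (hs : Ω.IsSteklovEigensystem μ ε lam u) (hμ : 0 < μ) (h : Ω.Tubular ε) (k : ℕ) :
    0 ≤ lam k := by
  have h1 := hs.energy_eq h k (u k)
  rw [hs.bdryForm_eq h, if_pos rfl, mul_one] at h1
  rw [← h1]
  exact h.energy_nonneg hμ _

theorem IsSteklovEigensystem.scaledEnergy_eq {lam : ℕ → ℝ} {u : ℕ → Ω.H2 ε}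
    (hs : Ω.IsSteklovEigensystem μ ε lam u) (h : Ω.Tubular ε) (k : ℕ) :
    scaledEnergy μ (u k) = lam k / ε + 1 := by
  rw [h.scaledEnergy_eq, hs.energy_eq h, hs.bdryForm_eq h, if_pos rfl, mul_one]

end SmoothDomain

/-! ### Convergence of the forms on lifts and upper bounds for the eigenvalues -/

theorem sum_sum_mul_le {ι : Type*} [Fintype ι] {x : ι → ι → ℝ} {η : ℝ}
    (hx : ∀ i j, |x i j| ≤ η) (c : ι → ℝ) :
    |∑ i, ∑ j, c i * c j * x i j| ≤ η * Fintype.card ι * ∑ i, c i ^ 2 := by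
  have h1 : ∀ i j, |c i * c j * x i j| ≤ η * (c i ^ 2 + c j ^ 2) / 2 := fun i j => by
    have e0 : 0 ≤ η := (abs_nonneg _).trans (hx i j)
    rw [abs_mul, abs_mul]
    have h2 : |c i| * |c j| ≤ (c i ^ 2 + c j ^ 2) / 2 := by
      rw [← sq_abs (c i), ← sq_abs (c j)]
      nlinarith [sq_nonneg (|c i| - |c j|)]
    calc _ ≤ (c i ^ 2 + c j ^ 2) / 2 * η := by
          gcongr
          exact hx i j
      _ = _ := by ring
  calc _ ≤ ∑ i, ∑ j, |c i * c j * x i j| :=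
        (Finset.abs_sum_le_sum_abs _ _).trans
          (Finset.sum_le_sum fun i _ => Finset.abs_sum_le_sum_abs _ _)
    _ ≤ ∑ i, ∑ j, η * (c i ^ 2 + c j ^ 2) / 2 :=
        Finset.sum_le_sum fun i _ => Finset.sum_le_sum fun j _ => h1 i j
    _ = _ := by
        simp only [mul_add, add_div, Finset.sum_add_distrib, Finset.sum_const, Finset.card_univ,
          nsmul_eq_mul, ← Finset.mul_sum, ← Finset.sum_div]
        ring

theorem LinearMap.apply_combination {V ι : Type*} [AddCommGroup V] [Module ℝ V] [Fintype ι]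
    (b : V →ₗ[ℝ] V →ₗ[ℝ] ℝ) (c : ι → ℝ) (v : ι → V) :
    b (∑ i, c i • v i) (∑ i, c i • v i) = ∑ i, ∑ j, c i * c j * b (v i) (v j) := by
  simp only [map_sum, LinearMap.sum_apply, map_smul, LinearMap.smul_apply, smul_eq_mul]
  rw [Finset.sum_comm]
  refine Finset.sum_congr rfl fun i _ => ?_
  rw [Finset.mul_sum]
  exact Finset.sum_congr rfl fun j _ => by ring

namespace SmoothDomain

variable {Ω : SmoothDomain} {ε μ C : ℝ}

/-- Smooth periodic functions lift to the tubular neighbourhoods with convergence of the forms. -/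
theorem eventually_exists_lifts (hμ : 0 < μ) (hC : 0 < C)
    (hE : ∀ᶠ ε in 𝓝[>] (0 : ℝ), Ω.Coercive μ C ε) {ι : Type*} [Fintype ι] {w : ι → ℝ → ℝ}
    (hw : ∀ i, 𝒞 (w i)) (pw : ∀ i, Periodic (w i) Ω.length)
    {η : ℝ} (hη : 0 < η) (M : ℝ) :
    ∀ᶠ ε in 𝓝[>] (0 : ℝ), ∃ (h : Ω.Tubular ε) (v : ι → Ω.H2 ε),
      (∀ i j, |h.bdryForm (v i) (v j) - 2 * ∫ s in 0..Ω.length, w i s * w j s| ≤ η ∧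
        |h.energy μ (v i) (v j) / ε - ∫ s in 0..Ω.length, w i s * Ω.limitOp (w j) s| ≤ η) ∧
      ∀ u : Ω.H2 ε, scaledEnergy μ u ≤ M → ∀ j,
        |h.bdryForm u (v j) - 2 * ∫ p in Ω.refSet, Ω.pull ε u.val p * w j (p 0)| ≤ η ∧
        |h.energy μ u (v j) / ε - ∫ p in Ω.refSet, Ω.pull ε u.val p * Ω.limitOp (w j) (p 0)|
          ≤ η := by
  choose c hc ex using fun i => exists_lift (Ω := Ω) (hw i) (pw i)
  choose D hD est using fun i => exists_energy_lift (Ω := Ω) hμ hC (hw i) (pw i) (hc i)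
  set A : ι → ℝ := fun i => |(∫ s in 0..Ω.length, w i s * Ω.limitOp (w i) s) +
    2 * ∫ s in 0..Ω.length, w i s * w i s| with hA
  set B : ι → ℝ := fun i => 2 * A i + 4 * D i with hB
  have B0 : ∀ i, 0 ≤ B i := fun i =>
    add_nonneg (mul_nonneg two_pos.le (abs_nonneg _)) (mul_nonneg four_pos.le (hD i).le)
  set M' := |M| + ∑ i, B i with hM'
  set D' := ∑ i, D i with hD'
  have BM : ∀ i, B i ≤ M' := fun i => (Finset.single_le_sum (f := B) (fun i _ => B0 i)
    (Finset.mem_univ i)).trans (le_add_of_nonneg_left (abs_nonneg M))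
  have DD : ∀ i, D i ≤ D' := fun i =>
    Finset.single_le_sum (f := D) (fun i _ => (hD i).le) (Finset.mem_univ i)
  have M0 : 0 ≤ M' := add_nonneg (abs_nonneg M) (Finset.sum_nonneg fun i _ => B0 i)
  have D0 : 0 ≤ D' := Finset.sum_nonneg fun i _ => (hD i).le
  have small : ∀ᶠ ε in 𝓝[>] (0 : ℝ), ε * (D' * M') ≤ η ^ 2 := by
    have t : Tendsto (fun ε : ℝ => ε * (D' * M')) (𝓝[>] 0) (𝓝 0) := by
      have : Continuous fun ε : ℝ => ε * (D' * M') := by fun_prop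
      simpa using (this.tendsto 0).mono_left nhdsWithin_le_nhds
    exact t.eventually_le_const (by positivity)
  filter_upwards [hE, small] with ε hco hs
  have h := hco.tubular
  have e0 := h.pos
  choose v S hv using fun i => ex i ε h
  have fst : ∀ (i : ι) (g : ℝ → ℝ), ∫ p in Ω.refSet, Ω.pull ε (v i).val p * g (p 0) =
      ∫ s in 0..Ω.length, w i s * g s := fun i g => by
    rw [← Ω.integral_refSet_fst fun s => w i s * g s]
    refine integral_congr_ae ?_
    filter_upwards [(hv i).val] with p hp
    rw [hp]
  have general : ∀ u : Ω.H2 ε, scaledEnergy μ u ≤ M' → ∀ j,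
        |h.bdryForm u (v j) - 2 * ∫ p in Ω.refSet, Ω.pull ε u.val p * w j (p 0)| ≤ η ∧
        |h.energy μ u (v j) / ε - ∫ p in Ω.refSet, Ω.pull ε u.val p * Ω.limitOp (w j) (p 0)|
          ≤ η := fun u hu j => by
    have key : D j * (ε * scaledEnergy μ u) ≤ η ^ 2 := by
      calc _ ≤ D' * (ε * M') := by
            have := h.scaledEnergy_nonneg hμ u
            gcongr
            exact DD j
        _ = ε * (D' * M') := by ring
        _ ≤ _ := hs
    have := est j ε hco (v j) (S j) (hv j) u
    exact ⟨abs_le_of_sq_le_sq (this.2.trans key) hη.le, abs_le_of_sq_le_sq (this.1.trans key) hη.le⟩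
  -- The estimates assume a bound on the scaled energy of `u`, so the lifts need one of their own.
  -- With `u` the lift itself they read `(N - (a + b))² ≤ 4DN`, which forces `N ≤ 2A + 4D`
  -- independently of `ε`.
  have bound : ∀ i, scaledEnergy μ (v i) ≤ M' := fun i => by
    refine le_trans ?_ (BM i)
    obtain ⟨E4, E5⟩ := est i ε hco (v i) (S i) (hv i) (v i)
    rw [fst] at E4 E5
    have N0 := h.scaledEnergy_nonneg hμ (v i)
    have Nd : scaledEnergy μ (v i) = h.energy μ (v i) (v i) / ε + h.bdryForm (v i) (v i) := rfl
    set N := scaledEnergy μ (v i)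
    set a := ∫ s in 0..Ω.length, w i s * Ω.limitOp (w i) s
    set b := 2 * ∫ s in 0..Ω.length, w i s * w i s
    have hX : (N - (a + b)) ^ 2 ≤ 4 * D i * N := by
      have e1 : D i * (ε * N) ≤ D i * N := by
        have := h.le_one
        have := (hD i).le
        gcongr
        nlinarith
      have e2 : N - (a + b) = (h.energy μ (v i) (v i) / ε - a) + (h.bdryForm (v i) (v i) - b) := by
        rw [Nd]; ring
      rw [e2]
      refine add_sq_le.trans ?_
      linarith
    have hle : a + b ≤ A i := le_abs_self _
    by_contra hlt
    have hlt' : 2 * A i + 4 * D i < N := not_le.1 hlt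
    have A0 : 0 ≤ A i := abs_nonneg _
    have Npos : 0 < N := by linarith [hD i]
    have : N * N ≤ (2 * A i + 4 * D i) * N := by nlinarith [sq_nonneg (a + b)]
    nlinarith
  refine ⟨h, v, fun i j => ?_, fun u hu j => general u ?_ j⟩
  · have := general (v i) (bound i) j
    rwa [fst, fst] at this
  · exact hu.trans ((le_abs_self M).trans
      (le_add_of_nonneg_right (Finset.sum_nonneg fun i _ => B0 i)))

/-- The upper half of the min-max principle: some nonzero combination of `k + 1` lifts is orthogonal
to the first `k` eigenfunctions, and its Rayleigh quotient is close to that of the functions on the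
curve. -/
theorem eventually_eigenvalue_le (hμ : 0 < μ) (hC : 0 < C)
    (hE : ∀ᶠ ε in 𝓝[>] (0 : ℝ), Ω.Coercive μ C ε) {k : ℕ} {w : Fin (k + 1) → ℝ → ℝ}
    (hw : ∀ i, 𝒞 (w i)) (pw : ∀ i, Periodic (w i) Ω.length)
    (ho : ∀ i j, 2 * ∫ s in 0..Ω.length, w i s * w j s = if i = j then 1 else 0)
    {Λ : ℝ} (hΛ : 0 ≤ Λ) (hq : ∀ c : Fin (k + 1) → ℝ, ∑ i, ∑ j, c i * c j *
      ∫ s in 0..Ω.length, w i s * Ω.limitOp (w j) s ≤ Λ * ∑ i, c i ^ 2)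
    {δ : ℝ} (hδ : 0 < δ) :
    ∀ᶠ ε in 𝓝[>] (0 : ℝ), ∀ (lam : ℕ → ℝ) (u : ℕ → Ω.H2 ε),
      Ω.IsSteklovEigensystem μ ε lam u → lam k / ε ≤ Λ + δ := by
  set m : ℝ := (Fintype.card (Fin (k + 1)) : ℝ) with hm
  have m0 : 0 < m := by simp only [hm, Fintype.card_fin]; positivity
  -- Chosen so that `Λ + ηm = (Λ + δ)(1 - ηm)`: the errors in numerator and denominator together
  -- cost exactly `δ`.
  set η := δ / (m * (1 + Λ + δ)) with hη
  have η0 : 0 < η := by positivity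
  have ηm : η * m * (1 + Λ + δ) = δ := by rw [hη]; field_simp
  filter_upwards [hE, eventually_exists_lifts hμ hC hE hw pw η0 0] with ε hco ⟨h, v, hv, _⟩ lam u hs
  have e0 := h.pos
  obtain ⟨c, c0, orth⟩ := exists_ne_zero_orthogonal h.bdryForm u v
  have S0 : 0 < ∑ i, c i ^ 2 := by
    obtain ⟨i, hi⟩ := Function.ne_iff.1 c0
    exact Finset.sum_pos' (fun i _ => sq_nonneg _) ⟨i, Finset.mem_univ i, by
      have : c i ≠ 0 := hi
      positivity⟩
  set S := ∑ i, c i ^ 2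
  have var := hs.variational hμ hC hco (k := k) (v := ∑ i, c i • v i)
    (fun j hj => by rw [h.bdryForm_symm]; exact orth j hj)
  have l0 := hs.nonneg hμ h k
  rw [LinearMap.apply_combination, LinearMap.apply_combination] at var
  have q1 := sum_sum_mul_le (fun i j => (hv i j).1) c
  have q2 := sum_sum_mul_le (fun i j => (hv i j).2) c
  simp only [mul_sub, Finset.sum_sub_distrib] at q1 q2
  rw [← hm] at q1 q2
  have r1 : ∑ i, ∑ j, c i * c j * (2 * ∫ s in 0..Ω.length, w i s * w j s) = S := by
    simp only [ho]
    simp [S, sq]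
  have r2 : ∑ i, ∑ j, c i * c j * (h.energy μ (v i) (v j) / ε) =
      (∑ i, ∑ j, c i * c j * h.energy μ (v i) (v j)) / ε := by
    simp only [Finset.sum_div, mul_div_assoc]
  rw [r1] at q1
  rw [r2] at q2
  have q1' := (abs_le.1 q1).1
  have q2' := (abs_le.1 q2).2
  have hq' := hq c
  set b := ∑ i, ∑ j, c i * c j * h.bdryForm (v i) (v j)
  set E := ∑ i, ∑ j, c i * c j * h.energy μ (v i) (v j)
  have var' : lam k / ε * b ≤ E / ε := by
    rw [div_mul_eq_mul_div]
    exact div_le_div_of_nonneg_right var e0.le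
  set x := lam k / ε with hx
  have x0 : 0 ≤ x := div_nonneg l0 e0.le
  have lt1 : 0 < 1 - η * m := by
    have : η * m * (1 + Λ + δ) < 1 * (1 + Λ + δ) := by rw [ηm]; linarith
    have := lt_of_mul_lt_mul_right this (by positivity)
    linarith
  have f1 : x * ((1 - η * m) * S) ≤ (Λ + η * m) * S := by
    calc _ ≤ x * b := by gcongr; linarith
      _ ≤ E / ε := var'
      _ ≤ _ := by linarith
  have f2 : Λ + η * m ≤ (Λ + δ) * (1 - η * m) := by nlinarith
  have f3 : x * ((1 - η * m) * S) ≤ (Λ + δ) * ((1 - η * m) * S) := by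
    refine f1.trans ?_
    rw [← mul_assoc]
    gcongr
  exact le_of_mul_le_mul_right f3 (by positivity)

theorem exists_eigenvalue_bound (hμ : 0 < μ) (hC : 0 < C)
    (hE : ∀ᶠ ε in 𝓝[>] (0 : ℝ), Ω.Coercive μ C ε) (k : ℕ) :
    ∃ B, ∀ᶠ ε in 𝓝[>] (0 : ℝ), ∀ (lam : ℕ → ℝ) (u : ℕ → Ω.H2 ε),
      Ω.IsSteklovEigensystem μ ε lam u → lam k / ε ≤ B := by
  obtain ⟨w, sw, pw, ow⟩ := Ω.exists_disjoint_bumps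
  set a : Fin (k + 1) → Fin (k + 1) → ℝ := fun i j =>
    ∫ s in 0..Ω.length, w i s * Ω.limitOp (w j) s with ha
  set η := ∑ i, ∑ j, |a i j| with hη
  have hx : ∀ i j, |a i j| ≤ η := fun i j =>
    (Finset.single_le_sum (f := fun j => |a i j|) (fun j _ => abs_nonneg _)
      (Finset.mem_univ j)).trans (Finset.single_le_sum (f := fun i => ∑ j, |a i j|)
      (fun i _ => Finset.sum_nonneg fun j _ => abs_nonneg _) (Finset.mem_univ i))
  have η0 : 0 ≤ η := (abs_nonneg _).trans (hx 0 0)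
  refine ⟨_, eventually_eigenvalue_le hμ hC hE (fun i : Fin (k + 1) => sw i) (fun i => pw i)
    (fun i j => by rw [ow]; simp only [Fin.ext_iff]) (by positivity)
    (fun c => (le_abs_self _).trans (sum_sum_mul_le hx c)) one_pos⟩

/-- The lift of the constant 1 has zero energy and positive boundary norm, so the lowest eigenvalue
is not only small but exactly zero. -/
theorem eventually_eigenvalue_zero (hμ : 0 < μ) (hC : 0 < C)
    (hE : ∀ᶠ ε in 𝓝[>] (0 : ℝ), Ω.Coercive μ C ε) :
    ∀ᶠ ε in 𝓝[>] (0 : ℝ), ∀ (lam : ℕ → ℝ) (u : ℕ → Ω.H2 ε),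
      Ω.IsSteklovEigensystem μ ε lam u → lam 0 = 0 := by
  have L := Ω.length_pos
  obtain ⟨c, -, ex⟩ := exists_lift (Ω := Ω) (w := fun _ => 1) contDiff_const fun _ => rfl
  filter_upwards [hE] with ε hco lam u hs
  have h := hco.tubular
  obtain ⟨v, S, hv⟩ := ex ε h
  have S0 : ∀ p ∈ Ω.refSet, S p = 0 := fun p hp => by
    have := hv.jac_mul p hp
    rw [deriv_const] at this
    exact (mul_eq_zero.1 this).resolve_left
      (h.jac_pos (p := p) ⟨by linarith [hp.2.1], by linarith [hp.2.2]⟩).ne'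
  have dS0 : ∀ p ∈ Ω.refSet, 𝒟 0 S p = 0 := fun p hp => by
    have : S =ᶠ[𝓝 p] fun _ => 0 := by
      filter_upwards [Ω.isOpen_refSet.mem_nhds hp] with q hq
      exact S0 q hq
    rw [partialDeriv, this.fderiv_eq]
    simp
  have en : h.energy μ v v = 0 := by
    rw [energy_lift_eq h hv]
    have e1 : ∫ p in Ω.refSet, hessTT v p * 𝒟 0 S p = 0 := by
      rw [setIntegral_congr_fun (g := fun _ => 0) Ω.isOpen_refSet.measurableSet fun p hp => by
        rw [dS0 p hp, mul_zero]]
      simp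
    have e2 : ∫ p in Ω.refSet, hessNT v p * (Ω.curvature (p 0) * S p) = 0 := by
      rw [setIntegral_congr_fun (g := fun _ => 0) Ω.isOpen_refSet.measurableSet fun p hp => by
        rw [S0 p hp, mul_zero, mul_zero]]
      simp
    rw [e1, e2]; simp
  have bp : 0 < h.bdryForm v v := by
    have hb := h.bdryIntegral_sq (h.memLp_bdryVal v) 0
    have : ∫ s in 0..Ω.length, bdryVal v 0 s ^ 2 = Ω.length := by
      rw [integral_of_le L.le, integral_congr_ae (g := fun _ => 1)]
      · simp [L.le]
      · filter_upwards [hv.bdryVal 0] with s h1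
        rw [h1]; simp
    rw [h.bdryForm_apply]
    linarith
  have var := hs.variational hμ hC hco (k := 0) (v := v) (by simp)
  rw [en] at var
  exact le_antisymm (nonpos_of_mul_nonpos_left var bp) (hs.nonneg hμ h 0)

end SmoothDomain

theorem tendsto_integral_mul_l2 {α : Type*} [MeasurableSpace α] {μ : Measure α}
    {f h : ℕ → α → ℝ} {g k : α → ℝ} (hf : ∀ n, MemLp (f n) 2 μ) (hg : MemLp g 2 μ)
    (hh : ∀ n, MemLp (h n) 2 μ) (hk : MemLp k 2 μ)
    (lf : Tendsto (fun n => ∫ x, (f n x - g x) ^ 2 ∂μ) atTop (𝓝 0))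
    (lh : Tendsto (fun n => ∫ x, (h n x - k x) ^ 2 ∂μ) atTop (𝓝 0)) :
    Tendsto (fun n => ∫ x, f n x * h n x ∂μ) atTop (𝓝 (∫ x, g x * k x ∂μ)) := by
  have a := tendsto_integral_mul_of_l2 hf hg hk lf
  have b := tendsto_integral_mul_of_l2 hh hk hg lh
  have cz : Tendsto (fun n => ∫ x, (f n x - g x) * (h n x - k x) ∂μ) atTop (𝓝 0) := by
    refine squeeze_zero_norm (a := fun n => √((∫ x, (f n x - g x) ^ 2 ∂μ) *
      ∫ x, (h n x - k x) ^ 2 ∂μ)) (fun n => ?_) (by simpa using (lf.mul lh).sqrt)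
    exact Real.abs_le_sqrt (integral_mul_sq_le ((hf n).sub hg) ((hh n).sub hk))
  have lim := (a.add b).add cz |>.sub_const (∫ x, k x * g x ∂μ)
  have e : (∫ x, g x * k x ∂μ) + (∫ x, k x * g x ∂μ) + 0 - ∫ x, k x * g x ∂μ =
      ∫ x, g x * k x ∂μ := by ring
  rw [e] at lim
  refine lim.congr fun n => ?_
  have i1 := integrable_mul_of_memLp (hf n) hk
  have i2 := integrable_mul_of_memLp (hh n) hg
  have i3 := integrable_mul_of_memLp ((hf n).sub hg) ((hh n).sub hk)
  have i4 := integrable_mul_of_memLp hk hg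
  simp only [Pi.sub_apply] at i3
  have a1 := integral_add i1 i2
  have a2 := integral_add (i1.add i2) i3
  have a3 := integral_sub ((i1.add i2).add i3) i4
  simp only [Pi.add_apply] at a2 a3
  rw [← a1, ← a2, ← a3]
  congr 1; ext x; ring

/-! ### Limits of eigensystems as the thickness tends to zero -/

namespace SmoothDomain

variable {Ω : SmoothDomain} {μ C : ℝ} {e : ℕ → ℝ}

/-- A sequence of eigensystems of the Steklov problem, for thicknesses tending to zero, such that
the scaled eigenvalues and the traces of the eigenfunctions converge. -/
structure SteklovLimit (μ C : ℝ) (e : ℕ → ℝ) (lam : ℕ → ℕ → ℝ)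
    (u : ∀ n, ℕ → Ω.H2 (e n)) (Λ : ℕ → ℝ) (g : ℕ → ℝ → ℝ) : Prop where
  mu_pos : 0 < μ
  const_pos : 0 < C
  eventually_coercive : ∀ᶠ ε in 𝓝[>] (0 : ℝ), Ω.Coercive μ C ε
  tendsto : Tendsto e atTop (𝓝[>] 0)
  coercive : ∀ n, Ω.Coercive μ C (e n)
  eigensystem : ∀ n, Ω.IsSteklovEigensystem μ (e n) (lam n) (u n)
  value : ∀ k, Tendsto (fun n => lam n k / e n) atTop (𝓝 (Λ k))
  continuous : ∀ k, Continuous (g k)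
  periodic : ∀ k, Periodic (g k) Ω.length
  trace : ∀ k, Tendsto (fun n => ∫ s in 0..Ω.length, (bdryVal (u n k) 0 s - g k s) ^ 2)
    atTop (𝓝 0)

/-- All scaled eigenvalues and traces are treated as one point of a countable product of compact
sets, so a single extraction replaces the diagonal argument. The traces on the outer curve suffice,
since the function differs little from either trace. -/
theorem exists_steklovLimit (hμ : 0 < μ) (hC : 0 < C)
    (hE : ∀ᶠ ε in 𝓝[>] (0 : ℝ), Ω.Coercive μ C ε) (he : Tendsto e atTop (𝓝[>] 0))
    {lam : ℕ → ℕ → ℝ} {u : ∀ n, ℕ → Ω.H2 (e n)}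
    (hco : ∀ n, Ω.Coercive μ C (e n)) (hs : ∀ n, Ω.IsSteklovEigensystem μ (e n) (lam n) (u n)) :
    ∃ φ : ℕ → ℕ, StrictMono φ ∧ ∃ (Λ : ℕ → ℝ) (g : ℕ → ℝ → ℝ),
      SteklovLimit μ C (fun n => e (φ n)) (fun n => lam (φ n)) (fun n => u (φ n)) Λ g := by
  have L := Ω.length_pos
  choose B hB using fun k => exists_eigenvalue_bound (Ω := Ω) hμ hC hE k
  choose R hR using fun k => exists_bdryVal_mem_holderBall (Ω := Ω) hμ hC (B k + 1)
  -- The default point `(0, 0)` stands for those `n` at which the eigenvalue bound is not yet in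
  -- force; for each `k` these are only finitely many.
  set K : ℕ → Set (ℝ × BoundedContinuousFunction (Icc 0 Ω.length) ℝ) := fun k =>
    insert (0, 0) (Icc 0 (B k) ×ˢ Ω.holderBall (R k)) with hK
  have cK : ∀ k, IsCompact (K k) := fun k =>
    (isCompact_Icc.prod (isCompact_holderBall (R k))).insert _
  have ex : ∀ n k, ∃ y ∈ K k, lam n k / e n ≤ B k → y.1 = lam n k / e n ∧
      bdryVal (u n k) 0 =ᵐ[𝓁 (Ioc 0 Ω.length)] Ω.extendPeriod y.2 := fun n k => by
    by_cases hle : lam n k / e n ≤ B k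
    · have h := (hco n).tubular
      obtain ⟨f, hf, ef⟩ := hR k (e n) (hco n) (u n k)
        (by rw [(hs n).scaledEnergy_eq h]; linarith) 0
      exact ⟨(lam n k / e n, f), mem_insert_of_mem _
        ⟨⟨div_nonneg ((hs n).nonneg hμ h k) h.pos.le, hle⟩, hf⟩, fun _ => ⟨rfl, ef⟩⟩
    · exact ⟨(0, 0), mem_insert _ _, fun h => absurd h hle⟩
  choose y hy ey using ex
  obtain ⟨a, ha, φ, hφ, lim⟩ := (isCompact_univ_pi cK).tendsto_subseq (x := y)
    fun n k _ => hy n k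
  have limk : ∀ k, Tendsto (fun n => y (φ n) k) atTop (𝓝 (a k)) := fun k =>
    (tendsto_pi_nhds.1 lim) k
  have ends : ∀ k, (a k).2 Ω.startPt = (a k).2 Ω.endPt := fun k => by
    rcases ha k (mem_univ k) with h | h
    · rw [h]; rfl
    · exact h.2.2.2
  choose g cg pg eg using fun k => exists_periodic_extension (Ω := Ω) (ends k)
  have heφ : Tendsto (fun n => e (φ n)) atTop (𝓝[>] 0) := he.comp hφ.tendsto_atTop
  have ev : ∀ k, ∀ᶠ n in atTop, lam (φ n) k / e (φ n) ≤ B k := fun k => by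
    filter_upwards [heφ.eventually (hB k)] with n hn
    exact hn _ _ (hs (φ n))
  refine ⟨φ, hφ, fun k => (a k).1, g, hμ, hC, hE, heφ, fun n => hco _, fun n => hs _,
    fun k => ?_, cg, pg, fun k => ?_⟩
  · refine ((continuous_fst.tendsto _).comp (limk k)).congr' ?_
    filter_upwards [ev k] with n hn
    exact (ey _ k hn).1
  · have d := (tendsto_iff_dist_tendsto_zero.1 ((continuous_snd.tendsto _).comp (limk k)))
    have d2 := (d.pow 2).const_mul Ω.length
    rw [zero_pow two_ne_zero, mul_zero] at d2
    refine squeeze_zero' (Eventually.of_forall fun n =>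
      iint_nonneg L.le fun s _ => sq_nonneg _) ?_ d2
    filter_upwards [ev k] with n hn
    refine integral_sq_sub_of_extendPeriod (ey _ k hn).2 ?_
    filter_upwards [ae_restrict_mem measurableSet_Ioc] with s hm
    exact eg k s (Ioc_subset_Icc_self hm)

namespace SteklovLimit

variable {lam : ℕ → ℕ → ℝ} {u : ∀ n, ℕ → Ω.H2 (e n)} {Λ : ℕ → ℝ} {g : ℕ → ℝ → ℝ}

theorem tendsto_zero (h : SteklovLimit μ C e lam u Λ g) : Tendsto e atTop (𝓝 0) :=
  h.tendsto.mono_right nhdsWithin_le_nhds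

theorem exists_bound (h : SteklovLimit μ C e lam u Λ g) (k : ℕ) :
    ∃ M, ∀ n, scaledEnergy μ (u n k) ≤ M := by
  obtain ⟨M, hM⟩ := (h.value k).bddAbove_range
  refine ⟨M + 1, fun n => ?_⟩
  rw [(h.eigensystem n).scaledEnergy_eq (h.coercive n).tubular]
  linarith [hM ⟨n, rfl⟩]

theorem memLp_pull (h : SteklovLimit μ C e lam u Λ g) (k n : ℕ) :
    𝓛 (Ω.pull (e n) (u n k).val) Ω.refSet :=
  (h.coercive n).tubular.memLp_comp (u n k).memLp_val

theorem memLp_limit_one (h : SteklovLimit μ C e lam u Λ g) (k : ℕ) :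
    𝓛 (g k) (Ioc 0 Ω.length) := memLp_continuous_one (h.continuous k)

theorem memLp_limit (h : SteklovLimit μ C e lam u Λ g) (k : ℕ) :
    𝓛 (fun p : Plane => g k (p 0)) Ω.refSet :=
  Ω.memLp_fst (h.memLp_limit_one k)

theorem tendsto_mul_bound (h : SteklovLimit μ C e lam u Λ g) (k : ℕ) (D : ℝ) :
    Tendsto (fun n => D * (e n * scaledEnergy μ (u n k))) atTop (𝓝 0) := by
  have : Tendsto (fun n => D * (e n * (lam n k / e n + 1))) atTop (𝓝 (D * (0 * (Λ k + 1)))) :=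
    (h.tendsto_zero.mul ((h.value k).add_const 1)).const_mul D
  rw [zero_mul, mul_zero] at this
  refine this.congr fun n => ?_
  rw [(h.eigensystem n).scaledEnergy_eq (h.coercive n).tubular]

theorem tendsto_sub_bdryVal (h : SteklovLimit μ C e lam u Λ g) (k : ℕ) (j : Fin 2) :
    Tendsto (fun n => ∫ p in Ω.refSet, (Ω.pull (e n) (u n k).val p - bdryVal (u n k) j (p 0)) ^ 2)
      atTop (𝓝 0) :=
  squeeze_zero (fun _ => integral_nonneg fun _ => sq_nonneg _)
    (fun n => (h.coercive n).sub_bdryVal (u n k) j) (h.tendsto_mul_bound k C)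

/-- The function is within `O(εN)` in squared norm of its outer trace, and the outer traces converge
by assumption. -/
theorem tendsto_val (h : SteklovLimit μ C e lam u Λ g) (k : ℕ) :
    Tendsto (fun n => ∫ p in Ω.refSet, (Ω.pull (e n) (u n k).val p - g k (p 0)) ^ 2)
      atTop (𝓝 0) := by
  refine squeeze_zero (fun n => integral_nonneg fun p => sq_nonneg _) (fun n => ?_)
    (by simpa using ((h.tendsto_sub_bdryVal k 0).const_mul 2).add ((h.trace k).const_mul 2))
  have mb := Ω.memLp_fst ((h.coercive n).tubular.memLp_bdryVal (u n k) 0)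
  have := integral_sq_add_le ((h.memLp_pull k n).sub mb) (mb.sub (h.memLp_limit k))
  simp only [Pi.sub_apply, sub_add_sub_cancel] at this
  rwa [Ω.integral_refSet_fst fun s => (bdryVal (u n k) 0 s - g k s) ^ 2] at this

theorem tendsto_trace (h : SteklovLimit μ C e lam u Λ g) (k : ℕ) (j : Fin 2) :
    Tendsto (fun n => ∫ s in 0..Ω.length, (bdryVal (u n k) j s - g k s) ^ 2)
      atTop (𝓝 0) := by
  refine squeeze_zero
    (fun n => iint_nonneg Ω.length_pos.le fun p _ => sq_nonneg _)
    (fun n => ?_)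
    (by simpa using ((h.tendsto_sub_bdryVal k j).const_mul 2).add ((h.tendsto_val k).const_mul 2))
  have mb := Ω.memLp_fst ((h.coercive n).tubular.memLp_bdryVal (u n k) j)
  rw [← Ω.integral_refSet_fst fun s => (bdryVal (u n k) j s - g k s) ^ 2]
  have := integral_sq_sub_le ((h.memLp_pull k n).sub (h.memLp_limit k)) ((h.memLp_pull k n).sub mb)
  simp only [Pi.sub_apply, sub_sub_sub_cancel_left] at this
  linarith

/-- On the inner curve the arclength density `jac` differs from 1 by `O(ε)`; this absorbs the
density into one factor of the boundary form. -/
theorem tendsto_jac_trace (h : SteklovLimit μ C e lam u Λ g) (k : ℕ) :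
    Tendsto (fun n => ∫ s in 0..Ω.length,
      (Ω.jac (e n) !₂[s, 1] * bdryVal (u n k) 1 s - g k s) ^ 2) atTop (𝓝 0) := by
  have L := Ω.length_pos
  obtain ⟨K, hK, hκ⟩ := Ω.exists_curvature_bound
  have lim : Tendsto (fun n => 2 * (e n * K) ^ 2 * (2 * scaledEnergy μ (u n k)) +
      2 * ∫ s in 0..Ω.length, (bdryVal (u n k) 1 s - g k s) ^ 2) atTop (𝓝 0) := by
    have a := (h.tendsto_zero.mul (h.tendsto_mul_bound k (4 * K ^ 2))).add
      ((h.tendsto_trace k 1).const_mul 2)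
    simp only [mul_zero, add_zero] at a
    refine a.congr fun n => ?_
    ring
  refine squeeze_zero (fun n => iint_nonneg L.le fun p _ => sq_nonneg _)
    (fun n => ?_) lim
  have ht := (h.coercive n).tubular
  have mb := ht.memLp_bdryVal (u n k) 1
  have cj : Continuous fun s => Ω.jac (e n) !₂[s, 1] - 1 :=
    (continuous_jac_trace 1).sub continuous_const
  have m1 := memLp_mul_one mb cj
  have := integral_sq_add_le m1 (mb.sub (h.memLp_limit_one k))
  have sm := integral_sq_mono (C := e n * K) mb
    (f := fun s => (Ω.jac (e n) !₂[s, 1] - 1) * bdryVal (u n k) 1 s) (ae_of_all _ fun s => by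
      rw [abs_mul, abs_sub_comm]
      exact mul_le_mul_of_nonneg_right (abs_one_sub_jac_le hκ ht.pos.le (by simp)) (abs_nonneg _))
  have hb := ht.integral_bdryVal_sq h.mu_pos (u n k) 1
  rw [integral_of_le L.le] at hb ⊢
  rw [integral_of_le L.le]
  have eq : ∀ s, Ω.jac (e n) !₂[s, 1] * bdryVal (u n k) 1 s - g k s =
      (Ω.jac (e n) !₂[s, 1] - 1) * bdryVal (u n k) 1 s + (bdryVal (u n k) 1 - g k) s := fun s => by
    simp only [Pi.sub_apply]; ring
  simp only [eq]
  refine this.trans ?_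
  have : (e n * K) ^ 2 * ∫ s in Ioc 0 Ω.length, bdryVal (u n k) 1 s ^ 2 ≤
    (e n * K) ^ 2 * (2 * scaledEnergy μ (u n k)) := by gcongr
  simp only [Pi.sub_apply]
  linarith

/-- Both boundary curves contribute the same limit, which is why the limit measure is `2 ds`. -/
theorem orthonormal (h : SteklovLimit μ C e lam u Λ g) (k l : ℕ) :
    2 * ∫ s in 0..Ω.length, g k s * g l s = if k = l then 1 else 0 := by
  have L := Ω.length_pos
  have mb := fun k n j => (h.coercive n).tubular.memLp_bdryVal (u n k) j
  have mj := fun k n => memLp_mul_one (mb k n 1) (continuous_jac_trace (Ω := Ω) (ε := e n) 1)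
  have t0 := h.tendsto_trace k 0
  have t0' := h.tendsto_trace l 0
  have t1 := h.tendsto_trace k 1
  have t1' := h.tendsto_jac_trace l
  simp only [integral_of_le L.le] at t0 t0' t1 t1' ⊢
  have a := tendsto_integral_mul_l2 (fun n => mb k n 0) (h.memLp_limit_one k) (fun n => mb l n 0)
    (h.memLp_limit_one l) t0 t0'
  have b := tendsto_integral_mul_l2 (fun n => mb k n 1) (h.memLp_limit_one k) (fun n => mj l n)
    (h.memLp_limit_one l) t1 t1'
  have lim := a.add b
  rw [two_mul]
  refine tendsto_nhds_unique (lim.congr fun n => ?_) tendsto_const_nhds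
  rw [← (h.eigensystem n).orthonormal k l, (h.coercive n).tubular.bdryIntegral_eq]
  simp only [integral_of_le L.le]
  congr 2; ext s; ring

/-- The eigenvalue equation, divided by `ε` and tested with lifts of `χ`. Replacing the forms by
their limits costs at most `η(1 + |Λ k|)`, and `η` is arbitrary. -/
theorem weak_solution (h : SteklovLimit μ C e lam u Λ g) (k : ℕ) {χ : ℝ → ℝ}
    (hχ : 𝒞 χ) (pχ : Periodic χ Ω.length) :
    ∫ s in 0..Ω.length, g k s * Ω.limitOp χ s =
      2 * Λ k * ∫ s in 0..Ω.length, g k s * χ s := by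
  obtain ⟨M, hM⟩ := h.exists_bound k
  have l1 : Tendsto (fun n => ∫ p in Ω.refSet, Ω.pull (e n) (u n k).val p * Ω.limitOp χ (p 0)) atTop
      (𝓝 (∫ p in Ω.refSet, g k (p 0) * Ω.limitOp χ (p 0))) :=
    tendsto_integral_mul_of_l2 (h.memLp_pull k) (h.memLp_limit k)
      (Ω.memLp_fst (memLp_continuous_one (contDiff_limitOp hχ).continuous)) (h.tendsto_val k)
  have l2 : Tendsto (fun n => ∫ p in Ω.refSet, Ω.pull (e n) (u n k).val p * χ (p 0)) atTop
      (𝓝 (∫ p in Ω.refSet, g k (p 0) * χ (p 0))) :=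
    tendsto_integral_mul_of_l2 (h.memLp_pull k) (h.memLp_limit k)
      (Ω.memLp_fst (memLp_continuous_one hχ.continuous)) (h.tendsto_val k)
  rw [Ω.integral_refSet_fst fun s => g k s * Ω.limitOp χ s] at l1
  rw [Ω.integral_refSet_fst fun s => g k s * χ s] at l2
  set a := ∫ s in 0..Ω.length, g k s * Ω.limitOp χ s
  set b := ∫ s in 0..Ω.length, g k s * χ s
  have key : ∀ η > 0, |a - Λ k * (2 * b)| ≤ η * (1 + |Λ k|) := fun η hη => by
    have lim := (l1.sub ((h.value k).mul (l2.const_mul 2))).abs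
    refine le_of_tendsto_of_tendsto lim (((h.value k).abs.const_add 1).const_mul η) ?_
    filter_upwards [h.tendsto.eventually (eventually_exists_lifts h.mu_pos h.const_pos
      h.eventually_coercive (fun _ : Unit => hχ) (fun _ => pχ) hη M)] with n ⟨ht, v, _, hv⟩
    obtain ⟨b1, b2⟩ := hv (u n k) (hM n) ()
    rw [(h.eigensystem n).energy_eq ht, mul_div_right_comm] at b2
    set x := lam n k / e n
    set y := ht.bdryForm (u n k) (v ())
    set p := ∫ p in Ω.refSet, Ω.pull (e n) (u n k).val p * Ω.limitOp χ (p 0)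
    set q := 2 * ∫ p in Ω.refSet, Ω.pull (e n) (u n k).val p * χ (p 0)
    have : p - x * q = -(x * y - p) + x * (y - q) := by ring
    rw [this]
    refine (abs_add_le _ _).trans ?_
    rw [abs_neg, abs_mul]
    have := mul_le_mul_of_nonneg_left b1 (abs_nonneg x)
    linarith
  have : |a - Λ k * (2 * b)| ≤ 0 := by
    refine le_of_forall_pos_le_add fun δ hδ => ?_
    have := key (δ / (1 + |Λ k|)) (by positivity)
    rw [div_mul_cancel₀ _ (by positivity)] at this
    linarith
  have := abs_nonpos_iff.1 this
  linarith

theorem contDiff (h : SteklovLimit μ C e lam u Λ g) (k : ℕ) : 𝒞 (g k) :=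
  contDiff_of_weak_solution (h.continuous k) (h.periodic k) fun _ hχ pχ => h.weak_solution k hχ pχ

theorem limitOp_eq (h : SteklovLimit μ C e lam u Λ g) (k : ℕ) (s : ℝ) :
    Ω.limitOp (g k) s = 2 * Λ k * g k s :=
  limitOp_eq_of_weak_solution (h.contDiff k) (h.periodic k)
    (fun _ hχ pχ => h.weak_solution k hχ pχ) s

theorem monotone (h : SteklovLimit μ C e lam u Λ g) : Monotone Λ := fun k l hkl =>
  le_of_tendsto_of_tendsto (h.value k) (h.value l) (Eventually.of_forall fun n =>
    div_le_div_of_nonneg_right ((h.eigensystem n).monotone hkl) (h.coercive n).tubular.pos.le)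

theorem nonneg (h : SteklovLimit μ C e lam u Λ g) (k : ℕ) : 0 ≤ Λ k :=
  ge_of_tendsto (h.value k) (Eventually.of_forall fun n => div_nonneg
    ((h.eigensystem n).nonneg h.mu_pos (h.coercive n).tubular k) (h.coercive n).tubular.pos.le)

end SteklovLimit

end SmoothDomain

/-! ### Variational inequality for the limit and growth of its eigenvalues -/

/-- The residual of an orthonormal expansion in eigenvectors. -/
theorem exists_residual {V : Type*} [AddCommGroup V] [Module ℝ V] {a b : V →ₗ[ℝ] V →ₗ[ℝ] ℝ}
    (sa : ∀ u v, a u v = a v u) (sb : ∀ u v, b u v = b v u) {lam : ℕ → ℝ} {u : ℕ → V}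
    (hu : ∀ k v, a (u k) v = lam k * b (u k) v) (ho : ∀ k l, b (u k) (u l) = if k = l then 1 else 0)
    (k : ℕ) (v : V) : ∃ z, (∀ j < k, b z (u j) = 0) ∧
      b z z = b v v - ∑ j ∈ Finset.range k, b (u j) v ^ 2 ∧
      a z z = a v v - ∑ j ∈ Finset.range k, lam j * b (u j) v ^ 2 := by
  set z := v - ∑ j ∈ Finset.range k, b (u j) v • u j with hz
  have orth : ∀ j < k, b z (u j) = 0 := fun j hj => by
    rw [hz]
    simp only [map_sub, map_sum, map_smul, LinearMap.sub_apply, LinearMap.sum_apply,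
      LinearMap.smul_apply, smul_eq_mul, ho, mul_ite, mul_one, mul_zero]
    rw [Finset.sum_ite_eq' (Finset.range k) j, if_pos (Finset.mem_range.2 hj), sb v]
    ring
  have step : ∀ q : V →ₗ[ℝ] V →ₗ[ℝ] ℝ, (∀ j < k, q z (u j) = 0) →
      q z z = q v v - ∑ j ∈ Finset.range k, b (u j) v * q (u j) v := fun q hq => by
    have e1 : q z z = q z v := by
      have e0 : q z (∑ j ∈ Finset.range k, b (u j) v • u j) = 0 := by
        rw [map_sum]
        exact Finset.sum_eq_zero fun j hj => by
          rw [map_smul, hq j (Finset.mem_range.1 hj), smul_zero]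
      have e2 : v = z + ∑ j ∈ Finset.range k, b (u j) v • u j := by rw [hz]; abel
      have e3 := congrArg (q z) e2
      rw [map_add, e0, add_zero] at e3
      exact e3.symm
    rw [e1, hz]
    simp only [map_sub, map_sum, map_smul, LinearMap.sub_apply, LinearMap.sum_apply,
      LinearMap.smul_apply, smul_eq_mul]
  refine ⟨z, orth, ?_, ?_⟩
  · rw [step b orth]
    simp only [sq]
  · rw [step a fun j hj => by rw [sa, hu, sb, orth j hj, mul_zero]]
    congr 1
    refine Finset.sum_congr rfl fun j _ => ?_
    rw [hu]; ring

namespace SmoothDomain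

variable {Ω : SmoothDomain} {μ C : ℝ} {e : ℕ → ℝ}

namespace SteklovLimit

variable {lam : ℕ → ℕ → ℝ} {u : ∀ n, ℕ → Ω.H2 (e n)} {Λ : ℕ → ℝ} {g : ℕ → ℝ → ℝ}

/-- The lift of `χ` minus its projections on the first `k` eigenfunctions is admissible in the
variational principle at fixed `ε`. Dropping the nonnegative energy of the projections leaves
quantities that all converge. This inequality is the source of completeness. -/
theorem variational (h : SteklovLimit μ C e lam u Λ g) (k : ℕ) {χ : ℝ → ℝ}
    (hχ : 𝒞 χ) (pχ : Periodic χ Ω.length) :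
    Λ k * ((2 * ∫ s in 0..Ω.length, χ s * χ s) -
      ∑ j ∈ Finset.range k, (2 * ∫ s in 0..Ω.length, g j s * χ s) ^ 2) ≤
      ∫ s in 0..Ω.length, χ s * Ω.limitOp χ s := by
  choose M hM using fun j => h.exists_bound j
  set M' := ∑ j ∈ Finset.range k, |M j| with hM'
  have MM : ∀ j < k, ∀ n, scaledEnergy μ (u n j) ≤ M' := fun j hj n =>
    ((hM j n).trans (le_abs_self _)).trans (Finset.single_le_sum (f := fun j => |M j|)
      (fun j _ => abs_nonneg _) (Finset.mem_range.2 hj))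
  set β : ℕ → ℝ := fun j => 2 * ∫ s in 0..Ω.length, g j s * χ s with hβ
  set b := 2 * ∫ s in 0..Ω.length, χ s * χ s
  set a := ∫ s in 0..Ω.length, χ s * Ω.limitOp χ s
  have lim : ∀ j, Tendsto (fun n => 2 * ∫ p in Ω.refSet, Ω.pull (e n) (u n j).val p * χ (p 0)) atTop
      (𝓝 (β j)) := fun j => by
    have := tendsto_integral_mul_of_l2 (h.memLp_pull j) (h.memLp_limit j)
      (Ω.memLp_fst (memLp_continuous_one hχ.continuous)) (h.tendsto_val j)
    rw [Ω.integral_refSet_fst fun s => g j s * χ s] at this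
    exact this.const_mul 2
  -- In `2η` one `η` is the error of the lifted pairing and the other the distance of that pairing
  -- from its limit.
  have key : ∀ η > 0, Λ k * (b - η - ∑ j ∈ Finset.range k, (|β j| + 2 * η) ^ 2) ≤ a + η :=
    fun η hη => by
      refine le_of_tendsto ((h.value k).mul_const _) ?_
      have near : ∀ᶠ n in atTop, ∀ j ∈ Finset.range k,
          |2 * (∫ p in Ω.refSet, Ω.pull (e n) (u n j).val p * χ (p 0)) - β j| < η := by
        refine (Finset.eventually_all _).2 fun j _ => ?_
        simpa only [Real.dist_eq] using Metric.tendsto_nhds.1 (lim j) η hη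
      filter_upwards [near, h.tendsto.eventually (eventually_exists_lifts h.mu_pos h.const_pos
        h.eventually_coercive (fun _ : Unit => hχ) (fun _ => pχ) hη M')] with n hn ⟨ht, v, hv, hu⟩
      have e0 := ht.pos
      have hs := h.eigensystem n
      obtain ⟨z, oz, bz, az⟩ := exists_residual (ht.energy_symm μ) ht.bdryForm_symm
        (hs.energy_eq ht) (hs.bdryForm_eq ht) k (v ())
      have var := hs.variational h.mu_pos h.const_pos (h.coercive n) oz
      have l0 := fun j => hs.nonneg h.mu_pos ht j
      have bz' : (h.coercive n).tubular.bdryForm z z = _ := bz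
      have az' : (h.coercive n).tubular.energy μ z z = _ := az
      rw [bz', az'] at var
      have pos : 0 ≤ ∑ j ∈ Finset.range k, lam n j * ht.bdryForm (u n j) (v ()) ^ 2 :=
        Finset.sum_nonneg fun j _ => mul_nonneg (l0 j) (sq_nonneg _)
      have sum : ∑ j ∈ Finset.range k, ht.bdryForm (u n j) (v ()) ^ 2 ≤
          ∑ j ∈ Finset.range k, (|β j| + 2 * η) ^ 2 := by
        refine Finset.sum_le_sum fun j hj => ?_
        have h1 := (hu (u n j) (MM j (Finset.mem_range.1 hj) n) ()).1
        have h2 := (hn j hj).le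
        rw [← sq_abs]
        have h3 : |ht.bdryForm (u n j) (v ())| ≤ |β j| + 2 * η := by
          have := abs_add_three (ht.bdryForm (u n j) (v ()) -
            2 * ∫ p in Ω.refSet, Ω.pull (e n) (u n j).val p * χ (p 0))
            (2 * (∫ p in Ω.refSet, Ω.pull (e n) (u n j).val p * χ (p 0)) - β j) (β j)
          have eq : ht.bdryForm (u n j) (v ()) -
            2 * (∫ p in Ω.refSet, Ω.pull (e n) (u n j).val p * χ (p 0)) +
            (2 * (∫ p in Ω.refSet, Ω.pull (e n) (u n j).val p * χ (p 0)) - β j) + β j =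
              ht.bdryForm (u n j) (v ()) := by ring
          rw [eq] at this
          linarith
        gcongr
      obtain ⟨q1, q2⟩ := hv () ()
      have q1' := (abs_le.1 q1).1
      have q2' := (abs_le.1 q2).2
      have x0 : 0 ≤ lam n k / e n := div_nonneg (l0 k) e0.le
      calc lam n k / e n * (b - η - ∑ j ∈ Finset.range k, (|β j| + 2 * η) ^ 2) ≤
            lam n k / e n * (ht.bdryForm (v ()) (v ()) -
              ∑ j ∈ Finset.range k, ht.bdryForm (u n j) (v ()) ^ 2) := by
            gcongr
            linarith
        _ ≤ (ht.energy μ (v ()) (v ())) / e n := by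
            rw [div_mul_eq_mul_div]
            refine div_le_div_of_nonneg_right ?_ e0.le
            linarith
        _ ≤ a + η := by linarith
  have cl : Continuous fun η : ℝ => Λ k * (b - η - ∑ j ∈ Finset.range k, (|β j| + 2 * η) ^ 2) := by
    fun_prop
  have cr : Continuous fun η : ℝ => a + η := by fun_prop
  have := le_of_tendsto_of_tendsto ((cl.tendsto 0).mono_left nhdsWithin_le_nhds)
    ((cr.tendsto 0).mono_left nhdsWithin_le_nhds)
    (eventually_mem_nhdsWithin.mono fun η hη => key η hη : ∀ᶠ η in 𝓝[>] (0 : ℝ), _)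
  simpa only [mul_zero, add_zero, sub_zero, sq_abs] using this

/-- The quadratic form of the limit problem equals `Λ k` at `g k`, by the normalization in `2 ds`,
and its curvature term is nonnegative. -/
theorem integral_deriv_deriv_sq_le (h : SteklovLimit μ C e lam u Λ g) (k : ℕ) :
    ∫ s in 0..Ω.length, deriv (deriv (g k)) s ^ 2 ≤ Λ k := by
  have L := Ω.length_pos
  have e1 := integral_mul_limitOp (Ω := Ω) (h.contDiff k) (h.contDiff k) (h.periodic k) (h.periodic k)
  simp only [h.limitOp_eq] at e1
  have e2 : ∫ s in 0..Ω.length, g k s * (2 * Λ k * g k s) = Λ k := by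
    have := h.orthonormal k k
    rw [if_pos rfl] at this
    calc _ = ∫ s in 0..Ω.length, Λ k * 2 * (g k s * g k s) := by congr 1; ext s; ring
      _ = Λ k * (2 * ∫ s in 0..Ω.length, g k s * g k s) := by
        rw [iint_const_mul]; ring
      _ = _ := by rw [this, mul_one]
  rw [← e2, e1]
  have c1 := (contDiff_infty_deriv (h.contDiff k)).continuous
  have c2 := (contDiff_infty_deriv (contDiff_infty_deriv (h.contDiff k))).continuous
  have cκ := Ω.contDiff_curvature.continuous
  refine iint_mono_on L.le intervalIntegrable_cont
    intervalIntegrable_cont fun s _ => ?_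
  nlinarith [sq_nonneg (Ω.curvature s * deriv (g k) s)]

theorem integral_deriv_sq_le (h : SteklovLimit μ C e lam u Λ g) (k : ℕ) :
    ∫ s in 0..Ω.length, deriv (g k) s ^ 2 ≤ 1 + Λ k := by
  have L := Ω.length_pos
  have s1 := contDiff_infty_deriv (h.contDiff k)
  have c0 := (h.contDiff k).continuous
  have c1 := s1.continuous
  have c2 := (contDiff_infty_deriv s1).continuous
  have ip := integral_mul_deriv_smooth (Ω := Ω) (h.contDiff k) s1 (h.periodic k)
    (h.periodic k).deriv_periodic
  have e2 := h.orthonormal k k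
  rw [if_pos rfl] at e2
  have le : -∫ s in 0..Ω.length, g k s * deriv (deriv (g k)) s ≤
      ∫ s in 0..Ω.length, (g k s * g k s + deriv (deriv (g k)) s ^ 2) := by
    rw [← iint_neg]
    refine iint_mono_on L.le intervalIntegrable_cont
      intervalIntegrable_cont fun s _ => ?_
    nlinarith [sq_nonneg (g k s + deriv (deriv (g k)) s), sq_nonneg (g k s),
      sq_nonneg (deriv (deriv (g k)) s)]
  rw [iint_add intervalIntegrable_cont
    intervalIntegrable_cont] at le
  have := h.integral_deriv_deriv_sq_le k
  simp only [sq] at this le ⊢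
  linarith

/-- Bounded eigenvalues would bound the `g k` in `H¹` and make a subsequence uniformly Cauchy.
Distinct `g k` have squared distance 1 in `ds`, a contradiction. -/
theorem tendsto_atTop (h : SteklovLimit μ C e lam u Λ g) : Tendsto Λ atTop atTop := by
  have L := Ω.length_pos
  rcases tendsto_atTop_of_monotone h.monotone with ht | ⟨l, hl⟩
  · exact ht
  exfalso
  have bd := fun k => h.monotone.ge_of_tendsto hl k
  obtain ⟨R, hR⟩ := exists_mem_holderBall (Ω := Ω) (1 + l)
  have l0 : 0 ≤ l := (h.nonneg 0).trans (bd 0)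
  have ex : ∀ k, ∃ f ∈ Ω.holderBall R, g k =ᵐ[𝓁 (Ioc 0 Ω.length)]
      Ω.extendPeriod f := fun k => by
    have s1 := contDiff_infty_deriv (h.contDiff k)
    refine hR (g k) (deriv (g k)) (h.memLp_limit_one k) (memLp_continuous_one s1.continuous)
      (fun χ hχ pχ => ?_) ?_ ((h.integral_deriv_sq_le k).trans (by linarith [bd k]))
    · have c0 := h.continuous k
      have c1 := s1.continuous
      have d0 := hχ.continuous
      have d1 := (contDiff_infty_deriv hχ).continuous
      rw [iint_add intervalIntegrable_cont
        intervalIntegrable_cont,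
        integral_mul_deriv_smooth (Ω := Ω) (h.contDiff k) hχ (h.periodic k) pχ]
      ring
    · have := h.orthonormal k k
      rw [if_pos rfl] at this
      simp only [sq]
      linarith
  choose f hf ef using ex
  obtain ⟨F, -, φ, hφ, lim⟩ := (isCompact_holderBall R).tendsto_subseq hf
  obtain ⟨N, hN⟩ := Metric.cauchySeq_iff.1 lim.cauchySeq (√(1 / (2 * Ω.length)))
    (Real.sqrt_pos.2 (by positivity))
  have hd := (hN N le_rfl (N + 1) (Nat.le_succ N)).le
  have ne : φ N ≠ φ (N + 1) := (hφ (Nat.lt_succ_self N)).ne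
  have le := integral_sq_sub_of_extendPeriod (ef (φ N)) (ef (φ (N + 1)))
  have one : ∫ s in 0..Ω.length, (g (φ N) s - g (φ (N + 1)) s) ^ 2 = 1 := by
    have c0 := h.continuous (φ N)
    have c1 := h.continuous (φ (N + 1))
    have o1 := h.orthonormal (φ N) (φ N)
    have o2 := h.orthonormal (φ (N + 1)) (φ (N + 1))
    have o3 := h.orthonormal (φ N) (φ (N + 1))
    rw [if_pos rfl] at o1 o2
    rw [if_neg ne] at o3
    have : ∫ s in 0..Ω.length, (g (φ N) s - g (φ (N + 1)) s) ^ 2 =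
        (∫ s in 0..Ω.length, g (φ N) s * g (φ N) s) -
        2 * (∫ s in 0..Ω.length, g (φ N) s * g (φ (N + 1)) s) +
        ∫ s in 0..Ω.length, g (φ (N + 1)) s * g (φ (N + 1)) s := by
      rw [← iint_const_mul, ← iint_sub
        intervalIntegrable_cont
        intervalIntegrable_cont, ← iint_add
        intervalIntegrable_cont
        intervalIntegrable_cont]
      congr 1; ext s; ring
    rw [this]; linarith
  have : Ω.length * dist (f (φ N)) (f (φ (N + 1))) ^ 2 ≤ Ω.length * √(1 / (2 * Ω.length)) ^ 2 := by
    simp only [Function.comp_apply] at hd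
    gcongr
  rw [Real.sq_sqrt (by positivity)] at this
  have h2 : Ω.length * (1 / (2 * Ω.length)) = 1 / 2 := by field_simp
  linarith

theorem isLimitSolution (h : SteklovLimit μ C e lam u Λ g) (k : ℕ) :
    Ω.IsLimitSolution (Λ k) (g k) := by
  refine ⟨contDiff_infty.1 (h.contDiff k) 4, fun s _ => ?_, fun i hi => ?_⟩
  · rw [← h.limitOp_eq k s, limitOp]
    simp only [iteratedDeriv_succ, iteratedDeriv_zero]
  · have p0 := h.periodic k
    have p1 := p0.deriv_periodic
    have p2 := p1.deriv_periodic
    have p3 := p2.deriv_periodic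
    interval_cases i <;> simp only [iteratedDeriv_succ, iteratedDeriv_zero]
    · simpa using (p0 0).symm
    · simpa using (p1 0).symm
    · simpa using (p2 0).symm
    · simpa using (p3 0).symm

end SteklovLimit

end SmoothDomain

/-! ### Completeness of the limit eigenfunctions -/

namespace SmoothDomain

variable (Ω : SmoothDomain) in
theorem memLp_limitMeasure {f : ℝ → ℝ} (hf : 𝓛 f (Ioc 0 Ω.length)) :
    MemLp f 2 Ω.limitMeasure := (Ω.memLp_Ioc.1 hf).smul_measure (by simp)

variable {Ω : SmoothDomain} {μ C : ℝ} {e : ℕ → ℝ}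

theorem inner_limitMeasure {f h : ℝ → ℝ} {x y : Lp ℝ 2 Ω.limitMeasure}
    (hx : x =ᵐ[Ω.limitMeasure] f) (hy : y =ᵐ[Ω.limitMeasure] h) :
    inner ℝ x y = 2 * ∫ s in 0..Ω.length, f s * h s := by
  rw [L2.inner_def, ← Ω.integral_Ioo fun s => f s * h s]
  have : ∫ s, f s * h s ∂Ω.limitMeasure = 2 * ∫ s in Ioo 0 Ω.length, f s * h s := by
    rw [limitMeasure, integral_smul_measure]
    simp
  rw [← this]
  refine integral_congr_ae ?_
  filter_upwards [hx, hy] with s h1 h2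
  rw [h1, h2]
  simp [mul_comm]

namespace SteklovLimit

variable {lam : ℕ → ℕ → ℝ} {u : ∀ n, ℕ → Ω.H2 (e n)} {Λ : ℕ → ℝ} {g : ℕ → ℝ → ℝ}

/-- Since `x - s f` has the same coefficients as `x`, Bessel's inequality for it bounds the sum of
squares in the variational inequality. Thus `Λ k (‖x‖² - ‖x - s f‖²)` is bounded in `k`, and `Λ k →
∞` gives `‖x‖ ≤ ‖x - s f‖` for every `s`, which means orthogonality. No density of the domain of the
form is needed here. -/
theorem inner_eq_zero_of_orthogonal (h : SteklovLimit μ C e lam u Λ g)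
    {v : ℕ → Lp ℝ 2 Ω.limitMeasure} (hv : ∀ k, v k =ᵐ[Ω.limitMeasure] g k) (ov : Orthonormal ℝ v)
    {f : Lp ℝ 2 Ω.limitMeasure} (hf : ∀ k, inner ℝ (v k) f = 0) {χ : ℝ → ℝ} (hχ : 𝒞 χ)
    (pχ : Periodic χ Ω.length) {x : Lp ℝ 2 Ω.limitMeasure}
    (hx : x =ᵐ[Ω.limitMeasure] χ) : inner ℝ f x = 0 := by
  have key : ∀ s : ℝ, ‖x‖ ^ 2 ≤ ‖x - s • f‖ ^ 2 := fun s => by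
    have le : ∀ k, Λ k * (‖x‖ ^ 2 - ‖x - s • f‖ ^ 2) ≤
        ∫ s in 0..Ω.length, χ s * Ω.limitOp χ s := fun k => by
      refine le_trans ?_ (h.variational k hχ pχ)
      refine mul_le_mul_of_nonneg_left ?_ (h.nonneg k)
      have bes := ov.sum_inner_products_le (x - s • f) (s := Finset.range k)
      have e1 : ∀ j, ‖inner ℝ (v j) (x - s • f)‖ ^ 2 =
          (2 * ∫ s in 0..Ω.length, g j s * χ s) ^ 2 := fun j => by
        rw [inner_sub_right, inner_smul_right, hf, mul_zero, sub_zero,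
          inner_limitMeasure (hv j) hx, Real.norm_eq_abs, sq_abs]
      simp only [e1] at bes
      rw [← inner_limitMeasure hx hx, real_inner_self_eq_norm_sq]
      linarith
    by_contra! hlt
    have pos : 0 < ‖x‖ ^ 2 - ‖x - s • f‖ ^ 2 := by linarith
    obtain ⟨k, hk⟩ := ((h.tendsto_atTop.atTop_mul_const pos).eventually_gt_atTop
      (∫ s in 0..Ω.length, χ s * Ω.limitOp χ s)).exists
    exact absurd (le k) (not_le.2 hk)
  set c : ℝ := inner ℝ f x with hc
  set m := ‖f‖ ^ 2 with hm
  have m0 : 0 ≤ m := sq_nonneg _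
  -- The denominator `m + 1` in place of `‖f‖²` avoids the case `f = 0`.
  have h1 := key (c / (m + 1))
  rw [norm_sub_sq_real, inner_smul_right, real_inner_comm, ← hc, norm_smul, mul_pow,
    Real.norm_eq_abs, sq_abs, ← hm] at h1
  have h2 : 2 * (c / (m + 1) * c) ≤ (c / (m + 1)) ^ 2 * m := by linarith
  have h3 : (c / (m + 1)) ^ 2 * (m + 2) ≤ 0 := by
    have : c / (m + 1) * c = (c / (m + 1)) ^ 2 * (m + 1) := by field_simp
    rw [this] at h2
    linarith
  have h4 : (c / (m + 1)) ^ 2 ≤ 0 := by nlinarith [sq_nonneg (c / (m + 1))]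
  have h5 : c / (m + 1) = 0 := by nlinarith [sq_nonneg (c / (m + 1))]
  have h6 : m + 1 ≠ 0 := by linarith
  simpa [h6] using h5

theorem isLimitEigenbasis (h : SteklovLimit μ C e lam u Λ g) : Ω.IsLimitEigenbasis Λ g := by
  refine ⟨h.monotone, h.isLimitSolution, ?_⟩
  have mg := fun k => Ω.memLp_limitMeasure (h.memLp_limit_one k)
  set v : ℕ → Lp ℝ 2 Ω.limitMeasure := fun k => (mg k).toLp (g k) with hv
  have ev : ∀ k, v k =ᵐ[Ω.limitMeasure] g k := fun k => (mg k).coeFn_toLp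
  have ov : Orthonormal ℝ v := orthonormal_iff_ite.2 fun i j => by
    rw [inner_limitMeasure (ev i) (ev j), h.orthonormal]
  have bot : (Submodule.span ℝ (range v))ᗮ = ⊥ := by
    refine (Submodule.eq_bot_iff _).2 fun f hf => ?_
    have of : ∀ k, inner ℝ (v k) f = 0 := fun k =>
      (Submodule.mem_orthogonal _ _).1 hf _ (Submodule.subset_span (mem_range_self k))
    have mf : 𝓛 f (Ioc 0 Ω.length) := by
      have : MemLp f 2 ((2 : ℝ≥0∞) • 𝓁 (Ioo 0 Ω.length)) := Lp.memLp f
      exact Ω.memLp_Ioc.2 (this.of_measure_le_smul (c := 1) (by simp) (by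
        rw [one_smul]
        exact fun s => by
          rw [Measure.smul_apply, smul_eq_mul]
          exact le_mul_of_one_le_left' (by norm_num)))
    have z := ae_eq_zero_of_periodic (Ω := Ω) mf fun χ hχ pχ => by
      have mχ := Ω.memLp_limitMeasure (memLp_continuous_one hχ.continuous)
      have i0 := h.inner_eq_zero_of_orthogonal ev ov of hχ pχ mχ.coeFn_toLp
      rw [inner_limitMeasure (EventuallyEq.refl _ _) mχ.coeFn_toLp] at i0
      linarith
    refine (Lp.eq_zero_iff_ae_eq_zero).2 ?_
    rw [Measure.restrict_congr_set Ioo_ae_eq_Ioc.symm] at z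
    exact (Measure.ae_smul_measure_le (μ := 𝓁 (Ioo 0 Ω.length)) (2 : ℝ≥0∞)) z
  refine ⟨HilbertBasis.mkOfOrthogonalEqBot ov bot, fun k => ?_⟩
  rw [HilbertBasis.coe_mkOfOrthogonalEqBot]
  exact ev k

end SteklovLimit

end SmoothDomain

/-! ### Weak convergence in `L²` and in `H²` of the strip -/

/-- A sequence bounded in `L²`. -/
structure L2Bounded {α : Type*} [MeasurableSpace α] (ν : Measure α) (f : ℕ → α → ℝ) : Prop where
  memLp : ∀ n, MemLp (f n) 2 ν
  bound : ∃ M, ∀ n, ∫ x, f n x ^ 2 ∂ν ≤ M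

/-- Weak convergence in `L²`, tested with square integrable functions. -/
def TendstoWeaklyL2 {α : Type*} [MeasurableSpace α] (ν : Measure α) (f : ℕ → α → ℝ) (g : α → ℝ) :
    Prop :=
  ∀ z, MemLp z 2 ν → Tendsto (fun n => ∫ x, f n x * z x ∂ν) atTop (𝓝 (∫ x, g x * z x ∂ν))

theorem L2Bounded.add {α : Type*} [MeasurableSpace α] {ν : Measure α} {f h : ℕ → α → ℝ}
    (hf : L2Bounded ν f) (hh : L2Bounded ν h) : L2Bounded ν fun n x => f n x + h n x := by
  obtain ⟨M, hM⟩ := hf.bound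
  obtain ⟨N, hN⟩ := hh.bound
  exact ⟨fun n => (hf.memLp n).add (hh.memLp n), 2 * M + 2 * N, fun n => by
    have := integral_sq_add_le (hf.memLp n) (hh.memLp n)
    linarith [hM n, hN n]⟩

/-- Bounded sequences need to be tested only on a dense set; the approximation error is uniform in
`n`. -/
theorem L2Bounded.tendstoWeaklyL2 {U : Set Plane} (hU : IsOpen U) {f : ℕ → Plane → ℝ}
    {g : Plane → ℝ} (hf : L2Bounded (𝓁 U) f) (hg : 𝓛 g U)
    (ht : ∀ ψ, IsTest U ψ → Tendsto (fun n => ∫ x in U, f n x * ψ x) atTop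
      (𝓝 (∫ x in U, g x * ψ x))) : TendstoWeaklyL2 (𝓁 U) f g := by
  intro z hz
  obtain ⟨M, hM⟩ := hf.bound
  have M0 : 0 ≤ M := (integral_nonneg fun x => sq_nonneg _).trans (hM 0)
  set G := ∫ x in U, g x ^ 2 with hG
  have G0 : 0 ≤ G := integral_nonneg fun x => sq_nonneg _
  refine Metric.tendsto_nhds.2 fun δ hδ => ?_
  obtain ⟨ψ, hψ, near⟩ := exists_isTest_near hU hz
    (δ := (δ / 4) ^ 2 / (M + G + 1)) (by positivity)
  have mψ := hψ.memLp (𝓁 U)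
  have diff : ∀ F : Plane → ℝ, 𝓛 F U → (∫ x in U, F x ^ 2) ≤ M + G + 1 →
      |(∫ x in U, F x * z x) - ∫ x in U, F x * ψ x| ≤ δ / 4 := fun F hF hle => by
    rw [← integral_sub (integrable_mul_of_memLp hF hz) (integrable_mul_of_memLp hF mψ)]
    refine abs_le_of_sq_le_sq ?_ (by positivity)
    have := integral_mul_sq_le hF (hz.sub mψ)
    simp only [Pi.sub_apply, mul_sub] at this
    refine this.trans ?_
    calc _ ≤ (M + G + 1) * ((δ / 4) ^ 2 / (M + G + 1)) :=
          mul_le_mul hle near (integral_nonneg fun x => sq_nonneg _) (by positivity)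
      _ = _ := by field_simp
  filter_upwards [Metric.tendsto_nhds.1 (ht ψ hψ) (δ / 4) (by positivity)] with n hn
  rw [Real.dist_eq] at hn ⊢
  have h1 := diff (f n) (hf.memLp n) (by linarith [hM n])
  have h2 := diff g hg (by linarith)
  rw [abs_le] at h1 h2
  rw [abs_lt] at hn ⊢
  constructor <;> linarith [h1.1, h1.2, h2.1, h2.2, hn.1, hn.2]

/-- A derivative is moved to the test function, where weak convergence of the functions applies.
Boundedness of the derivatives then extends the convergence to all square integrable tests. -/
theorem TendstoWeaklyL2.weakPartial {U : Set Plane} (hU : IsOpen U) {i : Fin 2}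
    {f f' : ℕ → Plane → ℝ} {g g' : Plane → ℝ} (h : TendstoWeaklyL2 (𝓁 U) f g)
    (hf : L2Bounded (𝓁 U) f') (hg : 𝓛 g' U)
    (wf : ∀ n, IsWeakPartial U i (f n) (f' n)) (wg : IsWeakPartial U i g g') :
    TendstoWeaklyL2 (𝓁 U) f' g' :=
  hf.tendstoWeaklyL2 hU hg fun ψ hψ => by
    have e : ∀ {a b : Plane → ℝ}, IsWeakPartial U i a b →
        ∫ x in U, b x * ψ x = -∫ x in U, a x * 𝒟 i ψ x := fun hw => by
      rw [hw ψ hψ.smooth hψ.compact hψ.subset, neg_neg]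
    simp only [e wg, fun n => e (wf n)]
    exact (h _ ((hψ.partialDeriv i).memLp _)).neg

theorem SobolevH2.innerH2_eq {U : Set Plane} (f z : SobolevH2 U) :
    f.innerH2 z = (∫ x in U, f.val x * z.val x) + (∑ i, ∫ x in U, f.grad i x * z.grad i x) +
      ∑ i, ∑ j, ∫ x in U, f.hess i j x * z.hess i j x := by
  rw [innerH2, hessForm, integral_finsetSum _ fun i _ =>
    integrable_mul_of_memLp (f.memLp_grad i) (z.memLp_grad i),
    integral_finsetSum _ fun i _ => integrable_finsetSum _ fun j _ => f.hessForm_integrable z i j]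
  simp only [integral_finsetSum _ fun j _ => f.hessForm_integrable z _ j]

theorem SobolevH2.tendsto_innerH2 {U : Set Plane} (hU : IsOpen U) {F : ℕ → SobolevH2 U}
    {G : SobolevH2 U} (h0 : TendstoWeaklyL2 (𝓁 U) (fun n => (F n).val) G.val)
    (h1 : ∀ i, L2Bounded (𝓁 U) fun n => (F n).grad i)
    (h2 : ∀ i j, L2Bounded (𝓁 U) fun n => (F n).hess i j) (z : SobolevH2 U) :
    Tendsto (fun n => (F n).innerH2 z) atTop (𝓝 (G.innerH2 z)) := by
  have g1 := fun i => h0.weakPartial hU (h1 i) (G.memLp_grad i) (fun n => (F n).weak_grad i)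
    (G.weak_grad i)
  have g2 := fun i j => (g1 i).weakPartial hU (h2 i j) (G.memLp_hess i j)
    (fun n => (F n).weak_hess i j) (G.weak_hess i j)
  simp only [innerH2_eq]
  exact ((h0 _ z.memLp_val).add (tendsto_finsetSum _ fun i _ => g1 i _ (z.memLp_grad i))).add
    (tendsto_finsetSum _ fun i _ => tendsto_finsetSum _ fun j _ => g2 i j _ (z.memLp_hess i j))

namespace SmoothDomain

variable {Ω : SmoothDomain} {μ C ε : ℝ} {e : ℕ → ℝ}

theorem L2Bounded.mul {f : ℕ → Plane → ℝ} (hf : L2Bounded (𝓁 Ω.refSet) f)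
    {c : ℕ → Plane → ℝ} (hc : ∀ n, Continuous (c n)) {K : ℝ}
    (hK : ∀ n, ∀ p ∈ Ω.refSet, |c n p| ≤ K) :
    L2Bounded (𝓁 Ω.refSet) fun n p => c n p * f n p := by
  obtain ⟨M, hM⟩ := hf.bound
  refine ⟨fun n => Ω.memLp_mul (hc n) (hf.memLp n), K ^ 2 * M, fun n => ?_⟩
  refine (integral_sq_mono (C := K) (hf.memLp n) (Ω.ae_refSet fun p hp => ?_)).trans
    (mul_le_mul_of_nonneg_left (hM n) (sq_nonneg K))
  rw [abs_mul]
  exact mul_le_mul_of_nonneg_right (hK n p hp) (abs_nonneg _)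

/-- A smooth function on the plane as an element of `H²(Σ)`. -/
def refOfSmooth (f : Plane → ℝ) (hf : 𝒞 f) : SobolevH2 Ω.refSet where
  val := f
  grad i := 𝒟 i f
  hess i j := 𝒟 j (𝒟 i f)
  memLp_val := Ω.memLp_continuous hf.continuous
  memLp_grad i := Ω.memLp_continuous (partialDeriv_contDiff hf i).continuous
  memLp_hess i j :=
    Ω.memLp_continuous (partialDeriv_contDiff (partialDeriv_contDiff hf i) j).continuous
  weak_grad := isWeakPartial_of_contDiff hf
  weak_hess i := isWeakPartial_of_contDiff (partialDeriv_contDiff hf i)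

/-- A function on `ω_ε`, in Fermi coordinates, as an element of `H²(Σ)`. -/
def Tubular.pullH2 (h : Ω.Tubular ε) (u : Ω.H2 ε) : SobolevH2 Ω.refSet where
  val := Ω.pull ε u.val
  grad := ![fun p => Ω.jac ε p * gradTan u p, fun p => -(ε * gradNor u p)]
  hess := ![![fun p => -(ε * p 1 * deriv Ω.curvature (p 0)) * gradTan u p +
      Ω.jac ε p * (Ω.jac ε p * hessTT u p - Ω.curvature (p 0) * gradNor u p),
      fun p => -(ε * Ω.curvature (p 0)) * gradTan u p + Ω.jac ε p * -(ε * hessTN u p)],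
    ![fun p => -(ε * (Ω.jac ε p * hessNT u p + Ω.curvature (p 0) * gradTan u p)),
      fun p => -(ε * -(ε * hessNN u p))]]
  memLp_val := (h.stripGrad_pull u).memF
  memLp_grad := Fin.forall_fin_two.2 ⟨(h.stripGrad_pull u).memS, (h.stripGrad_pull u).memT⟩
  memLp_hess := Fin.forall_fin_two.2
    ⟨Fin.forall_fin_two.2 ⟨(h.stripGrad_horiz u).memS, (h.stripGrad_horiz u).memT⟩,
      Fin.forall_fin_two.2 ⟨(h.stripGrad_vert u).memS, (h.stripGrad_vert u).memT⟩⟩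
  weak_grad := Fin.forall_fin_two.2 (h.stripGrad_pull u).isWeakPartial
  weak_hess := Fin.forall_fin_two.2 ⟨Fin.forall_fin_two.2 (h.stripGrad_horiz u).isWeakPartial,
    Fin.forall_fin_two.2 (h.stripGrad_vert u).isWeakPartial⟩

namespace SteklovLimit

variable {lam : ℕ → ℕ → ℝ} {u : ∀ n, ℕ → Ω.H2 (e n)} {Λ : ℕ → ℝ} {g : ℕ → ℝ → ℝ}

/-- Each derivative on the strip is a combination of frame components with coefficients built from
`ε ≤ 1`, `jac`, the curvature and its derivative, all bounded uniformly in `n`. -/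
theorem l2Bounded_pullH2 (h : SteklovLimit μ C e lam u Λ g) (k : ℕ) :
    (∀ i, L2Bounded (𝓁 Ω.refSet) fun n =>
      ((h.coercive n).tubular.pullH2 (u n k)).grad i) ∧
    ∀ i j, L2Bounded (𝓁 Ω.refSet) fun n =>
      ((h.coercive n).tubular.pullH2 (u n k)).hess i j := by
  obtain ⟨M, hM⟩ := h.exists_bound k
  obtain ⟨K, K0, hκ⟩ := Ω.exists_curvature_bound
  obtain ⟨K', -, hκ'⟩ := Ω.curvature_periodic.deriv_periodic.exists_abs_le Ω.length_pos.ne'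
    (Ω.contDiff_curvature.continuous_deriv (by simp))
  have e0 := fun n => (h.coercive n).tubular.pos
  have e1 := fun n => (h.coercive n).tubular.le_one
  have N0 := fun n => (h.coercive n).tubular.scaledEnergy_nonneg h.mu_pos (u n k)
  have nn := fun (n : ℕ) (X : Plane → ℝ) => integral_nonneg (μ := 𝓁 Ω.refSet) (f := fun p => X p ^ 2)
    (fun p => sq_nonneg (X p))
  have hs := fun n => (h.coercive n).tubular.integral_hess_sq h.mu_pos (u n k)
  have bT : L2Bounded (𝓁 Ω.refSet) fun n => gradTan (u n k) :=
    ⟨fun n => (h.coercive n).tubular.memLp_gradTan _, C * M, fun n =>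
      ((h.coercive n).gradTan _).trans (mul_le_mul_of_nonneg_left (hM n) h.const_pos.le)⟩
  have bN : L2Bounded (𝓁 Ω.refSet) fun n => gradNor (u n k) :=
    ⟨fun n => (h.coercive n).tubular.memLp_gradNor _, C * M, fun n =>
      ((h.coercive n).gradNor _).trans (mul_le_mul_of_nonneg_left
        ((mul_le_of_le_one_left (N0 n) (e1 n)).trans (hM n)) h.const_pos.le)⟩
  have bTT : L2Bounded (𝓁 Ω.refSet) fun n => hessTT (u n k) :=
    ⟨fun n => (h.coercive n).tubular.memLp_hessTT _, 2 * M, fun n => by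
      linarith [hs n, hM n, nn n (hessTN (u n k)), nn n (hessNT (u n k)), nn n (hessNN (u n k))]⟩
  have bTN : L2Bounded (𝓁 Ω.refSet) fun n => hessTN (u n k) :=
    ⟨fun n => (h.coercive n).tubular.memLp_hessTN _, 2 * M, fun n => by
      linarith [hs n, hM n, nn n (hessTT (u n k)), nn n (hessNT (u n k)), nn n (hessNN (u n k))]⟩
  have bNT : L2Bounded (𝓁 Ω.refSet) fun n => hessNT (u n k) :=
    ⟨fun n => (h.coercive n).tubular.memLp_hessNT _, 2 * M, fun n => by
      linarith [hs n, hM n, nn n (hessTT (u n k)), nn n (hessTN (u n k)), nn n (hessNN (u n k))]⟩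
  have bNN : L2Bounded (𝓁 Ω.refSet) fun n => hessNN (u n k) :=
    ⟨fun n => (h.coercive n).tubular.memLp_hessNN _, 2 * M, fun n => by
      linarith [hs n, hM n, nn n (hessTT (u n k)), nn n (hessTN (u n k)), nn n (hessNT (u n k))]⟩
  have cJ := fun n => (Ω.contDiff_jac (e n)).continuous
  have hJ : ∀ n, ∀ p ∈ Ω.refSet, |Ω.jac (e n) p| ≤ 2 := fun n p hp => by
    have := (h.coercive n).tubular.jac_mem p ⟨by linarith [hp.2.1], by linarith [hp.2.2]⟩
    rw [abs_le]
    constructor <;> linarith [this.1, this.2]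
  have cκ : Continuous fun p : Plane => Ω.curvature (p 0) :=
    Ω.contDiff_curvature.continuous.comp (by fun_prop)
  have cκ' : Continuous fun p : Plane => deriv Ω.curvature (p 0) :=
    (Ω.contDiff_curvature.continuous_deriv (by simp)).comp (by fun_prop)
  have c1 : Continuous fun p : Plane => p 1 := by fun_prop
  have ae : ∀ n, |e n| ≤ 1 := fun n => by rw [abs_of_pos (e0 n)]; exact e1 n
  have bE : ∀ {f : ℕ → Plane → ℝ}, L2Bounded (𝓁 Ω.refSet) f →
      L2Bounded (𝓁 Ω.refSet) fun n p => -(e n * f n p) := fun hf => by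
    have := L2Bounded.mul hf (c := fun n _ => -e n) (fun n => continuous_const) (K := 1)
      (fun n p _ => by rw [abs_neg]; exact ae n)
    simpa only [neg_mul] using this
  have bJ : ∀ {f : ℕ → Plane → ℝ}, L2Bounded (𝓁 Ω.refSet) f →
      L2Bounded (𝓁 Ω.refSet) fun n p => Ω.jac (e n) p * f n p := fun hf =>
    L2Bounded.mul hf cJ hJ
  have bK : ∀ {f : ℕ → Plane → ℝ}, L2Bounded (𝓁 Ω.refSet) f →
      L2Bounded (𝓁 Ω.refSet) fun n p => Ω.curvature (p 0) * f n p := fun hf =>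
    L2Bounded.mul hf (fun n => cκ) fun n p _ => hκ (p 0)
  have bK' : L2Bounded (𝓁 Ω.refSet) fun n p =>
      -(e n * p 1 * deriv Ω.curvature (p 0)) * gradTan (u n k) p :=
    L2Bounded.mul bT (fun n => by fun_prop) (K := K') fun n p hp => by
      rw [abs_neg, abs_mul, abs_mul]
      refine (mul_le_of_le_one_left (abs_nonneg _) ?_).trans (hκ' (p 0))
      exact mul_le_one₀ (ae n) (abs_nonneg _) (by rw [abs_of_pos hp.2.1]; exact hp.2.2.le)
  have bNκ : L2Bounded (𝓁 Ω.refSet) fun n p =>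
      -(Ω.curvature (p 0) * gradNor (u n k) p) := by
    have := L2Bounded.mul (bK bN) (c := fun n _ => -1) (fun n => continuous_const) (K := 1)
      (fun n p _ => by simp)
    simpa only [neg_mul, one_mul] using this
  refine ⟨Fin.forall_fin_two.2 ⟨bJ bT, bE bN⟩, Fin.forall_fin_two.2
    ⟨Fin.forall_fin_two.2 ⟨bK'.add (bJ ?_), ?_⟩, Fin.forall_fin_two.2
      ⟨bE ((bJ bNT).add (bK bT)), bE (bE bNN)⟩⟩⟩
  · simpa only [sub_eq_add_neg] using (bJ bTT).add bNκ
  · have sum := (bE (bK bT)).add (bJ (bE bTN))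
    have : L2Bounded (𝓁 Ω.refSet) fun n p =>
        -(e n * Ω.curvature (p 0)) * gradTan (u n k) p +
          Ω.jac (e n) p * -(e n * hessTN (u n k) p) := by
      simpa only [neg_mul, mul_assoc] using sum
    exact this

/-- The values converge strongly in `L²` and the derivatives are bounded, so weak convergence of the
derivatives is automatic. -/
theorem tendstoWeaklyH2 (h : SteklovLimit μ C e lam u Λ g) (k : ℕ) :
    TendstoWeaklyH2 Ω.refSet (fun n p => (u n k).val (Ω.fermi (e n) p)) fun p => g k (p 0) := by
  have sg : 𝒞 fun p : Plane => g k (p 0) := (h.contDiff k).comp (Plane.contDiff_apply 0)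
  refine ⟨fun n => (h.coercive n).tubular.pullH2 (u n k), refOfSmooth _ sg,
    Eventually.of_forall fun n => EventuallyEq.rfl, EventuallyEq.rfl,
    SobolevH2.tendsto_innerH2 Ω.isOpen_refSet (fun z hz => ?_) (h.l2Bounded_pullH2 k).1
      (h.l2Bounded_pullH2 k).2⟩
  exact tendsto_integral_mul_of_l2 (h.memLp_pull k) (h.memLp_limit k) hz (h.tendsto_val k)

end SteklovLimit

end SmoothDomain

/-! ### Uniqueness of the limit eigenvalues and their sign -/

namespace SmoothDomain

variable {Ω : SmoothDomain} {μ C : ℝ} {e : ℕ → ℝ}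

theorem sq_integral_mul_le_of_continuous {f h : ℝ → ℝ} (hf : Continuous f) (hh : Continuous h) :
    (∫ s in 0..Ω.length, f s * h s) ^ 2 ≤
      (∫ s in 0..Ω.length, f s ^ 2) * ∫ s in 0..Ω.length, h s ^ 2 := by
  simp only [integral_of_le Ω.length_pos.le]
  exact integral_mul_sq_le (memLp_continuous_one hf) (memLp_continuous_one hh)

/-- Integration by parts gives `∫ f'² = -∫ f f'' = 0`, so `f` is orthogonal to the derivative of
every test. -/
theorem ae_eq_const_of_integral_deriv_deriv_sq {f : ℝ → ℝ} (hf : 𝒞 f)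
    (pf : Periodic f Ω.length)
    (h0 : ∫ s in 0..Ω.length, deriv (deriv f) s ^ 2 ≤ 0) :
    ∃ c, f =ᵐ[𝓁 (Ioc 0 Ω.length)] fun _ => c := by
  have s1 := contDiff_infty_deriv hf
  have s2 := contDiff_infty_deriv s1
  have nn : ∀ X : ℝ → ℝ, 0 ≤ ∫ s in 0..Ω.length, X s ^ 2 := fun X =>
    iint_nonneg Ω.length_pos.le fun s _ => sq_nonneg _
  have z2 := le_antisymm h0 (nn _)
  have zero : ∀ {a b : ℝ → ℝ}, Continuous a → Continuous b →
      (∫ s in 0..Ω.length, b s ^ 2) = 0 → ∫ s in 0..Ω.length, a s * b s = 0 :=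
    fun ha hb hz => by
      have := sq_integral_mul_le_of_continuous (Ω := Ω) ha hb
      rw [hz, mul_zero] at this
      exact pow_eq_zero_iff two_ne_zero |>.1 (le_antisymm this (sq_nonneg _))
  have z1 : ∫ s in 0..Ω.length, deriv f s ^ 2 = 0 := by
    have := integral_mul_deriv_smooth (Ω := Ω) hf s1 pf pf.deriv_periodic
    rw [zero hf.continuous s2.continuous z2] at this
    simp only [sq]
    linarith
  refine ae_eq_const_of_periodic (memLp_continuous_one hf.continuous) fun χ hχ pχ => ?_
  rw [integral_mul_deriv_smooth (Ω := Ω) hf hχ pf pχ]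
  have := zero hχ.continuous s1.continuous z1
  simp only [mul_comm] at this ⊢
  linarith

namespace SteklovLimit

variable {lam : ℕ → ℕ → ℝ} {u : ∀ n, ℕ → Ω.H2 (e n)} {Λ : ℕ → ℝ} {g : ℕ → ℝ → ℝ}
  {e' : ℕ → ℝ} {lam' : ℕ → ℕ → ℝ} {u' : ∀ n, ℕ → SobolevH2 (Ω.thin (e' n))} {Λ' : ℕ → ℝ}
  {g' : ℕ → ℝ → ℝ}

/-- The limit functions of the second sequence are trial functions for the first. On them the limit
form is diagonal with entries at most `Λ' k`, so the min-max bound applies; by symmetry the two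
limits agree. -/
theorem value_le (h : SteklovLimit μ C e lam u Λ g) (h' : SteklovLimit μ C e' lam' u' Λ' g')
    (k : ℕ) : Λ k ≤ Λ' k := by
  refine le_of_forall_pos_le_add fun δ hδ => ?_
  have form : ∀ i j : ℕ, ∫ s in 0..Ω.length, g' i s * Ω.limitOp (g' j) s =
      if i = j then Λ' j else 0 := fun i j => by
    simp only [h'.limitOp_eq]
    calc _ = ∫ s in 0..Ω.length, Λ' j * 2 * (g' i s * g' j s) := by congr 1; ext s; ring
      _ = Λ' j * (2 * ∫ s in 0..Ω.length, g' i s * g' j s) := by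
        rw [iint_const_mul]; ring
      _ = _ := by rw [h'.orthonormal, mul_ite, mul_one, mul_zero]
  have ev := eventually_eigenvalue_le h.mu_pos h.const_pos h.eventually_coercive
    (w := fun i : Fin (k + 1) => g' i) (fun i => h'.contDiff i) (fun i => h'.periodic i)
    (fun i j => by rw [h'.orthonormal]; simp only [Fin.ext_iff]) (h'.nonneg k) (fun c => by
      simp only [form, ← Fin.ext_iff, mul_ite, mul_zero, Finset.sum_ite_eq, Finset.mem_univ,
        if_true]
      rw [Finset.mul_sum]
      refine Finset.sum_le_sum fun i _ => ?_
      rw [← sq, mul_comm]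
      exact mul_le_mul_of_nonneg_right (h'.monotone (Nat.lt_succ_iff.1 i.2)) (sq_nonneg _)) hδ
  refine le_of_tendsto (h.value k) ?_
  filter_upwards [h.tendsto.eventually ev] with n hn
  exact hn _ _ (h.eigensystem n)

theorem value_unique (h : SteklovLimit μ C e lam u Λ g)
    (h' : SteklovLimit μ C e' lam' u' Λ' g') : Λ = Λ' :=
  funext fun k => le_antisymm (h.value_le h' k) (h'.value_le h k)

theorem value_zero (h : SteklovLimit μ C e lam u Λ g) : Λ 0 = 0 := by
  refine tendsto_nhds_unique (h.value 0) (tendsto_const_nhds.congr' ?_)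
  filter_upwards [h.tendsto.eventually
    (eventually_eigenvalue_zero h.mu_pos h.const_pos h.eventually_coercive)] with n hn
  rw [hn _ _ (h.eigensystem n), zero_div]

/-- If `Λ 1` were not positive, `g 0` and `g 1` would both be constant, but two constants cannot be
orthonormal. -/
theorem value_pos (h : SteklovLimit μ C e lam u Λ g) {k : ℕ} (hk : k ≠ 0) : 0 < Λ k := by
  refine lt_of_lt_of_le ?_ (h.monotone (Nat.one_le_iff_ne_zero.2 hk))
  by_contra! le
  have L := Ω.length_pos
  obtain ⟨a, ha⟩ := ae_eq_const_of_integral_deriv_deriv_sq (h.contDiff 0) (h.periodic 0)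
    ((h.integral_deriv_deriv_sq_le 0).trans ((h.monotone zero_le_one).trans le))
  obtain ⟨b, hb⟩ := ae_eq_const_of_integral_deriv_deriv_sq (h.contDiff 1) (h.periodic 1)
    ((h.integral_deriv_deriv_sq_le 1).trans le)
  have int : ∀ {i j : ℕ} {x y : ℝ}, g i =ᵐ[𝓁 (Ioc 0 Ω.length)] (fun _ => x) →
      g j =ᵐ[𝓁 (Ioc 0 Ω.length)] (fun _ => y) →
      2 * (Ω.length * (x * y)) = if i = j then 1 else 0 := fun {i j x y} hx hy => by
    rw [← h.orthonormal i j, integral_of_le L.le,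
      integral_congr_ae (g := fun _ => x * y) (by
        filter_upwards [hx, hy] with s h1 h2
        rw [h1, h2])]
    simp [L.le]
  have e1 := int ha ha
  have e2 := int hb hb
  have e3 := int ha hb
  rw [if_pos rfl] at e1 e2
  rw [if_neg (by norm_num)] at e3
  have e4 : (2 * (Ω.length * (a * a))) * (2 * (Ω.length * (b * b))) =
      (2 * (Ω.length * (a * b))) ^ 2 := by ring
  rw [e1, e2, e3] at e4
  norm_num at e4

end SteklovLimit

theorem exists_steklovLimit_of_eventually (hμ : 0 < μ) (hC : 0 < C)
    (hE : ∀ᶠ ε in 𝓝[>] (0 : ℝ), Ω.Coercive μ C ε) {lam : ℝ → ℕ → ℝ}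
    {u : ∀ ε : ℝ, ℕ → Ω.H2 ε}
    (hs : ∀ᶠ ε in 𝓝[>] (0 : ℝ), Ω.IsSteklovEigensystem μ ε (lam ε) (u ε))
    (he : Tendsto e atTop (𝓝[>] 0)) :
    ∃ φ : ℕ → ℕ, StrictMono φ ∧ ∃ (Λ : ℕ → ℝ) (g : ℕ → ℝ → ℝ), SteklovLimit μ C
      (fun n => e (φ n)) (fun n => lam (e (φ n))) (fun n => u (e (φ n))) Λ g := by
  obtain ⟨N, hN⟩ := eventually_atTop.1 (he.eventually (hE.and hs))
  obtain ⟨φ, hφ, h⟩ := exists_steklovLimit hμ hC hE (e := fun n => e (n + N))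
    (he.comp (tendsto_add_atTop_nat N)) (lam := fun n => lam (e (n + N)))
    (u := fun n => u (e (n + N))) (fun n => (hN _ (Nat.le_add_left N n)).1)
    fun n => (hN _ (Nat.le_add_left N n)).2
  exact ⟨fun n => φ n + N, fun a b hab => Nat.add_lt_add_right (hφ hab) N, h⟩

end SmoothDomain

end

/-! ### Assembly of the theorem -/

theorem theorem1p1 (Ω : SmoothDomain) (μ : ℝ) (hμ : 0 < μ) :
    -- the eigenvalues of the limit problem
    ∃ lam₀ : ℕ → ℝ, (∃ w, Ω.IsLimitEigenbasis lam₀ w) ∧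
      -- for small thickness the Steklov problem has a discrete sequence of eigenvalues
      (∀ᶠ ε in 𝓝[>] (0 : ℝ), ∃ lam u, Ω.IsSteklovEigensystem μ ε lam u) ∧
      ∀ (lam : ℝ → ℕ → ℝ) (u : ∀ ε : ℝ, ℕ → SobolevH2 (Ω.thin ε)),
        (∀ᶠ ε in 𝓝[>] (0 : ℝ), Ω.IsSteklovEigensystem μ ε (lam ε) (u ε)) →
        -- convergence of the eigenvalues
        (∀ k, (fun ε => lam ε k) ~[𝓝[>] (0 : ℝ)] (fun ε => lam₀ k * ε)) ∧
        -- convergence of the eigenfunctions, along a subsequence of any sequence tending to zero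
        ∀ e : ℕ → ℝ, Tendsto e atTop (𝓝[>] (0 : ℝ)) →
          ∃ φ : ℕ → ℕ, StrictMono φ ∧ ∃ w : ℕ → ℝ → ℝ, Ω.IsLimitEigenbasis lam₀ w ∧
            ∀ k, TendstoWeaklyH2 Ω.refSet
              (fun n p => (u (e (φ n)) k).val (Ω.fermi (e (φ n)) p)) (fun p => w k (p 0)) := by
  obtain ⟨C, hC, hE⟩ := Ω.exists_coercive hμ
  have hS : ∀ᶠ ε in 𝓝[>] (0 : ℝ), ∃ lam u, Ω.IsSteklovEigensystem μ ε lam u :=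
    hE.mono fun ε hco => hco.exists_eigensystem hμ hC
  -- An arbitrary choice of an eigensystem wherever one exists, with a dummy value elsewhere, so
  -- that the limit eigenvalues are fixed before the given system is considered.
  have ex : ∀ ε : ℝ, ∃ (lam : ℕ → ℝ) (u : ℕ → SobolevH2 (Ω.thin ε)),
      (∃ lam u, Ω.IsSteklovEigensystem μ ε lam u) → Ω.IsSteklovEigensystem μ ε lam u := fun ε => by
    by_cases h : ∃ lam u, Ω.IsSteklovEigensystem μ ε lam u
    · obtain ⟨lam, u, hs⟩ := h
      exact ⟨lam, u, fun _ => hs⟩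
    · exact ⟨0, 0, fun h' => absurd h' h⟩
  choose lam u hs using ex
  obtain ⟨e, he⟩ := exists_seq_tendsto (𝓝[>] (0 : ℝ))
  obtain ⟨φ, -, lam₀, w, h₀⟩ := SmoothDomain.exists_steklovLimit_of_eventually hμ hC hE
    (hS.mono fun ε => hs ε) he
  refine ⟨lam₀, ⟨w, h₀.isLimitEigenbasis⟩, hS, fun lam u hs => ⟨fun k => ?_, fun e he => ?_⟩⟩
  -- Every sequence has a subsequence with a limit, and all these limits agree, so the full family
  -- converges.
  · have lim : Tendsto (fun ε => lam ε k / ε) (𝓝[>] 0) (𝓝 (lam₀ k)) :=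
      tendsto_of_subseq_tendsto fun e he => by
        obtain ⟨φ, -, Λ, g, h⟩ := SmoothDomain.exists_steklovLimit_of_eventually hμ hC hE hs he
        rw [← h.value_unique h₀]
        exact ⟨φ, h.value k⟩
    -- Equivalence to the zero function means eventual equality with zero, so for `k = 0`
    -- convergence of the ratio would not be enough.
    rcases eq_or_ne k 0 with rfl | hk
    · simp only [h₀.value_zero, zero_mul]
      refine isEquivalent_zero_iff_eventually_zero.2 ?_
      filter_upwards [hs, SmoothDomain.eventually_eigenvalue_zero hμ hC hE] with ε h1 h2
      exact h2 _ _ h1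
    · have pos := h₀.value_pos hk
      refine isEquivalent_of_tendsto_one ?_
      have := lim.div_const (lam₀ k)
      rw [div_self pos.ne'] at this
      refine this.congr fun ε => ?_
      rw [Pi.div_apply, div_div, mul_comm]
  · obtain ⟨φ, hφ, Λ, g, h⟩ := SmoothDomain.exists_steklovLimit_of_eventually hμ hC hE hs he
    obtain rfl := h.value_unique h₀
    exact ⟨φ, hφ, g, h.isLimitEigenbasis, h.tendstoWeaklyH2⟩
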